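/- Let $V:(0,\infty)\to\mathbb C^{n\times n}$ satisfy $V(x)=V(x)^\dagger$, $\int_0^\infty(1+x)\|V(x)\|\,dx<\infty$, $V\in C^\infty((0,\infty))$ and, for some $\rho\in(1,2]$ and all $j\ge 0$, $\|V^{(j)}(x)\|\le C_j(1+x)^{-\rho-j}$ on $(0,\infty)$ ($\|\cdot\|$ is the operator norm on $\mathbb C^n$). Let $A,B\in\mathbb C^{n\times n}$ satisfy $-B^\dagger A+A^\dagger B=0$ and $A^\dagger A+B^\dagger B>0$, and let $H_{A,B}\psi=-\psi''+V\psi$ in $L^2((0,\infty);\mathbb C^n)$ with boundary condition $-B^\dagger\psi(0)+A^\dagger\psi'(0)=0$; its domain consists of the $\psi\in L^2$ with $\psi,\psi'$ locally absolutely continuous on $[0,\infty)$, $-\psi''+V\psi\in L^2$, that satisfy the boundary condition. The following objects exist. * For $k\neq0$, $\operatorname{Im}k\ge0$, the Jost solution $f(k,x)$, i.e. the $n\times n$ matrix solution of $-f''+Vf=k^2f$ with $f=e^{ikx}[I+o(1/x)]$, $f'=ik\,e^{ikx}[I+o(1/x)]$ as $x\to\infty$. The Jost matrix is $J(k)=f(-k^*,0)^\dagger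 B-f'(-k^*,0)^\dagger A$ ($k^*$ is the complex conjugate). * A unitary matrix $M$, invertible matrices $T_1,T_2$ and $\theta_1,\dots,\theta_n\in(0,\pi]$ with $A=M\tilde A T_2M^\dagger T_1$, $B=M\tilde B T_2M^\dagger T_1$, $\tilde A=-\operatorname{diag}(\sin\theta_j)$, $\tilde B=\operatorname{diag}(\cos\theta_j)$. Let $n_N$ be the number of $j$ with $\theta_j=\pi/2$, let $n_M$ be the number of $j$ with $\theta_j\ne\pi/2,\pi$, and put $p=n_M+n_N$. * A constant $c_2\neq0$ with $\det J(k)=c_2k^{p}[1+O(1/k)]$ as $k\to\infty$ in $\{\operatorname{Im}k\ge0\}$. Put $h(k)=\det J(k)/(c_2k^{p})$. * On $\mathbb R\setminus\{0\}$, a continuous logarithm $\ln h(k)$ of $h$ with $\ln h(k)\to0$ as $|k|\to\infty$. Put $\ln_e h(k)=\frac12(\ln h(k)+\ln h(-k))$ and $\ln_o h(k)=\frac12(\ln h(k)-\ln h(-k))$. Define on $[0,\infty)$ (with one-sided derivatives at $0$) $b_0=1$, $b_{l+1}(x)=-b_l'(x)-\int_x^\infty V(y)b_l(y)\,dy$;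 then $c_{-1}=-\frac12A$ and $c_l=b_l(0)^\dagger B-\left(\frac12b_{l+1}(0)^\dagger+b_l'(0)^\dagger\right)A$ for $l\ge0$; $$d_l=\sum_{\sigma\in S_n}\operatorname{sign}\sigma\sum_{l_i\ge-1,\ l_1+\dots+l_n=l}(c_{l_1})_{1,\sigma_1}\cdots(c_{l_n})_{n,\sigma_n};\qquad e_l=\frac{(2i)^{p}}{c_2}\Big(d_{l-p}-\frac1l\sum_{j=1}^{l-1}j\,d_{l-p-j}\,e_j\Big),\quad l\ge1.$$ Then all eigenvalues of $H_{A,B}$ have the form $-\kappa^2$ with $\kappa>0$, and their total number $\mathcal N$, counted with multiplicity, is finite. Denote them by $-\kappa_1^2,\dots,-\kappa_{\mathcal N}^2$, repeated according to multiplicity. For any choice of the objects above, all the integrals below converge absolutely, and $$\sum_{l=1}^{\mathcal N}|\kappa_l|-\frac1\pi\int_0^\infty\ln_e h(k)\,dk=\frac{e_1}{4},$$ and, for every $j=1,2,\dots$, $$\sum_{l=1}^{\mathcal N}|\kappa_l|^{2j+1}+(-1)^{j+1}\frac{2j+1}{\pi}\int_0^\infty\Big(\ln_e h(k)-\sum_{l=1}^j\frac{(-1)^l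 e_{2l}}{(2k)^{2l}}\Big)k^{2j}\,dk=\frac{(2j+1)\,e_{2j+1}}{2^{2j+2}},$$ $$\sum_{l=1}^{\mathcal N}|\kappa_l|^{2j}+(-1)^{j}\frac{2j}{\pi}\int_0^\infty\Big(-i\ln_o h(k)-\sum_{l=0}^{j-1}\frac{(-1)^{l+1}e_{2l+1}}{(2k)^{2l+1}}\Big)k^{2j-1}\,dk=-j\,\frac{e_{2j}}{2^{2j}}.$$ -/

import Mathlib

open Set Filter Topology MeasureTheory
open scoped Matrix Matrix.Norms.L2Operator ContDiff ComplexOrder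

noncomputable section

namespace MatrixSchrodinger

variable {n : ℕ}

/-- The Hilbert space `L²((0,∞); ℂⁿ)`. -/
abbrev HalfLineL2 (n : ℕ) : Type :=
  Lp (EuclideanSpace ℂ (Fin n)) 2 ((volume : Measure ℝ).restrict (Ioi 0))

/-- Assumptions on the matrix potential on `(0,∞)` (values on `(-∞,0]` play no role): selfadjoint,
`∫₀^∞ (1+x)‖V(x)‖ dx < ∞`, smooth on `(0,∞)`, and, for some `ρ ∈ (1,2]`,
`‖V⁽ʲ⁾(x)‖ ≤ Cⱼ (1+x)^(-ρ-j)` for all `j`.  The matrix norm is the operator norm on `ℂⁿ`. -/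
structure IsAdmissiblePotential (V : ℝ → Matrix (Fin n) (Fin n) ℂ) : Prop where
  selfadjoint : ∀ x, 0 < x → (V x)ᴴ = V x
  faddeev : IntegrableOn (fun x : ℝ => (1 + x) * ‖V x‖) (Ioi 0)
  smooth : ContDiffOn ℝ ∞ V (Ioi 0)
  decay : ∃ ρ : ℝ, 1 < ρ ∧ ρ ≤ 2 ∧ ∀ j : ℕ, ∃ C : ℝ, ∀ x : ℝ, 0 < x →
    ‖iteratedDeriv j V x‖ ≤ C * (1 + x) ^ (-ρ - (j : ℝ))

/-- Selfadjoint boundary conditions `-B†ψ(0) + A†ψ'(0) = 0`: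
`-B†A + A†B = 0` and `A†A + B†B > 0`. -/
structure IsSelfadjointBC (A B : Matrix (Fin n) (Fin n) ℂ) : Prop where
  symm : -(Bᴴ * A) + Aᴴ * B = 0
  pos : (Aᴴ * A + Bᴴ * B).PosDef

/-- `ψ, ψ'` are locally absolutely continuous on `[0,∞)`, with derivatives `ψ'` and (a.e.) `ψ''`. -/
structure IsTwiceAC (ψ ψ' ψ'' : ℝ → EuclideanSpace ℂ (Fin n)) : Prop where
  integrable' : ∀ x, 0 ≤ x → IntervalIntegrable ψ' volume 0 x
  integrable'' : ∀ x, 0 ≤ x → IntervalIntegrable ψ'' volume 0 x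
  eq' : ∀ x, 0 ≤ x → ψ x = ψ 0 + ∫ t in (0 : ℝ)..x, ψ' t
  eq'' : ∀ x, 0 ≤ x → ψ' x = ψ' 0 + ∫ t in (0 : ℝ)..x, ψ'' t

/-- The graph of the operator `H_{A,B} ψ = -ψ'' + V ψ` in `L²((0,∞); ℂⁿ)`: its domain consists of
the `ψ ∈ L²` with `ψ, ψ'` locally absolutely continuous on `[0,∞)`, `-ψ'' + V ψ ∈ L²`
and `-B†ψ(0) + A†ψ'(0) = 0`. -/
def hamiltonianGraph (V : ℝ → Matrix (Fin n) (Fin n) ℂ) (A B : Matrix (Fin n) (Fin n) ℂ) :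
    Submodule ℂ (HalfLineL2 n × HalfLineL2 n) where
  carrier := {p | ∃ ψ ψ' ψ'' : ℝ → EuclideanSpace ℂ (Fin n), IsTwiceAC ψ ψ' ψ'' ∧
    (∀ᵐ x ∂((volume : Measure ℝ).restrict (Ioi 0)), p.1 x = ψ x) ∧
    (∀ᵐ x ∂((volume : Measure ℝ).restrict (Ioi 0)),
      p.2 x = -ψ'' x + Matrix.toEuclideanLin (V x) (ψ x)) ∧
    -(Matrix.toEuclideanLin Bᴴ (ψ 0)) + Matrix.toEuclideanLin Aᴴ (ψ' 0) = 0}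
  zero_mem' := by
    refine ⟨0, 0, 0, ⟨?_, ?_, ?_, ?_⟩, ?_, ?_, ?_⟩
    · intro x _; exact intervalIntegrable_const
    · intro x _; exact intervalIntegrable_const
    · intro x _; simp
    · intro x _; simp
    · filter_upwards [Lp.coeFn_zero (EuclideanSpace ℂ (Fin n)) 2
        ((volume : Measure ℝ).restrict (Ioi 0))] with x hx
      simpa using hx
    · filter_upwards [Lp.coeFn_zero (EuclideanSpace ℂ (Fin n)) 2
        ((volume : Measure ℝ).restrict (Ioi 0))] with x hx
      simpa using hx
    · simp
  add_mem' := by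
    rintro p q ⟨a, a', a'', ha, ha1, ha2, ha3⟩ ⟨b, b', b'', hb, hb1, hb2, hb3⟩
    refine ⟨a + b, a' + b', a'' + b'', ⟨?_, ?_, ?_, ?_⟩, ?_, ?_, ?_⟩
    · intro x hx; exact (ha.integrable' x hx).add (hb.integrable' x hx)
    · intro x hx; exact (ha.integrable'' x hx).add (hb.integrable'' x hx)
    · intro x hx
      simp only [Pi.add_apply]
      rw [intervalIntegral.integral_add (ha.integrable' x hx) (hb.integrable' x hx),
        ha.eq' x hx, hb.eq' x hx]
      abel
    · intro x hx
      simp only [Pi.add_apply]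
      rw [intervalIntegral.integral_add (ha.integrable'' x hx) (hb.integrable'' x hx),
        ha.eq'' x hx, hb.eq'' x hx]
      abel
    · filter_upwards [Lp.coeFn_add p.1 q.1, ha1, hb1] with x h1 h2 h3
      simp only [Prod.fst_add, h1, Pi.add_apply, h2, h3]
    · filter_upwards [Lp.coeFn_add p.2 q.2, ha2, hb2] with x h1 h2 h3
      simp only [Prod.snd_add, h1, Pi.add_apply, h2, h3, map_add]
      abel
    · simp only [Pi.add_apply, map_add]
      rw [← add_zero (0 : EuclideanSpace ℂ (Fin n))]
      nth_rewrite 1 [← ha3]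
      rw [← hb3]
      abel
  smul_mem' := by
    rintro c p ⟨a, a', a'', ha, ha1, ha2, ha3⟩
    refine ⟨c • a, c • a', c • a'', ⟨?_, ?_, ?_, ?_⟩, ?_, ?_, ?_⟩
    · intro x hx; exact (ha.integrable' x hx).smul c
    · intro x hx; exact (ha.integrable'' x hx).smul c
    · intro x hx
      simp only [Pi.smul_apply]
      rw [intervalIntegral.integral_smul, ha.eq' x hx, smul_add]
    · intro x hx
      simp only [Pi.smul_apply]
      rw [intervalIntegral.integral_smul, ha.eq'' x hx, smul_add]
    · filter_upwards [Lp.coeFn_smul c p.1, ha1] with x h1 h2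
      simp only [Prod.smul_fst, h1, Pi.smul_apply, h2]
    · filter_upwards [Lp.coeFn_smul c p.2, ha2] with x h1 h2
      simp only [Prod.smul_snd, h1, Pi.smul_apply, h2, map_smul, smul_add, smul_neg]
    · simp only [Pi.smul_apply, map_smul]
      rw [← smul_neg, ← smul_add, ha3, smul_zero]

/-- The eigenspace `{u | H_{A,B} u = E u}`. -/
def eigenspace (V : ℝ → Matrix (Fin n) (Fin n) ℂ) (A B : Matrix (Fin n) (Fin n) ℂ) (E : ℂ) :
    Submodule ℂ (HalfLineL2 n) :=
  (hamiltonianGraph V A B).comap (LinearMap.prod LinearMap.id (E • LinearMap.id))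

/-- `E` is an eigenvalue of `H_{A,B}`. -/
def IsEigenvalue (V : ℝ → Matrix (Fin n) (Fin n) ℂ) (A B : Matrix (Fin n) (Fin n) ℂ)
    (E : ℂ) : Prop :=
  eigenspace V A B E ≠ ⊥

/-- The set of the distinct `κ > 0` such that `-κ²` is an eigenvalue. -/
def boundStates (V : ℝ → Matrix (Fin n) (Fin n) ℂ) (A B : Matrix (Fin n) (Fin n) ℂ) : Set ℝ :=
  {κ | 0 < κ ∧ IsEigenvalue V A B (-(κ : ℂ) ^ 2)}

/-- The sum of `|κ|^q` over the eigenvalues `-κ²`, repeated according to multiplicity. -/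
def boundStateSum (V : ℝ → Matrix (Fin n) (Fin n) ℂ) (A B : Matrix (Fin n) (Fin n) ℂ)
    (q : ℕ) : ℝ :=
  ∑ᶠ κ ∈ boundStates V A B, (Module.finrank ℂ (eigenspace V A B (-(κ : ℂ) ^ 2)) : ℝ) * |κ| ^ q

/-- `f(k,x)` is the Jost solution and `f'(k,x)` its `x`-derivative, for `x ≥ 0`, `Im k ≥ 0`,
`k ≠ 0`: `-f'' + V f = k² f`, `f = e^{ikx}(I + o(1/x))`, `f' = ik e^{ikx}(I + o(1/x))`. -/
structure IsJostSolution (V : ℝ → Matrix (Fin n) (Fin n) ℂ)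
    (f f' : ℂ → ℝ → Matrix (Fin n) (Fin n) ℂ) : Prop where
  hasDeriv : ∀ k : ℂ, 0 ≤ k.im → k ≠ 0 → ∀ x : ℝ, 0 ≤ x →
    HasDerivWithinAt (f k) (f' k x) (Ici 0) x
  continuous_deriv : ∀ k : ℂ, 0 ≤ k.im → k ≠ 0 → ContinuousOn (f' k) (Ici 0)
  hasDeriv' : ∀ k : ℂ, 0 ≤ k.im → k ≠ 0 → ∀ x : ℝ, 0 < x →
    HasDerivAt (f' k) (V x * f k x - k ^ 2 • f k x) x
  asymp : ∀ k : ℂ, 0 ≤ k.im → k ≠ 0 →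
    (fun x : ℝ => Complex.exp (-(Complex.I * k * x)) • f k x - 1) =o[atTop]
      (fun x : ℝ => 1 / x)
  asymp' : ∀ k : ℂ, 0 ≤ k.im → k ≠ 0 →
    (fun x : ℝ => (Complex.exp (-(Complex.I * k * x)) / (Complex.I * k)) • f' k x - 1) =o[atTop]
      (fun x : ℝ => 1 / x)

/-- The Jost matrix `J(k) = f(-k*,0)† B - f'(-k*,0)† A`. -/
def jostMatrix (f f' : ℂ → ℝ → Matrix (Fin n) (Fin n) ℂ) (A B : Matrix (Fin n) (Fin n) ℂ)
    (k : ℂ) : Matrix (Fin n) (Fin n) ℂ :=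
  (f (-(starRingEnd ℂ k)) 0)ᴴ * B - (f' (-(starRingEnd ℂ k)) 0)ᴴ * A

/-- `θ ∈ (0,π]ⁿ` are the angles of a diagonal form of the boundary conditions:
`A = M Ã T₂ M† T₁`, `B = M B̃ T₂ M† T₁` with `Ã = -diag(sin θⱼ)`, `B̃ = diag(cos θⱼ)`,
`M` unitary and `T₁, T₂` invertible. -/
def IsBoundaryAngles (A B : Matrix (Fin n) (Fin n) ℂ) (θ : Fin n → ℝ) : Prop :=
  (∀ j, θ j ∈ Ioc 0 Real.pi) ∧
  ∃ M ∈ Matrix.unitaryGroup (Fin n) ℂ, ∃ T₁ T₂ : Matrix (Fin n) (Fin n) ℂ,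
    IsUnit T₁ ∧ IsUnit T₂ ∧
    A = M * (-Matrix.diagonal fun j => (Real.sin (θ j) : ℂ)) * T₂ * Mᴴ * T₁ ∧
    B = M * (Matrix.diagonal fun j => (Real.cos (θ j) : ℂ)) * T₂ * Mᴴ * T₁

/-- Number of Dirichlet conditions, `θⱼ = π`. -/
def numD (θ : Fin n → ℝ) : ℕ := {j | θ j = Real.pi}.ncard

/-- Number of Neumann conditions, `θⱼ = π/2`. -/
def numN (θ : Fin n → ℝ) : ℕ := {j | θ j = Real.pi / 2}.ncard

/-- Number of mixed conditions, `θⱼ ≠ π/2, π`. -/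
def numM (θ : Fin n → ℝ) : ℕ := {j | θ j ≠ Real.pi / 2 ∧ θ j ≠ Real.pi}.ncard

/-- `c ≠ 0` and `det J(k) = c k^p (1 + O(1/k))` as `k → ∞` in the closed upper half plane. -/
def IsLeadingConstant (J : ℂ → Matrix (Fin n) (Fin n) ℂ) (p : ℕ) (c : ℂ) : Prop :=
  c ≠ 0 ∧ (fun k : ℂ => (J k).det / (c * k ^ p) - 1)
    =O[Bornology.cobounded ℂ ⊓ 𝓟 {k : ℂ | 0 ≤ k.im}] (fun k : ℂ => 1 / k)

/-- `h(k) = det J(k) / (c k^p)`. -/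
def hFun (J : ℂ → Matrix (Fin n) (Fin n) ℂ) (p : ℕ) (c k : ℂ) : ℂ :=
  (J k).det / (c * k ^ p)

/-- `L = ln h` on `ℝ ∖ {0}`: the continuous logarithm which tends to zero as `|k| → ∞`. -/
structure IsLogBranch (h : ℂ → ℂ) (L : ℝ → ℂ) : Prop where
  continuousOn : ContinuousOn L {0}ᶜ
  exp_eq : ∀ k : ℝ, k ≠ 0 → Complex.exp (L k) = h k
  tendsto_zero : Tendsto L (Bornology.cobounded ℝ) (𝓝 0)

/-- Even part `(L(k) + L(-k))/2`. -/
def evenPart (L : ℝ → ℂ) (k : ℝ) : ℂ := (L k + L (-k)) / 2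

/-- Odd part `(L(k) - L(-k))/2`. -/
def oddPart (L : ℝ → ℂ) (k : ℝ) : ℂ := (L k - L (-k)) / 2

/-- `b₀ = 1`, `b_{l+1}(x) = -b_l'(x) - ∫ₓ^∞ V(y) b_l(y) dy` on `[0,∞)`; the derivative at `0` is
one-sided. -/
def bCoeff (V : ℝ → Matrix (Fin n) (Fin n) ℂ) : ℕ → ℝ → Matrix (Fin n) (Fin n) ℂ
  | 0 => fun _ => 1
  | l + 1 => fun x => -derivWithin (bCoeff V l) (Ici 0) x - ∫ y in Ioi x, V y * bCoeff V l y

/-- The coefficients `c_{-1} = -A/2`, `c_l = b_l(0)† B - (b_{l+1}(0)†/2 + b_l'(0)†) A` (`l ≥ 0`) of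
`J(k) = ∑_{l ≥ -1} c_l (2ik)^{-l}`, with index shifted by one: `cCoeff V A B m = c_{m-1}`.
(For `l = 0` the term `b₀'(0)` vanishes.) -/
def cCoeff (V : ℝ → Matrix (Fin n) (Fin n) ℂ) (A B : Matrix (Fin n) (Fin n) ℂ) :
    ℕ → Matrix (Fin n) (Fin n) ℂ
  | 0 => -((1 / 2 : ℂ) • A)
  | l + 1 => (bCoeff V l 0)ᴴ * B -
      ((1 / 2 : ℂ) • (bCoeff V (l + 1) 0)ᴴ + (derivWithin (bCoeff V l) (Ici 0) 0)ᴴ) * A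

/-- The coefficients `d_l`, `l ≥ -n`, of `det J(k) = ∑ d_l (2ik)^{-l}`, with index shifted by `n`:
`dCoeff V A B N = d_{N-n}`.  The inner sum is over `l₁,…,lₙ ≥ -1` with `l₁ + ⋯ + lₙ = N - n`,
written as `lᵢ = mᵢ - 1`. -/
def dCoeff (V : ℝ → Matrix (Fin n) (Fin n) ℂ) (A B : Matrix (Fin n) (Fin n) ℂ) (N : ℕ) : ℂ :=
  ∑ σ : Equiv.Perm (Fin n), ((Equiv.Perm.sign σ : ℤ) : ℂ) *
    ∑ m ∈ Finset.piAntidiag (Finset.univ : Finset (Fin n)) N, ∏ i, cCoeff V A B (m i) i (σ i)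

/-- The coefficients `e_l`, `l ≥ 1`, of `ln h(k) = ∑_{l ≥ 1} e_l (2ik)^{-l}`:
`e_l = ((2i)^p / c₂) (d_{l-p} - (1/l) ∑_{j=1}^{l-1} j d_{l-p-j} e_j)`, where `p` is the number of
non-Dirichlet conditions and `nD = n - p`; thus `d_{l-p}` is `dCoeff V A B (l + nD)`.
(The value at `l = 0` is irrelevant, and the term `j = 0` of the sum vanishes.) -/
def eCoeff (V : ℝ → Matrix (Fin n) (Fin n) ℂ) (A B : Matrix (Fin n) (Fin n) ℂ)
    (p nD : ℕ) (c₂ : ℂ) : ℕ → ℂ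
  | 0 => 0
  | l + 1 => (2 * Complex.I) ^ p / c₂ * (dCoeff V A B (l + 1 + nD) -
      (1 / ((l : ℂ) + 1)) * ∑ j : Fin (l + 1),
        (j : ℂ) * dCoeff V A B (l + 1 - j + nD) * eCoeff V A B p nD c₂ j)
  decreasing_by exact j.2

end MatrixSchrodinger

end

/-!
The trace identities are Cauchy's theorem for moments of `log h` in the upper half plane: the zeros
of `h` contribute the bound states, the expansion of `log h` at infinity contributes the `e_l`.

*The Jost solution.* The potential is replaced by a continuous `W` on the whole line that agrees
with `V` on `(0, ∞)` (`IsRegularPotential`). The factor `g = e^{-ikx} f` solves a Volterra equation;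
a contraction gives existence, and Gronwall's lemma gives bounds locally uniform in `k`
(`exists_solution`, `exists_isJostFactor`). Integration by parts turns the recursion for `b_l` into
an expansion of `g(k, 0)` in powers of `1/(2ik)`, hence into one of `det J` and of `log h`
(`hasLogExpansion_hFun`); that `det J` has exact order `k^p` is read off from the diagonal form of
the boundary conditions (`exists_isLeadingConstant`).

*Bound states.* The Wronskian and the symplectic form of the boundary data show that eigenvalues
are negative (`exists_eq_neg_sq_of_isEigenvalue`) and that the eigenspace of `-κ²` is the image of
`ker Γ(iκ)`, where `Γ(k) = J(-k*)†` is the boundary form of `f(k, ·)` (`finrank_eigenspace`). The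
same Wronskian identity bounds `‖Γ(k) v‖` below by a multiple of `|Re k| ‖v‖` near `iκ`
(`exists_gammaMat_lower_bound`), so the order of the zero of `det J` at `iκ` is exactly the
dimension of the kernel (`exists_det_eq_pow_mul`). Zeros stay away from `k = 0`
(`exists_no_small_zeros`) and from infinity, so they are finite in number and
`det J = ∏ (k - iκ)^m · D` with `D` zero-free. The lower bound, together with the maximum principle,
shows that `|log |D||` grows at most logarithmically at `0` (`IsJostFamily.exists_factorization`).

*Trace identities.* For even powers of `k` only the even part of `log h` on `ℝ` matters, and the
zeros may be removed with the factors `(k + iκ)/(k - iκ)`, whose logarithm is odd; for odd powers of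
`k` one uses `k²/(k² + κ²)`, whose logarithm is even. Both change the expansion at infinity by
explicit power sums of the `κ`, which is how these sums enter (`trace_identities`). What is left
is a zero-free `F`. Set `G(w) = log F(e^w)` on the strip `0 ≤ Im w ≤ π`, subtract the first `q`
terms of the expansion, multiply by `e^{(q+1)w}` and apply Cauchy's theorem
(`IsStripLog.integral_edges`, `IsZeroFree.moments`): only the coefficient of order `q + 1` survives.

*Behaviour at `k = 0`.* Nothing is assumed about zero energy, and only `|F|`, not `arg F`, is
controlled there. Borel-Carathéodory bounds `G` inside the strip, with a singularity at the edges
(`IsStripLog.exists_norm_le`) that is logarithmic, hence integrable along vertical segments. On the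
edges themselves, Cauchy's theorem for `G² e^w` bounds `Im G` by `Re G` in mean square
(`IsStripLog.integrableOn_norm_mul_exp`), which gives absolute convergence.
-/

namespace MatrixSchrodinger

/-! ### Integrals over half-lines -/

section Tail

lemma integrableOn_Ioi_of_continuous {X : Type*} [NormedAddCommGroup X] {φ : ℝ → X}
    (hc : Continuous φ) {a : ℝ} (hi : IntegrableOn φ (Ioi a)) (b : ℝ) : IntegrableOn φ (Ioi b) := by
  have h1 : IntegrableOn φ (Icc b a) := hc.continuousOn.integrableOn_Icc
  refine (h1.union hi).mono_set fun x hx => ?_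
  rcases le_or_gt x a with h | h
  · exact Or.inl ⟨le_of_lt hx, h⟩
  · exact Or.inr h

variable {X : Type*} [NormedAddCommGroup X] [NormedSpace ℝ X]

lemma integral_Ioi_eq_sub {φ : ℝ → X} (hc : Continuous φ) {a : ℝ}
    (hi : IntegrableOn φ (Ioi a)) (x : ℝ) :
    ∫ y in Ioi x, φ y = (∫ y in Ioi a, φ y) - ∫ y in a..x, φ y := by
  have h := intervalIntegral.integral_interval_add_Ioi' (hc.intervalIntegrable a x)
    (integrableOn_Ioi_of_continuous hc hi x)
  rw [← h]; abel

lemma hasDerivAt_integral_Ioi [CompleteSpace X] {φ : ℝ → X} (hc : Continuous φ) {a : ℝ}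
    (hi : IntegrableOn φ (Ioi a)) (x : ℝ) :
    HasDerivAt (fun x => ∫ y in Ioi x, φ y) (-φ x) x := by
  have h : HasDerivAt (fun x => ∫ y in a..x, φ y) (φ x) x :=
    intervalIntegral.integral_hasDerivAt_right (hc.intervalIntegrable _ _)
      hc.aestronglyMeasurable.stronglyMeasurableAtFilter hc.continuousAt
  have h2 := h.const_sub (∫ y in Ioi a, φ y)
  exact h2.congr_of_eventuallyEq (Eventually.of_forall fun y => integral_Ioi_eq_sub hc hi y)

lemma tendsto_integral_Ioi_zero {φ : ℝ → X} (hc : Continuous φ) {a : ℝ}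
    (hi : IntegrableOn φ (Ioi a)) :
    Tendsto (fun x => ∫ y in Ioi x, φ y) atTop (𝓝 0) := by
  have h := (intervalIntegral_tendsto_integral_Ioi a hi tendsto_id).const_sub
    (∫ y in Ioi a, φ y)
  rw [sub_self] at h
  exact h.congr fun y => (integral_Ioi_eq_sub hc hi y).symm

lemma integral_Ioi_mul_exp_tail {m : ℝ → ℝ} (hm : Continuous m)
    {a : ℝ} (hi : IntegrableOn m (Ioi a)) {c : ℝ} (hc : 0 < c) (h0 : ∀ x, 0 ≤ m x) (x : ℝ) :
    IntegrableOn (fun y => m y * Real.exp (c * ∫ z in Ioi y, m z)) (Ioi x) ∧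
    ∫ y in Ioi x, m y * Real.exp (c * ∫ z in Ioi y, m z)
      = (Real.exp (c * ∫ z in Ioi x, m z) - 1) / c := by
  have hd : ∀ y, HasDerivAt (fun y => -(Real.exp (c * ∫ z in Ioi y, m z)) / c)
      (m y * Real.exp (c * ∫ z in Ioi y, m z)) y := by
    intro y
    have h1 := (((hasDerivAt_integral_Ioi hm hi y).const_mul c).exp.neg).div_const c
    refine h1.congr_deriv ?_
    field_simp
  have hlim : Tendsto (fun y => -(Real.exp (c * ∫ z in Ioi y, m z)) / c) atTop
      (𝓝 (-(Real.exp (c * 0)) / c)) :=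
    (((Real.continuous_exp.tendsto _).comp
      ((tendsto_integral_Ioi_zero hm hi).const_mul c)).neg).div_const c
  have hint : IntegrableOn (fun y => m y * Real.exp (c * ∫ z in Ioi y, m z)) (Ioi x) :=
    integrableOn_Ioi_deriv_of_nonneg' (fun y _ => hd y)
      (fun y _ => mul_nonneg (h0 y) (Real.exp_pos _).le) hlim
  refine ⟨hint, ?_⟩
  rw [integral_Ioi_of_hasDerivAt_of_tendsto' (fun y _ => hd y) hint hlim]
  simp only [mul_zero, Real.exp_zero]
  ring

/-- Gronwall's inequality for integrals over half-lines: the weight `exp (-2 ∫ₓ^∞ m)` turns the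
integral operator into a contraction with factor `1/2`. -/
lemma gronwall_Ioi {m u : ℝ → ℝ} {a c : ℝ} (hm : Continuous m) (h0 : ∀ x, 0 ≤ m x)
    (hi : IntegrableOn m (Ioi a)) (hu0 : ∀ x, a ≤ x → 0 ≤ u x) {K : ℝ}
    (huK : ∀ x, a ≤ x → u x ≤ K) (hum : ContinuousOn u (Ici a)) (hc : 0 ≤ c)
    (h : ∀ x, a ≤ x → u x ≤ c + ∫ y in Ioi x, m y * u y) (x : ℝ) (hx : a ≤ x) :
    u x ≤ 2 * c * Real.exp (2 * ∫ y in Ioi x, m y) := by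
  set τ : ℝ → ℝ := fun x => ∫ y in Ioi x, m y with hτ
  have hτ0 : ∀ x, 0 ≤ τ x := fun x => setIntegral_nonneg measurableSet_Ioi fun y _ => h0 y
  let q : ℝ → ℝ := fun x => u x * Real.exp (-(2 * τ x))
  have hqle : ∀ x, a ≤ x → q x ≤ u x := fun x hx =>
    mul_le_of_le_one_right (hu0 x hx) (Real.exp_le_one_iff.2 (by linarith [hτ0 x]))
  set S := sSup (q '' Ici a) with hS
  have hbdd : BddAbove (q '' Ici a) := ⟨K, by
    rintro _ ⟨x, hx, rfl⟩; exact (hqle x hx).trans (huK x hx)⟩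
  have hqS : ∀ x, a ≤ x → q x ≤ S := fun x hx => le_csSup hbdd ⟨x, hx, rfl⟩
  have hS0 : 0 ≤ S := (mul_nonneg (hu0 a le_rfl) (Real.exp_pos _).le).trans (hqS a le_rfl)
  have huS : ∀ x, a ≤ x → u x ≤ S * Real.exp (2 * τ x) := by
    intro x hx
    have := hqS x hx
    have e : Real.exp (-(2 * τ x)) * Real.exp (2 * τ x) = 1 := by
      rw [← Real.exp_add]; simp
    calc u x = q x * Real.exp (2 * τ x) := by simp only [q]; rw [mul_assoc, e, mul_one]
      _ ≤ _ := by gcongr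
  -- inserting `u ≤ S exp (2τ)` into the integral bounds the weighted supremum by `c + S / 2`
  have key : ∀ x, a ≤ x → q x ≤ c + S / 2 := by
    intro x hx
    obtain ⟨i1, i2⟩ := integral_Ioi_mul_exp_tail hm hi (two_pos) h0 x
    have h1 : ∫ y in Ioi x, m y * u y ≤ ∫ y in Ioi x, S * (m y * Real.exp (2 * τ y)) := by
      apply setIntegral_mono_on₀
      · have hmi : IntegrableOn (fun y => m y * K) (Ioi x) :=
          (hi.mono_set (Ioi_subset_Ioi hx)).mul_const K
        refine hmi.mono' ?_ ?_
        · exact hm.aestronglyMeasurable.mul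
            ((hum.mono (fun y hy => hx.trans (le_of_lt hy))).aestronglyMeasurable
              measurableSet_Ioi)
        · refine (ae_restrict_iff' measurableSet_Ioi).2 (Eventually.of_forall fun y hy => ?_)
          have hy' : a ≤ y := hx.trans (le_of_lt hy)
          rw [Real.norm_of_nonneg (mul_nonneg (h0 y) (hu0 y hy'))]
          exact mul_le_mul_of_nonneg_left (huK y hy') (h0 y)
      · exact i1.const_mul S
      · exact measurableSet_Ioi.nullMeasurableSet
      · intro y hy
        have hy' : a ≤ y := hx.trans (le_of_lt hy)
        have := mul_le_mul_of_nonneg_left (huS y hy') (h0 y)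
        linarith
    rw [integral_const_mul, i2] at h1
    have h2 := (h x hx).trans (add_le_add_right h1 c)
    have e : Real.exp (2 * τ x) * Real.exp (-(2 * τ x)) = 1 := by
      rw [← Real.exp_add]; simp
    have e1 : Real.exp (-(2 * τ x)) ≤ 1 := Real.exp_le_one_iff.2 (by linarith [hτ0 x])
    have e0 := Real.exp_pos (-(2 * τ x))
    calc q x ≤ (c + S * ((Real.exp (2 * τ x) - 1) / 2)) * Real.exp (-(2 * τ x)) := by
          simp only [q]; gcongr
      _ = c * Real.exp (-(2 * τ x)) + S / 2 * (1 - Real.exp (-(2 * τ x))) := by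
          linear_combination (S / 2) * e
      _ ≤ c + S / 2 := by nlinarith
  have hSle : S ≤ c + S / 2 := csSup_le ⟨_, a, self_mem_Ici, rfl⟩ (by
    rintro _ ⟨x, hx, rfl⟩; exact key x hx)
  have : S ≤ 2 * c := by linarith
  exact (huS x hx).trans (by gcongr)

end Tail

/-! ### The Volterra kernel of `u'' + 2ik u'` -/

/-- The kernel `(e^{2ikt} - 1) / (2ik)`, which inverts `u ↦ u'' + 2ik u'` on functions vanishing
at infinity. -/
noncomputable def volterraKernel (k : ℂ) (t : ℝ) : ℂ :=
  (Complex.exp (2 * Complex.I * k * t) - 1) / (2 * Complex.I * k)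

lemma two_I_mul_ne_zero {k : ℂ} (hk : k ≠ 0) : 2 * Complex.I * k ≠ 0 := by
  simp [hk]

lemma norm_exp_two_I_le_one {k : ℂ} (hk : 0 ≤ k.im) {t : ℝ} (ht : 0 ≤ t) :
    ‖Complex.exp (2 * Complex.I * k * t)‖ ≤ 1 := by
  rw [Complex.norm_exp, Real.exp_le_one_iff]
  simp
  nlinarith [mul_nonneg hk ht]

lemma norm_volterraKernel_le_inv {k : ℂ} (hk : 0 ≤ k.im) {t : ℝ} (ht : 0 ≤ t) :
    ‖volterraKernel k t‖ ≤ 1 / ‖k‖ := by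
  have h := norm_exp_two_I_le_one hk ht
  have h2 : ‖Complex.exp (2 * Complex.I * k * t) - 1‖ ≤ 2 :=
    (norm_sub_le _ _).trans (by rw [norm_one]; linarith)
  rw [volterraKernel, norm_div]
  simp only [norm_mul, Complex.norm_I, mul_one, Complex.norm_ofNat]
  rcases eq_or_ne k 0 with rfl | hk0
  · simp
  · have : 0 < ‖k‖ := norm_pos_iff.2 hk0
    rw [div_le_div_iff₀ (by positivity) this]
    nlinarith

lemma hasDerivAt_exp_two_I (k : ℂ) (t : ℝ) :
    HasDerivAt (fun t : ℝ => Complex.exp (2 * Complex.I * k * t))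
      (2 * Complex.I * k * Complex.exp (2 * Complex.I * k * t)) t := by
  have h := ((Complex.ofRealCLM.hasDerivAt (x := t)).const_mul (2 * Complex.I * k)).cexp
  simp only [Complex.ofRealCLM_apply, Complex.ofReal_one, mul_one] at h
  convert h using 1
  ring

lemma hasDerivAt_volterraKernel {k : ℂ} (hk : k ≠ 0) (t : ℝ) :
    HasDerivAt (volterraKernel k) (Complex.exp (2 * Complex.I * k * t)) t := by
  have h := ((hasDerivAt_exp_two_I k t).sub_const 1).div_const (2 * Complex.I * k)
  exact h.congr_deriv (mul_div_cancel_left₀ _ (two_I_mul_ne_zero hk))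

lemma volterraKernel_zero (k : ℂ) : volterraKernel k 0 = 0 := by simp [volterraKernel]

lemma norm_volterraKernel_le {k : ℂ} (hk : 0 ≤ k.im) (hk0 : k ≠ 0) {t : ℝ} (ht : 0 ≤ t) :
    ‖volterraKernel k t‖ ≤ t := by
  have h := norm_image_sub_le_of_norm_deriv_le_segment' (f := volterraKernel k) (a := 0) (b := t)
    (C := 1) (fun x _ => (hasDerivAt_volterraKernel hk0 x).hasDerivWithinAt)
    (fun x hx => norm_exp_two_I_le_one hk hx.1) t ⟨ht, le_rfl⟩
  simpa [volterraKernel_zero] using h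

lemma continuous_volterraKernel (k : ℂ) : Continuous (volterraKernel k) := by
  unfold volterraKernel; fun_prop

section Volterra

variable {X : Type*} [NormedAddCommGroup X] [NormedSpace ℂ X]

lemma integrableOn_kernel_smul {κ : ℝ → ℂ} (hκ : Continuous κ) {C x : ℝ}
    (hC : ∀ t, 0 ≤ t → ‖κ t‖ ≤ C) {r : ℝ → X} (hr : IntegrableOn r (Ioi x)) :
    IntegrableOn (fun y => κ (y - x) • r y) (Ioi x) := by
  refine Integrable.bdd_smul (C := C) hr ?_ ?_
  · exact (hκ.comp (continuous_id.sub continuous_const)).aestronglyMeasurable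
  · exact (ae_restrict_iff' measurableSet_Ioi).2 (Eventually.of_forall fun y hy =>
      hC _ (sub_nonneg.2 (le_of_lt hy)))

lemma norm_integral_kernel_smul_le {κ : ℝ → ℂ} {C x : ℝ}
    (hC : ∀ t, 0 ≤ t → ‖κ t‖ ≤ C) {r : ℝ → X} (hr : IntegrableOn r (Ioi x)) :
    ‖∫ y in Ioi x, κ (y - x) • r y‖ ≤ C * ∫ y in Ioi x, ‖r y‖ := by
  rw [← integral_const_mul]
  refine norm_integral_le_of_norm_le (hr.norm.const_mul C) ?_
  refine (ae_restrict_iff' measurableSet_Ioi).2 (Eventually.of_forall fun y hy => ?_)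
  rw [norm_smul]
  exact mul_le_mul_of_nonneg_right (hC _ (sub_nonneg.2 (le_of_lt hy))) (norm_nonneg _)

/-- Variation of constants: a solution of `u'' + 2ik u' = r` which vanishes at infinity together
with its derivative is the Volterra integral of `r`. -/
lemma eq_integral_volterraKernel [CompleteSpace X]
    {k : ℂ} (hk : 0 ≤ k.im) (hk0 : k ≠ 0) {a : ℝ} {u u' r : ℝ → X}
    (hu : ContinuousOn u (Ici a)) (hu' : ContinuousOn u' (Ici a))
    (hd : ∀ x, a < x → HasDerivAt u (u' x) x)
    (hd' : ∀ x, a < x → HasDerivAt u' (r x - (2 * Complex.I * k) • u' x) x)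
    (hr : IntegrableOn r (Ioi a)) (h0 : Tendsto u atTop (𝓝 0)) (h0' : Tendsto u' atTop (𝓝 0))
    {x : ℝ} (hx : a ≤ x) :
    u x = ∫ y in Ioi x, volterraKernel k (y - x) • r y ∧
    u' x = -∫ y in Ioi x, Complex.exp (2 * Complex.I * k * ((y - x : ℝ) : ℂ)) • r y := by
  have hrx : IntegrableOn r (Ioi x) := hr.mono_set (Ioi_subset_Ioi hx)
  have hsub : Ici x ⊆ Ici a := Ici_subset_Ici.2 hx
  constructor
  · have hF : ∀ y ∈ Ioi x, HasDerivAt (fun y => volterraKernel k (y - x) • u' y - u y)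
        (volterraKernel k (y - x) • r y) y := by
      intro y hy
      have hay : a < y := lt_of_le_of_lt hx hy
      have h1 := ((hasDerivAt_volterraKernel hk0 (y - x)).comp_sub_const y x).smul (hd' y hay)
      refine (h1.sub (hd y hay)).congr_deriv ?_
      have : Complex.exp (2 * Complex.I * k * ((y - x : ℝ) : ℂ))
          = 1 + 2 * Complex.I * k * volterraKernel k (y - x) := by
        rw [volterraKernel, mul_div_cancel₀ _ (two_I_mul_ne_zero hk0)]; ring
      rw [this, smul_sub, smul_smul, add_smul, one_smul, mul_comm (volterraKernel k (y - x))]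
      abel
    have hlim : Tendsto (fun y => volterraKernel k (y - x) • u' y - u y) atTop (𝓝 0) := by
      have h1 : Tendsto (fun y => volterraKernel k (y - x) • u' y) atTop (𝓝 0) := by
        apply squeeze_zero_norm' (a := fun y => 1 / ‖k‖ * ‖u' y‖)
        · filter_upwards [Ici_mem_atTop x] with y hy
          rw [norm_smul]
          exact mul_le_mul_of_nonneg_right
            (norm_volterraKernel_le_inv hk (sub_nonneg.2 hy)) (norm_nonneg _)
        · simpa using h0'.norm.const_mul (1 / ‖k‖)
      simpa using h1.sub h0
    have hc : ContinuousWithinAt (fun y => volterraKernel k (y - x) • u' y - u y) (Ici x) x :=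
      ((((continuous_volterraKernel k).comp (continuous_id.sub continuous_const)).continuousOn.smul
        (hu'.mono hsub)).sub (hu.mono hsub)) x self_mem_Ici
    rw [integral_Ioi_of_hasDerivAt_of_tendsto hc hF
      (integrableOn_kernel_smul (continuous_volterraKernel k)
        (fun t ht => norm_volterraKernel_le_inv hk ht) hrx) hlim]
    simp [volterraKernel_zero]
  · have hF : ∀ y ∈ Ioi x, HasDerivAt
        (fun y : ℝ => Complex.exp (2 * Complex.I * k * ((y - x : ℝ) : ℂ)) • u' y)
        (Complex.exp (2 * Complex.I * k * ((y - x : ℝ) : ℂ)) • r y) y := by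
      intro y hy
      have hay : a < y := lt_of_le_of_lt hx hy
      have h1 := ((hasDerivAt_exp_two_I k (y - x)).comp_sub_const y x).smul (hd' y hay)
      refine h1.congr_deriv ?_
      rw [smul_sub, smul_smul, mul_comm (Complex.exp _)]
      abel
    have hlim : Tendsto (fun y : ℝ => Complex.exp (2 * Complex.I * k * ((y - x : ℝ) : ℂ)) • u' y)
        atTop (𝓝 0) := by
      apply squeeze_zero_norm' (a := fun y => ‖u' y‖)
      · filter_upwards [Ici_mem_atTop x] with y hy
        rw [norm_smul]
        exact mul_le_of_le_one_left (norm_nonneg _)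
          (norm_exp_two_I_le_one hk (sub_nonneg.2 hy))
      · simpa using h0'.norm
    have hcont : Continuous fun t : ℝ => Complex.exp (2 * Complex.I * k * (t : ℂ)) := by fun_prop
    have hc : ContinuousWithinAt
        (fun y : ℝ => Complex.exp (2 * Complex.I * k * ((y - x : ℝ) : ℂ)) • u' y) (Ici x) x :=
      (((hcont.comp (continuous_id.sub continuous_const)).continuousOn.smul
        (hu'.mono hsub))) x self_mem_Ici
    rw [integral_Ioi_of_hasDerivAt_of_tendsto hc hF
      (integrableOn_kernel_smul (κ := fun t : ℝ => Complex.exp (2 * Complex.I * k * (t : ℂ))) hcont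
        (fun t ht => norm_exp_two_I_le_one hk ht) hrx) hlim]
    simp

/-- The Volterra integral of `r` solves `u'' + 2ik u' = r` and vanishes at infinity. -/
lemma exists_solution_of_integrable [CompleteSpace X]
    {k : ℂ} (hk : 0 ≤ k.im) (hk0 : k ≠ 0) {r : ℝ → X}
    (hc : Continuous r) (hr : Integrable r) :
    ∃ u' : ℝ → X,
      (∀ x, HasDerivAt (fun x => ∫ y in Ioi x, volterraKernel k (y - x) • r y) (u' x) x) ∧
      (∀ x, HasDerivAt u' (r x - (2 * Complex.I * k) • u' x) x) ∧
      Tendsto (fun x => ∫ y in Ioi x, volterraKernel k (y - x) • r y) atTop (𝓝 0) ∧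
      Tendsto u' atTop (𝓝 0) := by
  have h2 := two_I_mul_ne_zero hk0
  let E : ℝ → ℂ := fun x => Complex.exp (2 * Complex.I * k * x)
  have hEc : Continuous E := by simp only [E]; fun_prop
  have hE0 : ∀ x, E x ≠ 0 := fun x => Complex.exp_ne_zero _
  have hEsub : ∀ x y : ℝ, Complex.exp (2 * Complex.I * k * ((y - x : ℝ) : ℂ)) = (E x)⁻¹ * E y := by
    intro x y
    simp only [E]
    rw [← Complex.exp_neg, ← Complex.exp_add]; congr 1; push_cast; ring
  have hEr : ∀ x, IntegrableOn (fun y => E y • r y) (Ioi x) := by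
    intro x
    have h := (integrableOn_kernel_smul (κ := E) (C := 1) hEc
      (fun t ht => norm_exp_two_I_le_one hk ht) (hr.integrableOn (s := Ioi x))).smul (E x)
    refine h.congr (Eventually.of_forall fun y => ?_)
    show E x • E (y - x) • r y = E y • r y
    have : E (y - x) = (E x)⁻¹ * E y := hEsub x y
    rw [this, smul_smul, mul_inv_cancel_left₀ (hE0 x)]
  have hcE : Continuous fun y => E y • r y := hEc.smul hc
  let P : ℝ → X := fun x => ∫ y in Ioi x, E y • r y
  have hP : ∀ x, HasDerivAt P (-(E x • r x)) x := hasDerivAt_integral_Ioi hcE (hEr 0)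
  let R : ℝ → X := fun x => ∫ y in Ioi x, r y
  have hR : ∀ x, HasDerivAt R (-(r x)) x := hasDerivAt_integral_Ioi hc (hr.integrableOn (s := Ioi 0))
  have hEd : ∀ x, HasDerivAt (fun x => (E x)⁻¹) (-(2 * Complex.I * k) * (E x)⁻¹) x := by
    intro x
    have h := (hasDerivAt_exp_two_I k x).inv (hE0 x)
    refine h.congr_deriv ?_
    show -(2 * Complex.I * k * E x) / E x ^ 2 = _
    field_simp [hE0 x]
  have hu : ∀ x, ∫ y in Ioi x, volterraKernel k (y - x) • r y
      = (2 * Complex.I * k)⁻¹ • ((E x)⁻¹ • P x - R x) := by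
    intro x
    have h1 : ∀ y, volterraKernel k (y - x) • r y
        = (2 * Complex.I * k)⁻¹ • ((E x)⁻¹ • (E y • r y) - r y) := by
      intro y
      rw [volterraKernel, hEsub x y, div_eq_inv_mul, mul_smul, sub_smul, one_smul, mul_smul]
    simp_rw [h1]
    have h3 := integral_sub ((hEr x).smul (E x)⁻¹) (hr.integrableOn (s := Ioi x))
    simp only [Pi.smul_apply] at h3
    rw [integral_smul, h3, integral_smul]
  refine ⟨fun x => -((E x)⁻¹ • P x), ?_, ?_, ?_, ?_⟩
  · intro x
    have h := (((hEd x).smul (hP x)).sub (hR x)).const_smul (2 * Complex.I * k)⁻¹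
    refine (h.congr_of_eventuallyEq (Eventually.of_forall hu)).congr_deriv ?_
    rw [smul_neg, smul_smul, inv_mul_cancel₀ (hE0 x), one_smul, neg_mul, neg_smul, mul_smul]
    simp only [sub_neg_eq_add]
    rw [show -r x + -((2 * Complex.I * k) • (E x)⁻¹ • P x) + r x
      = (2 * Complex.I * k) • -((E x)⁻¹ • P x) by rw [smul_neg]; abel,
      smul_smul, inv_mul_cancel₀ h2, one_smul]
  · intro x
    have h := ((hEd x).smul (hP x)).neg
    refine h.congr_deriv ?_
    rw [smul_neg, smul_smul, inv_mul_cancel₀ (hE0 x), one_smul, neg_mul, neg_smul, mul_smul,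
      smul_neg]
    abel
  · apply squeeze_zero_norm (a := fun x => 1 / ‖k‖ * ∫ y in Ioi x, ‖r y‖)
    · intro x
      exact norm_integral_kernel_smul_le (fun t ht => norm_volterraKernel_le_inv hk ht)
        hr.integrableOn
    · simpa using (tendsto_integral_Ioi_zero hc.norm (a := 0) hr.norm.integrableOn).const_mul
        (1 / ‖k‖)
  · apply squeeze_zero_norm (a := fun x => 1 * ∫ y in Ioi x, ‖r y‖)
    · intro x
      have := norm_integral_kernel_smul_le (κ := E) (x := x) (C := 1)
        (fun t ht => norm_exp_two_I_le_one hk ht) (r := r) hr.integrableOn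
      rw [norm_neg]
      have e : ∫ y in Ioi x, E (y - x) • r y = (E x)⁻¹ • P x := by
        simp only [P]
        rw [← integral_smul]
        congr 1; ext y
        have : E (y - x) = (E x)⁻¹ * E y := hEsub x y
        rw [this, mul_smul]
      rwa [e] at this
    · simpa using (tendsto_integral_Ioi_zero hc.norm (a := 0) hr.norm.integrableOn).const_mul
        (1 : ℝ)

end Volterra

/-! ### Existence of solutions with prescribed behaviour at infinity -/

variable {n : ℕ}

/-- Existence for the inhomogeneous equation `u'' + 2ik u' = W u + s` with `u, u' → 0` at infinity:
the Volterra integral operator is a contraction in the sup norm with weight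
`exp (-(2/|k|) ∫ₓ^∞ ‖W‖)`. -/
lemma exists_solution {W s : ℝ → Matrix (Fin n) (Fin n) ℂ} (hW : Continuous W)
    (hWi : Integrable W) (hs : Continuous s) (hsi : Integrable s)
    {k : ℂ} (hk : 0 ≤ k.im) (hk0 : k ≠ 0) :
    ∃ u u' : ℝ → Matrix (Fin n) (Fin n) ℂ, (∀ x, HasDerivAt u (u' x) x) ∧
      (∀ x, HasDerivAt u' (W x * u x + s x - (2 * Complex.I * k) • u' x) x) ∧
      Tendsto u atTop (𝓝 0) ∧ Tendsto u' atTop (𝓝 0) := by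
  have hkpos : 0 < ‖k‖ := norm_pos_iff.2 hk0
  set c : ℝ := 2 / ‖k‖ with hc
  have hcpos : 0 < c := by positivity
  set τ : ℝ → ℝ := fun x => ∫ y in Ioi x, ‖W y‖ with hτ
  have hτ0 : ∀ x, 0 ≤ τ x := fun x => setIntegral_nonneg measurableSet_Ioi fun y _ => norm_nonneg _
  have hτle : ∀ x, τ x ≤ ∫ y, ‖W y‖ := fun x =>
    setIntegral_le_integral hWi.norm (Eventually.of_forall fun y => norm_nonneg _)
  have hτc : Continuous τ := continuous_iff_continuousAt.2 fun x =>
    (hasDerivAt_integral_Ioi hW.norm (a := 0) hWi.norm.integrableOn x).continuousAt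
  let w : ℝ → ℝ := fun x => Real.exp (c * τ x)
  have hwc : Continuous w := by simp only [w]; fun_prop
  have hw1 : ∀ x, 1 ≤ w x := fun x => Real.one_le_exp (mul_nonneg hcpos.le (hτ0 x))
  have hw0 : ∀ x, 0 < w x := fun x => Real.exp_pos _
  set K : ℝ := Real.exp (c * ∫ y, ‖W y‖)
  have hwK : ∀ x, w x ≤ K := fun x => Real.exp_le_exp.2 (by gcongr; exact hτle x)
  -- the contraction acts on `h = w⁻¹ u`; in this unknown the weighted norm is the sup norm
  let r : (BoundedContinuousFunction ℝ (Matrix (Fin n) (Fin n) ℂ)) → ℝ →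
      Matrix (Fin n) (Fin n) ℂ := fun h y => W y * ((w y : ℂ) • h y) + s y
  have hrc : ∀ h, Continuous (r h) := by
    intro h; simp only [r]
    exact (hW.mul ((Complex.continuous_ofReal.comp hwc).smul h.continuous)).add hs
  have hWh : ∀ h : (BoundedContinuousFunction ℝ (Matrix (Fin n) (Fin n) ℂ)),
      Integrable fun y => W y * ((w y : ℂ) • h y) := by
    intro h
    refine (hWi.norm.mul_const (K * ‖h‖)).mono' ?_ (Eventually.of_forall fun y => ?_)
    · exact (hW.mul ((Complex.continuous_ofReal.comp hwc).smul h.continuous)).aestronglyMeasurable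
    · refine (norm_mul_le _ _).trans ?_
      rw [norm_smul, Complex.norm_real, Real.norm_of_nonneg (hw0 y).le]
      gcongr
      · exact hwK y
      · exact h.norm_coe_le_norm y
  have hri : ∀ h, Integrable (r h) := fun h => (hWh h).add hsi
  choose v' hv1 hv2 hv3 hv4 using fun h => exists_solution_of_integrable hk hk0 (hrc h) (hri h)
  let v : (BoundedContinuousFunction ℝ (Matrix (Fin n) (Fin n) ℂ)) → ℝ →
      Matrix (Fin n) (Fin n) ℂ := fun h x => ∫ y in Ioi x, volterraKernel k (y - x) • r h y
  have hvc : ∀ h, Continuous (v h) := fun h => continuous_iff_continuousAt.2 fun x =>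
    (hv1 h x).continuousAt
  have hvb : ∀ h x, ‖v h x‖ ≤ 1 / ‖k‖ * ∫ y, ‖r h y‖ := by
    intro h x
    refine (norm_integral_kernel_smul_le (fun t ht => norm_volterraKernel_le_inv hk ht)
      (hri h).integrableOn).trans ?_
    exact mul_le_mul_of_nonneg_left (setIntegral_le_integral (hri h).norm
      (Eventually.of_forall fun y => norm_nonneg _)) (by positivity)
  let T : (BoundedContinuousFunction ℝ (Matrix (Fin n) (Fin n) ℂ)) →
      (BoundedContinuousFunction ℝ (Matrix (Fin n) (Fin n) ℂ)) := fun h =>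
    BoundedContinuousFunction.ofNormedAddCommGroup (fun x => ((w x)⁻¹ : ℂ) • v h x)
      (((Complex.continuous_ofReal.comp hwc).inv₀
        (fun x => by simpa using (hw0 x).ne')).smul (hvc h))
      (1 / ‖k‖ * ∫ y, ‖r h y‖) (fun x => by
        rw [norm_smul, norm_inv, Complex.norm_real, Real.norm_of_nonneg (hw0 x).le]
        refine le_trans ?_ (hvb h x)
        exact mul_le_of_le_one_left (norm_nonneg _) (inv_le_one_of_one_le₀ (hw1 x)))
  have hTapp : ∀ h x, T h x = ((w x)⁻¹ : ℂ) • v h x := fun h x => rfl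
  have hcontr : ContractingWith (1 / 2 : NNReal) T := by
    refine ⟨by norm_num, LipschitzWith.of_dist_le_mul fun h₁ h₂ => ?_⟩
    rw [BoundedContinuousFunction.dist_le (by positivity)]
    intro x
    rw [dist_eq_norm, hTapp, hTapp, ← smul_sub, norm_smul, norm_inv, Complex.norm_real,
      Real.norm_of_nonneg (hw0 x).le]
    have e : v h₁ x - v h₂ x
        = ∫ y in Ioi x, volterraKernel k (y - x) • (W y * ((w y : ℂ) • (h₁ y - h₂ y))) := by
      have i1 : ∀ h, IntegrableOn (fun y => volterraKernel k (y - x) • r h y) (Ioi x) := fun h =>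
        integrableOn_kernel_smul (continuous_volterraKernel k)
          (fun t ht => norm_volterraKernel_le_inv hk ht) (hri h).integrableOn
      simp only [v]
      rw [← integral_sub (i1 h₁) (i1 h₂)]
      congr 1; ext1 y
      simp only [r]
      rw [← smul_sub, smul_sub (w y : ℂ), Matrix.mul_sub]
      congr 1
      abel
    have i2 : IntegrableOn (fun y => W y * ((w y : ℂ) • (h₁ y - h₂ y))) (Ioi x) :=
      (hWh (h₁ - h₂)).integrableOn
    have b1 := norm_integral_kernel_smul_le (κ := volterraKernel k)
      (fun t ht => norm_volterraKernel_le_inv hk ht) i2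
    rw [← e] at b1
    obtain ⟨j1, j2⟩ := integral_Ioi_mul_exp_tail hW.norm (a := 0) hWi.norm.integrableOn hcpos
      (fun x => norm_nonneg _) x
    have b2 : ∫ y in Ioi x, ‖W y * ((w y : ℂ) • (h₁ y - h₂ y))‖
        ≤ ∫ y in Ioi x, (‖W y‖ * w y) * dist h₁ h₂ := by
      refine setIntegral_mono_on i2.norm (j1.mul_const _) measurableSet_Ioi fun y _ => ?_
      refine (norm_mul_le _ _).trans ?_
      rw [norm_smul, Complex.norm_real, Real.norm_of_nonneg (hw0 y).le, mul_assoc]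
      gcongr
      rw [← dist_eq_norm]; exact BoundedContinuousFunction.dist_coe_le_dist y
    rw [integral_mul_const] at b2
    have b3 : ∫ y in Ioi x, ‖W y‖ * w y = (w x - 1) / c := j2
    rw [b3] at b2
    have hd : 0 ≤ dist h₁ h₂ := dist_nonneg
    have hwx := hw0 x
    calc (w x)⁻¹ * ‖v h₁ x - v h₂ x‖
        ≤ (w x)⁻¹ * (1 / ‖k‖ * ((w x - 1) / c * dist h₁ h₂)) := by
          gcongr
          exact b1.trans (by gcongr)
      _ = (1 / 2) * (1 - (w x)⁻¹) * dist h₁ h₂ := by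
          rw [hc]; field_simp
      _ ≤ ((1 / 2 : NNReal) : ℝ) * dist h₁ h₂ := by
          gcongr
          push_cast
          have : 0 < (w x)⁻¹ := by positivity
          linarith
  set h := hcontr.fixedPoint T with hh
  have hfix : T h = h := hcontr.fixedPoint_isFixedPt
  have hvh : ∀ x, (w x : ℂ) • h x = v h x := by
    intro x
    conv_lhs => rw [← hfix]
    rw [hTapp, smul_smul, mul_inv_cancel₀ (by exact_mod_cast (hw0 x).ne'), one_smul]
  refine ⟨v h, v' h, hv1 h, ?_, hv3 h, hv4 h⟩
  intro x
  have := hv2 h x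
  simp only [r] at this
  rwa [hvh x] at this

variable {n : ℕ}

/-! ### Jost solutions of a regular potential -/

/-- A potential on the whole line which is continuous, bounded, integrable and selfadjoint, with a
finite first moment on `(0,∞)`.  Every admissible potential agrees on `(0,∞)` with such a `W`. -/
structure IsRegularPotential (W : ℝ → Matrix (Fin n) (Fin n) ℂ) : Prop where
  continuous : Continuous W
  integrable : Integrable W
  moment : IntegrableOn (fun x : ℝ => |x| * ‖W x‖) (Ioi 0)
  selfadjoint : ∀ x, (W x)ᴴ = W x
  bounded : ∃ C, ∀ x, ‖W x‖ ≤ C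

/-- The closed upper half-plane without the origin. -/
def puncturedHalfPlane : Set ℂ := {k | 0 ≤ k.im ∧ k ≠ 0}

/-- `g(k,x) = e^{-ikx} f(k,x)` for the Jost solution `f`, together with `g' = ∂g/∂x`:
`g'' + 2ik g' = W g`, `g → 1` and `g' → 0` as `x → ∞`. -/
structure IsJostFactor (W : ℝ → Matrix (Fin n) (Fin n) ℂ)
    (g g' : ℂ → ℝ → Matrix (Fin n) (Fin n) ℂ) : Prop where
  hasDeriv : ∀ k ∈ puncturedHalfPlane, ∀ x, HasDerivAt (g k) (g' k x) x
  hasDeriv' : ∀ k ∈ puncturedHalfPlane, ∀ x,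
    HasDerivAt (g' k) (W x * g k x - (2 * Complex.I * k) • g' k x) x
  tendsto : ∀ k ∈ puncturedHalfPlane, Tendsto (g k) atTop (𝓝 1)
  tendsto' : ∀ k ∈ puncturedHalfPlane, Tendsto (g' k) atTop (𝓝 0)

lemma exists_isJostFactor {W : ℝ → Matrix (Fin n) (Fin n) ℂ} (hW : IsRegularPotential W) :
    ∃ g g' : ℂ → ℝ → Matrix (Fin n) (Fin n) ℂ, IsJostFactor W g g' := by
  have key : ∀ k : ℂ, ∃ u u' : ℝ → Matrix (Fin n) (Fin n) ℂ, k ∈ puncturedHalfPlane →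
      (∀ x, HasDerivAt u (u' x) x) ∧
      (∀ x, HasDerivAt u' (W x * u x + W x - (2 * Complex.I * k) • u' x) x) ∧
      Tendsto u atTop (𝓝 0) ∧ Tendsto u' atTop (𝓝 0) := by
    intro k
    by_cases hk : k ∈ puncturedHalfPlane
    · obtain ⟨u, u', h⟩ := exists_solution hW.continuous hW.integrable hW.continuous
        hW.integrable hk.1 hk.2
      exact ⟨u, u', fun _ => h⟩
    · exact ⟨0, 0, fun h => absurd h hk⟩
  choose u u' h using key
  refine ⟨fun k x => u k x + 1, u', ⟨?_, ?_, ?_, ?_⟩⟩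
  · intro k hk x
    exact ((h k hk).1 x).add_const 1
  · intro k hk x
    refine ((h k hk).2.1 x).congr_deriv ?_
    rw [Matrix.mul_add, Matrix.mul_one]
  · intro k hk
    simpa using (h k hk).2.2.1.add_const 1
  · intro k hk
    exact (h k hk).2.2.2

lemma exists_bound_of_tendsto {X : Type*} [NormedAddCommGroup X] {u : ℝ → X} {a : ℝ} {l : X}
    (hu : ContinuousOn u (Ici a)) (h : Tendsto u atTop (𝓝 l)) :
    ∃ C, ∀ x, a ≤ x → ‖u x‖ ≤ C := by
  have h1 : ∀ᶠ x in atTop, ‖u x‖ ≤ ‖l‖ + 1 :=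
    (h.norm.eventually (gt_mem_nhds (lt_add_one _))).mono fun x hx => hx.le
  obtain ⟨b, hb⟩ := eventually_atTop.1 h1
  obtain ⟨C, hC⟩ := (isCompact_Icc (a := a) (b := b)).exists_bound_of_continuousOn
    (hu.mono Icc_subset_Ici_self)
  refine ⟨max C (‖l‖ + 1), fun x hx => ?_⟩
  rcases le_or_gt x b with hxb | hxb
  · exact (hC x ⟨hx, hxb⟩).trans (le_max_left _ _)
  · exact (hb x hxb.le).trans (le_max_right _ _)

lemma integrableOn_mul_of_bound {W u : ℝ → Matrix (Fin n) (Fin n) ℂ} (hW : Continuous W)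
    (hWi : Integrable W) {a C : ℝ} (hu : ContinuousOn u (Ici a)) (hC : ∀ x, a ≤ x → ‖u x‖ ≤ C) :
    IntegrableOn (fun x => W x * u x) (Ioi a) := by
  refine (hWi.norm.mul_const C).integrableOn.mono' ?_ ?_
  · exact ((hW.continuousOn.mul hu).mono Ioi_subset_Ici_self).aestronglyMeasurable measurableSet_Ioi
  · refine (ae_restrict_iff' measurableSet_Ioi).2 (Eventually.of_forall fun y hy => ?_)
    exact (norm_mul_le _ _).trans
      (mul_le_mul_of_nonneg_left (hC y (le_of_lt hy)) (norm_nonneg _))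

/-- The data of a solution of `u'' + 2ik u' = W u + s` on `(a,∞)` that vanishes at infinity together
with its derivative. -/
structure IsDecayingSolution (W s : ℝ → Matrix (Fin n) (Fin n) ℂ) (k : ℂ) (a : ℝ)
    (u u' : ℝ → Matrix (Fin n) (Fin n) ℂ) : Prop where
  cont : ContinuousOn u (Ici a)
  cont' : ContinuousOn u' (Ici a)
  hasDeriv : ∀ x, a < x → HasDerivAt u (u' x) x
  hasDeriv' : ∀ x, a < x → HasDerivAt u' (W x * u x + s x - (2 * Complex.I * k) • u' x) x
  integrable : IntegrableOn s (Ioi a)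
  tendsto : Tendsto u atTop (𝓝 0)
  tendsto' : Tendsto u' atTop (𝓝 0)

namespace IsDecayingSolution

variable {W s u u' : ℝ → Matrix (Fin n) (Fin n) ℂ} {k : ℂ} {a : ℝ}

lemma integrableOn_source (h : IsDecayingSolution W s k a u u') (hW : Continuous W)
    (hWi : Integrable W) : IntegrableOn (fun x => W x * u x + s x) (Ioi a) := by
  obtain ⟨C, hC⟩ := exists_bound_of_tendsto h.cont h.tendsto
  exact (integrableOn_mul_of_bound hW hWi h.cont hC).add h.integrable

lemma repr (h : IsDecayingSolution W s k a u u') (hW : Continuous W)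
    (hWi : Integrable W) (hk : k ∈ puncturedHalfPlane) {x : ℝ} (hx : a ≤ x) :
    u x = ∫ y in Ioi x, volterraKernel k (y - x) • (W y * u y + s y) ∧
    u' x = -∫ y in Ioi x, Complex.exp (2 * Complex.I * k * ((y - x : ℝ) : ℂ)) •
      (W y * u y + s y) :=
  eq_integral_volterraKernel hk.1 hk.2 h.cont h.cont' h.hasDeriv h.hasDeriv'
    (h.integrableOn_source hW hWi) h.tendsto h.tendsto' hx

lemma norm_integral_source_le (h : IsDecayingSolution W s k a u u') (hW : Continuous W)
    (hWi : Integrable W) {x : ℝ} (hx : a ≤ x) :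
    ∫ y in Ioi x, ‖W y * u y + s y‖ ≤ (∫ y in Ioi x, ‖W y‖ * ‖u y‖) + ∫ y in Ioi a, ‖s y‖ := by
  obtain ⟨C, hC⟩ := exists_bound_of_tendsto h.cont h.tendsto
  have hsub : Ioi x ⊆ Ioi a := Ioi_subset_Ioi hx
  have i1 : IntegrableOn (fun y => ‖W y‖ * ‖u y‖) (Ioi x) := by
    refine (hWi.norm.mul_const C).integrableOn.mono' ?_ ?_
    · exact ((hW.norm.continuousOn.mul h.cont.norm).mono
        (hsub.trans Ioi_subset_Ici_self)).aestronglyMeasurable measurableSet_Ioi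
    · refine (ae_restrict_iff' measurableSet_Ioi).2 (Eventually.of_forall fun y hy => ?_)
      rw [Real.norm_of_nonneg (by positivity)]
      exact mul_le_mul_of_nonneg_left (hC y (hx.trans (le_of_lt hy))) (norm_nonneg _)
  have i2 : IntegrableOn (fun y => ‖s y‖) (Ioi x) :=
    IntegrableOn.mono_set h.integrable.norm hsub
  calc ∫ y in Ioi x, ‖W y * u y + s y‖ ≤ ∫ y in Ioi x, (‖W y‖ * ‖u y‖ + ‖s y‖) := by
        refine setIntegral_mono_on ((h.integrableOn_source hW hWi).mono_set hsub).norm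
          (i1.add i2) measurableSet_Ioi fun y _ => ?_
        exact (norm_add_le _ _).trans (add_le_add (norm_mul_le _ _) le_rfl)
    _ = (∫ y in Ioi x, ‖W y‖ * ‖u y‖) + ∫ y in Ioi x, ‖s y‖ := integral_add i1 i2
    _ ≤ _ := by
        exact add_le_add_right (setIntegral_mono_set h.integrable.norm
          (Eventually.of_forall fun y => norm_nonneg _) (Eventually.of_forall hsub)) _

lemma norm_le (h : IsDecayingSolution W s k a u u') (hW : Continuous W)
    (hWi : Integrable W) (hk : k ∈ puncturedHalfPlane) {x : ℝ} (hx : a ≤ x) :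
    ‖u x‖ ≤ 2 / ‖k‖ * Real.exp (2 / ‖k‖ * ∫ y, ‖W y‖) * ∫ y in Ioi a, ‖s y‖ := by
  obtain ⟨C, hC⟩ := exists_bound_of_tendsto h.cont h.tendsto
  have hkpos : 0 < ‖k‖ := norm_pos_iff.2 hk.2
  have hS : 0 ≤ ∫ y in Ioi a, ‖s y‖ := setIntegral_nonneg measurableSet_Ioi fun y _ => norm_nonneg _
  have key : ∀ x, a ≤ x → ‖u x‖ ≤ 1 / ‖k‖ * (∫ y in Ioi a, ‖s y‖) +
      ∫ y in Ioi x, (1 / ‖k‖ * ‖W y‖) * ‖u y‖ := by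
    intro x hx
    have h1 := norm_integral_kernel_smul_le (κ := volterraKernel k)
      (fun t ht => norm_volterraKernel_le_inv hk.1 ht)
      ((h.integrableOn_source hW hWi).mono_set (Ioi_subset_Ioi hx))
    rw [← (h.repr hW hWi hk hx).1] at h1
    have h2 := mul_le_mul_of_nonneg_left (h.norm_integral_source_le hW hWi hx)
      (by positivity : (0:ℝ) ≤ 1 / ‖k‖)
    simp_rw [mul_assoc]
    rw [integral_const_mul]
    linarith
  have := gronwall_Ioi (m := fun y => 1 / ‖k‖ * ‖W y‖) (continuous_const.mul hW.norm)
    (fun y => by positivity) (hWi.norm.const_mul _).integrableOn (fun x _ => norm_nonneg (u x))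
    hC h.cont.norm (by positivity) key x hx
  refine this.trans ?_
  rw [integral_const_mul]
  have e : ∫ y in Ioi x, ‖W y‖ ≤ ∫ y, ‖W y‖ :=
    setIntegral_le_integral hWi.norm (Eventually.of_forall fun y => norm_nonneg _)
  calc 2 * (1 / ‖k‖ * ∫ y in Ioi a, ‖s y‖) * Real.exp (2 * (1 / ‖k‖ * ∫ y in Ioi x, ‖W y‖))
      ≤ 2 * (1 / ‖k‖ * ∫ y in Ioi a, ‖s y‖) * Real.exp (2 * (1 / ‖k‖ * ∫ y, ‖W y‖)) := by gcongr
    _ = _ := by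
      rw [show 2 * (1 / ‖k‖ * ∫ y, ‖W y‖) = 2 / ‖k‖ * ∫ y, ‖W y‖ by ring]; ring

lemma norm_deriv_le' (h : IsDecayingSolution W s k a u u') (hW : Continuous W)
    (hWi : Integrable W) (hk : k ∈ puncturedHalfPlane) {x : ℝ} (hx : a ≤ x) :
    ‖u' x‖ ≤ ∫ y in Ioi x, ‖W y * u y + s y‖ := by
  rw [(h.repr hW hWi hk hx).2, norm_neg]
  simpa using norm_integral_kernel_smul_le
    (κ := fun t : ℝ => Complex.exp (2 * Complex.I * k * (t : ℂ)))
    (fun t ht => norm_exp_two_I_le_one hk.1 ht)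
    ((h.integrableOn_source hW hWi).mono_set (Ioi_subset_Ioi hx))

lemma norm_deriv_le (h : IsDecayingSolution W s k a u u') (hW : Continuous W)
    (hWi : Integrable W) (hk : k ∈ puncturedHalfPlane) {x : ℝ} (hx : a ≤ x) :
    ‖u' x‖ ≤ ((∫ y, ‖W y‖) * (2 / ‖k‖ * Real.exp (2 / ‖k‖ * ∫ y, ‖W y‖)) + 1) *
      ∫ y in Ioi a, ‖s y‖ := by
  refine (h.norm_deriv_le' hW hWi hk hx).trans ((h.norm_integral_source_le hW hWi hx).trans ?_)
  set B := 2 / ‖k‖ * Real.exp (2 / ‖k‖ * ∫ y, ‖W y‖) * ∫ y in Ioi a, ‖s y‖ with hB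
  have hS : 0 ≤ ∫ y in Ioi a, ‖s y‖ := setIntegral_nonneg measurableSet_Ioi fun y _ => norm_nonneg _
  have hB0 : 0 ≤ B := by positivity
  have e : ∫ y in Ioi x, ‖W y‖ * ‖u y‖ ≤ ∫ y in Ioi x, ‖W y‖ * B := by
    refine setIntegral_mono_on₀ ?_ (hWi.norm.mul_const B).integrableOn
      measurableSet_Ioi.nullMeasurableSet fun y hy => ?_
    · refine (hWi.norm.mul_const B).integrableOn.mono' ?_ ?_
      · exact ((hW.norm.continuousOn.mul h.cont.norm).mono
          ((Ioi_subset_Ioi hx).trans Ioi_subset_Ici_self)).aestronglyMeasurable measurableSet_Ioi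
      · refine (ae_restrict_iff' measurableSet_Ioi).2 (Eventually.of_forall fun y hy => ?_)
        rw [Real.norm_of_nonneg (by positivity)]
        exact mul_le_mul_of_nonneg_left (h.norm_le hW hWi hk (hx.trans (le_of_lt hy)))
          (norm_nonneg _)
    · exact mul_le_mul_of_nonneg_left (h.norm_le hW hWi hk (hx.trans (le_of_lt hy)))
          (norm_nonneg _)
  rw [integral_mul_const] at e
  have e2 : ∫ y in Ioi x, ‖W y‖ ≤ ∫ y, ‖W y‖ :=
    setIntegral_le_integral hWi.norm (Eventually.of_forall fun y => norm_nonneg _)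
  have e3 := mul_le_mul_of_nonneg_right e2 hB0
  calc _ ≤ (∫ y, ‖W y‖) * B + ∫ y in Ioi a, ‖s y‖ := by linarith
    _ = _ := by rw [hB]; ring

end IsDecayingSolution

section Estimates

variable {W : ℝ → Matrix (Fin n) (Fin n) ℂ} {g g' : ℂ → ℝ → Matrix (Fin n) (Fin n) ℂ}

lemma norm_one_le : ‖(1 : Matrix (Fin n) (Fin n) ℂ)‖ ≤ 1 := by
  rw [← Matrix.diagonal_one, Matrix.l2_opNorm_diagonal]
  exact (pi_norm_le_iff_of_nonneg zero_le_one).2 fun i => by simp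

lemma IsJostFactor.isDecayingSolution (hW : IsRegularPotential W) (hg : IsJostFactor W g g')
    {k : ℂ} (hk : k ∈ puncturedHalfPlane) (a : ℝ) :
    IsDecayingSolution W W k a (fun x => g k x - 1) (g' k) where
  cont := fun x _ => ((hg.hasDeriv k hk x).continuousAt.sub continuousAt_const).continuousWithinAt
  cont' := fun x _ => (hg.hasDeriv' k hk x).continuousAt.continuousWithinAt
  hasDeriv := fun x _ => (hg.hasDeriv k hk x).sub_const 1
  hasDeriv' := fun x _ => (hg.hasDeriv' k hk x).congr_deriv (by
    rw [Matrix.mul_sub, Matrix.mul_one]; abel)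
  integrable := hW.integrable.integrableOn
  tendsto := by simpa using (hg.tendsto k hk).sub_const 1
  tendsto' := hg.tendsto' k hk

lemma IsRegularPotential.continuous_moment (hW : IsRegularPotential W) :
    Continuous fun x : ℝ => |x| * ‖W x‖ := continuous_abs.mul hW.continuous.norm

/-- Uniform bounds for `g(k,x)`, down to `k = 0`.  They use the kernel bound
`|volterraKernel k t| ≤ t`, hence the first moment of the potential. -/
lemma exists_jost_bound (hW : IsRegularPotential W) (hg : IsJostFactor W g g') :
    ∃ C : ℝ, 0 < C ∧ ∀ k ∈ puncturedHalfPlane, ∀ x, 0 ≤ x → ‖g k x‖ ≤ C ∧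
      ‖g' k x‖ ≤ C * (∫ y in Ioi x, ‖W y‖) ∧ ‖g k x - 1‖ ≤ C * ∫ y in Ioi x, |y| * ‖W y‖ := by
  set m : ℝ → ℝ := fun x => |x| * ‖W x‖ with hm
  have hmc : Continuous m := hW.continuous_moment
  have hm0 : ∀ x, 0 ≤ m x := fun x => by positivity
  set C : ℝ := 2 * 1 * Real.exp (2 * ∫ y in Ioi 0, m y) with hC
  have hCpos : 0 < C := by positivity
  have hmt : ∀ x, 0 ≤ x → IntegrableOn m (Ioi x) := fun x hx =>
    hW.moment.mono_set (Ioi_subset_Ioi hx)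
  refine ⟨C, hCpos, fun k hk => ?_⟩
  have hd := hg.isDecayingSolution hW hk 0
  have hgc : Continuous (g k) := continuous_iff_continuousAt.2 fun x =>
    (hg.hasDeriv k hk x).continuousAt
  obtain ⟨B, hB⟩ := exists_bound_of_tendsto (a := 0) hgc.continuousOn (hg.tendsto k hk)
  have hsrc : ∀ y, W y * (g k y - 1) + W y = W y * g k y := fun y => by
    rw [Matrix.mul_sub, Matrix.mul_one]; abel
  have hrep := fun {x : ℝ} (hx : 0 ≤ x) => (hd.repr hW.continuous hW.integrable hk hx).1
  simp_rw [hsrc] at hrep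
  have hsub : ∀ x, 0 ≤ x → ‖g k x - 1‖ ≤ ∫ y in Ioi x, m y * ‖g k y‖ := by
    intro x hx
    rw [hrep hx]
    refine norm_integral_le_of_norm_le ?_
      ((ae_restrict_iff' measurableSet_Ioi).2 (Eventually.of_forall fun y hy => ?_))
    · refine ((hmt x hx).mul_const B).mono' ?_ ?_
      · exact (hmc.mul hgc.norm).aestronglyMeasurable
      · refine (ae_restrict_iff' measurableSet_Ioi).2 (Eventually.of_forall fun y hy => ?_)
        rw [Real.norm_of_nonneg (mul_nonneg (hm0 y) (norm_nonneg _))]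
        exact mul_le_mul_of_nonneg_left (hB y (hx.trans (le_of_lt hy))) (hm0 y)
    · have hxy : x < y := hy
      rw [norm_smul, hm]
      calc ‖volterraKernel k (y - x)‖ * ‖W y * g k y‖
          ≤ (y - x) * (‖W y‖ * ‖g k y‖) := by
            refine mul_le_mul (norm_volterraKernel_le hk.1 hk.2 (by linarith))
              (norm_mul_le _ _) (norm_nonneg _) (by linarith)
        _ ≤ |y| * (‖W y‖ * ‖g k y‖) := by
            gcongr
            exact (by linarith : y - x ≤ y).trans (le_abs_self y)
        _ = _ := by ring
  have hgC : ∀ x, 0 ≤ x → ‖g k x‖ ≤ C := by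
    intro x hx
    have := gronwall_Ioi hmc hm0 hW.moment (fun x _ => norm_nonneg (g k x)) hB
      hgc.norm.continuousOn zero_le_one (fun x hx => by
        calc ‖g k x‖ ≤ ‖(1 : Matrix (Fin n) (Fin n) ℂ)‖ + ‖g k x - 1‖ := by
              have := norm_add_le (1 : Matrix (Fin n) (Fin n) ℂ) (g k x - 1)
              simpa using this
          _ ≤ _ := add_le_add norm_one_le (hsub x hx)) x hx
    refine this.trans ?_
    rw [hC]
    gcongr 2 * 1 * Real.exp (2 * ?_)
    exact setIntegral_mono_set hW.moment (Eventually.of_forall fun y => hm0 y)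
      (Eventually.of_forall (Ioi_subset_Ioi hx))
  intro x hx
  refine ⟨hgC x hx, ?_, ?_⟩
  · refine (hd.norm_deriv_le' hW.continuous hW.integrable hk hx).trans ?_
    simp_rw [hsrc]
    rw [← integral_const_mul]
    refine setIntegral_mono_on ((integrableOn_mul_of_bound hW.continuous hW.integrable
      hgc.continuousOn hB).mono_set (Ioi_subset_Ioi hx)).norm
      (hW.integrable.norm.const_mul C).integrableOn measurableSet_Ioi fun y hy => ?_
    refine (norm_mul_le _ _).trans ?_
    rw [mul_comm]
    exact mul_le_mul_of_nonneg_right (hgC y (hx.trans (le_of_lt hy))) (norm_nonneg _)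
  · refine (hsub x hx).trans ?_
    rw [← integral_const_mul]
    refine setIntegral_mono_on ?_ ((hmt x hx).const_mul C) measurableSet_Ioi fun y hy => ?_
    · refine ((hmt x hx).mul_const B).mono' ?_ ?_
      · exact (hmc.mul hgc.norm).aestronglyMeasurable
      · refine (ae_restrict_iff' measurableSet_Ioi).2 (Eventually.of_forall fun y hy => ?_)
        rw [Real.norm_of_nonneg (mul_nonneg (hm0 y) (norm_nonneg _))]
        exact mul_le_mul_of_nonneg_left (hB y (hx.trans (le_of_lt hy))) (hm0 y)
    · rw [mul_comm C]
      exact mul_le_mul_of_nonneg_left (hgC y (hx.trans (le_of_lt hy))) (hm0 y)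

/-- `∫ₓ^∞ ‖W‖` is integrable on `(0,∞)`, as its integral is the first moment. -/
lemma integrableOn_tail (hW : IsRegularPotential W) :
    IntegrableOn (fun x => ∫ y in Ioi x, ‖W y‖) (Ioi 0) := by
  have hmc : Continuous fun x : ℝ => |x| * ‖W x‖ := hW.continuous_moment
  have hd : ∀ x ∈ Ioi (0 : ℝ), HasDerivAt
      (fun x => x * (∫ y in Ioi x, ‖W y‖) - ∫ y in Ioi x, |y| * ‖W y‖) (∫ y in Ioi x, ‖W y‖) x := by
    intro x hx
    have h1 := (hasDerivAt_id x).mul (hasDerivAt_integral_Ioi hW.continuous.norm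
      (a := 0) hW.integrable.norm.integrableOn x)
    have h2 := hasDerivAt_integral_Ioi hmc hW.moment x
    refine (h1.sub h2).congr_deriv ?_
    rw [abs_of_pos hx]; simp
  have hlim : Tendsto (fun x => x * (∫ y in Ioi x, ‖W y‖) - ∫ y in Ioi x, |y| * ‖W y‖) atTop
      (𝓝 0) := by
    have h0 := tendsto_integral_Ioi_zero hmc hW.moment
    have h1 : Tendsto (fun x => x * (∫ y in Ioi x, ‖W y‖)) atTop (𝓝 0) := by
      refine squeeze_zero' ?_ ?_ h0
      · filter_upwards [Ici_mem_atTop (0 : ℝ)] with x hx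
        exact mul_nonneg hx (setIntegral_nonneg measurableSet_Ioi fun y _ => norm_nonneg _)
      · filter_upwards [Ici_mem_atTop (0 : ℝ)] with x hx
        rw [← integral_const_mul]
        refine setIntegral_mono_on (hW.integrable.norm.const_mul x).integrableOn
          (hW.moment.mono_set (Ioi_subset_Ioi hx)) measurableSet_Ioi fun y hy => ?_
        exact mul_le_mul_of_nonneg_right ((le_of_lt hy).trans (le_abs_self y)) (norm_nonneg _)
    simpa using h1.sub h0
  refine integrableOn_Ioi_deriv_of_nonneg ?_ hd
    (fun x _ => setIntegral_nonneg measurableSet_Ioi fun y _ => norm_nonneg _) hlim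
  exact ((continuousAt_id.mul (hasDerivAt_integral_Ioi hW.continuous.norm
      (a := 0) hW.integrable.norm.integrableOn 0).continuousAt).sub
      (hasDerivAt_integral_Ioi hmc hW.moment 0).continuousAt).continuousWithinAt

end Estimates

/-! ### Dependence on the spectral parameter -/

section Extension

variable {X : Type*} [NormedAddCommGroup X] [NormedSpace ℝ X]

/-- An extension to the line of a function on `[0,∞)` that preserves continuity and
integrability. -/
noncomputable def extendLeft (φ : ℝ → X) (x : ℝ) : X := Real.exp (min x 0) • φ (max x 0)

lemma extendLeft_of_nonneg (φ : ℝ → X) {x : ℝ} (hx : 0 ≤ x) : extendLeft φ x = φ x := by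
  simp [extendLeft, hx]

lemma continuous_extendLeft {φ : ℝ → X} (h : ContinuousOn φ (Ici 0)) :
    Continuous (extendLeft φ) := by
  have h1 : Continuous fun x : ℝ => φ (max x 0) :=
    h.comp_continuous (by fun_prop) fun x => le_max_right x 0
  unfold extendLeft
  exact (by fun_prop : Continuous fun x : ℝ => Real.exp (min x 0)).smul h1

lemma integrable_extendLeft {φ : ℝ → X} (hi : IntegrableOn φ (Ioi 0)) :
    Integrable (extendLeft φ) := by
  rw [← integrableOn_univ, ← Iic_union_Ioi (a := (0 : ℝ))]
  refine IntegrableOn.union ?_ ?_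
  · have h1 : IntegrableOn (fun x : ℝ => Real.exp x • φ 0) (Iic 0) :=
      Integrable.smul_const (integrableOn_exp_Iic 0) (φ 0)
    refine h1.congr_fun (fun x hx => ?_) measurableSet_Iic
    have hx' : x ≤ 0 := hx
    simp [extendLeft, hx']
  · exact hi.congr_fun (fun x hx => (extendLeft_of_nonneg φ (le_of_lt hx)).symm) measurableSet_Ioi

end Extension

section Differentiability

variable {W : ℝ → Matrix (Fin n) (Fin n) ℂ} {g g' : ℂ → ℝ → Matrix (Fin n) (Fin n) ℂ}

/-- `g(k,0)` and `∂ₓg(k,0)` are differentiable in `k`, up to the real axis. The derivative solves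
the equation obtained by differentiating `g'' + 2ik g' = W g` with respect to `k`. -/
lemma exists_hasDerivWithinAt_jost (hW : IsRegularPotential W) (hg : IsJostFactor W g g')
    {k₀ : ℂ} (hk₀ : k₀ ∈ puncturedHalfPlane) :
    ∃ d d' : Matrix (Fin n) (Fin n) ℂ,
      HasDerivWithinAt (fun k => g k 0) d puncturedHalfPlane k₀ ∧
      HasDerivWithinAt (fun k => g' k 0) d' puncturedHalfPlane k₀ := by
  obtain ⟨C, hC, hb⟩ := exists_jost_bound hW hg
  set T : ℝ → ℝ := fun x => ∫ y in Ioi x, ‖W y‖ with hT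
  have hTi : IntegrableOn T (Ioi 0) := integrableOn_tail hW
  have hT0 : ∀ x, 0 ≤ T x := fun x => setIntegral_nonneg measurableSet_Ioi fun y _ => norm_nonneg _
  have hgc' : ∀ k ∈ puncturedHalfPlane, Continuous (g' k) := fun k hk =>
    continuous_iff_continuousAt.2 fun x => (hg.hasDeriv' k hk x).continuousAt
  have hgi' : ∀ k ∈ puncturedHalfPlane, IntegrableOn (g' k) (Ioi 0) := fun k hk =>
    (hTi.const_mul C).mono' (hgc' k hk).aestronglyMeasurable
      ((ae_restrict_iff' measurableSet_Ioi).2 (Eventually.of_forall fun y hy =>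
        (hb k hk y (le_of_lt hy)).2.1))
  set K := 2 / ‖k₀‖ * Real.exp (2 / ‖k₀‖ * ∫ y, ‖W y‖) with hK
  set K' := (∫ y, ‖W y‖) * K + 1 with hK'
  have hWn : 0 ≤ ∫ y, ‖W y‖ := integral_nonneg fun y => norm_nonneg _
  have hK0 : 0 ≤ K := by positivity
  have hK0' : 0 ≤ K' := by positivity
  -- `g(k) - g(k₀)` solves the equation at `k₀` with source `-2i(k - k₀) g'(k)`
  have hdiff : ∀ k ∈ puncturedHalfPlane, IsDecayingSolution W
      (fun x => (-(2 * Complex.I * (k - k₀))) • g' k x) k₀ 0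
      (fun x => g k x - g k₀ x) (fun x => g' k x - g' k₀ x) := by
    intro k hk
    refine ⟨?_, ?_, ?_, ?_, ?_, ?_, ?_⟩
    · exact fun x _ => ((hg.hasDeriv k hk x).sub
        (hg.hasDeriv k₀ hk₀ x)).continuousAt.continuousWithinAt
    · exact ((hgc' k hk).sub (hgc' k₀ hk₀)).continuousOn
    · exact fun x _ => (hg.hasDeriv k hk x).sub (hg.hasDeriv k₀ hk₀ x)
    · intro x _
      refine ((hg.hasDeriv' k hk x).sub (hg.hasDeriv' k₀ hk₀ x)).congr_deriv ?_
      rw [Matrix.mul_sub]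
      module
    · exact (hgi' k hk).smul (-(2 * Complex.I * (k - k₀)))
    · simpa using (hg.tendsto k hk).sub (hg.tendsto k₀ hk₀)
    · simpa using (hg.tendsto' k hk).sub (hg.tendsto' k₀ hk₀)
  have hLip : ∀ k ∈ puncturedHalfPlane, ∀ x, 0 ≤ x →
      ‖g' k x - g' k₀ x‖ ≤ K' * (2 * ‖k - k₀‖ * (C * ∫ x in Ioi 0, T x)) := by
    intro k hk x hx
    refine ((hdiff k hk).norm_deriv_le hW.continuous hW.integrable hk₀ hx).trans ?_
    refine mul_le_mul_of_nonneg_left ?_ hK0'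
    simp_rw [norm_smul]
    rw [integral_const_mul]
    have e1 : ‖-(2 * Complex.I * (k - k₀))‖ = 2 * ‖k - k₀‖ := by simp
    rw [e1, ← integral_const_mul C]
    refine mul_le_mul_of_nonneg_left ?_ (by positivity)
    exact setIntegral_mono_on (hgi' k hk).norm (hTi.const_mul C) measurableSet_Ioi
      fun y hy => (hb k hk y (le_of_lt hy)).2.1
  -- the Lipschitz bound holds pointwise only; dominated convergence makes it a limit in `L¹`
  have hL1 : Tendsto (fun k => ∫ x in Ioi (0:ℝ), ‖g' k x - g' k₀ x‖) (𝓝[puncturedHalfPlane] k₀)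
      (𝓝 0) := by
    have h00 : (𝓝 (0 : ℝ)) = 𝓝 (∫ x in Ioi (0:ℝ), (0 : ℝ)) := by simp
    rw [h00]
    refine tendsto_integral_filter_of_dominated_convergence (fun x => C * T x + C * T x)
      ?_ ?_ ((hTi.const_mul C).add (hTi.const_mul C)) ?_
    · filter_upwards [self_mem_nhdsWithin] with k hk
      exact ((hgc' k hk).sub (hgc' k₀ hk₀)).norm.aestronglyMeasurable
    · filter_upwards [self_mem_nhdsWithin] with k hk
      refine (ae_restrict_iff' measurableSet_Ioi).2 (Eventually.of_forall fun y hy => ?_)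
      rw [norm_norm]
      exact (norm_sub_le _ _).trans (add_le_add (hb k hk y (le_of_lt hy)).2.1
        (hb k₀ hk₀ y (le_of_lt hy)).2.1)
    · refine (ae_restrict_iff' measurableSet_Ioi).2 (Eventually.of_forall fun y hy => ?_)
      refine squeeze_zero' (Eventually.of_forall fun k => norm_nonneg _)
        (g := fun k => K' * (2 * ‖k - k₀‖ * (C * ∫ x in Ioi 0, T x))) ?_ ?_
      · filter_upwards [self_mem_nhdsWithin] with k hk
        exact hLip k hk y (le_of_lt hy)
      · have : Continuous fun k => K' * (2 * ‖k - k₀‖ * (C * ∫ x in Ioi 0, T x)) := by fun_prop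
        have h := this.tendsto k₀
        simp only [sub_self, norm_zero, mul_zero, zero_mul] at h
        exact h.mono_left nhdsWithin_le_nhds
  -- the candidate derivative `w` solves the equation with source `-2i g'(k₀)`, which is extended to
  -- the negative half-line in order to be integrable
  set s : ℝ → Matrix (Fin n) (Fin n) ℂ := fun x => (-(2 * Complex.I)) • g' k₀ x with hs
  have hsc : Continuous s := (hgc' k₀ hk₀).const_smul (-(2 * Complex.I))
  have hsi : IntegrableOn s (Ioi 0) := (hgi' k₀ hk₀).smul (-(2 * Complex.I))
  obtain ⟨w, w', hw1, hw2, hw3, hw4⟩ := exists_solution hW.continuous hW.integrable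
    (continuous_extendLeft hsc.continuousOn) (integrable_extendLeft hsi) hk₀.1 hk₀.2
  have hrem : ∀ k ∈ puncturedHalfPlane, IsDecayingSolution W
      (fun x => (-(2 * Complex.I * (k - k₀))) • (g' k x - g' k₀ x)) k₀ 0
      (fun x => g k x - g k₀ x - (k - k₀) • w x)
      (fun x => g' k x - g' k₀ x - (k - k₀) • w' x) := by
    intro k hk
    have h := hdiff k hk
    refine ⟨?_, ?_, ?_, ?_, ?_, ?_, ?_⟩
    · exact h.cont.sub (fun x _ => ((hw1 x).const_smul (k - k₀)).continuousAt.continuousWithinAt)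
    · exact h.cont'.sub (fun x _ => ((hw2 x).const_smul (k - k₀)).continuousAt.continuousWithinAt)
    · exact fun x hx => (h.hasDeriv x hx).sub ((hw1 x).const_smul (k - k₀))
    · intro x hx
      refine ((h.hasDeriv' x hx).sub ((hw2 x).const_smul (k - k₀))).congr_deriv ?_
      rw [extendLeft_of_nonneg _ hx.le, hs, Matrix.mul_sub (W x) (g k x - g k₀ x),
        Matrix.mul_smul]
      module
    · exact ((hgi' k hk).sub (hgi' k₀ hk₀)).smul (-(2 * Complex.I * (k - k₀)))
    · simpa using h.tendsto.sub (hw3.const_smul (k - k₀))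
    · simpa using h.tendsto'.sub (hw4.const_smul (k - k₀))
  have hsn : ∀ k, ∫ x in Ioi (0:ℝ), ‖(-(2 * Complex.I * (k - k₀))) • (g' k x - g' k₀ x)‖
      = 2 * ‖k - k₀‖ * ∫ x in Ioi (0:ℝ), ‖g' k x - g' k₀ x‖ := by
    intro k
    simp_rw [norm_smul]
    rw [integral_const_mul]
    congr 1
    simp
  have main : ∀ (B : ℝ) (q : ℂ → Matrix (Fin n) (Fin n) ℂ) (d : Matrix (Fin n) (Fin n) ℂ),
      (∀ k ∈ puncturedHalfPlane, ‖q k - q k₀ - (k - k₀) • d‖ ≤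
        B * (2 * ‖k - k₀‖ * ∫ x in Ioi (0:ℝ), ‖g' k x - g' k₀ x‖)) →
      HasDerivWithinAt q d puncturedHalfPlane k₀ := by
    intro B q d hq
    rw [hasDerivWithinAt_iff_isLittleO]
    have h1 : (fun k => B * (2 * ‖k - k₀‖ * ∫ x in Ioi (0:ℝ), ‖g' k x - g' k₀ x‖))
        =o[𝓝[puncturedHalfPlane] k₀] (fun k => k - k₀) := by
      have h2 : (fun k => 2 * B * ∫ x in Ioi (0:ℝ), ‖g' k x - g' k₀ x‖)
          =o[𝓝[puncturedHalfPlane] k₀] (fun _ => (1 : ℝ)) := by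
        rw [Asymptotics.isLittleO_one_iff]
        simpa using hL1.const_mul (2 * B)
      have h3 := h2.mul_isBigO (Asymptotics.isBigO_refl (fun k => ‖k - k₀‖)
        (𝓝[puncturedHalfPlane] k₀))
      simp only [one_mul] at h3
      refine (h3.trans_isBigO (Asymptotics.isBigO_refl _ _).norm_left).congr_left fun k => ?_
      ring
    refine (Asymptotics.IsBigO.of_bound 1 ?_).trans_isLittleO h1
    filter_upwards [self_mem_nhdsWithin] with k hk
    rw [one_mul]
    exact (hq k hk).trans (le_abs_self _)
  refine ⟨w 0, w' 0, main K _ _ fun k hk => ?_, main K' _ _ fun k hk => ?_⟩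
  · have := (hrem k hk).norm_le hW.continuous hW.integrable hk₀ le_rfl
    rwa [hsn] at this
  · have := (hrem k hk).norm_deriv_le hW.continuous hW.integrable hk₀ le_rfl
    rwa [hsn] at this

end Differentiability

variable {n : ℕ}

/-! ### Vector solutions, Wronskians and the boundary form -/

/-- The operator on `ℂⁿ` with Euclidean norm given by a matrix. -/
noncomputable def matOp (M : Matrix (Fin n) (Fin n) ℂ) :
    EuclideanSpace ℂ (Fin n) →L[ℂ] EuclideanSpace ℂ (Fin n) :=
  Matrix.toEuclideanCLM (n := Fin n) (𝕜 := ℂ) M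

lemma norm_matOp_apply_le (M : Matrix (Fin n) (Fin n) ℂ) (v : EuclideanSpace ℂ (Fin n)) :
    ‖matOp M v‖ ≤ ‖M‖ * ‖v‖ := (matOp M).le_opNorm v

lemma matOp_mul_apply (M N : Matrix (Fin n) (Fin n) ℂ) (v : EuclideanSpace ℂ (Fin n)) :
    matOp (M * N) v = matOp M (matOp N v) := by simp [matOp]

lemma matOp_add_apply (M N : Matrix (Fin n) (Fin n) ℂ) (v : EuclideanSpace ℂ (Fin n)) :
    matOp (M + N) v = matOp M v + matOp N v := by simp [matOp]

lemma matOp_sub_apply (M N : Matrix (Fin n) (Fin n) ℂ) (v : EuclideanSpace ℂ (Fin n)) :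
    matOp (M - N) v = matOp M v - matOp N v := by simp [matOp]

lemma matOp_smul_apply (c : ℂ) (M : Matrix (Fin n) (Fin n) ℂ) (v : EuclideanSpace ℂ (Fin n)) :
    matOp (c • M) v = c • matOp M v := by simp [matOp]

lemma matOp_one_apply (v : EuclideanSpace ℂ (Fin n)) :
    matOp (1 : Matrix (Fin n) (Fin n) ℂ) v = v := by simp [matOp]

lemma matOp_eq_toEuclideanLin (M : Matrix (Fin n) (Fin n) ℂ) (v : EuclideanSpace ℂ (Fin n)) :
    matOp M v = Matrix.toEuclideanLin M v := rfl

lemma inner_matOp_left (M : Matrix (Fin n) (Fin n) ℂ) (u v : EuclideanSpace ℂ (Fin n)) :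
    inner ℂ (matOp M u) v = inner ℂ u (matOp Mᴴ v) := by
  rw [← Matrix.star_eq_conjTranspose, matOp, matOp, map_star, ContinuousLinearMap.star_eq_adjoint,
    ContinuousLinearMap.adjoint_inner_right]

/-- Evaluation of `matOp` at a vector, as a continuous linear map of the matrix. -/
noncomputable def matEval (v : EuclideanSpace ℂ (Fin n)) :
    Matrix (Fin n) (Fin n) ℂ →L[ℂ] EuclideanSpace ℂ (Fin n) :=
  LinearMap.mkContinuous
    { toFun := fun M => matOp M v
      map_add' := fun M N => matOp_add_apply M N v
      map_smul' := fun c M => matOp_smul_apply c M v } ‖v‖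
    (fun M => by rw [mul_comm]; exact norm_matOp_apply_le M v)

lemma matEval_apply (v : EuclideanSpace ℂ (Fin n)) (M : Matrix (Fin n) (Fin n) ℂ) :
    matEval v M = matOp M v := rfl

lemma hasDerivAt_matOp {f : ℝ → Matrix (Fin n) (Fin n) ℂ} {f' : Matrix (Fin n) (Fin n) ℂ} {x : ℝ}
    (h : HasDerivAt f f' x) (v : EuclideanSpace ℂ (Fin n)) :
    HasDerivAt (fun x => matOp (f x) v) (matOp f' v) x :=
  ((matEval v).restrictScalars ℝ).hasFDerivAt.comp_hasDerivAt x h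

lemma tendsto_matOp {α : Type*} {l : Filter α} {f : α → Matrix (Fin n) (Fin n) ℂ}
    {M : Matrix (Fin n) (Fin n) ℂ} (h : Tendsto f l (𝓝 M)) (v : EuclideanSpace ℂ (Fin n)) :
    Tendsto (fun x => matOp (f x) v) l (𝓝 (matOp M v)) := by
  have h1 := ((matEval v).continuous.tendsto M).comp h
  simp only [Function.comp_def, matEval_apply] at h1
  exact h1

lemma surjective_matOp_of_norm_sub_one_lt {M : Matrix (Fin n) (Fin n) ℂ} (h : ‖M - 1‖ < 1) :
    Function.Surjective (matOp M) := by
  have hinj : Function.Injective (matOp M) := by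
    refine (injective_iff_map_eq_zero _).2 fun v hv => ?_
    have h1 : matOp (M - 1) v = -v := by
      rw [matOp_sub_apply, matOp_one_apply, hv, zero_sub]
    have h2 := norm_matOp_apply_le (M - 1) v
    rw [h1, norm_neg] at h2
    by_contra hne
    have : 0 < ‖v‖ := norm_pos_iff.2 hne
    nlinarith
  exact (LinearMap.injective_iff_surjective (f := (matOp M).toLinearMap)).1 hinj

/-- `ψ` is a solution of `-ψ'' + W ψ = E ψ` on `(0,∞)`, continuous up to `0` with its derivative. -/
structure IsSolution (W : ℝ → Matrix (Fin n) (Fin n) ℂ) (E : ℂ)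
    (ψ ψ' : ℝ → EuclideanSpace ℂ (Fin n)) : Prop where
  cont : ContinuousOn ψ (Ici 0)
  cont' : ContinuousOn ψ' (Ici 0)
  hasDeriv : ∀ x, 0 < x → HasDerivAt ψ (ψ' x) x
  hasDeriv' : ∀ x, 0 < x → HasDerivAt ψ' (matOp (W x) (ψ x) - E • ψ x) x

/-- The Wronskian `⟨φ, ψ'⟩ - ⟨φ', ψ⟩`. -/
noncomputable def wronskian (φ φ' ψ ψ' : ℝ → EuclideanSpace ℂ (Fin n)) (x : ℝ) : ℂ :=
  inner ℂ (φ x) (ψ' x) - inner ℂ (φ' x) (ψ x)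

lemma tendsto_wronskian {φ φ' ψ ψ' : ℝ → EuclideanSpace ℂ (Fin n)}
    (h1 : Tendsto φ atTop (𝓝 0)) (h2 : Tendsto φ' atTop (𝓝 0))
    (h3 : Tendsto ψ atTop (𝓝 0)) (h4 : Tendsto ψ' atTop (𝓝 0)) :
    Tendsto (wronskian φ φ' ψ ψ') atTop (𝓝 0) := by
  have h := (h1.inner h4 (𝕜 := ℂ)).sub (h2.inner h3 (𝕜 := ℂ))
  simp only [inner_zero_left, sub_self] at h
  exact h

lemma continuousOn_wronskian {φ φ' ψ ψ' : ℝ → EuclideanSpace ℂ (Fin n)} {s : Set ℝ}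
    (h1 : ContinuousOn φ s) (h2 : ContinuousOn φ' s)
    (h3 : ContinuousOn ψ s) (h4 : ContinuousOn ψ' s) :
    ContinuousOn (wronskian φ φ' ψ ψ') s :=
  (ContinuousOn.inner (𝕜 := ℂ) h1 h4).sub (ContinuousOn.inner (𝕜 := ℂ) h2 h3)

lemma hasDerivAt_wronskian {W : ℝ → Matrix (Fin n) (Fin n) ℂ} (hW : ∀ x, (W x)ᴴ = W x)
    {E₁ E₂ : ℂ} {φ φ' ψ ψ' : ℝ → EuclideanSpace ℂ (Fin n)}
    (hφ : IsSolution W E₁ φ φ') (hψ : IsSolution W E₂ ψ ψ') {x : ℝ} (hx : 0 < x) :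
    HasDerivAt (wronskian φ φ' ψ ψ')
      ((starRingEnd ℂ E₁ - E₂) * inner ℂ (φ x) (ψ x)) x := by
  have h := ((hφ.hasDeriv x hx).inner ℂ (hψ.hasDeriv' x hx)).sub
    ((hφ.hasDeriv' x hx).inner ℂ (hψ.hasDeriv x hx))
  refine h.congr_deriv ?_
  rw [inner_sub_right, inner_sub_left, inner_matOp_left, hW, inner_smul_left, inner_smul_right]
  ring

lemma nonpos_of_hasDerivAt_nonneg {y y' : ℝ → ℝ} {a : ℝ} (hc : ContinuousOn y (Ici a))
    (hd : ∀ x, a < x → HasDerivAt y (y' x) x) (h0 : ∀ x, a < x → 0 ≤ y' x)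
    (hlim : Tendsto y atTop (𝓝 0)) : MonotoneOn y (Ici a) ∧ ∀ x, a ≤ x → y x ≤ 0 := by
  have hm : MonotoneOn y (Ici a) := by
    refine monotoneOn_of_deriv_nonneg (convex_Ici a) hc ?_ ?_
    · rw [interior_Ici]; exact fun x hx => (hd x hx).differentiableAt.differentiableWithinAt
    · rw [interior_Ici]; exact fun x hx => by rw [(hd x hx).deriv]; exact h0 x hx
  refine ⟨hm, fun x hx => ge_of_tendsto hlim ?_⟩
  filter_upwards [Ici_mem_atTop x] with z hz
  exact hm hx (hx.trans hz) hz

/-- The boundary form `-B†u + A†u'`. -/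
noncomputable def bdryForm (A B : Matrix (Fin n) (Fin n) ℂ) (u u' : EuclideanSpace ℂ (Fin n)) :
    EuclideanSpace ℂ (Fin n) := -matOp Bᴴ u + matOp Aᴴ u'

/-- As `A†B = B†A`, the block matrix with rows `(A, -B)` and `(B, A)` has an explicit left inverse;
it is also a right inverse, which gives these identities. -/
lemma bdry_identities {A B : Matrix (Fin n) (Fin n) ℂ} (h : IsSelfadjointBC A B) :
    A * (Aᴴ * A + Bᴴ * B)⁻¹ * Aᴴ + B * (Aᴴ * A + Bᴴ * B)⁻¹ * Bᴴ = 1 ∧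
    A * (Aᴴ * A + Bᴴ * B)⁻¹ * Bᴴ = B * (Aᴴ * A + Bᴴ * B)⁻¹ * Aᴴ := by
  set P := Aᴴ * A + Bᴴ * B with hP
  have hdet : IsUnit P.det := (Matrix.isUnit_iff_isUnit_det _).1 h.pos.isUnit
  have hPP : P⁻¹ * P = 1 := Matrix.nonsing_inv_mul P hdet
  have hs : Aᴴ * B = Bᴴ * A := by
    have := h.symm
    rw [neg_add_eq_zero] at this; exact this.symm
  have h1 : Matrix.fromBlocks (P⁻¹ * Aᴴ) (P⁻¹ * Bᴴ) (-(P⁻¹ * Bᴴ)) (P⁻¹ * Aᴴ) *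
      Matrix.fromBlocks A (-B) B A = 1 := by
    rw [Matrix.fromBlocks_multiply, ← Matrix.fromBlocks_one]
    congr 1
    · rw [Matrix.mul_assoc, Matrix.mul_assoc, ← Matrix.mul_add, ← hP, hPP]
    · rw [Matrix.mul_neg, Matrix.mul_assoc, Matrix.mul_assoc, hs]; simp
    · rw [Matrix.neg_mul, Matrix.mul_assoc, Matrix.mul_assoc, hs]; simp
    · rw [Matrix.neg_mul, Matrix.mul_neg, neg_neg, Matrix.mul_assoc, Matrix.mul_assoc,
        ← Matrix.mul_add, add_comm, ← hP, hPP]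
  have h2 := mul_eq_one_comm.1 h1
  rw [Matrix.fromBlocks_multiply, ← Matrix.fromBlocks_one, Matrix.fromBlocks_inj] at h2
  obtain ⟨e1, e2, -, -⟩ := h2
  constructor
  · simpa [Matrix.mul_assoc] using e1
  · rw [Matrix.neg_mul, ← sub_eq_add_neg, sub_eq_zero] at e2
    simpa [Matrix.mul_assoc] using e2

/-- On boundary data the symplectic form `⟨u, v'⟩ - ⟨u', v⟩` is controlled by the boundary forms of
`(u,u')` and `(v,v')`: it equals `⟨p_u, β_v⟩ - ⟨β_u, p_v⟩` where `β` is the boundary form and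
`p_u = (A†A + B†B)⁻¹ (A†u + B†u')`. -/
lemma exists_symplectic_bound {A B : Matrix (Fin n) (Fin n) ℂ} (h : IsSelfadjointBC A B) :
    ∃ C : ℝ, 0 < C ∧ ∀ u u' v v' : EuclideanSpace ℂ (Fin n),
      ‖inner ℂ u v' - inner ℂ u' v‖ ≤ C * ((‖u‖ + ‖u'‖) * ‖bdryForm A B v v'‖ +
        ‖bdryForm A B u u'‖ * (‖v‖ + ‖v'‖)) := by
  obtain ⟨e1, e2⟩ := bdry_identities h
  set P := Aᴴ * A + Bᴴ * B with hP
  have hPh : (P⁻¹)ᴴ = P⁻¹ := by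
    rw [Matrix.conjTranspose_nonsing_inv, h.pos.isHermitian.eq]
  let p : EuclideanSpace ℂ (Fin n) → EuclideanSpace ℂ (Fin n) → EuclideanSpace ℂ (Fin n) :=
    fun u u' => matOp (P⁻¹ * Aᴴ) u + matOp (P⁻¹ * Bᴴ) u'
  have key : ∀ u u' v v' : EuclideanSpace ℂ (Fin n), inner ℂ u v' - inner ℂ u' v
      = inner ℂ (p u u') (bdryForm A B v v') - inner ℂ (bdryForm A B u u') (p v v') := by
    intro u u' v v'
    have i1 : matOp (A * P⁻¹ * Aᴴ) v' + matOp (B * P⁻¹ * Bᴴ) v' = v' := by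
      rw [← matOp_add_apply, e1, matOp_one_apply]
    have i2 : matOp (A * P⁻¹ * Aᴴ) v + matOp (B * P⁻¹ * Bᴴ) v = v := by
      rw [← matOp_add_apply, e1, matOp_one_apply]
    conv_lhs => rw [← i1, ← i2]
    simp only [p, bdryForm, inner_add_left, inner_add_right, inner_neg_left, inner_neg_right,
      inner_matOp_left, Matrix.conjTranspose_mul, hPh, Matrix.conjTranspose_conjTranspose,
      ← matOp_mul_apply, ← Matrix.mul_assoc, e2]
    ring
  set C := ‖P⁻¹ * Aᴴ‖ + ‖P⁻¹ * Bᴴ‖ + 1 with hC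
  have hC0 : 0 < C := by positivity
  have hp : ∀ u u', ‖p u u'‖ ≤ C * (‖u‖ + ‖u'‖) := by
    intro u u'
    refine (norm_add_le _ _).trans ((add_le_add (norm_matOp_apply_le _ _)
      (norm_matOp_apply_le _ _)).trans ?_)
    have := norm_nonneg (P⁻¹ * Aᴴ)
    have := norm_nonneg (P⁻¹ * Bᴴ)
    have := norm_nonneg u
    have := norm_nonneg u'
    rw [hC]
    nlinarith [mul_nonneg (norm_nonneg (P⁻¹ * Aᴴ)) (norm_nonneg u'),
      mul_nonneg (norm_nonneg (P⁻¹ * Bᴴ)) (norm_nonneg u)]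
  refine ⟨C, hC0, fun u u' v v' => ?_⟩
  rw [key]
  refine (norm_sub_le _ _).trans ((add_le_add (norm_inner_le_norm _ _)
    (norm_inner_le_norm _ _)).trans ?_)
  have h1 := mul_le_mul_of_nonneg_right (hp u u') (norm_nonneg (bdryForm A B v v'))
  have h2 := mul_le_mul_of_nonneg_left (hp v v') (norm_nonneg (bdryForm A B u u'))
  linarith

lemma symplectic_eq_zero {A B : Matrix (Fin n) (Fin n) ℂ} (h : IsSelfadjointBC A B)
    {u u' v v' : EuclideanSpace ℂ (Fin n)} (hu : bdryForm A B u u' = 0)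
    (hv : bdryForm A B v v' = 0) : inner ℂ u v' - inner ℂ u' v = 0 := by
  obtain ⟨C, -, hC⟩ := exists_symplectic_bound h
  have := hC u u' v v'
  rw [hu, hv] at this
  simpa using this

/-! ### Vector Jost solutions and the Jost matrix -/

section Jost

variable {W : ℝ → Matrix (Fin n) (Fin n) ℂ} {g g' : ℂ → ℝ → Matrix (Fin n) (Fin n) ℂ}
  {A B : Matrix (Fin n) (Fin n) ℂ}

/-- The vector Jost solution `e^{ikx} g(k,x) v`. -/
noncomputable def jostVec (g : ℂ → ℝ → Matrix (Fin n) (Fin n) ℂ) (k : ℂ)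
    (v : EuclideanSpace ℂ (Fin n)) (x : ℝ) : EuclideanSpace ℂ (Fin n) :=
  Complex.exp (Complex.I * k * x) • matOp (g k x) v

/-- The derivative `e^{ikx} (g'(k,x) + ik g(k,x)) v` of the vector Jost solution. -/
noncomputable def jostVec' (g g' : ℂ → ℝ → Matrix (Fin n) (Fin n) ℂ) (k : ℂ)
    (v : EuclideanSpace ℂ (Fin n)) (x : ℝ) : EuclideanSpace ℂ (Fin n) :=
  Complex.exp (Complex.I * k * x) • matOp (g' k x + (Complex.I * k) • g k x) v

/-- `B†f(k,0) - A†f'(k,0)`; the Jost matrix is `k ↦ Γ(-k*)†`. -/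
noncomputable def gammaMat (g g' : ℂ → ℝ → Matrix (Fin n) (Fin n) ℂ)
    (A B : Matrix (Fin n) (Fin n) ℂ) (k : ℂ) : Matrix (Fin n) (Fin n) ℂ :=
  Bᴴ * g k 0 - Aᴴ * (g' k 0 + (Complex.I * k) • g k 0)

lemma hasDerivAt_exp_I (k : ℂ) (x : ℝ) :
    HasDerivAt (fun x : ℝ => Complex.exp (Complex.I * k * x))
      (Complex.I * k * Complex.exp (Complex.I * k * x)) x := by
  have h := ((Complex.ofRealCLM.hasDerivAt (x := x)).const_mul (Complex.I * k)).cexp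
  simp only [Complex.ofRealCLM_apply, Complex.ofReal_one, mul_one] at h
  exact h.congr_deriv (mul_comm _ _)

lemma hasDerivAt_jostVec (hg : IsJostFactor W g g') {k : ℂ} (hk : k ∈ puncturedHalfPlane)
    (v : EuclideanSpace ℂ (Fin n)) (x : ℝ) :
    HasDerivAt (jostVec g k v) (jostVec' g g' k v x) x := by
  refine ((hasDerivAt_exp_I k x).smul (hasDerivAt_matOp (hg.hasDeriv k hk x) v)).congr_deriv ?_
  rw [jostVec', matOp_add_apply, matOp_smul_apply]
  module

lemma hasDerivAt_jostVec' (hg : IsJostFactor W g g') {k : ℂ} (hk : k ∈ puncturedHalfPlane)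
    (v : EuclideanSpace ℂ (Fin n)) (x : ℝ) :
    HasDerivAt (jostVec' g g' k v) (matOp (W x) (jostVec g k v x) - k ^ 2 • jostVec g k v x) x := by
  refine ((hasDerivAt_exp_I k x).smul (hasDerivAt_matOp ((hg.hasDeriv' k hk x).add
    ((hg.hasDeriv k hk x).const_smul (Complex.I * k))) v)).congr_deriv ?_
  simp only [jostVec, matOp_add_apply, matOp_sub_apply, matOp_smul_apply, matOp_mul_apply,
    map_smul, Pi.add_apply, Pi.smul_apply]
  have hI : k ^ 2 = -(Complex.I * k) * (Complex.I * k) := by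
    linear_combination k ^ 2 * Complex.I_mul_I
  rw [hI]
  module

lemma isSolution_jostVec (hg : IsJostFactor W g g') {k : ℂ} (hk : k ∈ puncturedHalfPlane)
    (v : EuclideanSpace ℂ (Fin n)) :
    IsSolution W (k ^ 2) (jostVec g k v) (jostVec' g g' k v) where
  cont := fun x _ => (hasDerivAt_jostVec hg hk v x).continuousAt.continuousWithinAt
  cont' := fun x _ => (hasDerivAt_jostVec' hg hk v x).continuousAt.continuousWithinAt
  hasDeriv := fun x _ => hasDerivAt_jostVec hg hk v x
  hasDeriv' := fun x _ => hasDerivAt_jostVec' hg hk v x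

lemma norm_exp_I (k : ℂ) (x : ℝ) :
    ‖Complex.exp (Complex.I * k * x)‖ = Real.exp (-(k.im * x)) := by
  rw [Complex.norm_exp]; simp

lemma norm_jostVec (k : ℂ) (v : EuclideanSpace ℂ (Fin n)) (x : ℝ) :
    ‖jostVec g k v x‖ = Real.exp (-(k.im * x)) * ‖matOp (g k x) v‖ := by
  rw [jostVec, norm_smul, norm_exp_I]

lemma tendsto_jostVec (hg : IsJostFactor W g g') {k : ℂ} (hk : 0 < k.im)
    (v : EuclideanSpace ℂ (Fin n)) :
    Tendsto (jostVec g k v) atTop (𝓝 0) ∧ Tendsto (jostVec' g g' k v) atTop (𝓝 0) := by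
  have hkU : k ∈ puncturedHalfPlane := ⟨hk.le, fun h => by simp [h] at hk⟩
  have hE : Tendsto (fun x : ℝ => Complex.exp (Complex.I * k * x)) atTop (𝓝 0) := by
    rw [tendsto_zero_iff_norm_tendsto_zero]
    have h0 : Tendsto (fun x : ℝ => Real.exp (-(k.im * x))) atTop (𝓝 0) :=
      Real.tendsto_exp_neg_atTop_nhds_zero.comp (tendsto_id.const_mul_atTop hk)
    exact h0.congr fun x => (norm_exp_I k x).symm
  have h1 : Tendsto (fun x => matOp (g k x) v) atTop (𝓝 (matOp 1 v)) :=
    tendsto_matOp (hg.tendsto k hkU) v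
  have h2 : Tendsto (fun x => matOp (g' k x + (Complex.I * k) • g k x) v) atTop
      (𝓝 (matOp (0 + (Complex.I * k) • 1) v)) :=
    tendsto_matOp ((hg.tendsto' k hkU).add ((hg.tendsto k hkU).const_smul (Complex.I * k))) v
  have h3 : Tendsto (fun x : ℝ => Complex.exp (Complex.I * k * x) • matOp (g k x) v) atTop
      (𝓝 ((0 : ℂ) • matOp 1 v)) := hE.smul h1
  have h4 : Tendsto (fun x : ℝ => Complex.exp (Complex.I * k * x) •
      matOp (g' k x + (Complex.I * k) • g k x) v) atTop
      (𝓝 ((0 : ℂ) • matOp (0 + (Complex.I * k) • 1) v)) := hE.smul h2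
  rw [zero_smul] at h3 h4
  exact ⟨h3, h4⟩

lemma jostVec_zero (k : ℂ) (v : EuclideanSpace ℂ (Fin n)) :
    jostVec g k v 0 = matOp (g k 0) v := by simp [jostVec]

lemma jostVec'_zero (k : ℂ) (v : EuclideanSpace ℂ (Fin n)) :
    jostVec' g g' k v 0 = matOp (g' k 0 + (Complex.I * k) • g k 0) v := by simp [jostVec']

lemma bdryForm_jostVec (k : ℂ) (v : EuclideanSpace ℂ (Fin n)) :
    bdryForm A B (jostVec g k v 0) (jostVec' g g' k v 0) = -matOp (gammaMat g g' A B k) v := by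
  rw [jostVec_zero, jostVec'_zero, bdryForm, gammaMat, matOp_sub_apply,
    matOp_mul_apply, matOp_mul_apply]
  abel

/-- Far out, all Jost solutions are close to `e^{ikx}`, uniformly in `k`. -/
lemma exists_norm_jost_sub_one_le (hW : IsRegularPotential W) (hg : IsJostFactor W g g')
    {ε : ℝ} (hε : 0 < ε) :
    ∃ x₀ : ℝ, 0 < x₀ ∧ ∀ k ∈ puncturedHalfPlane, ∀ x, x₀ ≤ x → ‖g k x - 1‖ ≤ ε := by
  obtain ⟨C, hC, hb⟩ := exists_jost_bound hW hg
  have h0 := (tendsto_integral_Ioi_zero hW.continuous_moment hW.moment).const_mul C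
  rw [mul_zero] at h0
  obtain ⟨x₀, hx₀⟩ := eventually_atTop.1 (h0.eventually (gt_mem_nhds hε))
  refine ⟨max x₀ 1, by positivity, fun k hk x hx => ?_⟩
  exact ((hb k hk x (by linarith [le_max_right x₀ 1])).2.2).trans
    (hx₀ x ((le_max_left _ _).trans hx)).le

lemma exists_norm_initial_le (hW : IsRegularPotential W) (hg : IsJostFactor W g g') :
    ∃ C : ℝ, 0 < C ∧ ∀ k ∈ puncturedHalfPlane, ‖g k 0‖ ≤ C ∧
      ‖g' k 0 + (Complex.I * k) • g k 0‖ ≤ C * (1 + ‖k‖) := by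
  obtain ⟨C, hC, hb⟩ := exists_jost_bound hW hg
  have hT : 0 ≤ ∫ y in Ioi (0:ℝ), ‖W y‖ :=
    setIntegral_nonneg measurableSet_Ioi fun y _ => norm_nonneg _
  refine ⟨C * (1 + ∫ y in Ioi (0:ℝ), ‖W y‖), by positivity, fun k hk => ?_⟩
  obtain ⟨h1, h2, -⟩ := hb k hk 0 le_rfl
  constructor
  · nlinarith
  · have h3 : ‖(Complex.I * k) • g k 0‖ ≤ ‖k‖ * C := by
      rw [norm_smul]; simp only [norm_mul, Complex.norm_I, one_mul]
      gcongr
    refine (norm_add_le _ _).trans ((add_le_add h2 h3).trans ?_)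
    nlinarith [mul_nonneg (mul_nonneg hC.le hT) (norm_nonneg k)]

lemma exists_norm_gammaMat_le (hW : IsRegularPotential W) (hg : IsJostFactor W g g')
    (A B : Matrix (Fin n) (Fin n) ℂ) :
    ∃ C : ℝ, 0 < C ∧ ∀ k ∈ puncturedHalfPlane, ‖gammaMat g g' A B k‖ ≤ C * (1 + ‖k‖) := by
  obtain ⟨C, hC, hb⟩ := exists_norm_initial_le hW hg
  refine ⟨(‖Bᴴ‖ + ‖Aᴴ‖ + 1) * C, by positivity, fun k hk => ?_⟩
  obtain ⟨h1, h2⟩ := hb k hk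
  refine (norm_sub_le _ _).trans ((add_le_add (norm_mul_le _ _) (norm_mul_le _ _)).trans ?_)
  have e1 := mul_le_mul_of_nonneg_left h1 (norm_nonneg Bᴴ)
  have e2 := mul_le_mul_of_nonneg_left h2 (norm_nonneg Aᴴ)
  have e3 : ‖Bᴴ‖ * C ≤ ‖Bᴴ‖ * C * (1 + ‖k‖) :=
    le_mul_of_one_le_right (by positivity) (by linarith [norm_nonneg k])
  have e4 : 0 ≤ C * (1 + ‖k‖) := by positivity
  nlinarith

lemma differentiableWithinAt_gammaMat (hW : IsRegularPotential W) (hg : IsJostFactor W g g')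
    (A B : Matrix (Fin n) (Fin n) ℂ) {k : ℂ} (hk : k ∈ puncturedHalfPlane) :
    DifferentiableWithinAt ℂ (gammaMat g g' A B) puncturedHalfPlane k := by
  obtain ⟨d, d', h1, h2⟩ := exists_hasDerivWithinAt_jost hW hg hk
  have h3 : DifferentiableWithinAt ℂ (fun k => g' k 0 + (Complex.I * k) • g k 0)
      puncturedHalfPlane k :=
    h2.differentiableWithinAt.add
      ((differentiableWithinAt_id.const_mul Complex.I).smul h1.differentiableWithinAt)
  exact (h1.differentiableWithinAt.const_mul Bᴴ).sub (h3.const_mul Aᴴ)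

/-- Lower bound for the Jost matrix away from the imaginary axis, for `Im k > 0`: the flux
`Im ⟨ψ, ψ'⟩` at `0` of a Jost solution equals `-Im (k²) ∫ ‖ψ‖²`, and
`∫ ‖ψ‖² ≥ c / Im k`. -/
lemma exists_gammaMat_lower_bound_aux (hW : IsRegularPotential W) (hg : IsJostFactor W g g')
    (hAB : IsSelfadjointBC A B) (R : ℝ) (hR : 0 < R) :
    ∃ c : ℝ, 0 < c ∧ ∀ k : ℂ, 0 < k.im → ‖k‖ ≤ R → ∀ v : EuclideanSpace ℂ (Fin n),
      c * |k.re| * ‖v‖ ≤ ‖matOp (gammaMat g g' A B k) v‖ := by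
  obtain ⟨x₀, hx₀, hgx⟩ := exists_norm_jost_sub_one_le hW hg (half_pos one_pos)
  obtain ⟨C, hC, hb⟩ := exists_norm_initial_le hW hg
  obtain ⟨S, hS, hsym⟩ := exists_symplectic_bound hAB
  refine ⟨Real.exp (-(2 * R * x₀)) / (4 * (S * (C + C * (1 + R)))), by positivity,
    fun k hk hkR v => ?_⟩
  have hkU : k ∈ puncturedHalfPlane := ⟨hk.le, fun h => by simp [h] at hk⟩
  rcases eq_or_ne k.re 0 with hre | hre
  · simp [hre]
  set ψ := jostVec g k v with hψ
  set ψ' := jostVec' g g' k v with hψ'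
  have hsol := isSolution_jostVec hg hkU v
  obtain ⟨t1, t2⟩ := tendsto_jostVec hg hk v
  have hE : (k ^ 2).im = 2 * k.re * k.im := by rw [pow_two, Complex.mul_im]; ring
  have hE0 : (k ^ 2).im ≠ 0 := by rw [hE]; positivity
  let om := wronskian ψ ψ' ψ ψ'
  -- the flux, normalized so that `y' = ‖ψ‖²`; it vanishes at infinity
  let y : ℝ → ℝ := fun x => -(om x).im / (2 * (k ^ 2).im)
  have hyc : ContinuousOn y (Ici 0) :=
    ((Complex.continuous_im.comp_continuousOn
      (continuousOn_wronskian hsol.cont hsol.cont' hsol.cont hsol.cont')).neg).div_const _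
  have hyd : ∀ x, 0 < x → HasDerivAt y (‖ψ x‖ ^ 2) x := by
    intro x hx
    have h1 := hasDerivAt_wronskian hW.selfadjoint hsol hsol hx
    have h2 := ((Complex.imCLM.hasFDerivAt.comp_hasDerivAt x h1).neg).div_const (2 * (k ^ 2).im)
    refine h2.congr_deriv ?_
    rw [inner_self_eq_norm_sq_to_K]
    have : (((starRingEnd ℂ) (k ^ 2) - k ^ 2) * ((‖ψ x‖ : ℂ)) ^ 2).im
        = -(2 * (k ^ 2).im) * ‖ψ x‖ ^ 2 := by
      rw [← Complex.ofReal_pow, Complex.im_mul_ofReal]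
      simp only [Complex.sub_im, Complex.conj_im]
      ring
    show -(((starRingEnd ℂ) (k ^ 2) - k ^ 2) * ((‖ψ x‖ : ℂ)) ^ 2).im / _ = _
    rw [this]
    field_simp
  have hyl : Tendsto y atTop (𝓝 0) := by
    have := (((Complex.continuous_im.tendsto _).comp
      (tendsto_wronskian t1 t2 t1 t2)).neg).div_const (2 * (k ^ 2).im)
    simpa using this
  have hy1 := (nonpos_of_hasDerivAt_nonneg hyc hyd (fun x _ => by positivity) hyl).1
  -- comparison with the explicit exponential on `[x₀, ∞)`
  let z : ℝ → ℝ := fun x => y x + Real.exp (-(2 * k.im * x)) * ‖v‖ ^ 2 / (8 * k.im)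
  have hz := (nonpos_of_hasDerivAt_nonneg (y := z) (a := x₀)
    (y' := fun x => ‖ψ x‖ ^ 2 - Real.exp (-(2 * k.im * x)) * ‖v‖ ^ 2 / 4) ?_ ?_ ?_ ?_).2 x₀ le_rfl
  rotate_left
  · exact (hyc.mono (Ici_subset_Ici.2 hx₀.le)).add (by fun_prop)
  · intro x hx
    have h1 : HasDerivAt (fun x : ℝ => -(2 * k.im * x)) (-(2 * k.im * 1)) x :=
      ((hasDerivAt_id x).const_mul (2 * k.im)).neg
    have h2 := ((h1.exp.mul_const (‖v‖ ^ 2)).div_const (8 * k.im))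
    refine ((hyd x (hx₀.trans hx)).add h2).congr_deriv ?_
    field_simp
    ring
  · intro x hx
    have h1 : ‖v‖ / 2 ≤ ‖matOp (g k x) v‖ := by
      have h2 := norm_matOp_apply_le (g k x - 1) v
      have h3 : matOp (g k x - 1) v = matOp (g k x) v - v := by
        rw [matOp_sub_apply, matOp_one_apply]
      rw [h3] at h2
      have h4 := mul_le_mul_of_nonneg_right (hgx k hkU x hx.le) (norm_nonneg v)
      have h5 := norm_sub_norm_le v (matOp (g k x) v)
      rw [norm_sub_rev] at h5
      linarith
    have h6 : ‖ψ x‖ = Real.exp (-(k.im * x)) * ‖matOp (g k x) v‖ := norm_jostVec k v x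
    have h7 : Real.exp (-(2 * k.im * x)) = Real.exp (-(k.im * x)) ^ 2 := by
      rw [← Real.exp_nat_mul]; congr 1; push_cast; ring
    rw [h6, h7, mul_pow]
    have h8 : (‖v‖ / 2) ^ 2 ≤ ‖matOp (g k x) v‖ ^ 2 := by gcongr
    nlinarith [sq_nonneg (Real.exp (-(k.im * x)))]
  · have h1 : Tendsto (fun x : ℝ => Real.exp (-(2 * k.im * x))) atTop (𝓝 0) :=
      Real.tendsto_exp_neg_atTop_nhds_zero.comp
        (tendsto_id.const_mul_atTop (by positivity : 0 < 2 * k.im))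
    have h2 := hyl.add ((h1.mul_const (‖v‖ ^ 2)).div_const (8 * k.im))
    simpa using h2
  have hy0 : y 0 ≤ y x₀ := hy1 (self_mem_Ici) hx₀.le hx₀.le
  have hw : ‖om 0‖ ≤ S * ((C + C * (1 + R)) * ‖v‖ * ‖matOp (gammaMat g g' A B k) v‖) * 2 := by
    have h1 := hsym (ψ 0) (ψ' 0) (ψ 0) (ψ' 0)
    rw [hψ, hψ', bdryForm_jostVec, norm_neg, ← hψ, ← hψ'] at h1
    obtain ⟨b1, b2⟩ := hb k hkU
    have h2 : ‖ψ 0‖ ≤ C * ‖v‖ := by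
      rw [hψ, jostVec_zero]
      exact (norm_matOp_apply_le _ _).trans (mul_le_mul_of_nonneg_right b1 (norm_nonneg v))
    have h3 : ‖ψ' 0‖ ≤ C * (1 + R) * ‖v‖ := by
      rw [hψ', jostVec'_zero]
      refine (norm_matOp_apply_le _ _).trans (mul_le_mul_of_nonneg_right (b2.trans ?_)
        (norm_nonneg v))
      gcongr
    have h4 : ‖ψ 0‖ + ‖ψ' 0‖ ≤ (C + C * (1 + R)) * ‖v‖ := by linarith
    refine h1.trans ?_
    have h5 := mul_le_mul_of_nonneg_right h4 (norm_nonneg (matOp (gammaMat g g' A B k) v))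
    have h6 := mul_le_mul_of_nonneg_left h5 hS.le
    linarith
  have hyw : -y 0 * (2 * |(k ^ 2).im|) ≤ ‖om 0‖ := by
    have h1 : |y 0| * (2 * |(k ^ 2).im|) = |(om 0).im| := by
      simp only [y]
      rw [abs_div, abs_neg, abs_mul, abs_two]
      field_simp
    have h2 := Complex.abs_im_le_norm (om 0)
    have h3 := neg_abs_le (y 0)
    nlinarith [abs_nonneg (k ^ 2).im]
  have hexp : Real.exp (-(2 * R * x₀)) ≤ Real.exp (-(2 * k.im * x₀)) := by
    apply Real.exp_le_exp.2
    have : k.im ≤ R := (Complex.im_le_norm k).trans hkR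
    nlinarith
  have hfin : Real.exp (-(2 * R * x₀)) * ‖v‖ ^ 2 * |k.re| ≤
      4 * (S * (C + C * (1 + R))) * ‖v‖ * ‖matOp (gammaMat g g' A B k) v‖ := by
    have h1 : Real.exp (-(2 * k.im * x₀)) * ‖v‖ ^ 2 / (8 * k.im) ≤ -y 0 := by
      have : y x₀ + Real.exp (-(2 * k.im * x₀)) * ‖v‖ ^ 2 / (8 * k.im) ≤ 0 := hz
      linarith
    have h2 : |(k ^ 2).im| = 2 * |k.re| * k.im := by
      rw [hE, abs_mul, abs_mul, abs_two, abs_of_pos hk]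
    rw [h2] at hyw
    have h3 := mul_le_mul_of_nonneg_right h1 (by positivity : 0 ≤ 2 * (2 * |k.re| * k.im))
    have h4 : Real.exp (-(2 * k.im * x₀)) * ‖v‖ ^ 2 / (8 * k.im) * (2 * (2 * |k.re| * k.im))
        = Real.exp (-(2 * k.im * x₀)) * ‖v‖ ^ 2 * |k.re| / 2 := by field_simp; ring
    have h5 := mul_le_mul_of_nonneg_right hexp (by positivity : 0 ≤ ‖v‖ ^ 2 * |k.re|)
    linarith
  rcases eq_or_ne v 0 with rfl | hv
  · simp
  have hvpos : 0 < ‖v‖ := norm_pos_iff.2 hv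
  have h6 : Real.exp (-(2 * R * x₀)) * ‖v‖ * |k.re| ≤
      4 * (S * (C + C * (1 + R))) * ‖matOp (gammaMat g g' A B k) v‖ := by
    refine le_of_mul_le_mul_right ?_ hvpos
    calc _ = Real.exp (-(2 * R * x₀)) * ‖v‖ ^ 2 * |k.re| := by ring
      _ ≤ _ := hfin
      _ = _ := by ring
  rw [div_mul_eq_mul_div, div_mul_eq_mul_div, div_le_iff₀ (by positivity)]
  calc _ = Real.exp (-(2 * R * x₀)) * ‖v‖ * |k.re| := by ring
    _ ≤ _ := h6
    _ = _ := by ring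

/-- The lower bound extends to real `k ≠ 0`, where the Jost solutions do not decay, by continuity. -/
lemma exists_gammaMat_lower_bound (hW : IsRegularPotential W) (hg : IsJostFactor W g g')
    (hAB : IsSelfadjointBC A B) (R : ℝ) (hR : 0 < R) :
    ∃ c : ℝ, 0 < c ∧ ∀ k ∈ puncturedHalfPlane, ‖k‖ ≤ R → ∀ v : EuclideanSpace ℂ (Fin n),
      c * |k.re| * ‖v‖ ≤ ‖matOp (gammaMat g g' A B k) v‖ := by
  obtain ⟨c, hc, h⟩ := exists_gammaMat_lower_bound_aux hW hg hAB (R + 1) (by positivity)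
  refine ⟨c, hc, fun k hk hkR v => ?_⟩
  have hcont := (differentiableWithinAt_gammaMat hW hg A B hk).continuousWithinAt
  let q : ℕ → ℂ := fun m => k + (1 / ((m : ℝ) + 1) : ℝ) * Complex.I
  have hq0 : Tendsto q atTop (𝓝 k) := by
    have h1 : Tendsto (fun m : ℕ => ((1 / ((m : ℝ) + 1) : ℝ) : ℂ)) atTop (𝓝 ((0 : ℝ) : ℂ)) :=
      (Complex.continuous_ofReal.tendsto _).comp tendsto_one_div_add_atTop_nhds_zero_nat
    simpa [q] using (h1.mul_const Complex.I).const_add k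
  have hqim : ∀ m, 0 < (q m).im := by
    intro m
    have : (q m).im = k.im + 1 / ((m : ℝ) + 1) := by
      simp only [q, Complex.add_im, Complex.im_ofReal_mul, Complex.I_im, mul_one]
    rw [this]
    have : 0 < 1 / ((m : ℝ) + 1) := by positivity
    linarith [hk.1]
  have hqU : ∀ m, q m ∈ puncturedHalfPlane := fun m =>
    ⟨(hqim m).le, fun h0 => by have := hqim m; rw [h0] at this; simp at this⟩
  have hq : Tendsto q atTop (𝓝[puncturedHalfPlane] k) :=
    tendsto_nhdsWithin_iff.2 ⟨hq0, Eventually.of_forall hqU⟩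
  have h1 : Tendsto (fun m => ‖matOp (gammaMat g g' A B (q m)) v‖) atTop
      (𝓝 ‖matOp (gammaMat g g' A B k) v‖) :=
    (tendsto_matOp (hcont.tendsto.comp hq) v).norm
  refine ge_of_tendsto h1 (Eventually.of_forall fun m => ?_)
  have hre : (q m).re = k.re := by
    simp only [q, Complex.add_re, Complex.re_ofReal_mul, Complex.I_re, mul_zero, add_zero]
  have hn : ‖q m‖ ≤ R + 1 := by
    refine (norm_add_le _ _).trans (add_le_add hkR ?_)
    rw [norm_mul, Complex.norm_I, mul_one, Complex.norm_real, Real.norm_of_nonneg (by positivity)]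
    rw [div_le_one (by positivity)]
    have : (0:ℝ) ≤ m := Nat.cast_nonneg m
    linarith
  have := h (q m) (hqim m) hn v
  rwa [hre] at this

end Jost

variable {n : ℕ}

/-! ### Zeros of the Jost matrix do not accumulate at zero -/

section SmallZeros

variable {W : ℝ → Matrix (Fin n) (Fin n) ℂ} {g g' : ℂ → ℝ → Matrix (Fin n) (Fin n) ℂ}
  {A B : Matrix (Fin n) (Fin n) ℂ}

lemma I_mul_mem {κ : ℝ} (hκ : 0 < κ) : Complex.I * κ ∈ puncturedHalfPlane :=
  ⟨by simp [hκ.le], by simp [hκ.ne']⟩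

lemma im_I_mul (κ : ℝ) : (Complex.I * κ).im = κ := by simp

lemma sq_I_mul (κ : ℝ) : (Complex.I * κ) ^ 2 = -(κ : ℂ) ^ 2 := by
  rw [mul_pow, Complex.I_sq]; ring

/-- Bound states `e^{-κx} g v` and `e^{-μx} g w` for `κ ≠ μ` are orthogonal; if `v` and `w` are close
to each other, this is impossible for small `κ + μ`, because the inner product is dominated by the
contribution of large `x`. -/
lemma exists_le_add_of_zeros (hW : IsRegularPotential W) (hg : IsJostFactor W g g')
    (hAB : IsSelfadjointBC A B) :
    ∃ δ : ℝ, 0 < δ ∧ ∀ κ μ : ℝ, 0 < κ → 0 < μ → κ ≠ μ → ∀ v w : EuclideanSpace ℂ (Fin n),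
      ‖v‖ = 1 → ‖w‖ = 1 → ‖v - w‖ ≤ 1 / 2 →
      matOp (gammaMat g g' A B (Complex.I * κ)) v = 0 →
      matOp (gammaMat g g' A B (Complex.I * μ)) w = 0 → δ ≤ κ + μ := by
  obtain ⟨x₀, hx₀, hgx⟩ := exists_norm_jost_sub_one_le hW hg (by norm_num : (0:ℝ) < 1 / 8)
  obtain ⟨C, hC, hb⟩ := exists_jost_bound hW hg
  refine ⟨min 1 (Real.exp (-x₀) / (4 * (C * C * x₀))), by positivity, ?_⟩
  intro κ μ hκ hμ hne v w hv hw hvw hΓv hΓw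
  by_contra! hlt
  set s := κ + μ with hs
  have hs0 : 0 < s := by positivity
  have hs1 : s < 1 := hlt.trans_le (min_le_left _ _)
  have hs2 : s < Real.exp (-x₀) / (4 * (C * C * x₀)) := hlt.trans_le (min_le_right _ _)
  have hκU := I_mul_mem hκ
  have hμU := I_mul_mem hμ
  set φ := jostVec g (Complex.I * κ) v with hφ
  set φ' := jostVec' g g' (Complex.I * κ) v with hφ'
  set ψ := jostVec g (Complex.I * μ) w with hψ
  set ψ' := jostVec' g g' (Complex.I * μ) w with hψ'
  have s1 := isSolution_jostVec hg hκU v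
  have s2 := isSolution_jostVec hg hμU w
  obtain ⟨t1, t2⟩ := tendsto_jostVec (g' := g') hg (by rw [im_I_mul]; exact hκ) v
  obtain ⟨t3, t4⟩ := tendsto_jostVec (g' := g') hg (by rw [im_I_mul]; exact hμ) w
  have hd0 : μ ^ 2 - κ ^ 2 ≠ 0 := by
    intro h
    have : (μ - κ) * (μ + κ) = 0 := by linarith
    rcases mul_eq_zero.1 this with h | h
    · exact hne (by linarith)
    · linarith
  let om := wronskian φ φ' ψ ψ'
  -- the primitive of `Re ⟨φ, ψ⟩` given by the Wronskian; it vanishes at `0` and at infinity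
  let y : ℝ → ℝ := fun x => (om x).re / (μ ^ 2 - κ ^ 2)
  have hyc : ContinuousOn y (Ici 0) :=
    (Complex.continuous_re.comp_continuousOn
      (continuousOn_wronskian s1.cont s1.cont' s2.cont s2.cont')).div_const _
  have hyd : ∀ x, 0 < x → HasDerivAt y (inner ℂ (φ x) (ψ x)).re x := by
    intro x hx
    have h1 := hasDerivAt_wronskian hW.selfadjoint s1 s2 hx
    have h2 := (Complex.reCLM.hasFDerivAt.comp_hasDerivAt x h1).div_const (μ ^ 2 - κ ^ 2)
    refine h2.congr_deriv ?_
    have e : (starRingEnd ℂ) ((Complex.I * κ) ^ 2) - (Complex.I * μ) ^ 2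
        = ((μ ^ 2 - κ ^ 2 : ℝ) : ℂ) := by
      rw [sq_I_mul, sq_I_mul]
      simp only [map_neg, map_pow, Complex.conj_ofReal]
      push_cast; ring
    rw [e]
    show (((μ ^ 2 - κ ^ 2 : ℝ) : ℂ) * inner ℂ (φ x) (ψ x)).re / _ = _
    rw [Complex.re_ofReal_mul]
    field_simp
  have hyl : Tendsto y atTop (𝓝 0) := by
    have := ((Complex.continuous_re.tendsto _).comp
      (tendsto_wronskian t1 t2 t3 t4)).div_const (μ ^ 2 - κ ^ 2)
    simpa using this
  have hy0 : y 0 = 0 := by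
    have h1 : om 0 = 0 := symplectic_eq_zero hAB
      (by rw [hφ, hφ', bdryForm_jostVec, hΓv, neg_zero])
      (by rw [hψ, hψ', bdryForm_jostVec, hΓw, neg_zero])
    simp [y, h1]
  have hinner : ∀ x, inner ℂ (φ x) (ψ x) = ((Real.exp (-(s * x)) : ℝ) : ℂ) *
      inner ℂ (matOp (g (Complex.I * κ) x) v) (matOp (g (Complex.I * μ) x) w) := by
    intro x
    rw [hφ, hψ, jostVec, jostVec, inner_smul_left, inner_smul_right, ← mul_assoc,
      ← Complex.exp_conj, ← Complex.exp_add]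
    congr 1
    rw [Complex.ofReal_exp]
    congr 1
    have : Complex.I * Complex.I = -1 := Complex.I_mul_I
    simp only [map_mul, Complex.conj_I, Complex.conj_ofReal, hs]
    push_cast
    linear_combination (κ * x + μ * x : ℂ) * this
  -- `Re ⟨φ, ψ⟩ ≥ e^{-sx} / 4` beyond `x₀`, so `z` increases there, and hence is nonpositive
  let z : ℝ → ℝ := fun x => y x + Real.exp (-(s * x)) / (4 * s)
  have hz := (nonpos_of_hasDerivAt_nonneg (y := z) (a := x₀)
    (y' := fun x => (inner ℂ (φ x) (ψ x)).re - Real.exp (-(s * x)) / 4) ?_ ?_ ?_ ?_).2 x₀ le_rfl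
  rotate_left
  · exact (hyc.mono (Ici_subset_Ici.2 hx₀.le)).add (by fun_prop)
  · intro x hx
    have h1 : HasDerivAt (fun x : ℝ => -(s * x)) (-(s * 1)) x :=
      ((hasDerivAt_id x).const_mul s).neg
    refine ((hyd x (hx₀.trans hx)).add (h1.exp.div_const (4 * s))).congr_deriv ?_
    field_simp
    ring
  · intro x hx
    rw [hinner, Complex.re_ofReal_mul]
    set a := matOp (g (Complex.I * κ) x) v with ha
    set b := matOp (g (Complex.I * μ) x) w with hb'
    have close : ∀ k ∈ puncturedHalfPlane, ∀ u : EuclideanSpace ℂ (Fin n), ‖u‖ = 1 →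
        ‖matOp (g k x) u - u‖ ≤ 1 / 8 := by
      intro k hk u hu
      have h2 := norm_matOp_apply_le (g k x - 1) u
      rw [matOp_sub_apply, matOp_one_apply, hu, mul_one] at h2
      exact h2.trans (hgx k hk x hx.le)
    have c1 := close _ hκU v hv
    have c2 := close _ hμU w hw
    have hab : ‖a - b‖ ≤ 3 / 4 := by
      have : a - b = (a - v) - (b - w) + (v - w) := by abel
      rw [this]
      refine (norm_add_le _ _).trans ((add_le_add_left (norm_sub_le _ _) _).trans ?_)
      linarith
    have ha7 : 7 / 8 ≤ ‖a‖ := by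
      have := norm_sub_norm_le v a
      rw [norm_sub_rev] at this
      linarith
    have hb7 : 7 / 8 ≤ ‖b‖ := by
      have := norm_sub_norm_le w b
      rw [norm_sub_rev] at this
      linarith
    have e := norm_sub_sq (𝕜 := ℂ) a b
    have e' : ‖a - b‖ ^ 2 = ‖a‖ ^ 2 - 2 * (inner ℂ a b).re + ‖b‖ ^ 2 := e
    have : 1 / 4 ≤ (inner ℂ a b).re := by
      have h1 : ‖a - b‖ ^ 2 ≤ (3 / 4) ^ 2 := by gcongr
      nlinarith
    have hpos := Real.exp_pos (-(s * x))
    nlinarith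
  · have h1 : Tendsto (fun x : ℝ => Real.exp (-(s * x))) atTop (𝓝 0) :=
      Real.tendsto_exp_neg_atTop_nhds_zero.comp (tendsto_id.const_mul_atTop hs0)
    simpa using hyl.add (h1.div_const (4 * s))
  have hlow : -(C * C * x₀) ≤ y x₀ := by
    have h2 : ∀ x ∈ Icc (0:ℝ) x₀, |(inner ℂ (φ x) (ψ x)).re| ≤ C * C := by
      intro x hx
      refine (Complex.abs_re_le_norm _).trans ((norm_inner_le_norm _ _).trans ?_)
      have b1 : ∀ k : ℝ, 0 < k → ∀ u : EuclideanSpace ℂ (Fin n), ‖u‖ = 1 →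
          ‖jostVec g (Complex.I * k) u x‖ ≤ C := by
        intro k hk u hu
        rw [norm_jostVec, im_I_mul]
        have e1 : Real.exp (-(k * x)) ≤ 1 := Real.exp_le_one_iff.2 (by nlinarith [hx.1])
        have e2 := norm_matOp_apply_le (g (Complex.I * k) x) u
        rw [hu, mul_one] at e2
        have e3 := (hb _ (I_mul_mem hk) x hx.1).1
        exact (mul_le_of_le_one_left (norm_nonneg _) e1).trans (e2.trans e3)
      exact mul_le_mul (b1 κ hκ v hv) (b1 μ hμ w hw) (norm_nonneg _) hC.le
    have h3 : ContinuousOn y (Icc 0 x₀) := hyc.mono Icc_subset_Ici_self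
    obtain ⟨ξ, hξ, hξe⟩ := exists_hasDerivAt_eq_slope y (fun x => (inner ℂ (φ x) (ψ x)).re) hx₀ h3
      (fun x hx => hyd x hx.1)
    rw [hy0, sub_zero, sub_zero, eq_div_iff hx₀.ne'] at hξe
    have h5 := h2 ξ ⟨hξ.1.le, hξ.2.le⟩
    have h6 := (abs_le.1 h5).1
    nlinarith
  have hz' : y x₀ + Real.exp (-(s * x₀)) / (4 * s) ≤ 0 := hz
  have he : Real.exp (-x₀) ≤ Real.exp (-(s * x₀)) := Real.exp_le_exp.2 (by nlinarith)
  have h1 : Real.exp (-x₀) / (4 * s) ≤ C * C * x₀ := by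
    have : Real.exp (-x₀) / (4 * s) ≤ Real.exp (-(s * x₀)) / (4 * s) := by gcongr
    linarith
  rw [div_le_iff₀ (by positivity)] at h1
  rw [lt_div_iff₀ (by positivity)] at hs2
  linarith

/-- Unit kernel vectors belonging to different small `κ` have distance more than `1 / 2`, so by
compactness of the unit sphere there are only finitely many small `κ`. -/
lemma exists_no_small_zeros (hW : IsRegularPotential W) (hg : IsJostFactor W g g')
    (hAB : IsSelfadjointBC A B) :
    ∃ δ : ℝ, 0 < δ ∧ ∀ κ : ℝ, 0 < κ → κ < δ → ∀ v : EuclideanSpace ℂ (Fin n),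
      matOp (gammaMat g g' A B (Complex.I * κ)) v = 0 → v = 0 := by
  obtain ⟨δ, hδ, h⟩ := exists_le_add_of_zeros hW hg hAB
  set Z : Set ℝ := {κ | 0 < κ ∧ κ < δ / 2 ∧ ∃ v : EuclideanSpace ℂ (Fin n), ‖v‖ = 1 ∧
    matOp (gammaMat g g' A B (Complex.I * κ)) v = 0} with hZ
  have hfin : Z.Finite := by
    obtain ⟨t, -, htf, ht⟩ := (isCompact_sphere (0 : EuclideanSpace ℂ (Fin n)) 1).finite_cover_balls
      (by norm_num : (0:ℝ) < 1 / 4)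
    have hex : ∀ κ : ℝ, ∃ c v : EuclideanSpace ℂ (Fin n), κ ∈ Z → c ∈ t ∧ ‖v‖ = 1 ∧
        dist v c < 1 / 4 ∧ matOp (gammaMat g g' A B (Complex.I * κ)) v = 0 := by
      intro κ
      by_cases hκ : κ ∈ Z
      · obtain ⟨v, hv, hv0⟩ := hκ.2.2
        have := ht (by simpa using hv : v ∈ Metric.sphere 0 1)
        simp only [mem_iUnion] at this
        obtain ⟨c, hc, hvc⟩ := this
        exact ⟨c, v, fun _ => ⟨hc, hv, hvc, hv0⟩⟩
      · exact ⟨0, 0, fun h => absurd h hκ⟩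
    choose c v hcv using hex
    refine Set.Finite.of_injOn (f := c) (t := t) (fun κ hκ => (hcv κ hκ).1) ?_ htf
    intro κ hκ μ hμ hcc
    by_contra hne
    obtain ⟨-, a1, a2, a3⟩ := hcv κ hκ
    obtain ⟨-, b1, b2, b3⟩ := hcv μ hμ
    have hd : ‖v κ - v μ‖ ≤ 1 / 2 := by
      rw [← dist_eq_norm]
      rw [hcc] at a2
      rw [dist_comm] at b2
      linarith [dist_triangle (v κ) (c μ) (v μ)]
    have := h κ μ hκ.1 hμ.1 hne (v κ) (v μ) a1 b1 hd a3 b3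
    linarith [hκ.2.1, hμ.2.1]
  have hex : ∃ ε : ℝ, 0 < ε ∧ ∀ κ ∈ Z, ε ≤ κ := by
    rcases hfin.toFinset.eq_empty_or_nonempty with he | hne
    · refine ⟨1, one_pos, fun κ hκ => ?_⟩
      have : κ ∈ hfin.toFinset := hfin.mem_toFinset.2 hκ
      simp [he] at this
    · refine ⟨hfin.toFinset.min' hne, (hfin.mem_toFinset.1 (Finset.min'_mem _ hne)).1,
        fun κ hκ => Finset.min'_le _ _ (hfin.mem_toFinset.2 hκ)⟩
  obtain ⟨ε, hε, hεZ⟩ := hex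
  refine ⟨min ε (δ / 2), by positivity, fun κ hκ hκδ v hv => ?_⟩
  by_contra hv0
  have hvn : ‖v‖ ≠ 0 := norm_ne_zero_iff.2 hv0
  have : κ ∈ Z := by
    refine ⟨hκ, hκδ.trans_le (min_le_right _ _), ((‖v‖⁻¹ : ℝ) : ℂ) • v, ?_, ?_⟩
    · rw [norm_smul, Complex.norm_real, norm_inv, norm_norm, inv_mul_cancel₀ hvn]
    · rw [map_smul, hv, smul_zero]
  exact absurd (hεZ κ this) (not_le.2 (hκδ.trans_le (min_le_left _ _)))

end SmallZeros

/-! ### Square-integrable solutions -/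

section SquareIntegrable

variable {W : ℝ → Matrix (Fin n) (Fin n) ℂ} {E : ℂ} {ψ ψ' : ℝ → EuclideanSpace ℂ (Fin n)}

lemma norm_sub_le_of_hasDerivAt {X : Type*} [NormedAddCommGroup X] [NormedSpace ℝ X]
    [CompleteSpace X] {G G' : ℝ → X} {m : ℝ → ℝ} {x : ℝ}
    (hG : ∀ y ∈ Icc x (x + 1), HasDerivAt G (G' y) y) (hG' : ContinuousOn G' (Icc x (x + 1)))
    (hm : ContinuousOn m (Icc x (x + 1))) (hle : ∀ y ∈ Icc x (x + 1), ‖G' y‖ ≤ m y) :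
    ‖G (x + 1) - G x‖ ≤ ∫ y in x..x + 1, m y := by
  have hx : x ≤ x + 1 := by linarith
  rw [← intervalIntegral.integral_eq_sub_of_hasDerivAt (f := G) (f' := G')
    (by rwa [uIcc_of_le hx]) (hG'.intervalIntegrable_of_Icc hx)]
  refine (intervalIntegral.norm_integral_le_integral_norm hx).trans ?_
  exact intervalIntegral.integral_mono_on hx (hG'.norm.intervalIntegrable_of_Icc hx)
    (hm.intervalIntegrable_of_Icc hx) hle

/-- A square-integrable solution vanishes at infinity together with its derivative.  Both are
bounded by the local mean of `‖ψ‖`, by integrating `(ηψ' - η'ψ)'` over `[x,x+1]` for cubic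
polynomials `η` with suitable values at the endpoints. -/
lemma tendsto_zero_of_sq_integrable (hW : IsRegularPotential W) (hψ : IsSolution W E ψ ψ')
    (hi : IntegrableOn (fun x => ‖ψ x‖ ^ 2) (Ioi 0)) :
    Tendsto ψ atTop (𝓝 0) ∧ Tendsto ψ' atTop (𝓝 0) := by
  obtain ⟨K, hK⟩ := hW.bounded
  have hK0 : 0 ≤ K := (norm_nonneg _).trans (hK 0)
  set Q := K + ‖E‖ with hQ
  have hQ0 : 0 ≤ Q := by positivity
  have hsecond : ∀ x, ‖matOp (W x) (ψ x) - E • ψ x‖ ≤ Q * ‖ψ x‖ := by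
    intro x
    refine (norm_sub_le _ _).trans ?_
    rw [norm_smul, hQ, add_mul]
    exact add_le_add_left ((norm_matOp_apply_le _ _).trans
      (mul_le_mul_of_nonneg_right (hK x) (norm_nonneg _))) _
  have hc'' : ContinuousOn (fun x => matOp (W x) (ψ x) - E • ψ x) (Ici 0) := by
    refine ContinuousOn.sub ?_ (hψ.cont.const_smul E)
    have h1 : Continuous fun x => matOp (W x) := by
      have : Continuous fun M : Matrix (Fin n) (Fin n) ℂ => matOp M :=
        AddMonoidHomClass.continuous_of_bound (Matrix.toEuclideanCLM (n := Fin n) (𝕜 := ℂ)) 1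
          fun M => by rw [one_mul]; exact le_rfl
      exact this.comp hW.continuous
    exact h1.continuousOn.clm_apply hψ.cont
  -- the cubic test functions
  have test : ∀ η η' η'' : ℝ → ℝ, Continuous η → Continuous η' → Continuous η'' →
      (∀ t, HasDerivAt η (η' t) t) → (∀ t, HasDerivAt η' (η'' t) t) →
      (∀ t ∈ Icc (0:ℝ) 1, |η t| ≤ 1 ∧ |η'' t| ≤ 6) → η 1 = 0 → η' 1 = 0 → ∀ x, 0 < x →
      ‖η 0 • ψ' x - η' 0 • ψ x‖ ≤ ∫ y in x..x + 1, (Q + 6) * ‖ψ y‖ := by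
    intro η η' η'' c0 c1 c2 d0 d1 hb e0 e1 x hx
    have hsub : Icc x (x + 1) ⊆ Ici 0 := fun y hy => hx.le.trans hy.1
    have h := norm_sub_le_of_hasDerivAt (x := x)
      (G := fun y => η (y - x) • ψ' y - η' (y - x) • ψ y)
      (G' := fun y => η (y - x) • (matOp (W y) (ψ y) - E • ψ y) - η'' (y - x) • ψ y)
      (m := fun y => (Q + 6) * ‖ψ y‖) ?_ ?_ ?_ ?_
    · simp only [add_sub_cancel_left, sub_self, e0, e1, zero_smul, zero_sub] at h
      rwa [norm_neg] at h
    · intro y hy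
      have hy0 : 0 < y := hx.trans_le hy.1
      refine ((((d0 (y - x)).comp_sub_const y x).smul (hψ.hasDeriv' y hy0)).sub
        (((d1 (y - x)).comp_sub_const y x).smul (hψ.hasDeriv y hy0))).congr_deriv ?_
      abel
    · refine ContinuousOn.sub ?_ ?_
      · exact (c0.comp (continuous_id.sub continuous_const)).continuousOn.smul (hc''.mono hsub)
      · exact (c2.comp (continuous_id.sub continuous_const)).continuousOn.smul (hψ.cont.mono hsub)
    · exact continuousOn_const.mul (hψ.cont.mono hsub).norm
    · intro y hy
      obtain ⟨b1, b2⟩ := hb (y - x) ⟨by linarith [hy.1], by linarith [hy.2]⟩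
      refine (norm_sub_le _ _).trans ?_
      rw [norm_smul, norm_smul, Real.norm_eq_abs, Real.norm_eq_abs]
      have h1 := mul_le_mul b1 (hsecond y) (norm_nonneg _) zero_le_one
      have h2 := mul_le_mul_of_nonneg_right b2 (norm_nonneg (ψ y))
      linarith
  have hmean : Tendsto (fun x => ∫ y in x..x + 1, (Q + 6) * ‖ψ y‖) atTop (𝓝 0) := by
    rw [Metric.tendsto_atTop]
    intro ε hε
    set δ := ε / (4 * (Q + 6)) with hδ
    have hδ0 : 0 < δ := by positivity
    have htail : Tendsto (fun x => ∫ y in Ioi x, ‖extendLeft ψ y‖ ^ 2) atTop (𝓝 0) := by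
      refine tendsto_integral_Ioi_zero (a := 0) ((continuous_extendLeft hψ.cont).norm.pow 2) ?_
      refine hi.congr_fun (fun x hx => ?_) measurableSet_Ioi
      simp only
      rw [extendLeft_of_nonneg _ (le_of_lt hx)]
    obtain ⟨x₁, hx₁⟩ := eventually_atTop.1 (htail.eventually
      (gt_mem_nhds (by positivity : 0 < δ ^ 2)))
    refine ⟨max x₁ 1, fun x hx => ?_⟩
    have hx1 : x₁ ≤ x := (le_max_left _ _).trans hx
    have hx0 : 0 < x := lt_of_lt_of_le one_pos ((le_max_right _ _).trans hx)
    have hxx : x ≤ x + 1 := by linarith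
    have hsub : Icc x (x + 1) ⊆ Ici 0 := fun y hy => hx0.le.trans hy.1
    have h0 : 0 ≤ ∫ y in x..x + 1, (Q + 6) * ‖ψ y‖ :=
      intervalIntegral.integral_nonneg hxx fun y _ => by positivity
    rw [Real.dist_eq, sub_zero, abs_of_nonneg h0]
    have h1 : ∫ y in x..x + 1, (Q + 6) * ‖ψ y‖ ≤
        ∫ y in x..x + 1, (Q + 6) * (δ + δ⁻¹ * ‖extendLeft ψ y‖ ^ 2) := by
      refine intervalIntegral.integral_mono_on hxx
        ((continuousOn_const.mul (hψ.cont.mono hsub).norm).intervalIntegrable_of_Icc hxx)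
        (Continuous.intervalIntegrable ?_ _ _) fun y hy => ?_
      · have := continuous_extendLeft hψ.cont
        fun_prop
      · rw [extendLeft_of_nonneg _ (hsub hy)]
        gcongr
        have h2 : 0 ≤ δ⁻¹ * (‖ψ y‖ - δ) ^ 2 := by positivity
        have h3 : δ⁻¹ * (‖ψ y‖ - δ) ^ 2 = δ⁻¹ * ‖ψ y‖ ^ 2 - 2 * ‖ψ y‖ + δ := by
          field_simp
          ring
        have := norm_nonneg (ψ y)
        linarith
    have hci : Continuous fun y => ‖extendLeft ψ y‖ ^ 2 := (continuous_extendLeft hψ.cont).norm.pow 2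
    have hrhs : ∫ y in x..x + 1, (Q + 6) * (δ + δ⁻¹ * ‖extendLeft ψ y‖ ^ 2)
        = (Q + 6) * (δ + δ⁻¹ * ∫ y in x..x + 1, ‖extendLeft ψ y‖ ^ 2) := by
      rw [intervalIntegral.integral_const_mul, intervalIntegral.integral_add
        intervalIntegrable_const ((hci.intervalIntegrable _ _).const_mul _),
        intervalIntegral.integral_const, intervalIntegral.integral_const_mul]
      simp
    rw [hrhs] at h1
    have h4 : ∫ y in x..x + 1, ‖extendLeft ψ y‖ ^ 2 ≤ ∫ y in Ioi x, ‖extendLeft ψ y‖ ^ 2 := by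
      rw [intervalIntegral.integral_of_le hxx]
      refine setIntegral_mono_set ?_ (Eventually.of_forall fun y => by positivity)
        (Eventually.of_forall Ioc_subset_Ioi_self)
      have : IntegrableOn (fun y => ‖extendLeft ψ y‖ ^ 2) (Ioi 0) := by
        refine hi.congr_fun (fun x hx => ?_) measurableSet_Ioi
        simp only
        rw [extendLeft_of_nonneg _ (le_of_lt hx)]
      exact this.mono_set (Ioi_subset_Ioi hx0.le)
    have h5 := (h4.trans_lt (hx₁ x hx1))
    have h6 : δ⁻¹ * ∫ y in x..x + 1, ‖extendLeft ψ y‖ ^ 2 ≤ δ := by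
      rw [inv_mul_le_iff₀ hδ0, ← pow_two]; exact h5.le
    have h7 : (Q + 6) * (2 * δ) < ε := by
      rw [hδ]; field_simp; norm_num
    nlinarith
  have b1 := test (fun t => 1 - 3 * t ^ 2 + 2 * t ^ 3) (fun t => -6 * t + 6 * t ^ 2)
    (fun t => -6 + 12 * t) (by fun_prop) (by fun_prop) (by fun_prop)
    (fun t => by
      have := (((hasDerivAt_id t).pow 2).const_mul 3).const_sub 1 |>.add
        (((hasDerivAt_id t).pow 3).const_mul 2)
      refine this.congr_deriv ?_
      simp; ring)
    (fun t => by
      have := ((hasDerivAt_id t).const_mul (-6)).add (((hasDerivAt_id t).pow 2).const_mul 6)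
      refine this.congr_deriv ?_
      simp; ring)
    (fun t ht => by
      refine ⟨abs_le.2 ⟨?_, ?_⟩, abs_le.2 ⟨by linarith [ht.1], by linarith [ht.2]⟩⟩
      · nlinarith [ht.1, ht.2, mul_nonneg ht.1 (sub_nonneg.2 ht.2), sq_nonneg t,
          mul_nonneg (sq_nonneg (1 - t)) ht.1]
      · nlinarith [ht.1, ht.2, mul_nonneg (sq_nonneg t) (sub_nonneg.2 ht.2), sq_nonneg t])
    (by norm_num) (by norm_num)
  have b2 := test (fun t => t - 2 * t ^ 2 + t ^ 3) (fun t => 1 - 4 * t + 3 * t ^ 2)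
    (fun t => -4 + 6 * t) (by fun_prop) (by fun_prop) (by fun_prop)
    (fun t => by
      have := ((hasDerivAt_id t).sub (((hasDerivAt_id t).pow 2).const_mul 2)).add
        ((hasDerivAt_id t).pow 3)
      refine this.congr_deriv ?_
      simp; ring)
    (fun t => by
      have := (((hasDerivAt_id t).const_mul 4).const_sub 1).add
        (((hasDerivAt_id t).pow 2).const_mul 3)
      refine this.congr_deriv ?_
      simp; ring)
    (fun t ht => by
      refine ⟨abs_le.2 ⟨?_, ?_⟩, abs_le.2 ⟨by linarith [ht.1], by linarith [ht.2]⟩⟩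
      · nlinarith [ht.1, ht.2, mul_nonneg ht.1 (sq_nonneg (1 - t))]
      · nlinarith [ht.1, ht.2, mul_nonneg (sq_nonneg t) (sub_nonneg.2 ht.2), sq_nonneg t])
    (by norm_num) (by norm_num)
  simp only [ne_eq, OfNat.ofNat_ne_zero, not_false_eq_true, zero_pow, mul_zero, sub_zero, add_zero,
    one_smul, zero_smul, zero_sub, norm_neg] at b1 b2
  constructor
  · exact squeeze_zero_norm' (by filter_upwards [Ioi_mem_atTop (0:ℝ)] with x hx using b2 x hx) hmean
  · exact squeeze_zero_norm' (by filter_upwards [Ioi_mem_atTop (0:ℝ)] with x hx using b1 x hx) hmean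

end SquareIntegrable

variable {n : ℕ}

/-! ### Decaying solutions with a given energy -/

section DecayingSolutions

variable {W : ℝ → Matrix (Fin n) (Fin n) ℂ} {E : ℂ} {ψ ψ' : ℝ → EuclideanSpace ℂ (Fin n)}

lemma continuous_matOp_comp (hW : Continuous W) : Continuous fun x => matOp (W x) := by
  have : Continuous fun M : Matrix (Fin n) (Fin n) ℂ => matOp M :=
    AddMonoidHomClass.continuous_of_bound (Matrix.toEuclideanCLM (n := Fin n) (𝕜 := ℂ)) 1
      fun M => by rw [one_mul]; exact le_rfl
  exact this.comp hW

lemma integrableOn_matOp_apply (hW : IsRegularPotential W)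
    {u : ℝ → EuclideanSpace ℂ (Fin n)} {a C : ℝ} (hu : ContinuousOn u (Ici a))
    (hC : ∀ x, a ≤ x → ‖u x‖ ≤ C) : IntegrableOn (fun x => matOp (W x) (u x)) (Ioi a) := by
  refine (hW.integrable.norm.mul_const C).integrableOn.mono' ?_ ?_
  · exact (((continuous_matOp_comp hW.continuous).continuousOn.clm_apply hu).mono
      Ioi_subset_Ici_self).aestronglyMeasurable measurableSet_Ioi
  · refine (ae_restrict_iff' measurableSet_Ioi).2 (Eventually.of_forall fun y hy => ?_)
    exact (norm_matOp_apply_le _ _).trans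
      (mul_le_mul_of_nonneg_left (hC y (le_of_lt hy)) (norm_nonneg _))

/-- Conservation of the flux `Im ⟪ψ, ψ'⟫` excludes non-real eigenvalues. -/
lemma eq_zero_of_im_ne_zero (hW : IsRegularPotential W) {A B : Matrix (Fin n) (Fin n) ℂ}
    (hAB : IsSelfadjointBC A B) (hψ : IsSolution W E ψ ψ')
    (h1 : Tendsto ψ atTop (𝓝 0)) (h2 : Tendsto ψ' atTop (𝓝 0))
    (hb : bdryForm A B (ψ 0) (ψ' 0) = 0) (hE : E.im ≠ 0) : ∀ x, 0 < x → ψ x = 0 := by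
  let om := wronskian ψ ψ' ψ ψ'
  let y : ℝ → ℝ := fun x => (om x).im / (-2 * E.im)
  have hyd : ∀ x, 0 < x → HasDerivAt y (‖ψ x‖ ^ 2) x := by
    intro x hx
    have h := ((Complex.imCLM.hasFDerivAt.comp_hasDerivAt x
      (hasDerivAt_wronskian hW.selfadjoint hψ hψ hx)).div_const (-2 * E.im))
    refine h.congr_deriv ?_
    rw [inner_self_eq_norm_sq_to_K]
    simp only [Complex.imCLM_apply, Complex.coe_algebraMap, ← Complex.ofReal_pow,
      Complex.im_mul_ofReal, Complex.sub_im, Complex.conj_im]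
    field_simp
    ring
  have hyc : ContinuousOn y (Ici 0) :=
    (Complex.continuous_im.comp_continuousOn
      (continuousOn_wronskian hψ.cont hψ.cont' hψ.cont hψ.cont')).div_const _
  have hyl : Tendsto y atTop (𝓝 0) := by
    have := ((Complex.continuous_im.tendsto _).comp
      (tendsto_wronskian h1 h2 h1 h2)).div_const (-2 * E.im)
    simp only [Complex.zero_im, zero_div] at this
    exact this
  have hy0 : y 0 = 0 := by
    have : om 0 = 0 := symplectic_eq_zero hAB hb hb
    simp [y, this]
  obtain ⟨hm, hle⟩ := nonpos_of_hasDerivAt_nonneg hyc hyd (fun x _ => by positivity) hyl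
  have hz : ∀ x ∈ Ici (0:ℝ), y x = 0 := fun x hx =>
    le_antisymm (hle x hx) (hy0 ▸ hm self_mem_Ici hx hx)
  intro x hx
  have h0 : HasDerivAt y 0 x := (hasDerivAt_const x (0:ℝ)).congr_of_eventuallyEq
    (by filter_upwards [Ioi_mem_nhds hx] with z hz' using hz z (mem_Ici_of_Ioi hz'))
  have := (hyd x hx).unique h0
  simpa using this

lemma eq_zero_of_norm_le_integral {m : ℝ → ℝ} (hm : Continuous m) (h0 : ∀ x, 0 ≤ m x)
    (hi : IntegrableOn m (Ioi 0)) {u : ℝ → EuclideanSpace ℂ (Fin n)} (hu : ContinuousOn u (Ici 0))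
    (h1 : Tendsto u atTop (𝓝 0)) (h : ∀ x, 0 ≤ x → ‖u x‖ ≤ ∫ y in Ioi x, m y * ‖u y‖) :
    ∀ x, 0 ≤ x → u x = 0 := by
  intro x hx
  obtain ⟨C, hC⟩ := exists_bound_of_tendsto hu h1
  have := gronwall_Ioi (u := fun x => ‖u x‖) (c := 0) hm h0 hi (fun x _ => norm_nonneg _) hC hu.norm
    le_rfl (fun x hx => by rw [zero_add]; exact h x hx) x hx
  simpa using this

/-- There are no positive eigenvalues: `u = e^{-ikx} ψ` satisfies `u'' + 2ik u' = W u` and vanishes at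
infinity, hence also the homogeneous Volterra equation, and Gronwall's inequality applies. -/
lemma eq_zero_of_pos_energy (hW : IsRegularPotential W) {k : ℝ} (hk : k ≠ 0)
    (hψ : IsSolution W ((k : ℂ) ^ 2) ψ ψ')
    (h1 : Tendsto ψ atTop (𝓝 0)) (h2 : Tendsto ψ' atTop (𝓝 0)) : ∀ x, 0 ≤ x → ψ x = 0 := by
  let e : ℝ → ℂ := fun x => Complex.exp (Complex.I * (-k : ℂ) * x)
  have he : ∀ x, ‖e x‖ = 1 := fun x => by
    show ‖Complex.exp (Complex.I * (-k : ℂ) * x)‖ = 1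
    rw [norm_exp_I]; simp
  have hed : ∀ x, HasDerivAt e (Complex.I * (-k : ℂ) * e x) x := hasDerivAt_exp_I (-k : ℂ)
  have hec : Continuous e := continuous_iff_continuousAt.2 fun x => (hed x).continuousAt
  let u : ℝ → EuclideanSpace ℂ (Fin n) := fun x => e x • ψ x
  let u' : ℝ → EuclideanSpace ℂ (Fin n) := fun x => e x • (ψ' x - (Complex.I * k) • ψ x)
  have hun : ∀ x, ‖u x‖ = ‖ψ x‖ := fun x => by rw [norm_smul, he, one_mul]
  have hu : ContinuousOn u (Ici 0) := hec.continuousOn.smul hψ.cont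
  have hu' : ContinuousOn u' (Ici 0) :=
    hec.continuousOn.smul (hψ.cont'.sub (hψ.cont.const_smul (Complex.I * k)))
  have tu : Tendsto u atTop (𝓝 0) := by
    rw [tendsto_zero_iff_norm_tendsto_zero] at h1 ⊢
    exact h1.congr fun x => (hun x).symm
  have tu' : Tendsto u' atTop (𝓝 0) := by
    have h3 : Tendsto (fun x => ψ' x - (Complex.I * k) • ψ x) atTop (𝓝 0) := by
      simpa using h2.sub (h1.const_smul (Complex.I * (k : ℂ)))
    rw [tendsto_zero_iff_norm_tendsto_zero] at h3 ⊢
    refine h3.congr fun x => ?_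
    rw [norm_smul, he, one_mul]
  have hd : ∀ x, 0 < x → HasDerivAt u (u' x) x := fun x hx =>
    ((hed x).smul (hψ.hasDeriv x hx)).congr_deriv (by simp only [u']; module)
  have hd' : ∀ x, 0 < x → HasDerivAt u' (matOp (W x) (u x) - (2 * Complex.I * k) • u' x) x := by
    intro x hx
    refine ((hed x).smul ((hψ.hasDeriv' x hx).sub
      ((hψ.hasDeriv x hx).const_smul (Complex.I * (k : ℂ))))).congr_deriv ?_
    simp only [u, u', map_smul, Pi.sub_apply, Pi.smul_apply]
    have hI : Complex.I * Complex.I = -1 := Complex.I_mul_I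
    have e1 : (k : ℂ) ^ 2 = -((Complex.I * k) * (Complex.I * k)) := by
      linear_combination ((k : ℂ) ^ 2) * hI
    rw [e1]
    module
  obtain ⟨C, hC⟩ := exists_bound_of_tendsto hu tu
  have hk' : (k : ℂ) ≠ 0 := by exact_mod_cast hk
  have hz := eq_zero_of_norm_le_integral (m := fun y => 1 / ‖(k : ℂ)‖ * ‖W y‖) (u := u)
    (continuous_const.mul hW.continuous.norm) (fun x => by positivity)
    (hW.integrable.norm.const_mul _).integrableOn hu tu ?_
  · intro x hx
    have := hz x hx
    rw [← norm_eq_zero, hun, norm_eq_zero] at this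
    exact this
  · intro x hx
    have hi : IntegrableOn (fun x => matOp (W x) (u x)) (Ioi 0) := integrableOn_matOp_apply hW hu hC
    rw [(eq_integral_volterraKernel (k := (k : ℂ)) (by simp) hk' hu hu' hd hd' hi tu tu' hx).1]
    have hi' := hi.mono_set (Ioi_subset_Ioi hx)
    refine (norm_integral_kernel_smul_le (κ := volterraKernel k) (fun t ht =>
      norm_volterraKernel_le_inv (by simp) ht) hi').trans ?_
    rw [← integral_const_mul]
    refine setIntegral_mono_on₀ (hi'.norm.const_mul _) ?_ measurableSet_Ioi.nullMeasurableSet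
      fun y hy => ?_
    · refine Integrable.mul_bdd (c := C) (hW.integrable.norm.const_mul _).integrableOn ?_ ?_
      · exact (hu.norm.mono (fun y hy => hx.trans (le_of_lt hy))).aestronglyMeasurable
          measurableSet_Ioi
      · refine (ae_restrict_iff' measurableSet_Ioi).2 (Eventually.of_forall fun y hy => ?_)
        rw [norm_norm]; exact hC y (hx.trans (le_of_lt hy))
    · rw [mul_assoc]
      exact mul_le_mul_of_nonneg_left (norm_matOp_apply_le _ _) (by positivity)

/-- Zero is not an eigenvalue: `ψ(x) = ∫ₓ^∞ (y - x) W(y) ψ(y) dy`, and Gronwall's inequality applies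
since the first moment of `W` is finite. -/
lemma eq_zero_of_zero_energy (hW : IsRegularPotential W) (hψ : IsSolution W 0 ψ ψ')
    (h1 : Tendsto ψ atTop (𝓝 0)) (h2 : Tendsto ψ' atTop (𝓝 0)) : ∀ x, 0 < x → ψ x = 0 := by
  obtain ⟨C, hC⟩ := exists_bound_of_tendsto hψ.cont h1
  have hi : IntegrableOn (fun x => matOp (W x) (ψ x)) (Ioi 0) :=
    integrableOn_matOp_apply hW hψ.cont hC
  have hmi : ∀ x, 0 ≤ x → IntegrableOn (fun y => |y| * ‖W y‖ * ‖ψ y‖) (Ioi x) := by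
    intro x hx
    refine Integrable.mul_bdd (c := C) (hW.moment.mono_set (Ioi_subset_Ioi hx)) ?_ ?_
    · exact (hψ.cont.norm.mono (fun y hy => hx.trans (le_of_lt hy))).aestronglyMeasurable
        measurableSet_Ioi
    · refine (ae_restrict_iff' measurableSet_Ioi).2 (Eventually.of_forall fun y hy => ?_)
      rw [norm_norm]; exact hC y (hx.trans (le_of_lt hy))
  have hd' : ∀ x, 0 < x → HasDerivAt ψ' (matOp (W x) (ψ x)) x := fun x hx =>
    (hψ.hasDeriv' x hx).congr_deriv (by simp)
  have hwi : ∀ x, 0 ≤ x → ∀ t, 0 ≤ t → t ≤ x →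
      IntegrableOn (fun y => (y - t) • matOp (W y) (ψ y)) (Ioi x) := by
    intro x hx t ht htx
    refine (hmi x hx).mono' ?_ ?_
    · refine ContinuousOn.aestronglyMeasurable ?_ measurableSet_Ioi
      refine ((continuous_id.sub continuous_const).continuousOn.smul
        ((continuous_matOp_comp hW.continuous).continuousOn.clm_apply (hψ.cont.mono ?_)))
      exact fun y hy => hx.trans (le_of_lt hy)
    · refine (ae_restrict_iff' measurableSet_Ioi).2 (Eventually.of_forall fun y hy => ?_)
      have hy' : x < y := hy
      rw [norm_smul, Real.norm_eq_abs, mul_assoc]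
      refine mul_le_mul ?_ (norm_matOp_apply_le _ _) (norm_nonneg _) (abs_nonneg _)
      rw [abs_of_nonneg (by linarith), abs_of_nonneg (by linarith)]; linarith
  have hle : ∀ x, 0 ≤ x → ∀ t, 0 ≤ t → t ≤ x →
      ‖∫ y in Ioi x, (y - t) • matOp (W y) (ψ y)‖ ≤ ∫ y in Ioi x, |y| * ‖W y‖ * ‖ψ y‖ := by
    intro x hx t ht htx
    refine norm_integral_le_of_norm_le (hmi x hx) ?_
    refine (ae_restrict_iff' measurableSet_Ioi).2 (Eventually.of_forall fun y hy => ?_)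
    have hy' : x < y := hy
    rw [norm_smul, Real.norm_eq_abs, mul_assoc]
    refine mul_le_mul ?_ (norm_matOp_apply_le _ _) (norm_nonneg _) (abs_nonneg _)
    rw [abs_of_nonneg (by linarith), abs_of_nonneg (by linarith)]; linarith
  -- `yψ'(y) → 0`, from `ψ'(y) = -∫_y^∞ Wψ`
  have hyψ : Tendsto (fun y => y • ψ' y) atTop (𝓝 0) := by
    have hm : ∀ x, 0 ≤ x → ‖x • ψ' x‖ ≤ ∫ y in Ioi x, |y| * (‖W y‖ * C) := by
      intro x hx
      have hix := hi.mono_set (Ioi_subset_Ioi hx)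
      have e : ψ' x = -∫ y in Ioi x, matOp (W y) (ψ y) := by
        have := integral_Ioi_of_hasDerivAt_of_tendsto (a := x) (hψ.cont'.continuousWithinAt hx
          |>.mono (Ici_subset_Ici.2 hx)) (fun y hy => hd' y (lt_of_le_of_lt hx hy)) hix h2
        rw [this]; simp
      rw [e, smul_neg, norm_neg, ← integral_smul]
      have i2 : IntegrableOn (fun y => |y| * (‖W y‖ * C)) (Ioi x) := by
        have h := (hW.moment.mono_set (Ioi_subset_Ioi hx)).mul_const C
        simp only [mul_assoc] at h
        exact h
      refine norm_integral_le_of_norm_le i2 ?_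
      refine (ae_restrict_iff' measurableSet_Ioi).2 (Eventually.of_forall fun y hy => ?_)
      have hy' : x < y := hy
      rw [norm_smul, Real.norm_eq_abs]
      refine mul_le_mul ?_ ((norm_matOp_apply_le _ _).trans (mul_le_mul_of_nonneg_left
        (hC y (by linarith)) (norm_nonneg _))) (norm_nonneg _) (abs_nonneg _)
      rw [abs_of_nonneg (by linarith), abs_of_nonneg (by linarith)]; linarith
    refine squeeze_zero_norm' (by filter_upwards [Ici_mem_atTop (0:ℝ)] with x hx using hm x hx) ?_
    refine tendsto_integral_Ioi_zero (a := 0)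
      (continuous_abs.mul (hW.continuous.norm.mul continuous_const)) ?_
    have h := hW.moment.mul_const C
    simp only [mul_assoc] at h
    exact h
  have hz := eq_zero_of_norm_le_integral (m := fun y => |y| * ‖W y‖) hW.continuous_moment
    (fun x => by positivity) hW.moment hψ.cont h1 ?_
  · exact fun x hx => hz x hx.le
  · intro x hx
    have e := integral_Ioi_of_hasDerivAt_of_tendsto (a := x) (m := (0 : EuclideanSpace ℂ (Fin n)))
      (f := fun y => (y - x) • ψ' y - ψ y) (f' := fun y => (y - x) • matOp (W y) (ψ y)) ?_ ?_
      (hwi x hx x hx le_rfl) ?_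
    · have e' : ψ x = ∫ y in Ioi x, (y - x) • matOp (W y) (ψ y) := by rw [e]; simp
      rw [e']
      exact hle x hx x hx le_rfl
    · have hs : Ici x ⊆ Ici 0 := Ici_subset_Ici.2 hx
      exact (((continuous_id.sub continuous_const).continuousOn.smul (hψ.cont'.mono hs)).sub
        (hψ.cont.mono hs)).continuousWithinAt self_mem_Ici
    · intro y hy
      have hy0 : 0 < y := lt_of_le_of_lt hx hy
      refine ((((hasDerivAt_id y).sub_const x).smul (hd' y hy0)).sub
        (hψ.hasDeriv y hy0)).congr_deriv ?_
      simp
    · have := (hyψ.sub (h2.const_smul x)).sub h1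
      simp only [smul_zero, sub_zero] at this
      refine this.congr fun y => ?_
      rw [sub_smul]

lemma IsSolution.eq_of_eq_at (hW : IsRegularPotential W) {φ φ' : ℝ → EuclideanSpace ℂ (Fin n)}
    (hψ : IsSolution W E ψ ψ') (hφ : IsSolution W E φ φ') {x₁ : ℝ} (hx₁ : 0 < x₁)
    (h : ψ x₁ = φ x₁) (h' : ψ' x₁ = φ' x₁) :
    ∀ x, 0 ≤ x → ψ x = φ x ∧ ψ' x = φ' x := by
  obtain ⟨K, hK⟩ := hW.bounded
  have hK0 : 0 ≤ K := (norm_nonneg _).trans (hK 0)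
  let F : ℝ → EuclideanSpace ℂ (Fin n) × EuclideanSpace ℂ (Fin n) →
      EuclideanSpace ℂ (Fin n) × EuclideanSpace ℂ (Fin n) :=
    fun x q => (q.2, matOp (W x) q.1 - E • q.1)
  have hF : ∀ x, LipschitzWith (Real.toNNReal (1 + K + ‖E‖)) (F x) := by
    intro x
    refine LipschitzWith.of_dist_le_mul fun p q => ?_
    rw [Real.coe_toNNReal _ (by positivity), dist_eq_norm, dist_eq_norm]
    have e : F x p - F x q = ((p - q).2, matOp (W x) (p - q).1 - E • (p - q).1) := by
      simp only [F, Prod.mk_sub_mk, Prod.fst_sub, Prod.snd_sub, map_sub, smul_sub]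
      congr 1
      abel
    rw [e, Prod.norm_mk]
    have n1 := norm_fst_le (p - q)
    have n2 := norm_snd_le (p - q)
    have hn := norm_nonneg (p - q)
    refine max_le ?_ ?_
    · nlinarith [norm_nonneg E]
    · refine (norm_sub_le _ _).trans ?_
      rw [norm_smul]
      have := (norm_matOp_apply_le (W x) (p - q).1).trans
        (mul_le_mul (hK x) n1 (norm_nonneg _) hK0)
      nlinarith [mul_le_mul_of_nonneg_left n1 (norm_nonneg E)]
  have hpos : ∀ x, 0 < x → (ψ x, ψ' x) = (φ x, φ' x) := by
    intro x hx
    exact ODE_solution_unique_of_mem_Ioo (v := F) (s := fun _ => univ) (a := 0) (b := x + x₁ + 1)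
      (t₀ := x₁) (f := fun x => (ψ x, ψ' x)) (g := fun x => (φ x, φ' x))
      (fun t _ => (hF t).lipschitzOnWith) ⟨hx₁, by linarith⟩
      (fun t ht => ⟨(hψ.hasDeriv t ht.1).prodMk (hψ.hasDeriv' t ht.1), mem_univ _⟩)
      (fun t ht => ⟨(hφ.hasDeriv t ht.1).prodMk (hφ.hasDeriv' t ht.1), mem_univ _⟩)
      (by simp [h, h']) ⟨hx, by linarith⟩
  have hcl : EqOn (fun x => (ψ x, ψ' x)) (fun x => (φ x, φ' x)) (closure (Ioi 0)) := by
    refine EqOn.of_subset_closure (s := Ioi (0:ℝ)) (fun x hx => hpos x hx) ?_ ?_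
      subset_closure le_rfl
    · rw [closure_Ioi]; exact hψ.cont.prodMk hψ.cont'
    · rw [closure_Ioi]; exact hφ.cont.prodMk hφ.cont'
  rw [closure_Ioi] at hcl
  intro x hx
  exact Prod.mk.inj (hcl hx)

/-- Decaying solutions of energy `-κ²` are Jost solutions: both lie in the same Lagrangian subspace
of initial values far out. -/
lemma exists_eq_jostVec {g g' : ℂ → ℝ → Matrix (Fin n) (Fin n) ℂ} (hW : IsRegularPotential W)
    (hg : IsJostFactor W g g') {κ : ℝ} (hκ : 0 < κ) (hψ : IsSolution W (-(κ : ℂ) ^ 2) ψ ψ')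
    (h1 : Tendsto ψ atTop (𝓝 0)) (h2 : Tendsto ψ' atTop (𝓝 0)) :
    ∃ v, ∀ x, 0 ≤ x → ψ x = jostVec g (Complex.I * κ) v x ∧
      ψ' x = jostVec' g g' (Complex.I * κ) v x := by
  obtain ⟨x₁, hx₁, hgx⟩ := exists_norm_jost_sub_one_le hW hg (by norm_num : (0:ℝ) < 1 / 2)
  have hU := I_mul_mem hκ
  have hsol : ∀ w, IsSolution W (-(κ : ℂ) ^ 2) (jostVec g (Complex.I * κ) w)
      (jostVec' g g' (Complex.I * κ) w) := fun w => by
    have := isSolution_jostVec hg hU w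
    rwa [sq_I_mul] at this
  have hlim : ∀ w, Tendsto (jostVec g (Complex.I * κ) w) atTop (𝓝 0) ∧
      Tendsto (jostVec' g g' (Complex.I * κ) w) atTop (𝓝 0) := fun w =>
    tendsto_jostVec (g' := g') hg (by rw [im_I_mul]; exact hκ) w
  -- the Wronskian of decaying solutions of equal energy is constant, hence zero
  have hwr : ∀ w, ∀ φ φ' : ℝ → EuclideanSpace ℂ (Fin n), IsSolution W (-(κ : ℂ) ^ 2) φ φ' →
      Tendsto φ atTop (𝓝 0) → Tendsto φ' atTop (𝓝 0) →
      wronskian (jostVec g (Complex.I * κ) w) (jostVec' g g' (Complex.I * κ) w) φ φ' x₁ = 0 := by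
    intro w φ φ' hφ t1 t2
    have hd : ∀ x ∈ Ioi x₁, HasDerivAt (wronskian (jostVec g (Complex.I * κ) w)
        (jostVec' g g' (Complex.I * κ) w) φ φ') 0 x := fun x hx =>
      (hasDerivAt_wronskian hW.selfadjoint (hsol w) hφ (hx₁.trans hx)).congr_deriv (by simp)
    have hc := continuousOn_wronskian (hsol w).cont (hsol w).cont' hφ.cont hφ.cont'
    have := integral_Ioi_of_hasDerivAt_of_tendsto (a := x₁)
      ((hc.continuousWithinAt hx₁.le).mono (Ici_subset_Ici.2 hx₁.le)) hd integrableOn_zero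
      (tendsto_wronskian (hlim w).1 (hlim w).2 t1 t2)
    simpa using this.symm
  have hsurj : ∀ z, ∃ w, jostVec g (Complex.I * κ) w x₁ = z := by
    intro z
    obtain ⟨w, hw⟩ := surjective_matOp_of_norm_sub_one_lt (lt_of_le_of_lt (hgx _ hU x₁ le_rfl)
      (by norm_num)) ((Complex.exp (Complex.I * (Complex.I * κ) * x₁))⁻¹ • z)
    exact ⟨w, by rw [jostVec, hw, smul_smul, mul_inv_cancel₀ (Complex.exp_ne_zero _), one_smul]⟩
  obtain ⟨v, hv⟩ := hsurj (ψ x₁)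
  -- once the values at `x₁` agree, the Wronskians with all Jost solutions determine `ψ'(x₁)`
  refine ⟨v, IsSolution.eq_of_eq_at hW hψ (hsol v) hx₁ hv.symm ?_⟩
  refine ext_inner_left ℂ fun z => ?_
  obtain ⟨w, rfl⟩ := hsurj z
  have e1 := hwr w _ _ hψ h1 h2
  have e2 := hwr w _ _ (hsol v) (hlim v).1 (hlim v).2
  rw [wronskian, sub_eq_zero] at e1 e2
  rw [e1, e2, hv]

end DecayingSolutions

variable {n : ℕ}

/-! ### Eigenspaces of the Hamiltonian -/

section Eigenspaces

variable {V W : ℝ → Matrix (Fin n) (Fin n) ℂ} {A B : Matrix (Fin n) (Fin n) ℂ} {E : ℂ}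
  {g g' : ℂ → ℝ → Matrix (Fin n) (Fin n) ℂ}

lemma mem_eigenspace {u : HalfLineL2 n} :
    u ∈ eigenspace V A B E ↔ (u, E • u) ∈ hamiltonianGraph V A B := Iff.rfl

/-- The primitive of `u'` is extended to the left of `0` by freezing `u'` there, so that two-sided
calculus applies. -/
lemma eq_add_integral_max {X : Type*} [NormedAddCommGroup X] [NormedSpace ℝ X] [CompleteSpace X]
    {u u' : ℝ → X} (hu' : ContinuousOn u' (Ici 0))
    (h : ∀ x, 0 ≤ x → u x = u 0 + ∫ t in (0:ℝ)..x, u' t) :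
    ContinuousOn u (Ici 0) ∧ ∀ x, 0 < x → HasDerivAt u (u' x) x := by
  have hc : Continuous fun t : ℝ => u' (max t 0) :=
    hu'.comp_continuous (by fun_prop) fun x => le_max_right x 0
  have hd : ∀ x, HasDerivAt (fun x => u 0 + ∫ t in (0:ℝ)..x, u' (max t 0)) (u' (max x 0)) x :=
    fun x => (intervalIntegral.integral_hasDerivAt_right (hc.intervalIntegrable _ _)
      hc.aestronglyMeasurable.stronglyMeasurableAtFilter hc.continuousAt).const_add (u 0)
  have he : EqOn u (fun x => u 0 + ∫ t in (0:ℝ)..x, u' (max t 0)) (Ici 0) := by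
    intro x hx
    simp only
    rw [h x hx]
    congr 1
    refine intervalIntegral.integral_congr fun t ht => ?_
    rw [uIcc_of_le hx] at ht
    simp [ht.1]
  refine ⟨ContinuousOn.congr (fun x _ => (hd x).continuousAt.continuousWithinAt) he, fun x hx => ?_⟩
  have := hd x
  rw [max_eq_left hx.le] at this
  exact this.congr_of_eventuallyEq (by filter_upwards [Ici_mem_nhds hx] with y hy using he hy)

/-- Eigenfunctions are classical solutions. -/
lemma exists_isSolution_of_mem_eigenspace (hW : IsRegularPotential W)
    (hVW : ∀ x, 0 < x → V x = W x) {u : HalfLineL2 n} (hu : u ∈ eigenspace V A B E) :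
    ∃ ψ ψ' : ℝ → EuclideanSpace ℂ (Fin n), IsSolution W E ψ ψ' ∧
      (∀ᵐ x ∂((volume : Measure ℝ).restrict (Ioi 0)), u x = ψ x) ∧
      bdryForm A B (ψ 0) (ψ' 0) = 0 ∧
      Tendsto ψ atTop (𝓝 0) ∧ Tendsto ψ' atTop (𝓝 0) := by
  obtain ⟨ψ, ψ', ψ'', hac, h1, h2, h3⟩ := mem_eigenspace.1 hu
  simp only at h1 h2
  have hψc : ContinuousOn ψ (Ici 0) := by
    have key : ∀ b, 0 < b → ContinuousOn ψ (Icc 0 b) := by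
      intro b hb
      have hi := hac.integrable' b hb.le
      have := intervalIntegral.continuousOn_primitive_interval'
        (a := 0) (b₁ := 0) (b₂ := b) hi left_mem_uIcc
      rw [uIcc_of_le hb.le] at this
      exact (continuousOn_const.add this).congr fun x hx => hac.eq' x hx.1
    intro x hx
    refine ((key (x + 1) (by linarith [mem_Ici.1 hx])) x ⟨hx, by linarith⟩).mono_of_mem_nhdsWithin ?_
    rw [← Ici_inter_Iic]
    exact inter_mem_nhdsWithin _ (Iic_mem_nhds (by linarith))
  have hF : ContinuousOn (fun x => matOp (W x) (ψ x) - E • ψ x) (Ici 0) :=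
    ((continuous_matOp_comp hW.continuous).continuousOn.clm_apply hψc).sub (hψc.const_smul E)
  have hae : ∀ᵐ x ∂((volume : Measure ℝ).restrict (Ioi 0)),
      ψ'' x = matOp (W x) (ψ x) - E • ψ x := by
    filter_upwards [h1, h2, Lp.coeFn_smul E u, ae_restrict_mem measurableSet_Ioi]
      with x e1 e2 e3 hx
    rw [e3, Pi.smul_apply, e1, ← matOp_eq_toEuclideanLin, hVW x hx] at e2
    rw [e2]; abel
  have hd' := eq_add_integral_max (u := ψ') hF (fun x hx => by
    rw [hac.eq'' x hx]
    congr 1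
    refine intervalIntegral.integral_congr_ae ?_
    rw [ae_restrict_iff' measurableSet_Ioi] at hae
    filter_upwards [hae] with t ht hmem
    rw [uIoc_of_le hx] at hmem
    exact ht hmem.1)
  have hd := eq_add_integral_max hd'.1 hac.eq'
  have hsol : IsSolution W E ψ ψ' := ⟨hd.1, hd'.1, hd.2, hd'.2⟩
  have hsq : IntegrableOn (fun x => ‖ψ x‖ ^ 2) (Ioi 0) := by
    have := (memLp_two_iff_integrable_sq_norm (Lp.aestronglyMeasurable u)).1 (Lp.memLp u)
    refine this.congr ?_
    filter_upwards [h1] with x hx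
    rw [hx]
  obtain ⟨t1, t2⟩ := tendsto_zero_of_sq_integrable hW hsol hsq
  exact ⟨ψ, ψ', hsol, h1, h3, t1, t2⟩

/-- All eigenvalues are negative. -/
lemma exists_eq_neg_sq_of_isEigenvalue (hW : IsRegularPotential W)
    (hVW : ∀ x, 0 < x → V x = W x) (hAB : IsSelfadjointBC A B) (h : IsEigenvalue V A B E) :
    ∃ κ : ℝ, 0 < κ ∧ E = -(κ : ℂ) ^ 2 := by
  by_contra! hcon
  refine h ((Submodule.eq_bot_iff _).2 fun u hu => ?_)
  obtain ⟨ψ, ψ', hsol, hae, hb, t1, t2⟩ := exists_isSolution_of_mem_eigenspace hW hVW hu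
  have hz : ∀ x, 0 < x → ψ x = 0 := by
    by_cases him : E.im = 0
    · have hE : E = (E.re : ℂ) := by apply Complex.ext <;> simp [him]
      rcases lt_trichotomy E.re 0 with hlt | heq | hgt
      · refine absurd ?_ (hcon (Real.sqrt (-E.re)) (Real.sqrt_pos.2 (by linarith)))
        rw [← Complex.ofReal_pow, Real.sq_sqrt (by linarith), hE]
        simp
      · rw [heq, Complex.ofReal_zero] at hE
        subst hE
        exact eq_zero_of_zero_energy hW hsol t1 t2
      · have e : ((Real.sqrt E.re : ℝ) : ℂ) ^ 2 = E := by
          rw [← Complex.ofReal_pow, Real.sq_sqrt hgt.le]; exact hE.symm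
        rw [← e] at hsol
        exact fun x hx => eq_zero_of_pos_energy hW (Real.sqrt_pos.2 hgt).ne' hsol t1 t2 x hx.le
    · exact eq_zero_of_im_ne_zero hW hAB hsol t1 t2 hb him
  refine Lp.eq_zero_iff_ae_eq_zero.2 ?_
  filter_upwards [hae, ae_restrict_mem measurableSet_Ioi] with x hx hx0
  rw [hx, hz x hx0]; rfl

lemma memLp_jostVec (hW : IsRegularPotential W) (hg : IsJostFactor W g g') {κ : ℝ} (hκ : 0 < κ)
    (v : EuclideanSpace ℂ (Fin n)) :
    MemLp (jostVec g (Complex.I * κ) v) 2 ((volume : Measure ℝ).restrict (Ioi 0)) := by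
  have hU := I_mul_mem hκ
  obtain ⟨C, hC, hb⟩ := exists_jost_bound hW hg
  have hm : AEStronglyMeasurable (jostVec g (Complex.I * κ) v)
      ((volume : Measure ℝ).restrict (Ioi 0)) :=
    ((isSolution_jostVec hg hU v).cont.mono Ioi_subset_Ici_self).aestronglyMeasurable
      measurableSet_Ioi
  refine (memLp_two_iff_integrable_sq_norm hm).2 ?_
  have hi : IntegrableOn (fun x : ℝ => (C * ‖v‖) ^ 2 * Real.exp (-(2 * κ) * x)) (Ioi 0) :=
    (exp_neg_integrableOn_Ioi 0 (by positivity)).const_mul _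
  refine hi.mono' (hm.norm.pow 2) ?_
  refine (ae_restrict_iff' measurableSet_Ioi).2 (Eventually.of_forall fun x hx => ?_)
  have hx0 : 0 ≤ x := le_of_lt hx
  rw [Real.norm_of_nonneg (by positivity), norm_jostVec, im_I_mul, mul_pow, ← Real.exp_nat_mul]
  have e : ((2 : ℕ) : ℝ) * -(κ * x) = -(2 * κ) * x := by push_cast; ring
  rw [e, mul_comm]
  gcongr
  exact (norm_matOp_apply_le _ _).trans
    (mul_le_mul_of_nonneg_right (hb _ hU x hx0).1 (norm_nonneg _))

/-- The linear map sending `v` to the class of `f(iκ,·) v` in `L²`. -/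
noncomputable def jostMap (hW : IsRegularPotential W) (hg : IsJostFactor W g g') {κ : ℝ}
    (hκ : 0 < κ) : EuclideanSpace ℂ (Fin n) →ₗ[ℂ] HalfLineL2 n where
  toFun v := (memLp_jostVec hW hg hκ v).toLp _
  map_add' v w := by
    rw [← MemLp.toLp_add]
    congr 1
    ext1 x
    simp [jostVec]
  map_smul' c v := by
    rw [RingHom.id_apply, ← MemLp.toLp_const_smul]
    congr 1
    ext1 x
    simp only [jostVec, map_smul, Pi.smul_apply]
    rw [smul_comm]

lemma coeFn_jostMap (hW : IsRegularPotential W) (hg : IsJostFactor W g g') {κ : ℝ}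
    (hκ : 0 < κ) (v : EuclideanSpace ℂ (Fin n)) :
    jostMap hW hg hκ v =ᵐ[(volume : Measure ℝ).restrict (Ioi 0)] jostVec g (Complex.I * κ) v :=
  MemLp.coeFn_toLp (memLp_jostVec hW hg hκ v)

lemma injective_jostMap (hW : IsRegularPotential W) (hg : IsJostFactor W g g') {κ : ℝ}
    (hκ : 0 < κ) : Function.Injective (jostMap hW hg hκ) := by
  refine (injective_iff_map_eq_zero _).2 fun v hv => ?_
  obtain ⟨x₁, hx₁, hgx⟩ := exists_norm_jost_sub_one_le hW hg (by norm_num : (0:ℝ) < 1 / 2)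
  have h0 : ∀ᵐ x ∂((volume : Measure ℝ).restrict (Ioi 0)), jostVec g (Complex.I * κ) v x = 0 := by
    have h1 := coeFn_jostMap hW hg hκ v
    rw [hv] at h1
    filter_upwards [h1, Lp.coeFn_zero (EuclideanSpace ℂ (Fin n)) 2
      ((volume : Measure ℝ).restrict (Ioi 0))] with x e1 e2
    rw [← e1, e2]; rfl
  have h0' := ae_restrict_of_ae_restrict_of_subset (Ioi_subset_Ioi hx₁.le) h0
  have hne : NeBot (ae ((volume : Measure ℝ).restrict (Ioi x₁))) := by
    rw [ae_neBot]
    intro h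
    have := Measure.restrict_eq_zero.1 h
    simp at this
  obtain ⟨x, hx, hx1⟩ := (h0'.and (ae_restrict_mem measurableSet_Ioi)).exists
  have e1 : matOp (g (Complex.I * κ) x) v = 0 := by
    rw [jostVec] at hx
    exact (smul_eq_zero.1 hx).resolve_left (Complex.exp_ne_zero _)
  have e2 := norm_matOp_apply_le (g (Complex.I * κ) x - 1) v
  rw [matOp_sub_apply, matOp_one_apply, e1, zero_sub, norm_neg] at e2
  have e3 := hgx _ (I_mul_mem hκ) x (le_of_lt hx1)
  have e4 := norm_nonneg v
  exact norm_eq_zero.1 (by nlinarith)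

/-- The eigenfunctions for `-κ²` are the column combinations `f(iκ, ·) v` with `v` in the kernel of
the boundary form of the Jost solution. -/
lemma eigenspace_eq_map (hW : IsRegularPotential W) (hg : IsJostFactor W g g')
    (hVW : ∀ x, 0 < x → V x = W x) {κ : ℝ} (hκ : 0 < κ) :
    eigenspace V A B (-(κ : ℂ) ^ 2) =
      (LinearMap.ker (matOp (gammaMat g g' A B (Complex.I * κ))).toLinearMap).map
        (jostMap hW hg hκ) := by
  have hU := I_mul_mem hκ
  ext u
  rw [Submodule.mem_map]
  constructor
  · intro hu
    obtain ⟨ψ, ψ', hsol, hae, hb, t1, t2⟩ := exists_isSolution_of_mem_eigenspace hW hVW hu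
    obtain ⟨v, hv⟩ := exists_eq_jostVec hW hg hκ hsol t1 t2
    refine ⟨v, ?_, ?_⟩
    · rw [(hv 0 le_rfl).1, (hv 0 le_rfl).2, bdryForm_jostVec, neg_eq_zero] at hb
      exact hb
    · refine Lp.ext ?_
      filter_upwards [coeFn_jostMap hW hg hκ v, hae, ae_restrict_mem measurableSet_Ioi]
        with x e1 e2 hx
      rw [e1, e2, (hv x (le_of_lt hx)).1]
  · rintro ⟨v, hv, rfl⟩
    have hv0 : matOp (gammaMat g g' A B (Complex.I * κ)) v = 0 := hv
    have hd := hasDerivAt_jostVec hg hU v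
    have hd' := hasDerivAt_jostVec' hg hU v
    have c1 : Continuous (jostVec g (Complex.I * κ) v) :=
      continuous_iff_continuousAt.2 fun x => (hd x).continuousAt
    have c2 : Continuous (jostVec' g g' (Complex.I * κ) v) :=
      continuous_iff_continuousAt.2 fun x => (hd' x).continuousAt
    have c3 : Continuous fun x => matOp (W x) (jostVec g (Complex.I * κ) v x)
        - (Complex.I * (κ : ℂ)) ^ 2 • jostVec g (Complex.I * κ) v x :=
      ((continuous_matOp_comp hW.continuous).clm_apply c1).sub
        (c1.const_smul ((Complex.I * (κ : ℂ)) ^ 2))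
    refine mem_eigenspace.2 ⟨jostVec g (Complex.I * κ) v, jostVec' g g' (Complex.I * κ) v, _,
      ⟨fun x _ => c2.intervalIntegrable _ _, fun x _ => c3.intervalIntegrable _ _, fun x _ => ?_,
        fun x _ => ?_⟩, ?_, ?_, ?_⟩
    · rw [intervalIntegral.integral_eq_sub_of_hasDerivAt (fun y _ => hd y)
        (c2.intervalIntegrable _ _)]; abel
    · rw [intervalIntegral.integral_eq_sub_of_hasDerivAt (fun y _ => hd' y)
        (c3.intervalIntegrable _ _)]; abel
    · exact coeFn_jostMap hW hg hκ v
    · filter_upwards [coeFn_jostMap hW hg hκ v, ae_restrict_mem measurableSet_Ioi,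
        Lp.coeFn_smul (-(κ : ℂ) ^ 2) (jostMap hW hg hκ v)] with x e1 hx e2
      rw [e2, Pi.smul_apply, e1, ← matOp_eq_toEuclideanLin, hVW x hx, sq_I_mul]
      abel
    · have := bdryForm_jostVec (A := A) (B := B) (g := g) (g' := g') (Complex.I * κ) v
      rw [hv0, neg_zero] at this
      exact this

lemma finrank_eigenspace (hW : IsRegularPotential W) (hg : IsJostFactor W g g')
    (hVW : ∀ x, 0 < x → V x = W x) {κ : ℝ} (hκ : 0 < κ) :
    Module.finrank ℂ (eigenspace V A B (-(κ : ℂ) ^ 2)) = Module.finrank ℂ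
      (LinearMap.ker (matOp (gammaMat g g' A B (Complex.I * κ))).toLinearMap) := by
  rw [eigenspace_eq_map hW hg hVW hκ]
  exact LinearEquiv.finrank_eq
    (Submodule.equivMapOfInjective _ (injective_jostMap hW hg hκ) _).symm

lemma finiteDimensional_eigenspace (hW : IsRegularPotential W) (hg : IsJostFactor W g g')
    (hVW : ∀ x, 0 < x → V x = W x) (hAB : IsSelfadjointBC A B) (E : ℂ) :
    FiniteDimensional ℂ (eigenspace V A B E) := by
  by_cases h : IsEigenvalue V A B E
  · obtain ⟨κ, hκ, rfl⟩ := exists_eq_neg_sq_of_isEigenvalue hW hVW hAB h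
    rw [eigenspace_eq_map hW hg hVW hκ]
    infer_instance
  · rw [IsEigenvalue, not_not] at h
    rw [h]
    infer_instance

lemma mem_boundStates_iff (hW : IsRegularPotential W) (hg : IsJostFactor W g g')
    (hVW : ∀ x, 0 < x → V x = W x) {κ : ℝ} (hκ : 0 < κ) :
    κ ∈ boundStates V A B ↔ (gammaMat g g' A B (Complex.I * κ)).det = 0 := by
  have h1 : κ ∈ boundStates V A B ↔
      LinearMap.ker (matOp (gammaMat g g' A B (Complex.I * κ))).toLinearMap ≠ ⊥ := by
    have h2 : IsEigenvalue V A B (-(κ : ℂ) ^ 2) ↔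
        LinearMap.ker (matOp (gammaMat g g' A B (Complex.I * κ))).toLinearMap ≠ ⊥ := by
      rw [IsEigenvalue, eigenspace_eq_map hW hg hVW hκ]
      refine not_congr ⟨fun h => ?_, fun h => by rw [h, Submodule.map_bot]⟩
      rw [← Submodule.map_bot (jostMap hW hg hκ)] at h
      exact Submodule.map_injective_of_injective (injective_jostMap hW hg hκ) h
    exact ⟨fun h => h2.1 h.2, fun h => ⟨hκ, h2.2 h⟩⟩
  rw [h1, ← Matrix.exists_mulVec_eq_zero_iff, Submodule.ne_bot_iff]
  constructor
  · rintro ⟨v, hv, hv0⟩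
    refine ⟨WithLp.ofLp v, fun h => hv0 (by ext i; exact congrFun h i), ?_⟩
    exact congrArg WithLp.ofLp hv
  · rintro ⟨v, hv, hv0⟩
    refine ⟨WithLp.toLp 2 v, congrArg (WithLp.toLp 2) hv0, fun h => hv (congrArg WithLp.ofLp h)⟩

end Eigenspaces

variable {n : ℕ}

/-! ### Functions with decaying derivatives -/

section DecayOfOrder

variable {X : Type*} [NormedAddCommGroup X] [NormedSpace ℝ X]

/-- `f` is `N` times differentiable on `[0,∞)`, and `f` and its derivatives up to order `N` are
`O(m)` there. -/
def DecayOfOrder (m : ℝ → ℝ) : ℕ → (ℝ → X) → Prop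
  | 0, f => ∃ C, ∀ x, 0 ≤ x → ‖f x‖ ≤ C * m x
  | N + 1, f => (∃ C, ∀ x, 0 ≤ x → ‖f x‖ ≤ C * m x) ∧ ∃ f' : ℝ → X,
      (∀ x, 0 ≤ x → HasDerivWithinAt f (f' x) (Ici 0) x) ∧ DecayOfOrder m N f'

variable {m : ℝ → ℝ} {N : ℕ} {f g : ℝ → X}

lemma DecayOfOrder.bound (h : DecayOfOrder m N f) : ∃ C, ∀ x, 0 ≤ x → ‖f x‖ ≤ C * m x := by
  cases N with
  | zero => exact h
  | succ N => exact h.1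

lemma DecayOfOrder.congr (h : DecayOfOrder m N f) (he : ∀ x, 0 ≤ x → g x = f x) :
    DecayOfOrder m N g := by
  cases N with
  | zero =>
    obtain ⟨C, hC⟩ := h
    exact ⟨C, fun x hx => by rw [he x hx]; exact hC x hx⟩
  | succ N =>
    obtain ⟨⟨C, hC⟩, f', hd, hf'⟩ := h
    exact ⟨⟨C, fun x hx => by rw [he x hx]; exact hC x hx⟩, f',
      fun x hx => (hd x hx).congr (fun y hy => he y hy) (he x hx), hf'⟩

lemma DecayOfOrder.of_succ (h : DecayOfOrder m (N + 1) f) : DecayOfOrder m N f := by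
  induction N generalizing f with
  | zero => exact h.1
  | succ N ih =>
    obtain ⟨hb, f', hd, hf'⟩ := h
    exact ⟨hb, f', hd, ih hf'⟩

lemma DecayOfOrder.mono {m' : ℝ → ℝ} (hm : ∀ x, 0 ≤ x → m x ≤ m' x) (hm0 : ∀ x, 0 ≤ x → 0 ≤ m x)
    (h : DecayOfOrder m N f) : DecayOfOrder m' N f := by
  have key : ∀ u : ℝ → X, (∃ C, ∀ x, 0 ≤ x → ‖u x‖ ≤ C * m x) →
      ∃ C, ∀ x, 0 ≤ x → ‖u x‖ ≤ C * m' x := by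
    rintro u ⟨C, hC⟩
    refine ⟨|C|, fun x hx => (hC x hx).trans ?_⟩
    exact (mul_le_mul_of_nonneg_right (le_abs_self C) (hm0 x hx)).trans
      (mul_le_mul_of_nonneg_left (hm x hx) (abs_nonneg C))
  induction N generalizing f with
  | zero => exact key f h
  | succ N ih =>
    obtain ⟨hb, f', hd, hf'⟩ := h
    exact ⟨key f hb, f', hd, ih hf'⟩

lemma DecayOfOrder.neg (h : DecayOfOrder m N f) : DecayOfOrder m N (fun x => -f x) := by
  induction N generalizing f with
  | zero =>
    obtain ⟨C, hC⟩ := h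
    exact ⟨C, fun x hx => by rw [norm_neg]; exact hC x hx⟩
  | succ N ih =>
    obtain ⟨⟨C, hC⟩, f', hd, hf'⟩ := h
    exact ⟨⟨C, fun x hx => by rw [norm_neg]; exact hC x hx⟩, _, fun x hx => (hd x hx).neg, ih hf'⟩

lemma DecayOfOrder.add (hf : DecayOfOrder m N f) (hg : DecayOfOrder m N g) :
    DecayOfOrder m N (fun x => f x + g x) := by
  have key : ∀ u v : ℝ → X, (∃ C, ∀ x, 0 ≤ x → ‖u x‖ ≤ C * m x) →
      (∃ C, ∀ x, 0 ≤ x → ‖v x‖ ≤ C * m x) → ∃ C, ∀ x, 0 ≤ x → ‖u x + v x‖ ≤ C * m x := by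
    rintro u v ⟨C, hC⟩ ⟨D, hD⟩
    exact ⟨C + D, fun x hx => by rw [add_mul]; exact norm_add_le_of_le (hC x hx) (hD x hx)⟩
  induction N generalizing f g with
  | zero => exact key f g hf hg
  | succ N ih =>
    obtain ⟨hb, f', hd, hf'⟩ := hf
    obtain ⟨hb2, g', hd2, hg'⟩ := hg
    exact ⟨key f g hb hb2, _, fun x hx => (hd x hx).add (hd2 x hx), ih hf' hg'⟩

lemma DecayOfOrder.mul {f g : ℝ → Matrix (Fin n) (Fin n) ℂ}
    (hf : DecayOfOrder m N f) (hg : DecayOfOrder (fun _ => 1) N g) :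
    DecayOfOrder m N (fun x => f x * g x) := by
  have key : ∀ u v : ℝ → Matrix (Fin n) (Fin n) ℂ, (∃ C, ∀ x, 0 ≤ x → ‖u x‖ ≤ C * m x) →
      (∃ C, ∀ x : ℝ, 0 ≤ x → ‖v x‖ ≤ C * 1) → ∃ C, ∀ x, 0 ≤ x → ‖u x * v x‖ ≤ C * m x := by
    rintro u v ⟨C, hC⟩ ⟨D, hD⟩
    refine ⟨C * D, fun x hx => (norm_mul_le _ _).trans ?_⟩
    have h1 := mul_le_mul (hC x hx) (hD x hx) (norm_nonneg _) ((norm_nonneg _).trans (hC x hx))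
    linarith
  induction N generalizing f g with
  | zero => exact key f g hf hg
  | succ N ih =>
    obtain ⟨hb, f', hd, hf'⟩ := id hf
    obtain ⟨hb2, g', hd2, hg'⟩ := id hg
    exact ⟨key f g hb hb2, _, fun x hx => (hd x hx).mul (hd2 x hx),
      (ih hf' hg.of_succ).add (ih hf.of_succ hg')⟩

lemma DecayOfOrder.derivWithin (h : DecayOfOrder m (N + 1) f) :
    DecayOfOrder m N (derivWithin f (Ici 0)) := by
  obtain ⟨-, f', hd, hf'⟩ := h
  exact hf'.congr fun x hx => (hd x hx).derivWithin (uniqueDiffOn_Ici 0 x hx)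

lemma DecayOfOrder.hasDerivWithinAt (h : DecayOfOrder m (N + 1) f) {x : ℝ} (hx : 0 ≤ x) :
    HasDerivWithinAt f (_root_.derivWithin f (Ici 0) x) (Ici 0) x := by
  obtain ⟨-, f', hd, -⟩ := h
  exact (hd x hx).differentiableWithinAt.hasDerivWithinAt

lemma DecayOfOrder.continuousOn (h : DecayOfOrder m (N + 1) f) : ContinuousOn f (Ici 0) :=
  fun _ hx => (h.hasDerivWithinAt hx).continuousWithinAt

end DecayOfOrder

/-! ### Regularization of the potential -/

section Regularization

/-- A function with bounded derivative on `(0,∞)` has a limit at `0`. -/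
lemma exists_tendsto_of_bounded_deriv {X : Type*} [NormedAddCommGroup X] [NormedSpace ℝ X]
    [CompleteSpace X] {φ φ' : ℝ → X} (hd : ∀ x, 0 < x → HasDerivAt φ (φ' x) x) {C : ℝ}
    (hC : ∀ x, 0 < x → ‖φ' x‖ ≤ C) : ∃ l, Tendsto φ (𝓝[>] 0) (𝓝 l) := by
  have hlip : ∀ x ∈ Ioi (0:ℝ), ∀ y ∈ Ioi (0:ℝ), ‖φ y - φ x‖ ≤ C * ‖y - x‖ := fun x hx y hy =>
    (convex_Ioi (0:ℝ)).norm_image_sub_le_of_norm_hasDerivWithin_le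
      (fun z hz => (hd z hz).hasDerivWithinAt) (fun z hz => hC z hz) hx hy
  have hC0 : 0 ≤ C := (norm_nonneg _).trans (hC 1 one_pos)
  have hu : UniformContinuousOn φ (Ioi 0) := by
    refine (LipschitzOnWith.of_dist_le_mul (K := Real.toNNReal C) fun x hx y hy => ?_).uniformContinuousOn
    rw [dist_eq_norm, dist_eq_norm, Real.coe_toNNReal _ hC0]
    exact hlip y hy x hx
  have hcauchy : Cauchy (map φ (𝓝[>] (0:ℝ))) :=
    (cauchy_nhds.mono nhdsWithin_le_nhds).map_of_le hu inf_le_right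
  exact CompleteSpace.complete hcauchy

/-- The potential extended by its limit at `0`. -/
noncomputable def extendZero {X : Type*} (φ : ℝ → X) (l : X) (x : ℝ) : X :=
  if 0 < x then φ x else l

lemma extendZero_of_pos {X : Type*} (φ : ℝ → X) (l : X) {x : ℝ} (hx : 0 < x) :
    extendZero φ l x = φ x := if_pos hx

lemma extendZero_zero {X : Type*} (φ : ℝ → X) (l : X) : extendZero φ l 0 = l :=
  if_neg (lt_irrefl 0)

lemma extendZero_eventuallyEq {X : Type*} (φ : ℝ → X) (l : X) {x : ℝ} (hx : 0 < x) :
    extendZero φ l =ᶠ[𝓝 x] φ := by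
  filter_upwards [Ioi_mem_nhds hx] with y hy using extendZero_of_pos φ l hy

lemma hasDerivWithinAt_extendZero {X : Type*} [NormedAddCommGroup X] [NormedSpace ℝ X]
    {φ φ' : ℝ → X} {l l' : X}
    (hd : ∀ x, 0 < x → HasDerivAt φ (φ' x) x) (hl : Tendsto φ (𝓝[>] 0) (𝓝 l))
    (hl' : Tendsto φ' (𝓝[>] 0) (𝓝 l')) {x : ℝ} (hx : 0 ≤ x) :
    HasDerivWithinAt (extendZero φ l) (extendZero φ' l' x) (Ici 0) x := by
  have hpos : ∀ x, 0 < x → HasDerivAt (extendZero φ l) (φ' x) x := fun x hx =>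
    (hd x hx).congr_of_eventuallyEq (extendZero_eventuallyEq φ l hx)
  rcases hx.eq_or_lt with rfl | hx
  · rw [extendZero_zero]
    refine hasDerivWithinAt_Ici_of_tendsto_deriv (s := Ioi 0)
      (fun y hy => (hpos y hy).differentiableAt.differentiableWithinAt) ?_ self_mem_nhdsWithin ?_
    · rw [ContinuousWithinAt, extendZero_zero]
      refine hl.congr' ?_
      filter_upwards [self_mem_nhdsWithin] with y hy using (extendZero_of_pos φ l hy).symm
    · refine hl'.congr' ?_
      filter_upwards [self_mem_nhdsWithin] with y hy using (hpos y hy).deriv.symm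
  · rw [extendZero_of_pos _ _ hx]
    exact (hpos x hx).hasDerivWithinAt

lemma norm_extendZero_le {X : Type*} [NormedAddCommGroup X]
    {φ : ℝ → X} {l : X} (hl : Tendsto φ (𝓝[>] 0) (𝓝 l)) {m : ℝ → ℝ}
    (hm : ContinuousWithinAt m (Ioi 0) 0) (hle : ∀ x, 0 < x → ‖φ x‖ ≤ m x) {x : ℝ} (hx : 0 ≤ x) :
    ‖extendZero φ l x‖ ≤ m x := by
  rcases hx.eq_or_lt with rfl | hx
  · rw [extendZero_zero]
    refine le_of_tendsto_of_tendsto hl.norm hm ?_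
    filter_upwards [self_mem_nhdsWithin] with y hy using hle y hy
  · rw [extendZero_of_pos _ _ hx]; exact hle x hx

/-- An admissible potential agrees on `(0,∞)` with a regular one, whose derivatives on `[0,∞)` are
all `O((1+x)^(-ρ))` with `ρ > 1`. -/
lemma exists_regularization {V : ℝ → Matrix (Fin n) (Fin n) ℂ} (hV : IsAdmissiblePotential V) :
    ∃ W : ℝ → Matrix (Fin n) (Fin n) ℂ, IsRegularPotential W ∧ (∀ x, 0 < x → V x = W x) ∧
      ∃ ρ : ℝ, 1 < ρ ∧ ∀ N, DecayOfOrder (fun x : ℝ => (1 + x) ^ (-ρ)) N W := by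
  obtain ⟨ρ, hρ, hρ2, hdec⟩ := hV.decay
  have hd : ∀ j x, 0 < x → HasDerivAt (iteratedDeriv j V) (iteratedDeriv (j + 1) V x) x := by
    intro j x hx
    have hVx : ContDiffAt ℝ ∞ V x := hV.smooth.contDiffAt (Ioi_mem_nhds hx)
    rw [iteratedDeriv_succ]
    have h1 : DifferentiableAt ℝ (iteratedFDeriv ℝ j V) x :=
      ContDiffAt.differentiableAt_iteratedFDeriv hVx (by exact_mod_cast ENat.natCast_lt_top j)
    rw [iteratedDeriv_eq_equiv_comp]
    exact ((ContinuousMultilinearMap.piFieldEquiv ℝ (Fin j)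
      (Matrix (Fin n) (Fin n) ℂ)).symm.toContinuousLinearEquiv.differentiableAt.comp x
        h1).hasDerivAt
  have hb : ∀ j, ∃ C, ∀ x : ℝ, 0 < x → ‖iteratedDeriv j V x‖ ≤ C * (1 + x) ^ (-ρ) := by
    intro j
    obtain ⟨C, hC⟩ := hdec j
    refine ⟨|C|, fun x hx => (hC x hx).trans ?_⟩
    refine mul_le_mul (le_abs_self C) ?_ (by positivity) (abs_nonneg C)
    exact Real.rpow_le_rpow_of_exponent_le (by linarith) (by linarith [(Nat.cast_nonneg j : (0:ℝ) ≤ j)])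
  have hle1 : ∀ x : ℝ, 0 ≤ x → (1 + x) ^ (-ρ) ≤ 1 := fun x hx =>
    Real.rpow_le_one_of_one_le_of_nonpos (by linarith) (by linarith)
  have hlim : ∀ j, ∃ l, Tendsto (iteratedDeriv j V) (𝓝[>] 0) (𝓝 l) := by
    intro j
    obtain ⟨C, hC⟩ := hb (j + 1)
    refine exists_tendsto_of_bounded_deriv (C := |C|) (hd j) fun x hx => (hC x hx).trans ?_
    have := hle1 x hx.le
    have h0 : 0 ≤ (1 + x) ^ (-ρ) := by positivity
    nlinarith [le_abs_self C, abs_nonneg C]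
  choose l hl using hlim
  let U : ℕ → ℝ → Matrix (Fin n) (Fin n) ℂ := fun j => extendZero (iteratedDeriv j V) (l j)
  have hU : ∀ N j, DecayOfOrder (fun x : ℝ => (1 + x) ^ (-ρ)) N (U j) := by
    have hbd : ∀ j, ∃ C, ∀ x : ℝ, 0 ≤ x → ‖U j x‖ ≤ C * (1 + x) ^ (-ρ) := by
      intro j
      obtain ⟨C, hC⟩ := hb j
      refine ⟨C, fun x hx => norm_extendZero_le (m := fun x => C * (1 + x) ^ (-ρ)) (hl j) ?_ hC hx⟩
      refine (ContinuousAt.mul continuousAt_const ?_).continuousWithinAt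
      exact ContinuousAt.rpow_const (by fun_prop) (Or.inl (by norm_num))
    intro N
    induction N with
    | zero => exact hbd
    | succ N ih =>
      exact fun j => ⟨hbd j, U (j + 1), fun x hx =>
        hasDerivWithinAt_extendZero (hd j) (hl j) (hl (j + 1)) hx, ih (j + 1)⟩
  have hU0 : ∀ x, 0 < x → U 0 x = V x := fun x hx => by
    rw [show U 0 x = iteratedDeriv 0 V x from extendZero_of_pos _ _ hx, iteratedDeriv_zero]
  have hVint : ∀ w : ℝ → ℝ, Continuous w → (∀ x, 0 < x → 0 ≤ w x ∧ w x ≤ 1 + x) →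
      IntegrableOn (fun x => w x * ‖V x‖) (Ioi 0) := by
    intro w hwc hw
    refine hV.faddeev.mono' ?_ ?_
    · exact (hwc.continuousOn.mul hV.smooth.continuousOn.norm).aestronglyMeasurable
        measurableSet_Ioi
    · refine (ae_restrict_iff' measurableSet_Ioi).2 (Eventually.of_forall fun x hx => ?_)
      obtain ⟨h1, h2⟩ := hw x hx
      rw [Real.norm_of_nonneg (by positivity)]
      exact mul_le_mul_of_nonneg_right h2 (norm_nonneg _)
  have hUc : ContinuousOn (U 0) (Ici 0) := (hU 1 0).continuousOn
  have hWU : ∀ x, 0 ≤ x → extendLeft (U 0) x = U 0 x := fun x hx => extendLeft_of_nonneg _ hx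
  have hWV : ∀ x, 0 < x → extendLeft (U 0) x = V x := fun x hx => by rw [hWU x hx.le, hU0 x hx]
  have hUself : ∀ x, 0 ≤ x → (U 0 x)ᴴ = U 0 x := by
    intro x hx
    have h0 : EqOn (fun x => (U 0 x)ᴴ) (U 0) (closure (Ioi 0)) := by
      refine EqOn.of_subset_closure (s := Ioi (0:ℝ)) (fun y hy => ?_) ?_ ?_ subset_closure le_rfl
      · simp only [hU0 y hy]; exact hV.selfadjoint y hy
      · rw [closure_Ioi]
        exact (continuous_id.matrix_conjTranspose).comp_continuousOn hUc
      · rw [closure_Ioi]; exact hUc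
    rw [closure_Ioi] at h0
    exact h0 hx
  refine ⟨extendLeft (U 0), ⟨continuous_extendLeft hUc, integrable_extendLeft ?_, ?_, ?_, ?_⟩,
    fun x hx => (hWV x hx).symm, ρ, hρ, fun N => (hU N 0).congr fun x hx => hWU x hx⟩
  · have h1 := hVint (fun _ => 1) continuous_const fun x hx => ⟨zero_le_one, by linarith⟩
    simp only [one_mul] at h1
    have h2 : IntegrableOn V (Ioi 0) := (integrable_norm_iff
      (hV.smooth.continuousOn.aestronglyMeasurable measurableSet_Ioi)).1 h1
    exact h2.congr_fun (fun x hx => (hU0 x hx).symm) measurableSet_Ioi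
  · refine (hVint (fun x => |x|) continuous_abs fun x hx =>
      ⟨abs_nonneg x, by rw [abs_of_pos hx]; linarith⟩).congr_fun (fun x hx => ?_) measurableSet_Ioi
    simp only [hWV x hx]
  · intro x
    rw [extendLeft, Matrix.conjTranspose_smul, hUself _ (le_max_right x 0)]
    simp
  · obtain ⟨C, hC⟩ := (hU 0 0).bound
    refine ⟨|C|, fun x => ?_⟩
    have h0 : 0 ≤ max x 0 := le_max_right x 0
    rw [extendLeft, norm_smul, Real.norm_of_nonneg (Real.exp_pos _).le]
    have h1 : Real.exp (min x 0) ≤ 1 := Real.exp_le_one_iff.2 (min_le_right _ _)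
    have h2 := hC _ h0
    have h3 := hle1 _ h0
    have h4 : 0 ≤ (1 + max x 0) ^ (-ρ) := by positivity
    have h5 : ‖U 0 (max x 0)‖ ≤ |C| := h2.trans (by nlinarith [le_abs_self C, abs_nonneg C])
    have := mul_le_mul h1 h5 (norm_nonneg _) zero_le_one
    linarith

end Regularization

variable {n : ℕ}

/-! ### Asymptotic expansion of the Jost solution -/

section Coefficients

variable {V W : ℝ → Matrix (Fin n) (Fin n) ℂ} {ρ : ℝ}

lemma bCoeff_succ_eq (hVW : ∀ x, 0 < x → V x = W x) (l : ℕ) {x : ℝ} (hx : 0 ≤ x) :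
    bCoeff V (l + 1) x = -derivWithin (bCoeff V l) (Ici 0) x -
      ∫ y in Ioi x, extendLeft (fun y => W y * bCoeff V l y) y := by
  have h : EqOn (fun y => V y * bCoeff V l y)
      (extendLeft fun y => W y * bCoeff V l y) (Ioi x) := by
    intro y hy
    have hy0 : 0 < y := lt_of_le_of_lt hx hy
    rw [extendLeft_of_nonneg (fun y => W y * bCoeff V l y) hy0.le, ← hVW y hy0]
  rw [bCoeff]
  simp only
  rw [setIntegral_congr_fun measurableSet_Ioi h]

lemma one_add_rpow_neg_le_one (hρ : 1 < ρ) {x : ℝ} (hx : 0 ≤ x) : (1 + x) ^ (-ρ) ≤ 1 :=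
  Real.rpow_le_one_of_one_le_of_nonpos (by linarith) (by linarith)

lemma bCoeff_step (hW : IsRegularPotential W) (hVW : ∀ x, 0 < x → V x = W x) (hρ : 1 < ρ) {l : ℕ}
    (h1 : ∀ N, DecayOfOrder (fun _ => 1) N (bCoeff V l))
    (h2 : ∀ N, DecayOfOrder (fun x : ℝ => (1 + x) ^ (-ρ)) N (derivWithin (bCoeff V l) (Ici 0))) :
    (∀ x, 0 ≤ x → HasDerivWithinAt (bCoeff V (l + 1))
      (-derivWithin (derivWithin (bCoeff V l) (Ici 0)) (Ici 0) x + W x * bCoeff V l x) (Ici 0) x) ∧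
    Tendsto (bCoeff V (l + 1)) atTop (𝓝 0) ∧
    Tendsto (derivWithin (bCoeff V l) (Ici 0)) atTop (𝓝 0) := by
  have hmt : Tendsto (fun x : ℝ => (1 + x) ^ (-ρ)) atTop (𝓝 0) :=
    (tendsto_rpow_neg_atTop (by linarith)).comp (tendsto_atTop_add_const_left _ 1 tendsto_id)
  set φ := extendLeft (fun y => W y * bCoeff V l y) with hφ
  obtain ⟨C, hC⟩ := (h1 0).bound
  simp only [mul_one] at hC
  have hφc : Continuous φ := continuous_extendLeft
    (hW.continuous.continuousOn.mul (h1 1).continuousOn)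
  have hφi : Integrable φ := integrable_extendLeft
    (integrableOn_mul_of_bound hW.continuous hW.integrable (h1 1).continuousOn hC)
  have t2 : Tendsto (derivWithin (bCoeff V l) (Ici 0)) atTop (𝓝 0) := by
    obtain ⟨D, hD⟩ := (h2 0).bound
    refine squeeze_zero_norm' (by filter_upwards [Ici_mem_atTop (0:ℝ)] with x hx using hD x hx) ?_
    simpa using hmt.const_mul D
  refine ⟨fun x hx => ?_, ?_, t2⟩
  · have e := ((h2 1).hasDerivWithinAt hx).neg.sub
      (hasDerivAt_integral_Ioi hφc (a := 0) hφi.integrableOn x).hasDerivWithinAt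
    refine (e.congr_deriv ?_).congr (fun y hy => bCoeff_succ_eq hVW l hy)
      (bCoeff_succ_eq hVW l hx)
    rw [hφ, extendLeft_of_nonneg _ hx]
    abel
  · have e := t2.neg.sub (tendsto_integral_Ioi_zero hφc (a := 0) hφi.integrableOn)
    rw [neg_zero, sub_zero] at e
    refine e.congr' ?_
    filter_upwards [Ici_mem_atTop (0:ℝ)] with x hx using (bCoeff_succ_eq hVW l hx).symm

/-- Each `b_l` is smooth up to `0` and bounded, and `b_l'` and its derivatives are
`O((1+x)^(-ρ))`. -/
lemma decayOfOrder_bCoeff (hW : IsRegularPotential W) (hVW : ∀ x, 0 < x → V x = W x) (hρ : 1 < ρ)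
    (hd : ∀ N, DecayOfOrder (fun x : ℝ => (1 + x) ^ (-ρ)) N W) (l : ℕ) :
    (∀ N, DecayOfOrder (fun _ => 1) N (bCoeff V l)) ∧
    (∀ N, DecayOfOrder (fun x : ℝ => (1 + x) ^ (-ρ)) N (derivWithin (bCoeff V l) (Ici 0))) := by
  set m : ℝ → ℝ := fun x => (1 + x) ^ (-ρ) with hm
  have hm1 : ∀ x, 0 ≤ x → m x ≤ 1 := fun x hx => one_add_rpow_neg_le_one hρ hx
  have hm0 : ∀ x, 0 ≤ x → 0 ≤ m x := fun x hx => by simp only [hm]; positivity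
  induction l with
  | zero =>
    have h0 : ∀ N, DecayOfOrder m N (fun _ : ℝ => (0 : Matrix (Fin n) (Fin n) ℂ)) := by
      intro N
      induction N with
      | zero => exact ⟨0, fun x _ => by simp⟩
      | succ N ih => exact ⟨⟨0, fun x _ => by simp⟩, _, fun x _ => hasDerivWithinAt_const _ _ _, ih⟩
    have hb1 : ∃ C, ∀ x : ℝ, 0 ≤ x → ‖(1 : Matrix (Fin n) (Fin n) ℂ)‖ ≤ C * 1 :=
      ⟨1, fun _ _ => by rw [mul_one]; exact norm_one_le⟩
    have h1 : ∀ N, DecayOfOrder (fun _ => 1) N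
        (fun _ : ℝ => (1 : Matrix (Fin n) (Fin n) ℂ)) := by
      intro N
      cases N with
      | zero => exact hb1
      | succ N => exact ⟨hb1, _, fun x _ => hasDerivWithinAt_const _ _ _, (h0 N).mono hm1 hm0⟩
    have e : bCoeff V 0 = fun _ => 1 := by ext1 x; rw [bCoeff]
    rw [e]
    refine ⟨h1, fun N => (h0 N).congr fun x _ => ?_⟩
    rw [derivWithin_fun_const]; rfl
  | succ l ih =>
    obtain ⟨h1, h2⟩ := ih
    obtain ⟨hder, ht, -⟩ := bCoeff_step hW hVW hρ h1 h2
    have hdec : ∀ N, DecayOfOrder m N (fun x =>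
        -derivWithin (derivWithin (bCoeff V l) (Ici 0)) (Ici 0) x + W x * bCoeff V l x) :=
      fun N => (h2 (N + 1)).derivWithin.neg.add ((hd N).mul (h1 N))
    have hbd : ∃ C, ∀ x : ℝ, 0 ≤ x → ‖bCoeff V (l + 1) x‖ ≤ C * 1 := by
      simp only [mul_one]
      exact exists_bound_of_tendsto (fun x hx => (hder x hx).continuousWithinAt) ht
    refine ⟨fun N => ?_, fun N => (hdec N).congr fun x hx =>
      (hder x hx).derivWithin (uniqueDiffOn_Ici 0 x hx)⟩
    cases N with
    | zero => exact hbd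
    | succ N => exact ⟨hbd, _, hder, (hdec N).mono hm1 hm0⟩

/-- The error of the partial sum `∑_{l ≤ N} b_l (2ik)^{-l}` of the expansion of `e^{-ikx} f(k,x)`
solves the Jost equation with source term `(2ik)^{-N} b_{N+1}'`. -/
lemma isDecayingSolution_error {g g' : ℂ → ℝ → Matrix (Fin n) (Fin n) ℂ}
    (hW : IsRegularPotential W) (hVW : ∀ x, 0 < x → V x = W x) (hρ : 1 < ρ)
    (hd : ∀ N, DecayOfOrder (fun x : ℝ => (1 + x) ^ (-ρ)) N W) (hg : IsJostFactor W g g')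
    {k : ℂ} (hk : k ∈ puncturedHalfPlane) (N : ℕ) :
    IsDecayingSolution W (fun x => (2 * Complex.I * k)⁻¹ ^ N •
        derivWithin (bCoeff V (N + 1)) (Ici 0) x) k 0
      (fun x => g k x - ∑ l ∈ Finset.range (N + 1), (2 * Complex.I * k)⁻¹ ^ l • bCoeff V l x)
      (fun x => g' k x - ∑ l ∈ Finset.range (N + 1), (2 * Complex.I * k)⁻¹ ^ l •
        derivWithin (bCoeff V l) (Ici 0) x) := by
  set s := (2 * Complex.I * k)⁻¹ with hs
  have hs1 : 2 * Complex.I * k * s = 1 := mul_inv_cancel₀ (two_I_mul_ne_zero hk.2)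
  have hb := decayOfOrder_bCoeff hW hVW hρ hd
  have hst := fun l => bCoeff_step hW hVW hρ (hb l).1 (hb l).2
  set b := bCoeff V with hbdef
  have db : ∀ l x, 0 < x → HasDerivAt (b l) (derivWithin (b l) (Ici 0) x) x := fun l x hx =>
    (((hb l).1 1).hasDerivWithinAt hx.le).hasDerivAt (Ici_mem_nhds hx)
  have e1 : ∀ l x, 0 ≤ x → derivWithin (b (l + 1)) (Ici 0) x =
      -derivWithin (derivWithin (b l) (Ici 0)) (Ici 0) x + W x * b l x := fun l x hx =>
    ((hst l).1 x hx).derivWithin (uniqueDiffOn_Ici 0 x hx)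
  have db' : ∀ l x, 0 < x → HasDerivAt (derivWithin (b l) (Ici 0))
      (W x * b l x - derivWithin (b (l + 1)) (Ici 0) x) x := fun l x hx => by
    refine ((((hb l).2 1).hasDerivWithinAt hx.le).hasDerivAt (Ici_mem_nhds hx)).congr_deriv ?_
    rw [e1 l x hx.le]; abel
  have b0 : b 0 = fun _ => 1 := by ext1 x; rw [hbdef, bCoeff]
  have b0' : ∀ x, derivWithin (b 0) (Ici 0) x = 0 := fun x => by
    rw [b0, derivWithin_fun_const]; rfl
  -- the term `2ik` of the equation shifts the summation index; the sums telescope except for `l = N`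
  have tele : ∀ x, (2 * Complex.I * k) • ∑ l ∈ Finset.range (N + 1),
      s ^ l • derivWithin (b l) (Ici 0) x =
      ∑ l ∈ Finset.range N, s ^ l • derivWithin (b (l + 1)) (Ici 0) x := by
    intro x
    rw [Finset.sum_range_succ', b0', smul_zero, add_zero, Finset.smul_sum]
    refine Finset.sum_congr rfl fun l _ => ?_
    rw [smul_smul, pow_succ, mul_comm (s ^ l) s, ← mul_assoc, hs1, one_mul]
  refine ⟨?_, ?_, ?_, ?_, ?_, ?_, ?_⟩
  · exact ContinuousOn.sub (fun x _ => (hg.hasDeriv k hk x).continuousAt.continuousWithinAt)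
      (continuousOn_finsetSum _ fun l _ => ((hb l).1 1).continuousOn.const_smul (s ^ l))
  · exact ContinuousOn.sub (fun x _ => (hg.hasDeriv' k hk x).continuousAt.continuousWithinAt)
      (continuousOn_finsetSum _ fun l _ => ((hb l).2 1).continuousOn.const_smul (s ^ l))
  · intro x hx
    exact (hg.hasDeriv k hk x).sub (HasDerivAt.fun_sum fun l _ => (db l x hx).const_smul (s ^ l))
  · intro x hx
    refine ((hg.hasDeriv' k hk x).sub
      (HasDerivAt.fun_sum fun l _ => (db' l x hx).const_smul (s ^ l))).congr_deriv ?_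
    rw [smul_sub (2 * Complex.I * k), tele, Matrix.mul_sub, Finset.mul_sum]
    simp only [smul_sub, Finset.sum_sub_distrib, Matrix.mul_smul]
    rw [Finset.sum_range_succ (fun l => s ^ l • derivWithin (b (l + 1)) (Ici 0) x)]
    abel
  · obtain ⟨C, hC⟩ := ((hb (N + 1)).2 1).bound
    have hi : IntegrableOn (fun x : ℝ => ‖s ^ N‖ * (C * (x + 1) ^ (-ρ))) (Ioi 0) :=
      ((integrableOn_add_rpow_Ioi_of_lt (by linarith) (by norm_num)).const_mul C).const_mul _
    refine hi.mono' ?_ ?_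
    · exact ((((hb (N + 1)).2 1).continuousOn.const_smul (s ^ N)).mono
        Ioi_subset_Ici_self).aestronglyMeasurable measurableSet_Ioi
    · refine (ae_restrict_iff' measurableSet_Ioi).2 (Eventually.of_forall fun x hx => ?_)
      rw [norm_smul, add_comm x 1]
      exact mul_le_mul_of_nonneg_left (hC x (le_of_lt hx)) (norm_nonneg _)
  · have h1 : Tendsto (fun x => ∑ l ∈ Finset.range (N + 1), s ^ l • b l x) atTop (𝓝 1) := by
      have h2 : Tendsto (fun x => ∑ l ∈ Finset.range N, s ^ (l + 1) • b (l + 1) x) atTop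
          (𝓝 (∑ l ∈ Finset.range N, s ^ (l + 1) • 0)) :=
        tendsto_finsetSum _ fun l _ => (hst l).2.1.const_smul (s ^ (l + 1))
      have h3 := h2.add_const (1 : Matrix (Fin n) (Fin n) ℂ)
      simp only [smul_zero, Finset.sum_const_zero, zero_add] at h3
      refine h3.congr fun x => ?_
      rw [Finset.sum_range_succ', b0]
      simp
    simpa using (hg.tendsto k hk).sub h1
  · have h2 : Tendsto (fun x => ∑ l ∈ Finset.range (N + 1), s ^ l •
        derivWithin (b l) (Ici 0) x) atTop (𝓝 (∑ l ∈ Finset.range (N + 1), s ^ l • 0)) :=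
      tendsto_finsetSum _ fun l _ => (hst l).2.2.const_smul (s ^ l)
    simpa using (hg.tendsto' k hk).sub h2

/-- The source of the error equation is `O(k^{-N})` in `L¹`, and the bounds for the solution in terms
of the source are uniform in `|k| ≥ 1`. -/
lemma exists_norm_error_le {g g' : ℂ → ℝ → Matrix (Fin n) (Fin n) ℂ}
    (hW : IsRegularPotential W) (hVW : ∀ x, 0 < x → V x = W x) (hρ : 1 < ρ)
    (hd : ∀ N, DecayOfOrder (fun x : ℝ => (1 + x) ^ (-ρ)) N W) (hg : IsJostFactor W g g')
    (N : ℕ) : ∃ C : ℝ, ∀ k ∈ puncturedHalfPlane, 1 ≤ ‖k‖ →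
      ‖g k 0 - ∑ l ∈ Finset.range (N + 1), (2 * Complex.I * k)⁻¹ ^ l • bCoeff V l 0‖
        ≤ C * ‖k‖⁻¹ ^ N ∧
      ‖g' k 0 - ∑ l ∈ Finset.range (N + 1), (2 * Complex.I * k)⁻¹ ^ l •
        derivWithin (bCoeff V l) (Ici 0) 0‖ ≤ C * ‖k‖⁻¹ ^ N := by
  set S := ∫ y in Ioi (0:ℝ), ‖derivWithin (bCoeff V (N + 1)) (Ici 0) y‖ with hS
  set w := ∫ y, ‖W y‖ with hw
  have hS0 : 0 ≤ S := setIntegral_nonneg measurableSet_Ioi fun y _ => norm_nonneg _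
  have hw0 : 0 ≤ w := integral_nonneg fun y => norm_nonneg _
  refine ⟨((w + 1) * (2 * Real.exp (2 * w)) + 1) * S, fun k hk hk1 => ?_⟩
  have h := isDecayingSolution_error hW hVW hρ hd hg hk N
  have h1 := h.norm_le hW.continuous hW.integrable hk le_rfl
  have h2 := h.norm_deriv_le hW.continuous hW.integrable hk le_rfl
  simp only [norm_smul, norm_pow, norm_inv, norm_mul, Complex.norm_I, Complex.norm_ofNat,
    mul_one, integral_const_mul] at h1 h2
  rw [← hS, ← hw] at h1 h2
  have hkpos : 0 < ‖k‖ := by linarith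
  have hk2 : 2 / ‖k‖ ≤ 2 := by rw [div_le_iff₀ hkpos]; linarith
  have he : Real.exp (2 / ‖k‖ * w) ≤ Real.exp (2 * w) :=
    Real.exp_le_exp.2 (mul_le_mul_of_nonneg_right hk2 hw0)
  have hp : (2 * ‖k‖)⁻¹ ^ N ≤ ‖k‖⁻¹ ^ N := by
    gcongr; linarith
  have hq : 2 / ‖k‖ * Real.exp (2 / ‖k‖ * w) ≤ 2 * Real.exp (2 * w) :=
    mul_le_mul hk2 he (Real.exp_pos _).le zero_le_two
  have hq0 : 0 ≤ 2 / ‖k‖ * Real.exp (2 / ‖k‖ * w) := by positivity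
  have hpS : (2 * ‖k‖)⁻¹ ^ N * S ≤ S * ‖k‖⁻¹ ^ N := by
    rw [mul_comm S]; exact mul_le_mul_of_nonneg_right hp hS0
  have hpS0 : 0 ≤ (2 * ‖k‖)⁻¹ ^ N * S := by positivity
  set X := 2 * Real.exp (2 * w) with hX
  have hX0 : 0 ≤ X := by positivity
  constructor
  · refine h1.trans ((mul_le_mul hq hpS hpS0 hX0).trans ?_)
    rw [mul_assoc _ S, ← sub_nonneg, ← sub_mul]
    have : 0 ≤ (w + 1) * X + 1 - X := by nlinarith
    positivity
  · have h3 : w * (2 / ‖k‖ * Real.exp (2 / ‖k‖ * w)) + 1 ≤ (w + 1) * X + 1 := by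
      nlinarith [mul_le_mul_of_nonneg_left hq hw0]
    refine h2.trans ((mul_le_mul h3 hpS hpS0 (by positivity)).trans ?_)
    rw [mul_assoc _ S]

end Coefficients

variable {n : ℕ}

/-! ### The Jost solution and the Jost matrix -/

section JostSolution

variable {V W : ℝ → Matrix (Fin n) (Fin n) ℂ} {g g' f f' : ℂ → ℝ → Matrix (Fin n) (Fin n) ℂ}

lemma exp_I_mul_exp_neg (k : ℂ) (x : ℝ) :
    Complex.exp (-(Complex.I * k * x)) * Complex.exp (Complex.I * k * x) = 1 := by
  rw [← Complex.exp_add, neg_add_cancel, Complex.exp_zero]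

/-- The first moment of `W` gives the rate: `x ∫ₓ^∞ ‖W‖ ≤ ∫ₓ^∞ |y| ‖W y‖ dy → 0`. -/
lemma isLittleO_tail_one_div (hW : IsRegularPotential W) {X : Type*} [NormedAddCommGroup X]
    {u : ℝ → X} {K : ℝ} (h : ∀ x, 0 ≤ x → ‖u x‖ ≤ K * ∫ y in Ioi x, ‖W y‖) :
    u =o[atTop] (fun x : ℝ => 1 / x) := by
  have ht : Tendsto (fun x => |K| * ∫ y in Ioi x, |y| * ‖W y‖) atTop (𝓝 0) := by
    simpa using (tendsto_integral_Ioi_zero hW.continuous_moment hW.moment).const_mul |K|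
  rw [Asymptotics.isLittleO_iff]
  intro c hc
  filter_upwards [Ioi_mem_atTop (0:ℝ), ht.eventually (gt_mem_nhds hc)] with x hx hxc
  have hx0 : 0 < x := hx
  have h1 : x * ∫ y in Ioi x, ‖W y‖ ≤ ∫ y in Ioi x, |y| * ‖W y‖ := by
    rw [← integral_const_mul]
    refine setIntegral_mono_on₀ (hW.integrable.norm.integrableOn.const_mul x)
      (hW.moment.mono_set (Ioi_subset_Ioi hx0.le)) measurableSet_Ioi.nullMeasurableSet fun y hy => ?_
    refine mul_le_mul_of_nonneg_right ?_ (norm_nonneg _)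
    exact (le_of_lt hy).trans (le_abs_self y)
  have h0 : 0 ≤ ∫ y in Ioi x, ‖W y‖ := setIntegral_nonneg measurableSet_Ioi fun y _ => norm_nonneg _
  rw [Real.norm_of_nonneg (by positivity), mul_one_div, le_div_iff₀ hx0]
  calc ‖u x‖ * x ≤ (|K| * ∫ y in Ioi x, ‖W y‖) * x := by
        refine mul_le_mul_of_nonneg_right ((h x hx0.le).trans ?_) hx0.le
        exact mul_le_mul_of_nonneg_right (le_abs_self K) h0
    _ ≤ |K| * ∫ y in Ioi x, |y| * ‖W y‖ := by
        rw [mul_assoc, mul_comm _ x]; exact mul_le_mul_of_nonneg_left h1 (abs_nonneg K)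
    _ ≤ c := hxc.le

lemma exists_isJostSolution (hW : IsRegularPotential W) (hVW : ∀ x, 0 < x → V x = W x) :
    ∃ f f' : ℂ → ℝ → Matrix (Fin n) (Fin n) ℂ, IsJostSolution V f f' := by
  obtain ⟨g, g', hg⟩ := exists_isJostFactor hW
  have hd : ∀ k ∈ puncturedHalfPlane, ∀ x : ℝ,
      HasDerivAt (fun x : ℝ => Complex.exp (Complex.I * k * x) • g k x)
        (Complex.exp (Complex.I * k * x) • (g' k x + (Complex.I * k) • g k x)) x := by
    intro k hk x
    refine ((hasDerivAt_exp_I k x).smul (hg.hasDeriv k hk x)).congr_deriv ?_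
    module
  have hd' : ∀ k ∈ puncturedHalfPlane, ∀ x : ℝ, HasDerivAt (fun x : ℝ =>
      Complex.exp (Complex.I * k * x) • (g' k x + (Complex.I * k) • g k x))
        (W x * (Complex.exp (Complex.I * k * x) • g k x) -
          k ^ 2 • (Complex.exp (Complex.I * k * x) • g k x)) x := by
    intro k hk x
    refine ((hasDerivAt_exp_I k x).smul ((hg.hasDeriv' k hk x).add
      ((hg.hasDeriv k hk x).const_smul (Complex.I * k)))).congr_deriv ?_
    have e1 : k ^ 2 = -((Complex.I * k) * (Complex.I * k)) := by
      have hI : Complex.I * Complex.I = -1 := Complex.I_mul_I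
      linear_combination (k ^ 2) * hI
    rw [Matrix.mul_smul, e1]
    simp only [Pi.add_apply, Pi.smul_apply]
    module
  have hexp : ∀ k : ℂ, ∀ x : ℝ, ∀ M : Matrix (Fin n) (Fin n) ℂ,
      Complex.exp (-(Complex.I * k * x)) • Complex.exp (Complex.I * k * x) • M = M :=
    fun k x M => by rw [smul_smul, exp_I_mul_exp_neg, one_smul]
  have hest : ∀ k ∈ puncturedHalfPlane, ∀ x : ℝ, ‖g k x - 1‖ ≤
      2 / ‖k‖ * Real.exp (2 / ‖k‖ * ∫ y, ‖W y‖) * ∫ y in Ioi x, ‖W y‖ := fun k hk x =>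
    (hg.isDecayingSolution hW hk x).norm_le hW.continuous hW.integrable hk le_rfl
  refine ⟨fun k x => Complex.exp (Complex.I * k * x) • g k x,
    fun k x => Complex.exp (Complex.I * k * x) • (g' k x + (Complex.I * k) • g k x),
    fun k h1 h2 x _ => (hd k ⟨h1, h2⟩ x).hasDerivWithinAt,
    fun k h1 h2 x _ => (hd' k ⟨h1, h2⟩ x).continuousAt.continuousWithinAt,
    fun k h1 h2 x hx => by rw [hVW x hx]; exact hd' k ⟨h1, h2⟩ x, fun k h1 h2 => ?_,
    fun k h1 h2 => ?_⟩
  · simp only [hexp]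
    exact isLittleO_tail_one_div hW fun x _ => hest k ⟨h1, h2⟩ x
  · obtain ⟨C, hC, hb⟩ := exists_jost_bound hW hg
    have hIk : Complex.I * k ≠ 0 := mul_ne_zero Complex.I_ne_zero h2
    have e : ∀ x : ℝ, (Complex.exp (-(Complex.I * k * x)) / (Complex.I * k)) •
        Complex.exp (Complex.I * k * x) • (g' k x + (Complex.I * k) • g k x) - 1
        = (Complex.I * k)⁻¹ • g' k x + (g k x - 1) := by
      intro x
      rw [div_eq_inv_mul, mul_smul, hexp, smul_add, smul_smul, inv_mul_cancel₀ hIk, one_smul]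
      abel
    simp only [e]
    refine isLittleO_tail_one_div hW (K := ‖(Complex.I * k)⁻¹‖ * C +
      2 / ‖k‖ * Real.exp (2 / ‖k‖ * ∫ y, ‖W y‖)) fun x hx => ?_
    rw [add_mul]
    refine norm_add_le_of_le ?_ (hest k ⟨h1, h2⟩ x)
    rw [norm_smul, mul_assoc]
    exact mul_le_mul_of_nonneg_left (hb k ⟨h1, h2⟩ x hx).2.1 (norm_nonneg _)

/-- Uniqueness of the Jost solution. -/
lemma IsJostSolution.eq_at_zero (hW : IsRegularPotential W) (hVW : ∀ x, 0 < x → V x = W x)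
    (hg : IsJostFactor W g g') (hf : IsJostSolution V f f') {k : ℂ} (hk : k ∈ puncturedHalfPlane) :
    f k 0 = g k 0 ∧ f' k 0 = g' k 0 + (Complex.I * k) • g k 0 := by
  have hIk : Complex.I * k ≠ 0 := mul_ne_zero Complex.I_ne_zero hk.2
  have hone : (fun x : ℝ => 1 / x) =o[atTop] (fun _ => (1 : ℝ)) := by
    rw [Asymptotics.isLittleO_one_iff]
    simpa using tendsto_inv_atTop_zero (𝕜 := ℝ)
  have t1 := (Asymptotics.isLittleO_one_iff (F := ℝ)).1 ((hf.asymp k hk.1 hk.2).trans hone)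
  have t2 := (Asymptotics.isLittleO_one_iff (F := ℝ)).1 ((hf.asymp' k hk.1 hk.2).trans hone)
  have hed : ∀ x : ℝ, HasDerivAt (fun x : ℝ => Complex.exp (-(Complex.I * k * x)))
      (-(Complex.I * k) * Complex.exp (-(Complex.I * k * x))) x := by
    intro x
    have := hasDerivAt_exp_I (-k) x
    simpa only [mul_neg, neg_mul] using this
  have hec : Continuous fun x : ℝ => Complex.exp (-(Complex.I * k * x)) := by fun_prop
  have hfc : ContinuousOn (f k) (Ici 0) := fun x hx =>
    (hf.hasDeriv k hk.1 hk.2 x hx).continuousWithinAt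
  have h : IsDecayingSolution W (fun _ => 0) k 0
      (fun x => Complex.exp (-(Complex.I * k * x)) • f k x - g k x)
      (fun x => Complex.exp (-(Complex.I * k * x)) • (f' k x - (Complex.I * k) • f k x)
        - g' k x) := by
    refine ⟨?_, ?_, ?_, ?_, integrableOn_zero, ?_, ?_⟩
    · exact (hec.continuousOn.smul hfc).sub
        fun x _ => (hg.hasDeriv k hk x).continuousAt.continuousWithinAt
    · exact (hec.continuousOn.smul ((hf.continuous_deriv k hk.1 hk.2).sub
        (hfc.const_smul (Complex.I * k)))).sub
        fun x _ => (hg.hasDeriv' k hk x).continuousAt.continuousWithinAt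
    · intro x hx
      have hfx := (hf.hasDeriv k hk.1 hk.2 x hx.le).hasDerivAt (Ici_mem_nhds hx)
      refine (((hed x).smul hfx).sub (hg.hasDeriv k hk x)).congr_deriv ?_
      module
    · intro x hx
      have hfx := (hf.hasDeriv k hk.1 hk.2 x hx.le).hasDerivAt (Ici_mem_nhds hx)
      refine (((hed x).smul ((hf.hasDeriv' k hk.1 hk.2 x hx).sub
        (hfx.const_smul (Complex.I * k)))).sub (hg.hasDeriv' k hk x)).congr_deriv ?_
      have e1 : k ^ 2 = -((Complex.I * k) * (Complex.I * k)) := by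
        have hI : Complex.I * Complex.I = -1 := Complex.I_mul_I
        linear_combination (k ^ 2) * hI
      rw [Matrix.mul_sub, Matrix.mul_smul, e1, hVW x hx]
      simp only [Pi.sub_apply, Pi.smul_apply]
      module
    · have := t1.sub ((hg.tendsto k hk).sub_const 1)
      simpa using this
    · have h3 := ((t2.sub t1).const_smul (Complex.I * k)).sub (hg.tendsto' k hk)
      simp only [sub_zero, smul_zero] at h3
      refine h3.congr fun x => ?_
      rw [sub_sub_sub_cancel_right, smul_sub, smul_smul, mul_div_cancel₀ _ hIk, smul_sub]
      rw [smul_comm (Complex.I * k) (Complex.exp _)]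
  have h1 := h.norm_le hW.continuous hW.integrable hk le_rfl
  have h2 := h.norm_deriv_le hW.continuous hW.integrable hk le_rfl
  simp only [norm_zero, integral_zero, mul_zero, norm_le_zero_iff, Complex.ofReal_zero, neg_zero,
    Complex.exp_zero, one_smul, sub_eq_zero] at h1 h2
  exact ⟨h1, by rw [← h2, h1]; abel⟩

lemma neg_conj_mem {k : ℂ} (hk : k ∈ puncturedHalfPlane) :
    -(starRingEnd ℂ k) ∈ puncturedHalfPlane :=
  ⟨by simpa using hk.1, by simpa using hk.2⟩

lemma jostMatrix_eq {A B : Matrix (Fin n) (Fin n) ℂ} (hW : IsRegularPotential W)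
    (hVW : ∀ x, 0 < x → V x = W x)
    (hg : IsJostFactor W g g') (hf : IsJostSolution V f f') {k : ℂ} (hk : k ∈ puncturedHalfPlane) :
    jostMatrix f f' A B k = (gammaMat g g' A B (-(starRingEnd ℂ k)))ᴴ := by
  obtain ⟨e1, e2⟩ := hf.eq_at_zero hW hVW hg (neg_conj_mem hk)
  rw [jostMatrix, gammaMat, e1, e2]
  simp only [Matrix.conjTranspose_sub, Matrix.conjTranspose_mul, Matrix.conjTranspose_conjTranspose]

/-- The expansion of the Jost matrix in powers of `1/(2ik)`. -/
lemma exists_norm_jostMatrix_sub_le {ρ : ℝ} (A B : Matrix (Fin n) (Fin n) ℂ)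
    (hW : IsRegularPotential W) (hVW : ∀ x, 0 < x → V x = W x) (hρ : 1 < ρ)
    (hd : ∀ N, DecayOfOrder (fun x : ℝ => (1 + x) ^ (-ρ)) N W)
    (hf : IsJostSolution V f f') (N : ℕ) :
    ∃ C : ℝ, ∀ k ∈ puncturedHalfPlane, 1 ≤ ‖k‖ →
      ‖(2 * Complex.I * k)⁻¹ • jostMatrix f f' A B k -
        ∑ m ∈ Finset.range (N + 1), (2 * Complex.I * k)⁻¹ ^ m • cCoeff V A B m‖
        ≤ C * ‖k‖⁻¹ ^ N := by
  obtain ⟨g, g', hg⟩ := exists_isJostFactor hW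
  obtain ⟨C, hC⟩ := exists_norm_error_le hW hVW hρ hd hg N
  set D := Bᴴ * bCoeff V N 0 - Aᴴ * derivWithin (bCoeff V N) (Ici 0) 0 with hD
  refine ⟨‖Bᴴ‖ * C + ‖Aᴴ‖ * C + ‖Aᴴ‖ * C + ‖D‖, fun k hk hk1 => ?_⟩
  set q := -(starRingEnd ℂ k) with hq
  have hqU : q ∈ puncturedHalfPlane := neg_conj_mem hk
  have hqn : ‖q‖ = ‖k‖ := by rw [hq, norm_neg, Complex.norm_conj]
  obtain ⟨h1, h2⟩ := hC q hqU (by rw [hqn]; exact hk1)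
  rw [hqn] at h1 h2
  set s := (2 * Complex.I * q)⁻¹ with hs
  have hsk : (2 * Complex.I * k)⁻¹ = star s := by
    simp [hs, hq]
  have hs1 : s * (Complex.I * q) = 1 / 2 := by
    have h0 : Complex.I * q ≠ 0 := mul_ne_zero Complex.I_ne_zero hqU.2
    rw [hs, mul_assoc, mul_inv, mul_assoc, inv_mul_cancel₀ h0]; norm_num
  have hsn : ‖s‖ ≤ ‖k‖⁻¹ := by
    rw [hs, norm_inv, norm_mul, norm_mul, Complex.norm_I, hqn]
    simp only [Complex.norm_ofNat, mul_one]
    gcongr; linarith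
  have hk1' : ‖k‖⁻¹ ≤ 1 := inv_le_one_of_one_le₀ hk1
  have hs1' : ‖s‖ ≤ 1 := hsn.trans hk1'
  set r := g q 0 - ∑ l ∈ Finset.range (N + 1), s ^ l • bCoeff V l 0 with hr
  set r' := g' q 0 - ∑ l ∈ Finset.range (N + 1), s ^ l • derivWithin (bCoeff V l) (Ici 0) 0 with hr'
  let γ : ℕ → Matrix (Fin n) (Fin n) ℂ := fun m => (cCoeff V A B m)ᴴ
  have b0 : bCoeff V 0 0 = 1 := by rw [bCoeff]
  have γ0 : γ 0 = -((1 / 2 : ℂ) • (Aᴴ * bCoeff V 0 0)) := by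
    simp only [γ, cCoeff, b0, Matrix.mul_one, Matrix.conjTranspose_neg, Matrix.conjTranspose_smul]
    simp
  have γs : ∀ m, γ (m + 1) = Bᴴ * bCoeff V m 0 - Aᴴ * derivWithin (bCoeff V m) (Ici 0) 0
      - (1 / 2 : ℂ) • (Aᴴ * bCoeff V (m + 1) 0) := by
    intro m
    simp only [γ, cCoeff, Matrix.conjTranspose_sub, Matrix.conjTranspose_mul,
      Matrix.conjTranspose_conjTranspose, Matrix.conjTranspose_add, Matrix.conjTranspose_smul,
      Matrix.mul_add, Matrix.mul_smul]
    rw [show star (1 / 2 : ℂ) = 1 / 2 by simp]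
    abel
  have hsum : ∀ N, ∑ m ∈ Finset.range (N + 1), s ^ m • γ m =
      s • (Bᴴ * ∑ l ∈ Finset.range (N + 1), s ^ l • bCoeff V l 0) -
      s • (Aᴴ * ∑ l ∈ Finset.range (N + 1), s ^ l • derivWithin (bCoeff V l) (Ici 0) 0) -
      (1 / 2 : ℂ) • (Aᴴ * ∑ l ∈ Finset.range (N + 1), s ^ l • bCoeff V l 0) -
      s ^ (N + 1) • (Bᴴ * bCoeff V N 0 - Aᴴ * derivWithin (bCoeff V N) (Ici 0) 0) := by
    intro N
    induction N with
    | zero => simp only [zero_add, Finset.sum_range_one, γ0, pow_zero, one_smul, pow_one]; module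
    | succ N ih =>
      rw [Finset.sum_range_succ, ih, γs]
      rw [Finset.sum_range_succ (fun l => s ^ l • bCoeff V l 0) (N + 1),
        Finset.sum_range_succ (fun l => s ^ l • derivWithin (bCoeff V l) (Ici 0) 0) (N + 1)]
      simp only [Matrix.mul_add, Matrix.mul_smul]
      module
  have key : s • gammaMat g g' A B q - ∑ m ∈ Finset.range (N + 1), s ^ m • γ m =
      s • (Bᴴ * r) - s • (Aᴴ * r') - (1 / 2 : ℂ) • (Aᴴ * r) + s ^ (N + 1) • D := by
    rw [hsum N, gammaMat, hr, hr', hD, Matrix.mul_add, Matrix.mul_smul, smul_sub, smul_add, smul_smul,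
      hs1]
    simp only [Matrix.mul_sub, smul_sub]
    abel
  have hconj : (2 * Complex.I * k)⁻¹ • jostMatrix f f' A B k -
      ∑ m ∈ Finset.range (N + 1), (2 * Complex.I * k)⁻¹ ^ m • cCoeff V A B m =
      (s • gammaMat g g' A B q - ∑ m ∈ Finset.range (N + 1), s ^ m • γ m)ᴴ := by
    rw [jostMatrix_eq hW hVW hg hf hk, hsk]
    simp only [Matrix.conjTranspose_sub, Matrix.conjTranspose_smul, Matrix.conjTranspose_sum, γ,
      Matrix.conjTranspose_conjTranspose, star_pow]
    rfl
  rw [hconj, Matrix.l2_opNorm_conjTranspose, key]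
  have hC0 : 0 ≤ C * ‖k‖⁻¹ ^ N := (norm_nonneg _).trans h1
  have t1 : ‖s • (Bᴴ * r)‖ ≤ ‖Bᴴ‖ * (C * ‖k‖⁻¹ ^ N) := by
    rw [norm_smul]
    refine (mul_le_of_le_one_left (norm_nonneg _) hs1').trans ((norm_mul_le _ _).trans ?_)
    exact mul_le_mul_of_nonneg_left h1 (norm_nonneg _)
  have t2 : ‖s • (Aᴴ * r')‖ ≤ ‖Aᴴ‖ * (C * ‖k‖⁻¹ ^ N) := by
    rw [norm_smul]
    refine (mul_le_of_le_one_left (norm_nonneg _) hs1').trans ((norm_mul_le _ _).trans ?_)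
    exact mul_le_mul_of_nonneg_left h2 (norm_nonneg _)
  have t3 : ‖(1 / 2 : ℂ) • (Aᴴ * r)‖ ≤ ‖Aᴴ‖ * (C * ‖k‖⁻¹ ^ N) := by
    rw [norm_smul]
    refine (mul_le_of_le_one_left (norm_nonneg _) (by norm_num)).trans ((norm_mul_le _ _).trans ?_)
    exact mul_le_mul_of_nonneg_left h1 (norm_nonneg _)
  have t4 : ‖s ^ (N + 1) • D‖ ≤ ‖D‖ * ‖k‖⁻¹ ^ N := by
    rw [norm_smul, norm_pow, mul_comm]
    refine mul_le_mul_of_nonneg_left ?_ (norm_nonneg _)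
    rw [pow_succ]
    exact (mul_le_of_le_one_right (by positivity) hs1').trans (by gcongr)
  have := norm_add_le_of_le (norm_sub_le_of_le (norm_sub_le_of_le t1 t2) t3) t4
  refine this.trans (le_of_eq ?_)
  ring

end JostSolution

variable {n : ℕ}

/-! ### Asymptotic expansions in powers of `1/(2ik)` -/

section Expansions

/-- Neighbourhoods of infinity in the closed upper half-plane. -/
noncomputable abbrev upperInfty : Filter ℂ := Bornology.cobounded ℂ ⊓ 𝓟 {k : ℂ | 0 ≤ k.im}

lemma eventually_upperInfty (R : ℝ) : ∀ᶠ k in upperInfty, k ∈ puncturedHalfPlane ∧ R ≤ ‖k‖ := by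
  have h1 : ∀ᶠ k in Bornology.cobounded ℂ, max R 1 ≤ ‖k‖ :=
    (tendsto_norm_cobounded_atTop (E := ℂ)).eventually (eventually_ge_atTop _)
  rw [eventually_inf_principal]
  filter_upwards [h1] with k hk him
  refine ⟨⟨him, ?_⟩, (le_max_left _ _).trans hk⟩
  rintro rfl
  rw [norm_zero] at hk
  exact absurd ((le_max_right R 1).trans hk) (by norm_num)

lemma eventually_upperInfty_iff {p : ℂ → Prop} :
    (∀ᶠ k in upperInfty, p k) ↔ ∃ R : ℝ, ∀ k : ℂ, 0 ≤ k.im → R ≤ ‖k‖ → p k := by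
  constructor
  · intro h
    rw [eventually_inf_principal, ← comap_norm_atTop, eventually_comap] at h
    obtain ⟨R, hR⟩ := eventually_atTop.1 h
    exact ⟨R, fun k hk hkR => hR _ hkR k rfl hk⟩
  · rintro ⟨R, hR⟩
    filter_upwards [eventually_upperInfty R] with k hk using hR k hk.1.1 hk.2

instance : NeBot upperInfty := by
  rw [neBot_iff]
  intro h
  have h1 : ∀ᶠ k in upperInfty, False := by rw [h]; exact eventually_bot
  obtain ⟨R, hR⟩ := eventually_upperInfty_iff.1 h1
  exact hR (Complex.I * (|R| : ℝ)) (by simp) (by simp [le_abs_self])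

lemma tendsto_inv_upperInfty : Tendsto (fun k : ℂ => k⁻¹) upperInfty (𝓝 0) :=
  (tendsto_inv₀_cobounded (α := ℂ)).mono_left inf_le_left

/-- The expansion variable `1/(2ik)`. -/
noncomputable def invTwoI (k : ℂ) : ℂ := (2 * Complex.I * k)⁻¹

lemma invTwoI_eq (k : ℂ) : invTwoI k = (2 * Complex.I)⁻¹ * k⁻¹ := by rw [invTwoI, mul_inv]

lemma tendsto_invTwoI : Tendsto invTwoI upperInfty (𝓝 0) := by
  have := tendsto_inv_upperInfty.const_mul (2 * Complex.I)⁻¹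
  rw [mul_zero] at this
  exact this.congr fun k => (invTwoI_eq k).symm

lemma invTwoI_pow_isBigO (N : ℕ) : (fun k => invTwoI k ^ N) =O[upperInfty] fun k => k⁻¹ ^ N := by
  refine Asymptotics.IsBigO.pow ?_ N
  rw [show invTwoI = fun k => (2 * Complex.I)⁻¹ * k⁻¹ from funext invTwoI_eq]
  exact Asymptotics.isBigO_const_mul_self _ _ _

lemma inv_pow_isBigO_of_le {M N : ℕ} (h : M ≤ N) :
    (fun k : ℂ => k⁻¹ ^ N) =O[upperInfty] fun k => k⁻¹ ^ M := by
  refine Asymptotics.IsBigO.of_bound 1 ?_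
  filter_upwards [eventually_upperInfty 1] with k hk
  rw [one_mul, norm_pow, norm_pow, norm_inv]
  exact pow_le_pow_of_le_one (by positivity) (inv_le_one_of_one_le₀ hk.2) h

lemma isBigO_one_of_tendsto {f : ℂ → ℂ} {l : ℂ} (h : Tendsto f upperInfty (𝓝 l)) :
    f =O[upperInfty] fun k : ℂ => k⁻¹ ^ 0 := by
  simp only [pow_zero]
  exact h.isBigO_one ℂ

lemma tendsto_eval_invTwoI (P : Polynomial ℂ) :
    Tendsto (fun k => P.eval (invTwoI k)) upperInfty (𝓝 (P.coeff 0)) := by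
  rw [Polynomial.coeff_zero_eq_eval_zero]
  exact (P.continuous.tendsto 0).comp tendsto_invTwoI

lemma coeff_eq_zero_of_isBigO {P : Polynomial ℂ} {N : ℕ}
    (h : (fun k => P.eval (invTwoI k)) =O[upperInfty] fun k => k⁻¹ ^ N) :
    ∀ m < N, P.coeff m = 0 := by
  intro m
  induction m using Nat.strong_induction_on with
  | _ m ih =>
    intro hm
    obtain ⟨Q, rfl⟩ := Polynomial.X_pow_dvd_iff.2 fun d hd => ih d hd (hd.trans hm)
    have e : (Polynomial.X ^ m * Q).coeff m = Q.coeff 0 := by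
      simpa using Polynomial.coeff_X_pow_mul Q m 0
    rw [e]
    refine tendsto_nhds_unique (tendsto_eval_invTwoI Q) ?_
    have h1 : (fun k => Q.eval (invTwoI k)) =O[upperInfty] fun k : ℂ => k⁻¹ := by
      have h2 : (fun k => (2 * Complex.I * k) ^ m) =O[upperInfty] fun k : ℂ => k ^ m :=
        (Asymptotics.isBigO_const_mul_self _ _ _).pow m
      refine (h2.mul h).congr' ?_ EventuallyEq.rfl |>.trans ?_
      · filter_upwards [eventually_upperInfty 1] with k hk
        simp only [Polynomial.eval_mul, Polynomial.eval_pow, Polynomial.eval_X]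
        rw [← mul_assoc, ← mul_pow, invTwoI, mul_inv_cancel₀ (two_I_mul_ne_zero hk.1.2), one_pow,
          one_mul]
      · refine Asymptotics.IsBigO.of_bound 1 ?_
        filter_upwards [eventually_upperInfty 1] with k hk
        obtain ⟨d, rfl⟩ : ∃ d, N = m + 1 + d := ⟨N - (m + 1), by omega⟩
        have e1 : k ^ m * k⁻¹ ^ (m + 1 + d) = k⁻¹ * k⁻¹ ^ d := by
          rw [pow_add, pow_succ, ← mul_assoc, ← mul_assoc, ← mul_pow, mul_inv_cancel₀ hk.1.2,
            one_pow, one_mul]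
        rw [e1, one_mul, norm_mul, norm_pow, norm_inv]
        exact mul_le_of_le_one_right (by positivity)
          (pow_le_one₀ (by positivity) (inv_le_one_of_one_le₀ hk.2))
    exact h1.trans_tendsto tendsto_inv_upperInfty

/-- `φ(k)` has the asymptotic expansion `∑ₘ Aₘ (2ik)^{-m}` at infinity in the closed upper
half-plane. -/
def HasExpansion (φ : ℂ → ℂ) (A : PowerSeries ℂ) : Prop :=
  ∀ N, ∃ P : Polynomial ℂ, (∀ m < N, P.coeff m = PowerSeries.coeff m A) ∧
    (fun k => φ k - P.eval (invTwoI k)) =O[upperInfty] fun k => k⁻¹ ^ N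

lemma HasExpansion.isBigO_one {φ : ℂ → ℂ} {A : PowerSeries ℂ} (h : HasExpansion φ A) :
    φ =O[upperInfty] fun k : ℂ => k⁻¹ ^ 0 := by
  obtain ⟨P, -, hP⟩ := h 0
  simpa using hP.add (isBigO_one_of_tendsto (tendsto_eval_invTwoI P))

lemma hasExpansion_const (c : ℂ) : HasExpansion (fun _ => c) (PowerSeries.C c) := by
  intro N
  refine ⟨Polynomial.C c, fun m _ => ?_, ?_⟩
  · rw [Polynomial.coeff_C, PowerSeries.coeff_C]
  · simpa using Asymptotics.isBigO_zero _ _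

lemma HasExpansion.add {φ ψ : ℂ → ℂ} {A B : PowerSeries ℂ} (h1 : HasExpansion φ A)
    (h2 : HasExpansion ψ B) : HasExpansion (fun k => φ k + ψ k) (A + B) := by
  intro N
  obtain ⟨P, hP, hP'⟩ := h1 N
  obtain ⟨Q, hQ, hQ'⟩ := h2 N
  refine ⟨P + Q, fun m hm => by rw [Polynomial.coeff_add, map_add, hP m hm, hQ m hm], ?_⟩
  refine (hP'.add hQ').congr_left fun k => ?_
  rw [Polynomial.eval_add]; ring

lemma HasExpansion.mul {φ ψ : ℂ → ℂ} {A B : PowerSeries ℂ} (h1 : HasExpansion φ A)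
    (h2 : HasExpansion ψ B) : HasExpansion (fun k => φ k * ψ k) (A * B) := by
  intro N
  obtain ⟨P, hP, hP'⟩ := h1 N
  obtain ⟨Q, hQ, hQ'⟩ := h2 N
  refine ⟨P * Q, fun m hm => ?_, ?_⟩
  · rw [Polynomial.coeff_mul, PowerSeries.coeff_mul]
    refine Finset.sum_congr rfl fun p hp => ?_
    have := Finset.HasAntidiagonal.mem_antidiagonal.1 hp
    rw [hP _ (by omega), hQ _ (by omega)]
  · have t1 := hP'.mul h2.isBigO_one
    have t2 := hQ'.mul (isBigO_one_of_tendsto (tendsto_eval_invTwoI P))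
    simp only [pow_zero, mul_one] at t1 t2
    refine (t1.add t2).congr_left fun k => ?_
    rw [Polynomial.eval_mul]; ring

lemma HasExpansion.sum {ι : Type*} (s : Finset ι) {φ : ι → ℂ → ℂ} {A : ι → PowerSeries ℂ}
    (h : ∀ i, HasExpansion (φ i) (A i)) :
    HasExpansion (fun k => ∑ i ∈ s, φ i k) (∑ i ∈ s, A i) := by
  classical
  induction s using Finset.induction_on with
  | empty => simpa using hasExpansion_const 0
  | insert a s ha ih => simpa only [Finset.sum_insert ha] using (h a).add ih

lemma HasExpansion.prod {ι : Type*} (s : Finset ι) {φ : ι → ℂ → ℂ} {A : ι → PowerSeries ℂ}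
    (h : ∀ i, HasExpansion (φ i) (A i)) :
    HasExpansion (fun k => ∏ i ∈ s, φ i k) (∏ i ∈ s, A i) := by
  classical
  induction s using Finset.induction_on with
  | empty => simpa using hasExpansion_const 1
  | insert a s ha ih => simpa only [Finset.prod_insert ha] using (h a).mul ih

/-- Logarithmic expansion `log F(k) ~ ∑_{l ≥ 1} a_l k^{-l}` at infinity in the closed upper
half-plane, stated without choosing a logarithm. -/
def HasLogExpansion (F : ℂ → ℂ) (a : ℕ → ℂ) : Prop :=
  ∀ N, (fun k => F k * Complex.exp (-∑ l ∈ Finset.range N, a (l + 1) * k⁻¹ ^ (l + 1)) - 1)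
    =O[upperInfty] fun k => k⁻¹ ^ (N + 1)

lemma HasLogExpansion.mul {F G : ℂ → ℂ} {a b : ℕ → ℂ} (hF : HasLogExpansion F a)
    (hG : HasLogExpansion G b) : HasLogExpansion (fun k => F k * G k) (fun l => a l + b l) := by
  intro N
  have h1 := hF N
  have h2 := hG N
  have h3 : (fun k => G k * Complex.exp (-∑ l ∈ Finset.range N, b (l + 1) * k⁻¹ ^ (l + 1)))
      =O[upperInfty] fun k : ℂ => k⁻¹ ^ 0 := by
    simpa using (h2.trans (inv_pow_isBigO_of_le (Nat.zero_le _))).add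
      (isBigO_one_of_tendsto (tendsto_const_nhds (x := (1 : ℂ))))
  have h4 := h1.mul h3
  simp only [pow_zero, mul_one] at h4
  refine (h4.add h2).congr_left fun k => ?_
  simp only [add_mul, Finset.sum_add_distrib, neg_add, Complex.exp_add]
  ring

lemma hasLogExpansion_one : HasLogExpansion (fun _ => 1) (fun _ => 0) := by
  intro N
  simpa using Asymptotics.isBigO_zero _ _

lemma HasLogExpansion.prod {ι : Type*} (s : Finset ι) {F : ι → ℂ → ℂ} {a : ι → ℕ → ℂ}
    (h : ∀ i, HasLogExpansion (F i) (a i)) :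
    HasLogExpansion (fun k => ∏ i ∈ s, F i k) (fun l => ∑ i ∈ s, a i l) := by
  classical
  induction s using Finset.induction_on with
  | empty => simpa using hasLogExpansion_one
  | insert i s hi ih => simpa only [Finset.prod_insert hi, Finset.sum_insert hi] using (h i).mul ih

lemma HasLogExpansion.congr {F G : ℂ → ℂ} {a b : ℕ → ℂ} (hF : HasLogExpansion F a)
    (h : F =ᶠ[upperInfty] G) (hab : ∀ l, a (l + 1) = b (l + 1)) : HasLogExpansion G b := by
  intro N
  refine (hF N).congr' ?_ EventuallyEq.rfl
  filter_upwards [h] with k hk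
  simp only [hk, hab]

/-- A polynomial substitute for taking the logarithm of a power series, whose coefficients are
determined by `P' = P Q'`. If `P' - P Q'` vanishes to order `N`, then `P e^{-Q}` is constant up to order `N + 1`. -/
lemma eval_mul_exp_isBigO {P Q : Polynomial ℂ} {N : ℕ} (hP : P.coeff 0 = 1) (hQ : Q.coeff 0 = 0)
    (h : ∀ m < N, (Polynomial.derivative P - P * Polynomial.derivative Q).coeff m = 0)
    {α : Type*} {l : Filter α} {z : α → ℂ} (hz : Tendsto z l (𝓝 0)) :
    (fun x => P.eval (z x) * Complex.exp (-Q.eval (z x)) - 1) =O[l] fun x => z x ^ (N + 1) := by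
  obtain ⟨R, hR⟩ := Polynomial.X_pow_dvd_iff.2 h
  let Φ : ℂ → ℂ := fun w => P.eval w * Complex.exp (-Q.eval w)
  have hd : ∀ w, HasDerivAt Φ (Complex.exp (-Q.eval w) * (w ^ N * R.eval w)) w := by
    intro w
    refine ((P.hasDerivAt w).mul (Q.hasDerivAt w).neg.cexp).congr_deriv ?_
    have e := congrArg (Polynomial.eval w) hR
    simp only [Polynomial.eval_sub, Polynomial.eval_mul, Polynomial.eval_pow,
      Polynomial.eval_X] at e
    rw [← e]
    simp only [Pi.neg_apply]
    ring
  obtain ⟨C, hC⟩ := (isCompact_closedBall (0:ℂ) 1).exists_bound_of_continuousOn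
    (f := fun w => Complex.exp (-Q.eval w) * R.eval w)
    ((Complex.continuous_exp.comp Q.continuous.neg).mul R.continuous).continuousOn
  have h0 : Φ 0 = 1 := by
    simp only [Φ, ← Polynomial.coeff_zero_eq_eval_zero, hP, hQ]; simp
  refine Asymptotics.IsBigO.of_bound C ?_
  filter_upwards [hz.eventually (Metric.closedBall_mem_nhds 0 one_pos)] with x hx
  have hx1 : ‖z x‖ ≤ 1 := mem_closedBall_zero_iff.1 hx
  have := (convex_closedBall (0:ℂ) ‖z x‖).norm_image_sub_le_of_norm_hasDerivWithin_le
    (f := Φ) (C := C * ‖z x‖ ^ N) (fun w _ => (hd w).hasDerivWithinAt) (fun w hw => ?_)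
    (x := 0) (y := z x) (by simp) (by simp)
  · rw [h0, sub_zero] at this
    rw [norm_pow, pow_succ, ← mul_assoc]
    exact this
  · have hw' : ‖w‖ ≤ ‖z x‖ := mem_closedBall_zero_iff.1 hw
    have h1 := hC w (mem_closedBall_zero_iff.2 (hw'.trans hx1))
    have h2 : ‖w‖ ^ N ≤ ‖z x‖ ^ N := pow_le_pow_left₀ (norm_nonneg _) hw' N
    rw [mul_left_comm, norm_mul, norm_pow, mul_comm]
    exact mul_le_mul h1 h2 (by positivity) ((norm_nonneg _).trans h1)

/-- `log (1 + c/k) = -∑ (-c)^l / (l k^l)`. -/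
lemma hasLogExpansion_one_add (c : ℂ) :
    HasLogExpansion (fun k => 1 + c * k⁻¹) (fun l => -(-c) ^ l / l) := by
  intro N
  have h := eval_mul_exp_isBigO (P := 1 + Polynomial.C c * Polynomial.X) (N := N)
    (Q := ∑ l ∈ Finset.range N, Polynomial.C (-(-c) ^ (l + 1) / ((l + 1 : ℕ) : ℂ)) *
      Polynomial.X ^ (l + 1)) (by simp) (by
        rw [Polynomial.finsetSum_coeff]
        exact Finset.sum_eq_zero fun l _ => by simp) ?_ tendsto_inv_upperInfty
  · refine h.congr_left fun k => ?_
    simp only [Polynomial.eval_add, Polynomial.eval_one, Polynomial.eval_mul, Polynomial.eval_C,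
      Polynomial.eval_X, Polynomial.eval_finsetSum, Polynomial.eval_pow]
  · have e : Polynomial.derivative (1 + Polynomial.C c * Polynomial.X) -
        (1 + Polynomial.C c * Polynomial.X) * Polynomial.derivative (∑ l ∈ Finset.range N,
          Polynomial.C (-(-c) ^ (l + 1) / ((l + 1 : ℕ) : ℂ)) * Polynomial.X ^ (l + 1)) =
        Polynomial.X ^ N * (Polynomial.C c * Polynomial.C (-c) ^ N) := by
      have e1 : ∀ l : ℕ, Polynomial.derivative (Polynomial.C (-(-c) ^ (l + 1) / ((l + 1 : ℕ) : ℂ)) *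
          Polynomial.X ^ (l + 1)) = Polynomial.C c * (Polynomial.C (-c) * Polynomial.X) ^ l := by
        intro l
        have h0 : ((l + 1 : ℕ) : ℂ) ≠ 0 := by exact_mod_cast Nat.succ_ne_zero l
        rw [Polynomial.derivative_C_mul_X_pow, div_mul_cancel₀ _ h0, Nat.add_sub_cancel, mul_pow,
          ← mul_assoc, ← map_pow, ← map_mul]
        congr 2
        ring
      rw [Polynomial.derivative_sum, Finset.sum_congr rfl fun l _ => e1 l, ← Finset.mul_sum]
      have e2 := mul_neg_geom_sum (Polynomial.C (-c) * Polynomial.X) N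
      have e3 : (1 : Polynomial ℂ) + Polynomial.C c * Polynomial.X =
          1 - Polynomial.C (-c) * Polynomial.X := by simp
      simp only [Polynomial.derivative_add, Polynomial.derivative_one, Polynomial.derivative_mul,
        Polynomial.derivative_C, Polynomial.derivative_X, zero_mul, mul_one, zero_add]
      rw [e3, mul_left_comm, e2]
      ring
    intro m hm
    rw [e]
    exact Polynomial.X_pow_dvd_iff.1 (dvd_mul_right _ _) m hm

end Expansions

variable {n : ℕ}

/-! ### Expansion of the determinant of the Jost matrix and of its logarithm -/

section DetExpansion

variable {V W : ℝ → Matrix (Fin n) (Fin n) ℂ} {f f' : ℂ → ℝ → Matrix (Fin n) (Fin n) ℂ}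
  {A B : Matrix (Fin n) (Fin n) ℂ} {ρ : ℝ}

lemma norm_entry_le (M : Matrix (Fin n) (Fin n) ℂ) (i j : Fin n) : ‖M i j‖ ≤ ‖M‖ := by
  have h1 := norm_matOp_apply_le M (EuclideanSpace.single j 1)
  rw [PiLp.norm_single, norm_one, mul_one] at h1
  refine le_trans ?_ h1
  have h2 := PiLp.norm_apply_le (matOp M (EuclideanSpace.single j (1 : ℂ))) i
  have h3 : matOp M (EuclideanSpace.single j (1 : ℂ)) i = M i j := by
    simp [matOp_eq_toEuclideanLin, Matrix.toLpLin_apply]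
  rwa [h3] at h2

lemma hasExpansion_jostMatrix_entry (hW : IsRegularPotential W) (hVW : ∀ x, 0 < x → V x = W x)
    (hρ : 1 < ρ) (hd : ∀ N, DecayOfOrder (fun x : ℝ => (1 + x) ^ (-ρ)) N W)
    (hf : IsJostSolution V f f') (i j : Fin n) :
    HasExpansion (fun k => (invTwoI k • jostMatrix f f' A B k) i j)
      (PowerSeries.mk fun m => cCoeff V A B m i j) := by
  intro N
  obtain ⟨C, hC⟩ := exists_norm_jostMatrix_sub_le A B hW hVW hρ hd hf N
  refine ⟨PowerSeries.trunc (N + 1) (PowerSeries.mk fun m => cCoeff V A B m i j),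
    fun m hm => ?_, ?_⟩
  · rw [PowerSeries.coeff_trunc, if_pos (by omega)]
  · refine Asymptotics.IsBigO.of_bound C ?_
    filter_upwards [eventually_upperInfty 1] with k hk
    have h1 := (norm_entry_le _ i j).trans (hC k hk.1 hk.2)
    rw [norm_pow, norm_inv]
    refine le_trans (le_of_eq ?_) h1
    congr 1
    rw [Polynomial.eval, PowerSeries.eval₂_trunc_eq_sum_range, Matrix.sub_apply, Matrix.sum_apply,
      ← invTwoI]
    congr 1
    refine Finset.sum_congr rfl fun m _ => ?_
    rw [Matrix.smul_apply, smul_eq_mul, PowerSeries.coeff_mk, RingHom.id_apply, mul_comm]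

/-- `det (J(k) / (2ik))` has the expansion with coefficients `d_{N-n}`. -/
lemma hasExpansion_det (hW : IsRegularPotential W) (hVW : ∀ x, 0 < x → V x = W x)
    (hρ : 1 < ρ) (hd : ∀ N, DecayOfOrder (fun x : ℝ => (1 + x) ^ (-ρ)) N W)
    (hf : IsJostSolution V f f') :
    HasExpansion (fun k => (invTwoI k • jostMatrix f f' A B k).det)
      (PowerSeries.mk (dCoeff V A B)) := by
  have h := HasExpansion.sum (Finset.univ : Finset (Equiv.Perm (Fin n))) fun σ =>
    (hasExpansion_const ((Equiv.Perm.sign σ : ℤ) : ℂ)).mul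
      (HasExpansion.prod (Finset.univ : Finset (Fin n)) fun i =>
        hasExpansion_jostMatrix_entry (A := A) (B := B) hW hVW hρ hd hf i (σ i))
  have e1 : (fun k => (invTwoI k • jostMatrix f f' A B k).det) = fun k => ∑ σ : Equiv.Perm (Fin n),
      ((Equiv.Perm.sign σ : ℤ) : ℂ) * ∏ i, (invTwoI k • jostMatrix f f' A B k) i (σ i) := by
    funext k
    rw [← Matrix.det_transpose, Matrix.det_apply']
    rfl
  have e2 : PowerSeries.mk (dCoeff V A B) = ∑ σ : Equiv.Perm (Fin n),
      PowerSeries.C ((Equiv.Perm.sign σ : ℤ) : ℂ) *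
        ∏ i, PowerSeries.mk fun m => cCoeff V A B m i (σ i) := by
    ext N
    rw [PowerSeries.coeff_mk, map_sum, dCoeff]
    refine Finset.sum_congr rfl fun σ _ => ?_
    rw [PowerSeries.coeff_C_mul, PowerSeries.coeff_prod]
    congr 1
    refine Finset.sum_bij' (i := fun m _ => Finsupp.equivFunOnFinite.symm m) (j := fun m _ => ⇑m)
      ?_ ?_ ?_ ?_ ?_
    · intro m hm
      rw [Finset.mem_finsuppAntidiag]
      exact ⟨(Finset.mem_piAntidiag.1 hm).1, Finset.subset_univ _⟩
    · intro m hm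
      rw [Finset.mem_piAntidiag]
      exact ⟨(Finset.mem_finsuppAntidiag.1 hm).1, fun i _ => Finset.mem_univ i⟩
    · intro m _; rfl
    · intro m _; ext i; rfl
    · intro m _
      refine Finset.prod_congr rfl fun i _ => ?_
      rw [PowerSeries.coeff_mk]; rfl
  rw [e1, e2]
  exact h

variable {p nD : ℕ} {c₂ : ℂ}

lemma isBigO_hFun_sub_one {J : ℂ → Matrix (Fin n) (Fin n) ℂ} (hc : IsLeadingConstant J p c₂) :
    (fun k => hFun J p c₂ k - 1) =O[upperInfty] fun k => k⁻¹ ^ 1 := by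
  have h := hc.2
  simp only [one_div] at h
  simp only [pow_one]
  exact h

lemma tendsto_hFun {J : ℂ → Matrix (Fin n) (Fin n) ℂ} (hc : IsLeadingConstant J p c₂) :
    Tendsto (hFun J p c₂) upperInfty (𝓝 1) := by
  have h := isBigO_hFun_sub_one hc
  simp only [pow_one] at h
  have := (h.trans_tendsto tendsto_inv_upperInfty).add_const 1
  simpa using this

lemma det_smul_eq_hFun {J : ℂ → Matrix (Fin n) (Fin n) ℂ} (hc : c₂ ≠ 0) (hp : p + nD = n) {k : ℂ}
    (hk : k ≠ 0) : (invTwoI k • J k).det =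
      invTwoI k ^ nD * (c₂ / (2 * Complex.I) ^ p * hFun J p c₂ k) := by
  have h1 : 2 * Complex.I * k * invTwoI k = 1 := mul_inv_cancel₀ (two_I_mul_ne_zero hk)
  have h2 : (2 * Complex.I : ℂ) ≠ 0 := by simp
  have h3 : invTwoI k ^ p = ((2 * Complex.I) ^ p * k ^ p)⁻¹ := by
    rw [invTwoI, inv_pow, mul_pow]
  rw [Matrix.det_smul, Fintype.card_fin, hFun]
  have h4 : invTwoI k ^ n = invTwoI k ^ nD * ((2 * Complex.I) ^ p * k ^ p)⁻¹ := by
    rw [← h3, ← pow_add, add_comm, hp]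
  rw [h4]
  field_simp

/-- The leading coefficients of the expansion of the determinant. -/
lemma dCoeff_leading (hW : IsRegularPotential W) (hVW : ∀ x, 0 < x → V x = W x)
    (hρ : 1 < ρ) (hd : ∀ N, DecayOfOrder (fun x : ℝ => (1 + x) ^ (-ρ)) N W)
    (hf : IsJostSolution V f f') (hp : p + nD = n)
    (hc : IsLeadingConstant (jostMatrix f f' A B) p c₂) :
    (∀ m < nD, dCoeff V A B m = 0) ∧ (2 * Complex.I) ^ p / c₂ * dCoeff V A B nD = 1 := by
  obtain ⟨P, hP, hP'⟩ := hasExpansion_det (A := A) (B := B) hW hVW hρ hd hf (nD + 1)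
  set c := c₂ / (2 * Complex.I) ^ p with hcdef
  have hc0 : c ≠ 0 := div_ne_zero hc.1 (by simp)
  have h1 : (fun k => (invTwoI k • jostMatrix f f' A B k).det - c * invTwoI k ^ nD) =O[upperInfty]
      fun k => k⁻¹ ^ (nD + 1) := by
    have h2 := ((invTwoI_pow_isBigO nD).mul (isBigO_hFun_sub_one hc)).const_mul_left c
    simp only [← pow_add] at h2
    refine h2.congr' ?_ EventuallyEq.rfl
    filter_upwards [eventually_upperInfty 1] with k hk
    rw [det_smul_eq_hFun hc.1 hp hk.1.2]
    ring
  have h2 := coeff_eq_zero_of_isBigO (P := P - Polynomial.C c * Polynomial.X ^ nD) (N := nD + 1) (by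
    refine (h1.sub hP').congr_left fun k => ?_
    simp only [Polynomial.eval_sub, Polynomial.eval_mul, Polynomial.eval_C, Polynomial.eval_pow,
      Polynomial.eval_X]
    ring)
  have h3 : ∀ m < nD + 1, dCoeff V A B m = if m = nD then c else 0 := by
    intro m hm
    have := h2 m hm
    rw [Polynomial.coeff_sub, Polynomial.coeff_C_mul_X_pow, hP m hm, PowerSeries.coeff_mk,
      sub_eq_zero] at this
    exact this
  refine ⟨fun m hm => by rw [h3 m (by omega), if_neg (by omega)], ?_⟩
  rw [h3 nD (by omega), if_pos rfl, hcdef]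
  have : (2 * Complex.I : ℂ) ^ p ≠ 0 := by simp
  have := hc.1
  field_simp

lemma hasExpansion_hFun (hW : IsRegularPotential W) (hVW : ∀ x, 0 < x → V x = W x)
    (hρ : 1 < ρ) (hd : ∀ N, DecayOfOrder (fun x : ℝ => (1 + x) ^ (-ρ)) N W)
    (hf : IsJostSolution V f f') (hp : p + nD = n)
    (hc : IsLeadingConstant (jostMatrix f f' A B) p c₂) :
    HasExpansion (hFun (jostMatrix f f' A B) p c₂)
      (PowerSeries.mk fun m => (2 * Complex.I) ^ p / c₂ * dCoeff V A B (m + nD)) := by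
  intro N
  obtain ⟨h0, -⟩ := dCoeff_leading hW hVW hρ hd hf hp hc
  obtain ⟨P, hP, hP'⟩ := hasExpansion_det (A := A) (B := B) hW hVW hρ hd hf (N + nD)
  obtain ⟨Q, rfl⟩ := Polynomial.X_pow_dvd_iff.2 (fun m (hm : m < nD) => by
    rw [hP m (by omega), PowerSeries.coeff_mk, h0 m hm])
  refine ⟨Polynomial.C ((2 * Complex.I) ^ p / c₂) * Q, fun m hm => ?_, ?_⟩
  · have := hP (m + nD) (by omega)
    rw [Polynomial.coeff_X_pow_mul] at this
    rw [Polynomial.coeff_C_mul, this, PowerSeries.coeff_mk, PowerSeries.coeff_mk]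
  · have h1 : (fun k => ((2 * Complex.I) ^ p / c₂) * (2 * Complex.I * k) ^ nD) =O[upperInfty]
        fun k : ℂ => k ^ nD :=
      ((Asymptotics.isBigO_const_mul_self _ _ _).pow nD).const_mul_left _
    refine (h1.mul hP').congr' ?_ ?_
    · filter_upwards [eventually_upperInfty 1] with k hk
      have h2 : (2 * Complex.I * k) ^ nD * invTwoI k ^ nD = 1 := by
        rw [← mul_pow, invTwoI, mul_inv_cancel₀ (two_I_mul_ne_zero hk.1.2), one_pow]
      have h3 : (2 * Complex.I) ^ p / c₂ * (c₂ / (2 * Complex.I) ^ p) = 1 := by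
        have : (2 * Complex.I : ℂ) ^ p ≠ 0 := by simp
        have := hc.1
        field_simp
      rw [det_smul_eq_hFun hc.1 hp hk.1.2]
      simp only [Polynomial.eval_mul, Polynomial.eval_pow, Polynomial.eval_X, Polynomial.eval_C]
      linear_combination ((2 * Complex.I) ^ p / c₂ * (c₂ / (2 * Complex.I) ^ p) *
        hFun (jostMatrix f f' A B) p c₂ k - (2 * Complex.I) ^ p / c₂ * Q.eval (invTwoI k)) * h2 +
        hFun (jostMatrix f f' A B) p c₂ k * h3
    · filter_upwards [eventually_upperInfty 1] with k hk
      have : k ^ nD * k⁻¹ ^ nD = 1 := by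
        rw [← mul_pow, mul_inv_cancel₀ hk.1.2, one_pow]
      rw [pow_add]
      linear_combination k⁻¹ ^ N * this

/-- `e_l` are the coefficients of `ln h`: their recursion says `H' = H (ln H)'` for the power series
`H` of `h`. -/
lemma hasLogExpansion_hFun (hW : IsRegularPotential W) (hVW : ∀ x, 0 < x → V x = W x)
    (hρ : 1 < ρ) (hd : ∀ N, DecayOfOrder (fun x : ℝ => (1 + x) ^ (-ρ)) N W)
    (hf : IsJostSolution V f f') (hp : p + nD = n)
    (hc : IsLeadingConstant (jostMatrix f f' A B) p c₂) :
    HasLogExpansion (hFun (jostMatrix f f' A B) p c₂)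
      (fun l => eCoeff V A B p nD c₂ l * (2 * Complex.I)⁻¹ ^ l) := by
  intro N
  obtain ⟨-, hlead⟩ := dCoeff_leading hW hVW hρ hd hf hp hc
  obtain ⟨P, hP, hP'⟩ := hasExpansion_hFun hW hVW hρ hd hf hp hc (N + 1)
  set e := eCoeff V A B p nD c₂ with he
  set H : ℕ → ℂ := fun m => (2 * Complex.I) ^ p / c₂ * dCoeff V A B (m + nD) with hH
  have hPc : ∀ m < N + 1, P.coeff m = H m := fun m hm => by rw [hP m hm, PowerSeries.coeff_mk]
  have hH0 : H 0 = 1 := by rw [hH]; simpa using hlead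
  have hrec : ∀ l : ℕ, ((l : ℂ) + 1) * H (l + 1) =
      ∑ j ∈ Finset.range (l + 1), ((j : ℂ) + 1) * e (j + 1) * H (l - j) := by
    intro l
    have h1 : e (l + 1) = H (l + 1) - 1 / ((l : ℂ) + 1) * ∑ j ∈ Finset.range (l + 1),
        (j : ℂ) * H (l + 1 - j) * e j := by
      rw [he, eCoeff, ← he, Finset.sum_range, mul_sub, hH]
      simp only [Finset.mul_sum]
      congr 1
      refine Finset.sum_congr rfl fun j _ => ?_
      ring
    have h2 : ((l : ℂ) + 1) ≠ 0 := by exact_mod_cast Nat.succ_ne_zero l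
    have h3 : ((l : ℂ) + 1) * e (l + 1) = ((l : ℂ) + 1) * H (l + 1) -
        ∑ j ∈ Finset.range (l + 1), (j : ℂ) * H (l + 1 - j) * e j := by
      rw [h1]; field_simp
    rw [Finset.sum_range_succ' ] at h3
    rw [Finset.sum_range_succ, Nat.sub_self, hH0, mul_one, h3]
    have h4 : ∑ j ∈ Finset.range l, ((j : ℂ) + 1) * e (j + 1) * H (l - j) =
        ∑ j ∈ Finset.range l, ((j + 1 : ℕ) : ℂ) * H (l + 1 - (j + 1)) * e (j + 1) := by
      refine Finset.sum_congr rfl fun j _ => ?_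
      rw [Nat.add_sub_add_right]; push_cast; ring
    rw [h4]
    simp
  let Q : Polynomial ℂ := ∑ l ∈ Finset.range N, Polynomial.C (e (l + 1)) * Polynomial.X ^ (l + 1)
  have hQ' : ∀ m < N, (Polynomial.derivative Q).coeff m = ((m : ℂ) + 1) * e (m + 1) := by
    intro m hm
    rw [Polynomial.coeff_derivative, Polynomial.finsetSum_coeff]
    simp only [Polynomial.coeff_C_mul_X_pow]
    rw [Finset.sum_eq_single m]
    · simp [mul_comm]
    · intro b _ hb; rw [if_neg (by omega)]
    · intro h; exact absurd (Finset.mem_range.2 hm) h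
  have hΦ := eval_mul_exp_isBigO (P := P) (Q := Q) (N := N) (by rw [hPc 0 (by omega), hH0]) (by
      rw [Polynomial.finsetSum_coeff]
      exact Finset.sum_eq_zero fun l _ => by simp) (fun m hm => ?_) tendsto_invTwoI
  · have h1 : (fun k => Complex.exp (-Q.eval (invTwoI k))) =O[upperInfty] fun k : ℂ => k⁻¹ ^ 0 :=
      isBigO_one_of_tendsto ((Complex.continuous_exp.tendsto _).comp (tendsto_eval_invTwoI Q).neg)
    have h2 := hP'.mul h1
    simp only [pow_zero, mul_one] at h2
    refine (h2.add (hΦ.trans (invTwoI_pow_isBigO (N + 1)))).congr_left fun k => ?_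
    have e1 : ∑ l ∈ Finset.range N, e (l + 1) * (2 * Complex.I)⁻¹ ^ (l + 1) * k⁻¹ ^ (l + 1) =
        Q.eval (invTwoI k) := by
      simp only [Q, Polynomial.eval_finsetSum, Polynomial.eval_mul, Polynomial.eval_C,
        Polynomial.eval_pow, Polynomial.eval_X, invTwoI_eq, mul_pow, mul_assoc]
    rw [e1]; ring
  · rw [Polynomial.coeff_sub, Polynomial.coeff_derivative, Polynomial.coeff_mul,
      Finset.Nat.sum_antidiagonal_eq_sum_range_succ (fun i j => P.coeff i *
        (Polynomial.derivative Q).coeff j), sub_eq_zero, hPc _ (by omega), mul_comm, hrec,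
      ← Finset.sum_range_reflect]
    refine Finset.sum_congr rfl fun j hj => ?_
    have hj' := Finset.mem_range.1 hj
    rw [hPc j (by omega), hQ' (m - j) (by omega)]
    have e1 : m + 1 - 1 - j = m - j := by omega
    have e2 : m - (m - j) = j := by omega
    rw [e1, e2]; ring

end DetExpansion

variable {n : ℕ}

/-! ### Diagonal form of the boundary conditions -/

section Angles

variable {A B : Matrix (Fin n) (Fin n) ℂ}

/-- `det (B + tA)` is a polynomial in `t` that does not vanish at `t = i`. -/
lemma exists_isUnit_add_smul (h : IsSelfadjointBC A B) : ∃ t : ℝ, IsUnit (B + (t : ℂ) • A) := by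
  let Q : Polynomial ℂ := (B.map (Polynomial.C : ℂ → Polynomial ℂ) +
    (Polynomial.X : Polynomial ℂ) • A.map (Polynomial.C : ℂ → Polynomial ℂ)).det
  have hQ : ∀ t : ℂ, Q.eval t = (B + t • A).det := by
    intro t
    have := RingHom.map_det (Polynomial.evalRingHom t)
      (B.map (Polynomial.C : ℂ → Polynomial ℂ) +
        (Polynomial.X : Polynomial ℂ) • A.map (Polynomial.C : ℂ → Polynomial ℂ))
    rw [Polynomial.coe_evalRingHom] at this
    rw [this]
    congr 1
    ext i j
    simp
    ring
  have hI : Q.eval Complex.I ≠ 0 := by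
    rw [hQ]
    have h1 : (B + Complex.I • A)ᴴ * (B + Complex.I • A) = Aᴴ * A + Bᴴ * B := by
      have hs : Aᴴ * B = Bᴴ * A := by
        have := h.symm
        rw [neg_add_eq_sub, sub_eq_zero] at this
        exact this
      rw [Matrix.conjTranspose_add, Matrix.conjTranspose_smul, Matrix.add_mul, Matrix.mul_add,
        Matrix.mul_add, Matrix.smul_mul, Matrix.mul_smul, Matrix.smul_mul, Matrix.mul_smul, hs,
        smul_smul]
      simp
      abel
    have h2 := (Matrix.isUnit_iff_isUnit_det _).1 h.pos.isUnit
    rw [← h1, Matrix.det_mul] at h2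
    exact (isUnit_of_mul_isUnit_right h2).ne_zero
  have hQ0 : Q ≠ 0 := by rintro h0; rw [h0] at hI; simp at hI
  have hinf : (range fun t : ℝ => (t : ℂ)).Infinite :=
    infinite_range_of_injective Complex.ofReal_injective
  obtain ⟨z, ⟨t, rfl⟩, hz⟩ := hinf.exists_notMem_finset Q.roots.toFinset
  refine ⟨t, (Matrix.isUnit_iff_isUnit_det _).2 (isUnit_iff_ne_zero.2 ?_)⟩
  rw [← hQ]
  intro h0
  exact hz (by rw [Multiset.mem_toFinset]; exact (Polynomial.mem_roots hQ0).2 h0)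

lemma exists_angle {a b : ℝ} (h : a ≠ 0 ∨ b ≠ 0) :
    ∃ θ ∈ Ioc 0 Real.pi, ∃ τ : ℝ, τ ≠ 0 ∧ a = -Real.sin θ * τ ∧ b = Real.cos θ * τ := by
  have key : ∀ b : ℝ, ∀ a : ℝ, 0 < a → ∃ θ ∈ Ioc 0 Real.pi, ∃ τ : ℝ, τ ≠ 0 ∧ a = -Real.sin θ * τ ∧
      b = Real.cos θ * τ := by
    intro b a ha
    set r := Real.sqrt (a ^ 2 + b ^ 2) with hr
    have hr0 : 0 < r := Real.sqrt_pos.2 (by positivity)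
    have hr2 : r ^ 2 = a ^ 2 + b ^ 2 := Real.sq_sqrt (by positivity)
    have hb : |b| < r := abs_lt_of_sq_lt_sq (by nlinarith) hr0.le
    have hb1 := (abs_lt.1 hb).1
    have hb2 := (abs_lt.1 hb).2
    have hx1 : -1 < -b / r := by rw [lt_div_iff₀ hr0]; linarith
    have hx2 : -b / r < 1 := by rw [div_lt_iff₀ hr0]; linarith
    refine ⟨Real.arccos (-b / r), ⟨Real.arccos_pos.2 hx2, Real.arccos_le_pi _⟩, -r,
      neg_ne_zero.2 hr0.ne', ?_, ?_⟩
    · rw [Real.sin_arccos]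
      have : 1 - (-b / r) ^ 2 = (a / r) ^ 2 := by
        field_simp
        linarith
      rw [this, Real.sqrt_sq (by positivity)]
      field_simp
    · rw [Real.cos_arccos hx1.le hx2.le]
      field_simp
  rcases lt_trichotomy a 0 with ha | ha | ha
  · obtain ⟨θ, hθ, τ, hτ, h1, h2⟩ := key (-b) (-a) (by linarith)
    exact ⟨θ, hθ, -τ, neg_ne_zero.2 hτ, by linarith, by linarith⟩
  · refine ⟨Real.pi, ⟨Real.pi_pos, le_rfl⟩, -b, neg_ne_zero.2 (h.resolve_left (by simp [ha])), ?_, ?_⟩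
    · simp [ha]
    · simp
  · exact key b a ha

/-- The boundary conditions are diagonalized by an eigenbasis of the selfadjoint matrix
`(A - tB)(B + tA)⁻¹`. -/
lemma exists_isBoundaryAngles (h : IsSelfadjointBC A B) : ∃ θ, IsBoundaryAngles A B θ := by
  obtain ⟨t, ht⟩ := exists_isUnit_add_smul h
  set T := B + (t : ℂ) • A with hT
  have hdet : IsUnit T.det := (Matrix.isUnit_iff_isUnit_det _).1 ht
  have hTT : T⁻¹ * T = 1 := Matrix.nonsing_inv_mul T hdet
  have hTT' : T * T⁻¹ = 1 := Matrix.mul_nonsing_inv T hdet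
  set H := (A - (t : ℂ) • B) * T⁻¹ with hH
  have hHT : H * T = A - (t : ℂ) • B := by rw [hH, Matrix.mul_assoc, hTT, Matrix.mul_one]
  have hs : Aᴴ * B = Bᴴ * A := by
    have := h.symm
    rw [neg_add_eq_sub, sub_eq_zero] at this
    exact this
  have hTconj : Tᴴ = Bᴴ + (t : ℂ) • Aᴴ := by
    rw [hT, Matrix.conjTranspose_add, Matrix.conjTranspose_smul]; simp
  have hherm : H.IsHermitian := by
    have h1 : Tᴴ * H * T = Tᴴ * Hᴴ * T := by
      have e1 : Tᴴ * H * T = Tᴴ * (A - (t : ℂ) • B) := by rw [Matrix.mul_assoc, hHT]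
      have e2 : Tᴴ * Hᴴ * T = (Aᴴ - (t : ℂ) • Bᴴ) * T := by
        rw [← Matrix.conjTranspose_mul, hHT, Matrix.conjTranspose_sub, Matrix.conjTranspose_smul]
        simp
      rw [e1, e2, hTconj, hT]
      simp only [Matrix.add_mul, Matrix.sub_mul, Matrix.mul_add, Matrix.mul_sub, Matrix.smul_mul,
        Matrix.mul_smul, hs]
      module
    have hTTc : (T⁻¹)ᴴ * Tᴴ = 1 := by rw [← Matrix.conjTranspose_mul, hTT', Matrix.conjTranspose_one]
    have h2 := congrArg (fun X => (T⁻¹)ᴴ * X * T⁻¹) h1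
    have e3 : ∀ X : Matrix (Fin n) (Fin n) ℂ, (T⁻¹)ᴴ * (Tᴴ * X * T) * T⁻¹ = X := by
      intro X
      calc (T⁻¹)ᴴ * (Tᴴ * X * T) * T⁻¹ = ((T⁻¹)ᴴ * Tᴴ) * X * (T * T⁻¹) := by
            simp only [Matrix.mul_assoc]
        _ = X := by rw [hTTc, hTT', Matrix.one_mul, Matrix.mul_one]
    simp only [e3] at h2
    exact h2.symm
  set M : Matrix (Fin n) (Fin n) ℂ := (hherm.eigenvectorUnitary : Matrix (Fin n) (Fin n) ℂ) with hM
  have hMu : M ∈ Matrix.unitaryGroup (Fin n) ℂ := hherm.eigenvectorUnitary.2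
  have hMM : M * Mᴴ = 1 := Matrix.mem_unitaryGroup_iff.1 hMu
  set lam := hherm.eigenvalues with hlam
  have hspec : H = M * Matrix.diagonal (fun j => (lam j : ℂ)) * Mᴴ := by
    have := hherm.spectral_theorem
    rw [Unitary.conjStarAlgAut_apply] at this
    exact this
  -- on the `j`th eigenvector `(A, B)` is a multiple of `(λ + t, 1 - tλ)`, which does not vanish
  have hang : ∀ j, ∃ θ ∈ Ioc 0 Real.pi, ∃ τ : ℝ, τ ≠ 0 ∧ lam j + t = -Real.sin θ * τ ∧
      1 - t * lam j = Real.cos θ * τ := by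
    intro j
    refine exists_angle ?_
    by_contra! hcon
    have : lam j = -t := by linarith
    rw [this] at hcon
    nlinarith [hcon.2, sq_nonneg t]
  choose θ hθ τ hτ h1 h2 using hang
  have ht2 : ((1 + t ^ 2 : ℝ) : ℂ) ≠ 0 := by exact_mod_cast (by positivity : (1 + t ^ 2 : ℝ) ≠ 0)
  set u : ℂ := ((1 + t ^ 2 : ℝ) : ℂ)⁻¹ with hu
  have hu1 : u * (1 + (t : ℂ) ^ 2) = 1 := by
    have := inv_mul_cancel₀ ht2
    push_cast at this ⊢
    rw [hu]; push_cast; exact this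
  have hA : A = u • ((H + (t : ℂ) • 1) * T) := by
    rw [Matrix.add_mul, hHT, Matrix.smul_mul, Matrix.one_mul, hT]
    have : A - (t : ℂ) • B + (t : ℂ) • (B + (t : ℂ) • A) = (1 + (t : ℂ) ^ 2) • A := by module
    rw [this, smul_smul, hu1, one_smul]
  have hB : B = u • ((1 - (t : ℂ) • H) * T) := by
    rw [Matrix.sub_mul, Matrix.smul_mul, hHT, Matrix.one_mul, hT]
    have : B + (t : ℂ) • A - (t : ℂ) • (A - (t : ℂ) • B) = (1 + (t : ℂ) ^ 2) • B := by module
    rw [this, smul_smul, hu1, one_smul]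
  have hdiag : ∀ c : Fin n → ℂ, M * Matrix.diagonal c * Mᴴ * (u • T) =
      u • (M * Matrix.diagonal c * Mᴴ * T) := fun c => Matrix.mul_smul _ _ _
  refine ⟨θ, hθ, M, hMu, u • T, Matrix.diagonal fun j => (τ j : ℂ), ?_, ?_, ?_, ?_⟩
  · rw [Matrix.isUnit_iff_isUnit_det, Matrix.det_smul]
    exact ((isUnit_iff_ne_zero.2 (inv_ne_zero ht2)).pow _).mul hdet
  · rw [Matrix.isUnit_iff_isUnit_det, Matrix.det_diagonal, isUnit_iff_ne_zero]
    exact Finset.prod_ne_zero_iff.2 fun j _ => by exact_mod_cast hτ j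
  · have hn : (-Matrix.diagonal fun j => (Real.sin (θ j) : ℂ)) =
        Matrix.diagonal fun j => -(Real.sin (θ j) : ℂ) := Matrix.diagonal_neg _
    rw [Matrix.mul_assoc M, hn, Matrix.diagonal_mul_diagonal, hdiag]
    conv_lhs => rw [hA, hspec]
    congr 2
    have : (t : ℂ) • (1 : Matrix (Fin n) (Fin n) ℂ) = M * ((t : ℂ) • 1) * Mᴴ := by
      rw [Matrix.mul_smul, Matrix.mul_one, Matrix.smul_mul, hMM]
    rw [this, ← Matrix.add_mul, ← Matrix.mul_add, Matrix.smul_one_eq_diagonal,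
      Matrix.diagonal_add]
    congr 3
    funext j
    have := congrArg (fun x : ℝ => (x : ℂ)) (h1 j)
    push_cast at this
    simpa using this
  · rw [Matrix.mul_assoc M, Matrix.diagonal_mul_diagonal, hdiag]
    conv_lhs => rw [hB, hspec]
    congr 2
    have e1 : (t : ℂ) • (M * Matrix.diagonal (fun j => (lam j : ℂ)) * Mᴴ) =
        M * ((t : ℂ) • Matrix.diagonal (fun j => (lam j : ℂ))) * Mᴴ := by
      rw [Matrix.mul_smul, Matrix.smul_mul]
    have e2 : (1 : Matrix (Fin n) (Fin n) ℂ) = M * Matrix.diagonal (fun _ => 1) * Mᴴ := by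
      rw [Matrix.diagonal_one, Matrix.mul_one, hMM]
    rw [e1]
    conv_lhs => rw [e2]
    rw [← Matrix.sub_mul, ← Matrix.mul_sub, ← Matrix.diagonal_smul, Matrix.diagonal_sub]
    congr 3
    funext j
    have := congrArg (fun x : ℝ => (x : ℂ)) (h2 j)
    push_cast at this
    simpa using this

lemma numM_add_numN_add_numD (θ : Fin n → ℝ) : numM θ + numN θ + numD θ = n := by
  have hpi : Real.pi / 2 ≠ Real.pi := by have := Real.pi_pos; intro h; linarith
  have h1 : {j | θ j ≠ Real.pi / 2 ∧ θ j ≠ Real.pi} ∪ {j | θ j = Real.pi / 2} ∪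
      {j | θ j = Real.pi} = univ := by
    ext j
    simp only [mem_union, Set.mem_ofPred_eq, mem_univ, iff_true]
    tauto
  have d1 : Disjoint ({j | θ j ≠ Real.pi / 2 ∧ θ j ≠ Real.pi} ∪ {j | θ j = Real.pi / 2})
      {j | θ j = Real.pi} := by
    rw [Set.disjoint_left]
    rintro j (hj | hj) hj2
    · exact hj.2 hj2
    · exact hpi (hj.symm.trans hj2)
  have d2 : Disjoint {j | θ j ≠ Real.pi / 2 ∧ θ j ≠ Real.pi} {j | θ j = Real.pi / 2} := by
    rw [Set.disjoint_left]
    exact fun j hj hj2 => hj.1 hj2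
  rw [numM, numN, numD, ← ncard_union_eq d2, ← ncard_union_eq d1, h1, ncard_univ]
  simp

end Angles

/-! ### The leading term of the determinant of the Jost matrix -/

section LeadingConstant

variable {V W : ℝ → Matrix (Fin n) (Fin n) ℂ} {f f' : ℂ → ℝ → Matrix (Fin n) (Fin n) ℂ}
  {A B : Matrix (Fin n) (Fin n) ℂ} {ρ : ℝ}

lemma isBigO_mul_sub {φ ψ : ℂ → ℂ} {a b : ℂ}
    (h1 : (fun k => φ k - a) =O[upperInfty] fun k => k⁻¹)
    (h2 : (fun k => ψ k - b) =O[upperInfty] fun k => k⁻¹) :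
    (fun k => φ k * ψ k - a * b) =O[upperInfty] fun k => k⁻¹ := by
  have h3 : φ =O[upperInfty] fun k : ℂ => k⁻¹ ^ 0 := by
    have := (h1.trans_tendsto tendsto_inv_upperInfty).add_const a
    simp only [sub_add_cancel] at this
    exact isBigO_one_of_tendsto this
  have t1 := h3.mul h2
  simp only [pow_zero, one_mul] at t1
  refine (t1.add (h1.const_mul_left b)).congr_left fun k => ?_
  ring

lemma isBigO_prod_sub {ι : Type*} (s : Finset ι) {φ : ι → ℂ → ℂ} {a : ι → ℂ}
    (h : ∀ i, (fun k => φ i k - a i) =O[upperInfty] fun k => k⁻¹) :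
    (fun k => ∏ i ∈ s, φ i k - ∏ i ∈ s, a i) =O[upperInfty] fun k => k⁻¹ := by
  classical
  induction s using Finset.induction_on with
  | empty => simpa using Asymptotics.isBigO_zero _ _
  | insert i s hi ih => simpa only [Finset.prod_insert hi] using isBigO_mul_sub (h i) ih

lemma isBigO_det_sub {Φ : ℂ → Matrix (Fin n) (Fin n) ℂ} {Φ₀ : Matrix (Fin n) (Fin n) ℂ}
    (h : ∀ i j, (fun k => Φ k i j - Φ₀ i j) =O[upperInfty] fun k => k⁻¹) :
    (fun k => (Φ k).det - Φ₀.det) =O[upperInfty] fun k => k⁻¹ := by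
  have h1 : (fun k => ∑ σ : Equiv.Perm (Fin n), ((Equiv.Perm.sign σ : ℤ) : ℂ) *
      (∏ i, Φ k (σ i) i - ∏ i, Φ₀ (σ i) i)) =O[upperInfty] fun k => k⁻¹ :=
    Asymptotics.IsBigO.fun_sum fun σ _ => (isBigO_prod_sub (Finset.univ : Finset (Fin n))
      fun i => h (σ i) i).const_mul_left ((Equiv.Perm.sign σ : ℤ) : ℂ)
  refine h1.congr_left fun k => ?_
  rw [Matrix.det_apply', Matrix.det_apply', ← Finset.sum_sub_distrib]
  refine Finset.sum_congr rfl fun σ _ => ?_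
  ring

/-- In the basis that diagonalizes the boundary conditions, the leading part of `J(k)` is
`ik sin θ + cos θ`. Dividing the columns with `θ_j ≠ π` by `k` gives a matrix that converges to an
invertible diagonal matrix. -/
lemma exists_isLeadingConstant (hW : IsRegularPotential W) (hVW : ∀ x, 0 < x → V x = W x)
    (hρ : 1 < ρ) (hd : ∀ N, DecayOfOrder (fun x : ℝ => (1 + x) ^ (-ρ)) N W)
    (hf : IsJostSolution V f f') {θ : Fin n → ℝ} (hθ : IsBoundaryAngles A B θ) :
    ∃ c₂, IsLeadingConstant (jostMatrix f f' A B) (numM θ + numN θ) c₂ := by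
  classical
  obtain ⟨hθ0, M, hMu, T₁, T₂, hT₁, hT₂, hA, hB⟩ := hθ
  have hMM : M * Mᴴ = 1 := Matrix.mem_unitaryGroup_iff.1 hMu
  have hMM' : Mᴴ * M = 1 := Matrix.mem_unitaryGroup_iff'.1 hMu
  set J := jostMatrix f f' A B with hJ
  set S : Matrix (Fin n) (Fin n) ℂ := Matrix.diagonal fun j => (Real.sin (θ j) : ℂ) with hS
  set Co : Matrix (Fin n) (Fin n) ℂ := Matrix.diagonal fun j => (Real.cos (θ j) : ℂ) with hCo
  set Y := T₂ * Mᴴ * T₁ with hY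
  have hYu : IsUnit Y := (hT₂.mul ⟨⟨Mᴴ, M, hMM', hMM⟩, rfl⟩).mul hT₁
  have hYdet : IsUnit Y.det := (Matrix.isUnit_iff_isUnit_det _).1 hYu
  have hYY : Y * Y⁻¹ = 1 := Matrix.mul_nonsing_inv Y hYdet
  have hYY' : Y⁻¹ * Y = 1 := Matrix.nonsing_inv_mul Y hYdet
  have hcancel : ∀ X : Matrix (Fin n) (Fin n) ℂ, Mᴴ * (M * X * T₂ * Mᴴ * T₁) * Y⁻¹ = X := by
    intro X
    calc Mᴴ * (M * X * T₂ * Mᴴ * T₁) * Y⁻¹ = (Mᴴ * M) * X * (Y * Y⁻¹) := by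
          rw [hY]; simp only [Matrix.mul_assoc]
      _ = X := by rw [hMM', hYY, Matrix.one_mul, Matrix.mul_one]
  have hAY : Mᴴ * A * Y⁻¹ = -S := by rw [hA]; exact hcancel _
  have hBY : Mᴴ * B * Y⁻¹ = Co := by rw [hB]; exact hcancel _
  obtain ⟨C, hC⟩ := exists_norm_jostMatrix_sub_le A B hW hVW hρ hd hf 2
  set Z := Mᴴ * ((1 / 2 : ℂ) • (bCoeff V 1 0)ᴴ) * M with hZ
  -- `J(k) = -ik A + B - b₁(0)† A / 2 + O(1/k)`
  let Er : ℂ → Matrix (Fin n) (Fin n) ℂ := fun k =>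
    J k - (-(Complex.I * k) • A + B - ((1 / 2 : ℂ) • (bCoeff V 1 0)ᴴ) * A)
  have hEr : Er =O[upperInfty] fun k => k⁻¹ := by
    have h1 : (fun k => invTwoI k • Er k) =O[upperInfty] fun k => k⁻¹ ^ 2 := by
      have h2 : (fun k => invTwoI k ^ 2 • cCoeff V A B 2) =O[upperInfty] fun k => k⁻¹ ^ 2 :=
        ((invTwoI_pow_isBigO 2).smul (Asymptotics.isBigO_const_const (cCoeff V A B 2)
          (one_ne_zero' ℂ) upperInfty)).congr_right fun k => by simp
      have h3 : (fun k => invTwoI k • J k - ∑ m ∈ Finset.range (2 + 1),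
          invTwoI k ^ m • cCoeff V A B m) =O[upperInfty] fun k => k⁻¹ ^ 2 := by
        refine Asymptotics.IsBigO.of_bound C ?_
        filter_upwards [eventually_upperInfty 1] with k hk
        rw [norm_pow, norm_inv]
        exact hC k hk.1 hk.2
      refine (h3.add h2).congr' ?_ EventuallyEq.rfl
      filter_upwards [eventually_upperInfty 1] with k hk
      have hs : invTwoI k * (Complex.I * k) = 1 / 2 := by
        have h0 : Complex.I * k ≠ 0 := mul_ne_zero Complex.I_ne_zero hk.1.2
        rw [invTwoI, mul_assoc, mul_inv, mul_assoc, inv_mul_cancel₀ h0]; norm_num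
      have b0 : bCoeff V 0 0 = 1 := by rw [bCoeff]
      have b0' : derivWithin (bCoeff V 0) (Ici 0) 0 = 0 := by
        have : bCoeff V 0 = fun _ => 1 := by ext1 x; rw [bCoeff]
        rw [this, derivWithin_fun_const]; rfl
      simp only [Finset.sum_range_succ, Finset.sum_range_zero, zero_add, pow_zero, one_smul, pow_one,
        Er]
      have c0 : cCoeff V A B 0 = -((1 / 2 : ℂ) • A) := by rw [cCoeff]
      have c1 : cCoeff V A B 1 = B - ((1 / 2 : ℂ) • (bCoeff V 1 0)ᴴ) * A := by
        rw [cCoeff, b0, b0']; simp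
      have e1 : invTwoI k • (-(Complex.I * k) • A + B - ((1 / 2 : ℂ) • (bCoeff V 1 0)ᴴ) * A) =
          -((1 / 2 : ℂ) • A) + invTwoI k • (B - ((1 / 2 : ℂ) • (bCoeff V 1 0)ᴴ) * A) := by
        rw [add_sub_assoc, smul_add, smul_smul, mul_neg, hs, neg_smul]
      rw [c0, c1, smul_sub (invTwoI k) (J k), e1]
      abel
    refine (((Asymptotics.isBigO_const_mul_self (2 * Complex.I) (fun k : ℂ => k)
      upperInfty).smul h1)).congr' ?_ ?_
    · filter_upwards [eventually_upperInfty 1] with k hk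
      rw [smul_smul, invTwoI, mul_inv_cancel₀ (two_I_mul_ne_zero hk.1.2), one_smul]
    · filter_upwards [eventually_upperInfty 1] with k hk
      have := hk.1.2
      rw [smul_eq_mul]
      field_simp
  set E' : ℂ → Matrix (Fin n) (Fin n) ℂ := fun k => Mᴴ * Er k * Y⁻¹ with hE'
  have hE'b : ∀ i j, (fun k => E' k i j) =O[upperInfty] fun k => k⁻¹ := by
    intro i j
    refine Asymptotics.IsBigO.trans (Asymptotics.IsBigO.of_bound (‖Mᴴ‖ * ‖Y⁻¹‖)
      (Eventually.of_forall fun k => ?_)) hEr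
    refine (norm_entry_le _ i j).trans ((norm_mul_le _ _).trans ?_)
    rw [mul_right_comm]
    exact mul_le_mul_of_nonneg_right (norm_mul_le _ _) (norm_nonneg _)
  have hK : ∀ k, Mᴴ * J k * Y⁻¹ = (Complex.I * k) • S + Co - Z * (-S) + E' k := by
    intro k
    have e1 : J k = -(Complex.I * k) • A + B - ((1 / 2 : ℂ) • (bCoeff V 1 0)ᴴ) * A + Er k := by
      simp only [Er]; abel
    have e2 : Mᴴ * (((1 / 2 : ℂ) • (bCoeff V 1 0)ᴴ) * A) * Y⁻¹ = Z * (Mᴴ * A * Y⁻¹) := by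
      have : Z * (Mᴴ * A * Y⁻¹) = Mᴴ * ((1 / 2 : ℂ) • (bCoeff V 1 0)ᴴ) * (M * Mᴴ) * A * Y⁻¹ := by
        rw [hZ]; simp only [Matrix.mul_assoc]
      rw [this, hMM, Matrix.mul_one]
      simp only [Matrix.mul_assoc]
    conv_lhs => rw [e1]
    rw [Matrix.mul_add, Matrix.mul_sub, Matrix.mul_add, Matrix.mul_smul, Matrix.add_mul,
      Matrix.sub_mul, Matrix.add_mul, Matrix.smul_mul, e2, hAY, hBY]
    simp [hE']
  -- `δ` holds the scaling factors of the columns, and `Φ₀` is the limit of the scaled matrix; a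
  -- Dirichlet column (`θ_j = π`) of the term `b₁(0)† A / 2` vanishes, the others are lower order
  let δ : ℂ → Fin n → ℂ := fun k j => if θ j = Real.pi then 1 else k⁻¹
  let Φ₀ : Matrix (Fin n) (Fin n) ℂ := Matrix.diagonal fun j =>
    if θ j = Real.pi then -1 else Complex.I * (Real.sin (θ j) : ℂ)
  have hΦ₀ : Φ₀.det ≠ 0 := by
    rw [Matrix.det_diagonal]
    refine Finset.prod_ne_zero_iff.2 fun j _ => ?_
    split_ifs with h
    · exact neg_ne_zero.2 one_ne_zero
    · refine mul_ne_zero Complex.I_ne_zero ?_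
      exact_mod_cast (Real.sin_pos_of_pos_of_lt_pi (hθ0 j).1 (lt_of_le_of_ne (hθ0 j).2 h)).ne'
  have hentry : ∀ i j, (fun k => (Mᴴ * J k * Y⁻¹ * Matrix.diagonal (δ k)) i j - Φ₀ i j)
      =O[upperInfty] fun k => k⁻¹ := by
    intro i j
    have e : ∀ k, (Mᴴ * J k * Y⁻¹ * Matrix.diagonal (δ k)) i j = (Complex.I * k * S i j + Co i j
        + Z i j * (Real.sin (θ j) : ℂ) + E' k i j) * δ k j := by
      intro k
      rw [Matrix.mul_diagonal, hK, Matrix.mul_neg, sub_neg_eq_add, hS]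
      simp only [Matrix.add_apply, Matrix.smul_apply, smul_eq_mul, Matrix.mul_diagonal]
    simp only [e]
    by_cases h : θ j = Real.pi
    · refine (hE'b i j).congr_left fun k => ?_
      have hs : S i j = 0 := by
        rw [hS]; by_cases hij : i = j
        · subst hij; rw [Matrix.diagonal_apply_eq, h]; simp
        · rw [Matrix.diagonal_apply_ne _ hij]
      have hc : Co i j = Φ₀ i j := by
        rw [hCo]; by_cases hij : i = j
        · subst hij; simp only [Φ₀]; rw [Matrix.diagonal_apply_eq, Matrix.diagonal_apply_eq, if_pos h, h]
          simp
        · simp only [Φ₀]; rw [Matrix.diagonal_apply_ne _ hij, Matrix.diagonal_apply_ne _ hij]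
      rw [hs, hc, h]
      simp [δ, h]
    · have h1 : (fun k => Co i j + Z i j * (Real.sin (θ j) : ℂ) + E' k i j) =O[upperInfty]
          fun _ => (1 : ℂ) := by
        refine Asymptotics.IsBigO.add (Asymptotics.isBigO_const_const _ one_ne_zero _) ?_
        exact (hE'b i j).trans (tendsto_inv_upperInfty.isBigO_one ℂ)
      have h2 := h1.mul (Asymptotics.isBigO_refl (fun k : ℂ => k⁻¹) upperInfty)
      simp only [one_mul] at h2
      refine h2.congr' ?_ EventuallyEq.rfl
      filter_upwards [eventually_upperInfty 1] with k hk
      have hs : Φ₀ i j = Complex.I * S i j := by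
        rw [hS]; by_cases hij : i = j
        · subst hij; simp only [Φ₀]
          rw [Matrix.diagonal_apply_eq, Matrix.diagonal_apply_eq, if_neg h]
        · simp only [Φ₀]; rw [Matrix.diagonal_apply_ne _ hij, Matrix.diagonal_apply_ne _ hij, mul_zero]
      simp only [δ, if_neg h]
      have := hk.1.2
      rw [hs]
      field_simp
      ring
  have hdet := isBigO_det_sub hentry
  have hprod : ∀ k, ∏ j, δ k j = k⁻¹ ^ (numM θ + numN θ) := by
    intro k
    simp only [δ]
    rw [Finset.prod_ite, Finset.prod_const_one, one_mul, Finset.prod_const]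
    congr 1
    have h1 := numM_add_numN_add_numD θ
    have h2 : (Finset.univ.filter fun j => θ j = Real.pi).card = numD θ := by
      rw [numD, ← ncard_coe_finset]
      congr 1
      ext j; simp
    have h3 := Finset.card_filter_add_card_filter_not (s := (Finset.univ : Finset (Fin n)))
      (fun j => θ j = Real.pi)
    rw [Finset.card_univ, Fintype.card_fin] at h3
    omega
  have hMdet : Mᴴ.det * M.det = 1 := by rw [← Matrix.det_mul, hMM', Matrix.det_one]
  have hYdet' : Y⁻¹.det * Y.det = 1 := by rw [← Matrix.det_mul, hYY', Matrix.det_one]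
  have hM0 : M.det ≠ 0 := right_ne_zero_of_mul_eq_one hMdet
  refine ⟨Φ₀.det * M.det * Y.det, mul_ne_zero (mul_ne_zero hΦ₀ hM0) hYdet.ne_zero, ?_⟩
  simp only [one_div]
  refine (hdet.const_mul_left (Φ₀.det)⁻¹).congr' ?_ EventuallyEq.rfl
  filter_upwards [eventually_upperInfty 1] with k hk
  rw [Matrix.det_mul _ (Matrix.diagonal (δ k)), Matrix.det_diagonal (d := δ k), hprod,
    Matrix.det_mul, Matrix.det_mul, inv_pow]
  have hk0 : k ^ (numM θ + numN θ) ≠ 0 := pow_ne_zero _ hk.1.2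
  have hY0 := hYdet.ne_zero
  have e1 : Mᴴ.det = M.det⁻¹ := eq_inv_of_mul_eq_one_left hMdet
  have e2 : Y⁻¹.det = Y.det⁻¹ := eq_inv_of_mul_eq_one_left hYdet'
  rw [e1, e2]
  field_simp

end LeadingConstant

variable {n : ℕ}

/-! ### Order of zeros of determinants -/

section DetOrder

variable {α : Type*} {l : Filter α} {s : α → ℂ}

/-- If `|T|` columns of `M` are `O(s)` in a fixed basis and the others are bounded, then `det M` is
`O(s^|T|)`. -/
lemma det_isBigO_of_columns {M : α → Matrix (Fin n) (Fin n) ℂ} {U : Matrix (Fin n) (Fin n) ℂ}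
    (hU : U.det ≠ 0) (T : Finset (Fin n))
    (h1 : ∀ i j, (fun x => (M x * U) i j) =O[l] fun _ => (1 : ℂ))
    (h2 : ∀ j ∈ T, ∀ i, (fun x => (M x * U) i j) =O[l] s) :
    (fun x => (M x).det) =O[l] fun x => s x ^ T.card := by
  have h3 : (fun x => (M x * U).det) =O[l] fun x => s x ^ T.card := by
    simp only [Matrix.det_apply']
    refine Asymptotics.IsBigO.fun_sum fun σ _ => Asymptotics.IsBigO.const_mul_left ?_ _
    have h4 : (fun x => ∏ i, (M x * U) (σ i) i) =O[l]
        fun x => ∏ i : Fin n, if i ∈ T then s x else 1 := by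
      refine Asymptotics.IsBigO.finsetProd fun i _ => ?_
      by_cases hi : i ∈ T
      · simp only [if_pos hi]; exact h2 i hi (σ i)
      · simp only [if_neg hi]; exact h1 (σ i) i
    refine h4.congr_right fun x => ?_
    rw [Finset.prod_ite]
    simp
  simp only [Matrix.det_mul] at h3
  refine (h3.const_mul_left (U.det)⁻¹).congr_left fun x => ?_
  field_simp

lemma mul_isBigO_one {M : α → Matrix (Fin n) (Fin n) ℂ} (U : Matrix (Fin n) (Fin n) ℂ) {w : α → ℂ}
    (h : M =O[l] w) (i j : Fin n) : (fun x => (M x * U) i j) =O[l] w := by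
  refine Asymptotics.IsBigO.trans (Asymptotics.IsBigO.of_bound ‖U‖ (Eventually.of_forall
    fun x => ?_)) h
  rw [mul_comm]
  exact (norm_entry_le _ i j).trans (norm_mul_le _ _)

lemma det_eigenvectorUnitary_ne_zero {H : Matrix (Fin n) (Fin n) ℂ} (hH : H.IsHermitian) :
    (hH.eigenvectorUnitary : Matrix (Fin n) (Fin n) ℂ).det ≠ 0 := by
  have h := Matrix.mem_unitaryGroup_iff.1 hH.eigenvectorUnitary.2
  have h2 := congrArg Matrix.det h
  rw [Matrix.det_mul, Matrix.det_one] at h2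
  exact left_ne_zero_of_mul_eq_one h2

lemma mul_eigenvectorUnitary_apply {H : Matrix (Fin n) (Fin n) ℂ} (hH : H.IsHermitian)
    (i j : Fin n) : (H * (hH.eigenvectorUnitary : Matrix (Fin n) (Fin n) ℂ)) i j =
      (hH.eigenvalues j : ℂ) * (hH.eigenvectorUnitary : Matrix (Fin n) (Fin n) ℂ) i j := by
  have h := congrFun (hH.mulVec_eigenvectorBasis j) i
  rw [Matrix.mul_apply]
  exact h

lemma card_eigenvalues_ne_zero {H : Matrix (Fin n) (Fin n) ℂ} (hH : H.IsHermitian) :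
    (Finset.univ.filter fun j => hH.eigenvalues j ≠ 0).card = H.rank := by
  rw [hH.rank_eq_card_non_zero_eigs, Fintype.card_subtype]

/-- The small columns are those in the kernel of `M₀`. -/
lemma det_isBigO_of_sub {M : α → Matrix (Fin n) (Fin n) ℂ} (M₀ : Matrix (Fin n) (Fin n) ℂ)
    (h1 : M =O[l] fun _ => (1 : ℂ)) (h : (fun x => M x - M₀) =O[l] s) :
    (fun x => (M x).det) =O[l] fun x => s x ^ (n - M₀.rank) := by
  have hH : (M₀ᴴ * M₀).IsHermitian := Matrix.isHermitian_conjTranspose_mul_self M₀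
  set U : Matrix (Fin n) (Fin n) ℂ := (hH.eigenvectorUnitary : Matrix (Fin n) (Fin n) ℂ) with hU
  have hcard : (Finset.univ.filter fun j => ¬ hH.eigenvalues j ≠ 0).card = n - M₀.rank := by
    have h3 := Finset.card_filter_add_card_filter_not (s := (Finset.univ : Finset (Fin n)))
      (fun j => hH.eigenvalues j ≠ 0)
    rw [Finset.card_univ, Fintype.card_fin, card_eigenvalues_ne_zero,
      Matrix.rank_conjTranspose_mul_self] at h3
    omega
  rw [← hcard]
  refine det_isBigO_of_columns (det_eigenvectorUnitary_ne_zero hH) _ (mul_isBigO_one U h1)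
    fun j hj i => ?_
  have hj0 : hH.eigenvalues j = 0 := by simpa using hj
  have h0 : (M₀ * U) i j = 0 := by
    have e : (M₀ᴴ * M₀) *ᵥ (fun i => U i j) = 0 := by
      funext i
      have := mul_eigenvectorUnitary_apply hH i j
      rw [hj0, Complex.ofReal_zero, zero_mul] at this
      exact this
    exact congrFun ((Matrix.conjTranspose_mul_self_mulVec_eq_zero _ _).1 e) i
  refine (mul_isBigO_one U h i j).congr_left fun x => ?_
  rw [Matrix.sub_mul, Matrix.sub_apply, h0, sub_zero]

/-- The small columns are those in the range of `M₀`. -/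
lemma det_isBigO_of_mul {M : α → Matrix (Fin n) (Fin n) ℂ} (M₀ : Matrix (Fin n) (Fin n) ℂ)
    (h1 : M =O[l] fun _ => (1 : ℂ)) (h : (fun x => M x * M₀) =O[l] s) :
    (fun x => (M x).det) =O[l] fun x => s x ^ M₀.rank := by
  have hH : (M₀ * M₀ᴴ).IsHermitian := Matrix.isHermitian_mul_conjTranspose_self M₀
  set U : Matrix (Fin n) (Fin n) ℂ := (hH.eigenvectorUnitary : Matrix (Fin n) (Fin n) ℂ) with hU
  have hcard := card_eigenvalues_ne_zero hH
  rw [Matrix.rank_self_mul_conjTranspose] at hcard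
  rw [← hcard]
  refine det_isBigO_of_columns (det_eigenvectorUnitary_ne_zero hH) _ (mul_isBigO_one U h1)
    fun j hj i => ?_
  have hj0 : (hH.eigenvalues j : ℂ) ≠ 0 := by
    have : hH.eigenvalues j ≠ 0 := by simpa using hj
    exact_mod_cast this
  refine ((mul_isBigO_one (M₀ᴴ * U) h i j).const_mul_left (hH.eigenvalues j : ℂ)⁻¹).congr_left
    fun x => ?_
  have e : (M x * M₀ * (M₀ᴴ * U)) i j = (hH.eigenvalues j : ℂ) * (M x * U) i j := by
    rw [Matrix.mul_assoc, ← Matrix.mul_assoc M₀, Matrix.mul_apply, Matrix.mul_apply,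
      Finset.mul_sum]
    refine Finset.sum_congr rfl fun m _ => ?_
    rw [mul_eigenvectorUnitary_apply hH m j]
    ring
  rw [e, inv_mul_cancel_left₀ hj0]

/-- If `J` is differentiable at `k₀`, `det J` is analytic there and `J(k₀ + t)⁻¹ = O(1/t)` along
the real direction, then the order of the zero of `det J` is the dimension of the kernel of
`J(k₀)`. -/
lemma exists_det_eq_pow_mul {J : ℂ → Matrix (Fin n) (Fin n) ℂ} {k₀ : ℂ}
    (hJ : DifferentiableAt ℂ J k₀) (hΔ : AnalyticAt ℂ (fun k => (J k).det) k₀) {C : ℝ}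
    (hlow : ∀ᶠ t : ℝ in 𝓝[≠] 0, IsUnit (J (k₀ + t)).det ∧ ‖(J (k₀ + t))⁻¹‖ ≤ C / |t|) :
    ∃ D : ℂ → ℂ, AnalyticAt ℂ D k₀ ∧ D k₀ ≠ 0 ∧
      ∀ᶠ z in 𝓝 k₀, (J z).det = (z - k₀) ^ (n - (J k₀).rank) * D z := by
  set r := (J k₀).rank with hr
  have hrn : r ≤ n := by simpa using (J k₀).rank_le_width
  have hγ : Tendsto (fun t : ℝ => k₀ + (t : ℂ)) (𝓝[≠] 0) (𝓝 k₀) := by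
    have : Tendsto (fun t : ℝ => k₀ + (t : ℂ)) (𝓝 0) (𝓝 (k₀ + ((0 : ℝ) : ℂ))) :=
      (continuous_const.add Complex.continuous_ofReal).tendsto 0
    rw [Complex.ofReal_zero, add_zero] at this
    exact this.mono_left nhdsWithin_le_nhds
  have hJO : (fun k => J k - J k₀) =O[𝓝 k₀] fun k => k - k₀ := hJ.isBigO_sub
  have hJ1 : J =O[𝓝 k₀] fun _ => (1 : ℂ) := hJ.continuousAt.isBigO_one ℂ
  have hup : (fun k => (J k).det) =O[𝓝 k₀] fun k => (k - k₀) ^ (n - r) := det_isBigO_of_sub _ hJ1 hJO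
  -- `t J(k₀ + t)⁻¹` is bounded, and `O(t)` on the range of `J(k₀)`, so its determinant is `O(tʳ)`
  have hdown : (fun t : ℝ => (t : ℂ) ^ (n - r)) =O[𝓝[≠] 0] fun t : ℝ => (J (k₀ + t)).det := by
    let R : ℝ → Matrix (Fin n) (Fin n) ℂ := fun t => (t : ℂ) • (J (k₀ + t))⁻¹
    have hR1 : R =O[𝓝[≠] 0] fun _ => (1 : ℂ) := by
      refine Asymptotics.IsBigO.of_bound C ?_
      filter_upwards [hlow, self_mem_nhdsWithin] with t ht ht0
      have : 0 < |t| := abs_pos.2 ht0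
      rw [norm_smul, Complex.norm_real, Real.norm_eq_abs, norm_one, mul_one]
      calc |t| * ‖(J (k₀ + t))⁻¹‖ ≤ |t| * (C / |t|) := by gcongr; exact ht.2
        _ = C := by field_simp
    have hRJ : (fun t => R t * J k₀) =O[𝓝[≠] 0] fun t : ℝ => (t : ℂ) := by
      have h1 : (fun t : ℝ => J (k₀ + t) - J k₀) =O[𝓝[≠] 0] fun t : ℝ => (t : ℂ) :=
        (hJO.comp_tendsto hγ).congr_right fun t => by simp
      have h2 : (fun t => R t * (J (k₀ + t) - J k₀)) =O[𝓝[≠] 0] fun t : ℝ => (t : ℂ) := by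
        simpa only [one_mul] using hR1.mul h1
      have h3 : (fun t : ℝ => (t : ℂ) • (1 : Matrix (Fin n) (Fin n) ℂ)) =O[𝓝[≠] 0]
          fun t : ℝ => (t : ℂ) :=
        ((Asymptotics.isBigO_refl (fun t : ℝ => (t : ℂ)) (𝓝[≠] 0)).smul
          (Asymptotics.isBigO_const_const (1 : Matrix (Fin n) (Fin n) ℂ)
            (one_ne_zero' ℂ) _)).congr_right fun t => by simp
      refine (h3.sub h2).congr' ?_ EventuallyEq.rfl
      filter_upwards [hlow] with t ht
      rw [Matrix.mul_sub, Matrix.smul_mul, Matrix.nonsing_inv_mul _ ht.1]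
      abel
    have hdet := det_isBigO_of_mul _ hR1 hRJ
    rw [← hr] at hdet
    have h4 := hdet.mul (Asymptotics.isBigO_refl (fun t : ℝ => (J (k₀ + t)).det) (𝓝[≠] 0))
    obtain ⟨K, hK⟩ := h4.bound
    refine Asymptotics.IsBigO.of_bound K ?_
    filter_upwards [hK, hlow, self_mem_nhdsWithin] with t ht ht2 ht0
    have ht0' : (0:ℝ) < ‖(t : ℂ)‖ := by
      rw [Complex.norm_real]; exact norm_pos_iff.2 ht0
    have e : (R t).det * (J (k₀ + t)).det = (t : ℂ) ^ n := by
      rw [← Matrix.det_mul, Matrix.smul_mul, Matrix.nonsing_inv_mul _ ht2.1, Matrix.det_smul]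
      simp
    rw [e, norm_mul, norm_pow, norm_pow] at ht
    rw [norm_pow]
    have e2 : ‖(t : ℂ)‖ ^ n = ‖(t : ℂ)‖ ^ r * ‖(t : ℂ)‖ ^ (n - r) := by
      rw [← pow_add]; congr 1; omega
    rw [e2, mul_left_comm] at ht
    exact le_of_mul_le_mul_left ht (pow_pos ht0' r)
  have hne : ¬∀ᶠ z in 𝓝 k₀, (J z).det = 0 := by
    intro h
    obtain ⟨t, h1, h2⟩ := ((hγ.eventually h).and hlow).exists
    exact h2.1.ne_zero h1
  obtain ⟨p, D, hD, hD0, hp⟩ := hΔ.exists_eventuallyEq_pow_smul_nonzero_iff.2 hne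
  suffices hpm : p = n - r by
    subst hpm
    exact ⟨D, hD, hD0, hp⟩
  have hDi : (fun z => (D z)⁻¹) =O[𝓝 k₀] fun _ => (1 : ℂ) :=
    (hD.continuousAt.inv₀ hD0).isBigO_one ℂ
  have hD1 : D =O[𝓝 k₀] fun _ => (1 : ℂ) := hD.continuousAt.isBigO_one ℂ
  have hDev : ∀ᶠ z in 𝓝 k₀, D z ≠ 0 := hD.continuousAt.eventually_ne hD0
  have hcomp : ∀ a b : ℕ, (fun t : ℝ => (t : ℂ) ^ a) =O[𝓝[≠] 0] (fun t : ℝ => (t : ℂ) ^ b) →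
      b ≤ a := by
    intro a b h
    by_contra! hab
    obtain ⟨d, rfl⟩ : ∃ d, b = a + (d + 1) := ⟨b - a - 1, by omega⟩
    obtain ⟨K, hK⟩ := h.bound
    have ht : Tendsto (fun t : ℝ => K * |t| ^ (d + 1)) (𝓝[≠] 0) (𝓝 0) := by
      have : Tendsto (fun t : ℝ => K * |t| ^ (d + 1)) (𝓝 0) (𝓝 (K * |0| ^ (d + 1))) :=
        (by fun_prop : Continuous fun t : ℝ => K * |t| ^ (d + 1)).tendsto 0
      simp only [abs_zero, ne_eq, Nat.add_eq_zero_iff, one_ne_zero, and_false, not_false_eq_true,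
        zero_pow, mul_zero] at this
      exact this.mono_left nhdsWithin_le_nhds
    obtain ⟨t, h1, h2, h3⟩ := (hK.and ((ht.eventually (gt_mem_nhds one_pos)).and
      self_mem_nhdsWithin)).exists
    rw [pow_add, norm_mul, norm_pow, norm_pow, Complex.norm_real, Real.norm_eq_abs] at h1
    have ht0 : 0 < |t| ^ a := pow_pos (abs_pos.2 h3) a
    nlinarith
  refine le_antisymm ?_ ?_
  · refine hcomp _ _ ((hdown.trans ?_))
    refine ((((Asymptotics.isBigO_refl (fun k => (k - k₀) ^ p) (𝓝 k₀)).mul hD1).comp_tendsto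
      hγ)).congr' ?_ ?_
    · filter_upwards [hγ.eventually hp] with t ht
      rw [ht]; rfl
    · filter_upwards with t
      simp
  · refine hcomp _ _ ?_
    refine ((hup.mul hDi).comp_tendsto hγ).congr' ?_ ?_
    · filter_upwards [hγ.eventually hp, hγ.eventually hDev] with t ht ht2
      simp only [Function.comp_apply]
      rw [ht, smul_eq_mul, mul_inv_cancel_right₀ ht2]
      simp
    · filter_upwards with t
      simp

lemma isUnit_det_of_lower_bound {M : Matrix (Fin n) (Fin n) ℂ} {c : ℝ} (hc : 0 < c)
    (h : ∀ v, c * ‖v‖ ≤ ‖matOp M v‖) : IsUnit M.det ∧ ‖M⁻¹‖ ≤ 1 / c := by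
  have hu : IsUnit M.det := by
    rw [isUnit_iff_ne_zero]
    intro h0
    obtain ⟨v, hv0, hv⟩ := Matrix.exists_mulVec_eq_zero_iff.2 h0
    have h1 : matOp M (WithLp.toLp 2 v) = 0 := congrArg (WithLp.toLp 2) hv
    have h2 := h (WithLp.toLp 2 v)
    rw [h1, norm_zero] at h2
    have h3 : ‖WithLp.toLp 2 v‖ = 0 := by nlinarith [norm_nonneg (WithLp.toLp 2 v)]
    exact hv0 (congrArg WithLp.ofLp (norm_eq_zero.1 h3))
  refine ⟨hu, (matOp M⁻¹).opNorm_le_bound (by positivity) fun v => ?_⟩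
  have h1 := h (matOp M⁻¹ v)
  rw [← matOp_mul_apply, Matrix.mul_nonsing_inv _ hu, matOp_one_apply] at h1
  rw [div_mul_eq_mul_div, one_mul, le_div_iff₀ hc]
  linarith

lemma norm_det_le (M : Matrix (Fin n) (Fin n) ℂ) : ‖M.det‖ ≤ (n.factorial : ℝ) * ‖M‖ ^ n := by
  have := Matrix.det_le (abv := IsAbsoluteValue.toAbsoluteValue (norm : ℂ → ℝ)) (A := M) (x := ‖M‖)
    (fun i j => norm_entry_le M i j)
  simpa using this

lemma finrank_ker_matOp (M : Matrix (Fin n) (Fin n) ℂ) :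
    Module.finrank ℂ (LinearMap.ker (matOp M).toLinearMap) = n - Mᴴ.rank := by
  have h1 := LinearMap.finrank_range_add_finrank_ker (matOp M).toLinearMap
  have h2 : Module.finrank ℂ (LinearMap.range (matOp M).toLinearMap) = M.rank := by
    rw [Matrix.rank_eq_finrank_range_toLin M (PiLp.basisFun 2 ℂ (Fin n)) (PiLp.basisFun 2 ℂ (Fin n)),
      ← Matrix.toEuclideanLin_eq_toLin]
    rfl
  rw [h2, finrank_euclideanSpace, Fintype.card_fin] at h1
  rw [Matrix.rank_conjTranspose]
  omega

end DetOrder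

/-! ### Moments of holomorphic functions in a strip -/

/-- The closed strip `0 ≤ Im w ≤ π`, the image of the punctured half plane under the logarithm. -/
def closedStrip : Set ℂ := {w | 0 ≤ w.im ∧ w.im ≤ Real.pi}

/-- `G` is continuous on the strip, holomorphic inside, its real part grows at most linearly in
`Re w`, and `G(w) ∼ ∑_{l ≥ 1} a_l e^{-lw}` as `Re w → ∞`.  No bound is assumed for the imaginary
part of `G` as `Re w → -∞`. -/
structure IsStripLog (G : ℂ → ℂ) (a : ℕ → ℂ) : Prop where
  continuousOn : ContinuousOn G closedStrip
  differentiableAt : ∀ w : ℂ, 0 < w.im → w.im < Real.pi → DifferentiableAt ℂ G w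
  re_le : ∃ C : ℝ, 0 < C ∧ ∀ w ∈ closedStrip, |(G w).re| ≤ C * (1 + |w.re|)
  expansion : ∀ N : ℕ, ∃ C R : ℝ, 0 ≤ C ∧ ∀ w ∈ closedStrip, R ≤ w.re →
    ‖G w - ∑ l ∈ Finset.range N, a (l + 1) * Complex.exp (-((l + 1 : ℕ) : ℂ) * w)‖ ≤
      C * Real.exp (-((N : ℝ) + 1) * w.re)

/-- The profile `1 + φ^{-1/4} + (π-φ)^{-1/4}`, square integrable on `(0, π)`. -/
noncomputable def edgeProfile (φ : ℝ) : ℝ :=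
  1 + φ ^ (-(1 / 4) : ℝ) + (Real.pi - φ) ^ (-(1 / 4) : ℝ)

lemma one_le_edgeProfile {φ : ℝ} (h0 : 0 ≤ φ) (h1 : φ ≤ Real.pi) : 1 ≤ edgeProfile φ := by
  have h2 := Real.rpow_nonneg h0 (-(1 / 4))
  have h3 := Real.rpow_nonneg (sub_nonneg.2 h1) (-(1 / 4))
  rw [edgeProfile]; linarith

lemma intervalIntegrable_edgeProfile_sq :
    IntervalIntegrable (fun φ => edgeProfile φ ^ 2) volume 0 Real.pi := by
  have h1 : IntervalIntegrable (fun φ : ℝ => φ ^ (-(1 / 2) : ℝ)) volume 0 Real.pi :=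
    intervalIntegral.intervalIntegrable_rpow' (by norm_num)
  have h2 : IntervalIntegrable (fun φ : ℝ => (Real.pi - φ) ^ (-(1 / 2) : ℝ)) volume 0 Real.pi := by
    have h := (h1.comp_sub_left Real.pi).symm
    simpa using h
  have h3 : IntervalIntegrable (fun φ : ℝ => 3 * (1 + φ ^ (-(1 / 2) : ℝ) +
      (Real.pi - φ) ^ (-(1 / 2) : ℝ))) volume 0 Real.pi :=
    ((intervalIntegrable_const.add h1).add h2).const_mul 3
  refine h3.mono_fun' ?_ ?_
  · have hm : Measurable fun φ => edgeProfile φ ^ 2 := by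
      unfold edgeProfile; fun_prop
    exact hm.aestronglyMeasurable
  · rw [uIoc_of_le Real.pi_pos.le]
    refine (ae_restrict_mem measurableSet_Ioc).mono fun φ hφ => ?_
    have e1 : ∀ x : ℝ, 0 ≤ x → x ^ (-(1 / 2) : ℝ) = (x ^ (-(1 / 4) : ℝ)) ^ 2 := fun x hx => by
      rw [← Real.rpow_natCast, ← Real.rpow_mul hx]; norm_num
    beta_reduce
    rw [Real.norm_of_nonneg (sq_nonneg _), e1 φ hφ.1.le, e1 (Real.pi - φ) (sub_nonneg.2 hφ.2),
      edgeProfile]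
    set x := φ ^ (-(1 / 4) : ℝ)
    set y := (Real.pi - φ) ^ (-(1 / 4) : ℝ)
    nlinarith [sq_nonneg (1 - x), sq_nonneg (1 - y), sq_nonneg (x - y)]

lemma abs_log_le_rpow {x : ℝ} (h0 : 0 < x) (h1 : x ≤ Real.pi) :
    |Real.log x| ≤ 4 + 4 * x ^ (-(1 / 4) : ℝ) := by
  have h2 : 0 < x ^ (-(1 / 4) : ℝ) := Real.rpow_pos_of_pos h0 _
  have h3 : Real.log x ≤ 4 := by
    have := Real.log_le_sub_one_of_pos h0
    linarith [Real.pi_lt_four]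
  have h4 : -Real.log x ≤ 4 * x ^ (-(1 / 4) : ℝ) := by
    have h := Real.log_le_sub_one_of_pos h2
    rw [Real.log_rpow h0] at h
    linarith
  rw [abs_le]; constructor <;> linarith

section StripBounds

variable {G : ℂ → ℂ} {a : ℕ → ℂ}

lemma mk_mem_strip (t : ℝ) {φ : ℝ} (h0 : 0 ≤ φ) (h1 : φ ≤ Real.pi) :
    (t + φ * Complex.I : ℂ) ∈ closedStrip := by
  constructor <;> simpa

/-- The Borel–Carathéodory inequality on the largest disc inside the strip. -/
lemma IsStripLog.exists_norm_deriv_le (hG : IsStripLog G a) : ∃ K : ℝ, 0 < K ∧ ∀ w : ℂ,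
    0 < w.im → w.im < Real.pi →
      ‖deriv G w‖ ≤ K * (1 + |w.re|) * (1 / w.im + 1 / (Real.pi - w.im)) := by
  obtain ⟨C, hC, hre⟩ := hG.re_le
  refine ⟨24 * C, by positivity, fun w h0 h1 => ?_⟩
  set r := min w.im (Real.pi - w.im)
  have hr : 0 < r := lt_min h0 (by linarith)
  have hr2 : r ≤ 2 := by
    have e1 : r ≤ w.im := min_le_left _ _
    have e2 : r ≤ Real.pi - w.im := min_le_right _ _
    linarith [Real.pi_lt_four]
  have hin : ∀ z : ℂ, ‖z‖ < r → 0 < (w + z).im ∧ (w + z).im < Real.pi := fun z hz => by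
    have e1 : r ≤ w.im := min_le_left _ _
    have e2 : r ≤ Real.pi - w.im := min_le_right _ _
    have e3 := abs_le.1 (Complex.abs_im_le_norm z)
    rw [Complex.add_im]
    constructor <;> linarith [e3.1, e3.2]
  set M : ℝ := 2 * C * (3 + |w.re|)
  have hM : 0 < M := by positivity
  have hf : DifferentiableOn ℂ (fun z => G (w + z) - G w) (Metric.ball 0 r) := by
    intro z hz
    have hz' := hin z (by simpa using hz)
    have hd := hG.differentiableAt (w + z) hz'.1 hz'.2
    exact ((hd.comp z ((differentiableAt_const w).add differentiableAt_id)).sub_const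
      _).differentiableWithinAt
  have hmaps : MapsTo (fun z => G (w + z) - G w) (Metric.ball 0 r) {z | z.re ≤ M} := by
    intro z hz
    have hzr : ‖z‖ < r := by simpa using hz
    have hz' := hin z hzr
    have e1 := abs_le.1 (hre (w + z) ⟨hz'.1.le, hz'.2.le⟩)
    have e2 := abs_le.1 (hre w ⟨h0.le, h1.le⟩)
    have e3 : |(w + z).re| ≤ |w.re| + 2 := by
      rw [Complex.add_re]
      linarith [abs_add_le w.re z.re, Complex.abs_re_le_norm z]
    have e4 : C * (1 + |(w + z).re|) ≤ C * (3 + |w.re|) :=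
      mul_le_mul_of_nonneg_left (by linarith) hC.le
    have e5 : C * (1 + |w.re|) ≤ C * (3 + |w.re|) :=
      mul_le_mul_of_nonneg_left (by linarith) hC.le
    simp only [mem_ofPred_eq, Complex.sub_re, M]
    linarith [e1.2, e2.1]
  have hlip : ∀ᶠ x in 𝓝 w, ‖G x - G w‖ ≤ 4 * M / r * ‖x - w‖ := by
    have hball : Metric.ball w (r / 2) ∈ 𝓝 w := Metric.ball_mem_nhds w (by positivity)
    filter_upwards [hball] with x hx
    have hx' : ‖x - w‖ < r / 2 := by simpa [dist_eq_norm] using hx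
    have h := Complex.borelCaratheodory_zero (z := x - w) hM hf hmaps hr
      (by simp only [Metric.mem_ball, dist_zero_right]; linarith) (by simp)
    simp only [add_sub_cancel] at h
    refine h.trans ?_
    rw [div_mul_eq_mul_div, div_le_div_iff₀ (by linarith) hr]
    have : 0 ≤ M * ‖x - w‖ := by positivity
    nlinarith
  have h3 := (hG.differentiableAt w h0 h1).hasDerivAt.le_of_lip' (by positivity) hlip
  refine h3.trans ?_
  have h4 : 1 / r ≤ 1 / w.im + 1 / (Real.pi - w.im) := by
    have p1 : 0 < 1 / w.im := by positivity
    have p2 : 0 < 1 / (Real.pi - w.im) := one_div_pos.2 (by linarith)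
    rcases min_choice w.im (Real.pi - w.im) with h | h
    · simp only [r, h]; linarith
    · simp only [r, h]; linarith
  calc 4 * M / r = 4 * M * (1 / r) := by ring
    _ ≤ (24 * C * (1 + |w.re|)) * (1 / w.im + 1 / (Real.pi - w.im)) := by
        refine mul_le_mul ?_ h4 (by positivity) (by positivity)
        simp only [M]; nlinarith [abs_nonneg w.re]

/-- A holomorphic function on the strip whose real part is of linear growth has at most logarithmic
singularities at the edges. -/
lemma IsStripLog.exists_norm_le (hG : IsStripLog G a) : ∃ K : ℝ, 0 < K ∧ ∀ t φ : ℝ,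
    0 < φ → φ < Real.pi → ‖G (t + φ * Complex.I)‖ ≤ K * (1 + |t|) ^ 2 * edgeProfile φ := by
  obtain ⟨K, hK, hd⟩ := hG.exists_norm_deriv_le
  have hpi := Real.pi_gt_three
  set G₀ := G ((0 : ℝ) + (Real.pi / 2 : ℝ) * Complex.I)
  refine ⟨‖G₀‖ + 12 * K, by positivity, fun t φ h0 h1 => ?_⟩
  have hmid : ‖G (t + (Real.pi / 2 : ℝ) * Complex.I) - G₀‖ ≤ (K * (1 + |t|) * 2) * ‖t - 0‖ := by
    refine (convex_uIcc (0 : ℝ) t).norm_image_sub_le_of_norm_hasDerivWithin_le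
      (f := fun s : ℝ => G (s + (Real.pi / 2 : ℝ) * Complex.I))
      (f' := fun s : ℝ => deriv G (s + (Real.pi / 2 : ℝ) * Complex.I)) (fun s _ => ?_)
      (fun s hs => ?_) left_mem_uIcc right_mem_uIcc
    · have e1 := (hG.differentiableAt (s + (Real.pi / 2 : ℝ) * Complex.I) (by simp; linarith)
        (by simp; linarith)).hasDerivAt
      have e2 : HasDerivAt (fun s : ℝ => (s + (Real.pi / 2 : ℝ) * Complex.I : ℂ)) 1 s :=
        (Complex.ofRealCLM.hasDerivAt (x := s)).add_const _
      exact (e1.scomp s e2).hasDerivWithinAt.congr_deriv (by simp)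
    · have e1 := hd (s + (Real.pi / 2 : ℝ) * Complex.I) (by simp; linarith) (by simp; linarith)
      have e2 : |s| ≤ |t| := by
        have := abs_sub_left_of_mem_uIcc hs
        simpa using this
      refine e1.trans ?_
      have e3 : (((s : ℂ) + (Real.pi / 2 : ℝ) * Complex.I).im) = Real.pi / 2 := by simp
      have e4 : (((s : ℂ) + (Real.pi / 2 : ℝ) * Complex.I).re) = s := by simp
      rw [e3, e4]
      have e5 : 1 / (Real.pi / 2) + 1 / (Real.pi - Real.pi / 2) ≤ 2 := by
        rw [show Real.pi - Real.pi / 2 = Real.pi / 2 by ring, ← add_div,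
          div_le_iff₀ (by linarith)]
        linarith
      have e6 : 0 < 1 / (Real.pi / 2) + 1 / (Real.pi - Real.pi / 2) := by
        rw [show Real.pi - Real.pi / 2 = Real.pi / 2 by ring]; positivity
      gcongr
  -- the logistic parametrization of `(0, π)` turns the bound on the derivative into a constant
  set ψ : ℝ → ℝ := fun s => Real.pi / (1 + Real.exp (-s))
  have hψpos : ∀ s, 0 < ψ s := fun s => by simp only [ψ]; positivity
  have hψlt : ∀ s, ψ s < Real.pi := fun s => by
    simp only [ψ]
    rw [div_lt_iff₀ (by positivity)]
    nlinarith [Real.exp_pos (-s)]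
  have hψd : ∀ s, HasDerivAt ψ (ψ s * (Real.pi - ψ s) / Real.pi) s := fun s => by
    have e1 : HasDerivAt (fun s : ℝ => 1 + Real.exp (-s)) (Real.exp (-s) * (-1)) s :=
      ((hasDerivAt_neg s).exp).const_add 1
    have hne : 1 + Real.exp (-s) ≠ 0 := by positivity
    refine ((hasDerivAt_const s Real.pi).div e1 hne).congr_deriv ?_
    simp only [ψ]
    field_simp
    ring
  set σ := Real.log φ - Real.log (Real.pi - φ)
  have hψσ : ψ σ = φ := by
    have e1 : Real.exp (-σ) = (Real.pi - φ) / φ := by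
      simp only [σ, neg_sub, Real.exp_sub, Real.exp_log h0, Real.exp_log (sub_pos.2 h1)]
    simp only [ψ, e1]
    field_simp
    ring
  have hψ0 : ψ 0 = Real.pi / 2 := by simp [ψ]; norm_num
  have hver : ‖G (t + (ψ σ : ℝ) * Complex.I) - G (t + (ψ 0 : ℝ) * Complex.I)‖ ≤
      (K * (1 + |t|)) * ‖σ - 0‖ := by
    refine (convex_uIcc (0 : ℝ) σ).norm_image_sub_le_of_norm_hasDerivWithin_le
      (f := fun s : ℝ => G (t + (ψ s : ℝ) * Complex.I))
      (f' := fun s : ℝ => (((ψ s * (Real.pi - ψ s) / Real.pi : ℝ) : ℂ) * Complex.I) •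
        deriv G (t + (ψ s : ℝ) * Complex.I)) (fun s _ => ?_)
      (fun s hs => ?_) left_mem_uIcc right_mem_uIcc
    · have e1 := (hG.differentiableAt (t + (ψ s : ℝ) * Complex.I) (by simpa using hψpos s)
        (by simpa using hψlt s)).hasDerivAt
      have e2 : HasDerivAt (fun s : ℝ => (t + (ψ s : ℝ) * Complex.I : ℂ))
          (((ψ s * (Real.pi - ψ s) / Real.pi : ℝ) : ℂ) * Complex.I) s :=
        ((hψd s).ofReal_comp.mul_const Complex.I).const_add (t : ℂ)
      exact (e1.scomp s e2).hasDerivWithinAt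
    · have e1 := hd (t + (ψ s : ℝ) * Complex.I) (by simpa using hψpos s) (by simpa using hψlt s)
      have e3 : (((t : ℂ) + (ψ s : ℝ) * Complex.I).im) = ψ s := by simp
      have e4 : (((t : ℂ) + (ψ s : ℝ) * Complex.I).re) = t := by simp
      rw [e3, e4] at e1
      have p1 := hψpos s
      have p2 : 0 < Real.pi - ψ s := sub_pos.2 (hψlt s)
      have p3 := Real.pi_pos
      rw [norm_smul, norm_mul, Complex.norm_I, mul_one, Complex.norm_real,
        Real.norm_of_nonneg (by positivity)]
      calc ψ s * (Real.pi - ψ s) / Real.pi * ‖deriv G (t + (ψ s : ℝ) * Complex.I)‖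
          ≤ ψ s * (Real.pi - ψ s) / Real.pi *
            (K * (1 + |t|) * (1 / ψ s + 1 / (Real.pi - ψ s))) := by gcongr
        _ = K * (1 + |t|) := by field_simp; ring
  rw [hψσ, hψ0, sub_zero] at hver
  rw [sub_zero, Real.norm_eq_abs] at hmid
  have hσ : |σ| ≤ 8 * edgeProfile φ := by
    have e1 := abs_log_le_rpow h0 h1.le
    have e2 := abs_log_le_rpow (sub_pos.2 h1) (by linarith)
    have e3 := abs_sub (Real.log φ) (Real.log (Real.pi - φ))
    have e4 := Real.rpow_nonneg h0.le (-(1 / 4))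
    have e5 := Real.rpow_nonneg (sub_pos.2 h1).le (-(1 / 4))
    have e6 : |σ| ≤ |Real.log φ| + |Real.log (Real.pi - φ)| := e3
    rw [edgeProfile]
    linarith
  have hω := one_le_edgeProfile h0.le h1.le
  have hn : ‖G (t + φ * Complex.I)‖ ≤ ‖G₀‖ + K * (1 + |t|) * 2 * |t| + K * (1 + |t|) * |σ| := by
    have e1 : G (t + φ * Complex.I) = G₀ + (G (t + (Real.pi / 2 : ℝ) * Complex.I) - G₀) +
      (G (t + φ * Complex.I) - G (t + (Real.pi / 2 : ℝ) * Complex.I)) := by ring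
    rw [e1]
    rw [Real.norm_eq_abs] at hver
    exact (norm_add₃_le).trans (add_le_add (add_le_add le_rfl hmid) hver)
  have hT : 1 ≤ 1 + |t| := by linarith [abs_nonneg t]
  set T := 1 + |t|
  have b1 : ‖G₀‖ ≤ ‖G₀‖ * T ^ 2 * edgeProfile φ := by
    have : 1 ≤ T ^ 2 * edgeProfile φ := one_le_mul_of_one_le_of_one_le (one_le_pow₀ hT) hω
    nlinarith [norm_nonneg G₀]
  have b2 : K * T * 2 * |t| ≤ 2 * K * T ^ 2 * edgeProfile φ := by
    have e1 : K * T * 2 * |t| ≤ 2 * K * T ^ 2 := by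
      have : |t| ≤ T := by simp [T]
      calc K * T * 2 * |t| ≤ K * T * 2 * T := by gcongr
        _ = 2 * K * T ^ 2 := by ring
    exact e1.trans (le_mul_of_one_le_right (by positivity) hω)
  have b3 : K * T * |σ| ≤ 8 * K * T ^ 2 * edgeProfile φ := by
    have hp : 0 ≤ edgeProfile φ := by linarith
    calc K * T * |σ| ≤ K * T * (8 * edgeProfile φ) := by gcongr
      _ = 8 * K * T * edgeProfile φ := by ring
      _ ≤ 8 * K * T ^ 2 * edgeProfile φ := by
        gcongr
        nlinarith
  have b4 : 0 ≤ K * T ^ 2 * edgeProfile φ := by positivity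
  nlinarith [hn, b1, b2, b3, b4]

end StripBounds

/-! ### Cauchy's theorem in the strip -/

section StripContour

variable {G Φ : ℂ → ℂ} {a : ℕ → ℂ}

lemma one_add_pow_mul_exp_le {s : ℝ} (hs : 0 ≤ s) :
    (1 + s) ^ 4 * Real.exp (-s) ≤ 8 ^ 4 * Real.exp (-(1 / 2) * s) := by
  have h1 : 1 + s ≤ 8 * Real.exp (s / 8) := by
    have := Real.add_one_le_exp (s / 8)
    linarith
  have h2 : (1 + s) ^ 4 ≤ 8 ^ 4 * Real.exp (s / 2) := by
    calc (1 + s) ^ 4 ≤ (8 * Real.exp (s / 8)) ^ 4 := by gcongr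
      _ = 8 ^ 4 * Real.exp (s / 2) := by
        rw [mul_pow, ← Real.exp_nat_mul]; congr 2; push_cast; ring
  calc (1 + s) ^ 4 * Real.exp (-s) ≤ 8 ^ 4 * Real.exp (s / 2) * Real.exp (-s) := by gcongr
    _ = 8 ^ 4 * Real.exp (-(1 / 2) * s) := by
      rw [mul_assoc, ← Real.exp_add]; congr 2; ring

lemma integrable_of_exp_decay {X : Type*} [NormedAddCommGroup X] {f : ℝ → X} (hc : Continuous f)
    (h1 : IntegrableOn f (Iic 0)) {K R : ℝ} (h2 : ∀ t, R ≤ t → ‖f t‖ ≤ K * Real.exp (-t)) :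
    Integrable f := by
  rw [← integrableOn_univ, ← Iic_union_Ioi (a := (0 : ℝ))]
  refine h1.union ?_
  have h3 : IntegrableOn (fun t => ‖f t‖) (Ioi 0) := by
    refine integrable_of_isBigO_exp_neg one_pos hc.norm.continuousOn ?_
    refine Asymptotics.IsBigO.of_bound K ?_
    filter_upwards [eventually_ge_atTop R] with t ht
    rw [norm_norm, Real.norm_of_nonneg (Real.exp_pos _).le, neg_one_mul]
    exact h2 t ht
  exact (integrable_norm_iff hc.aestronglyMeasurable).1 h3

lemma continuous_strip_bottom (h : ContinuousOn Φ closedStrip) : Continuous fun t : ℝ => Φ t :=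
  h.comp_continuous Complex.continuous_ofReal fun t => by
    constructor <;> simp [Real.pi_pos.le]

lemma continuous_strip_top (h : ContinuousOn Φ closedStrip) :
    Continuous fun t : ℝ => Φ (t + Real.pi * Complex.I) :=
  h.comp_continuous (by fun_prop) fun t => mk_mem_strip t Real.pi_pos.le le_rfl

/-- Cauchy's theorem for the rectangles `[-T, T] × [0, π]`. -/
lemma tendsto_integral_edges (hc : ContinuousOn Φ closedStrip)
    (hd : ∀ w : ℂ, 0 < w.im → w.im < Real.pi → DifferentiableAt ℂ Φ w) {c : ℂ}
    (hr : Tendsto (fun T : ℝ => ∫ φ in (0 : ℝ)..Real.pi, Φ (T + φ * Complex.I)) atTop (𝓝 c))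
    (hl : Tendsto (fun T : ℝ => ∫ φ in (0 : ℝ)..Real.pi, Φ ((-T : ℝ) + φ * Complex.I))
      atTop (𝓝 0)) :
    Tendsto (fun T : ℝ => ∫ t in -T..T, (Φ t - Φ (t + Real.pi * Complex.I))) atTop
      (𝓝 (-(Complex.I * c))) := by
  have hpi := Real.pi_pos
  have h1 := (hl.const_mul Complex.I).sub (hr.const_mul Complex.I)
  rw [mul_zero, zero_sub] at h1
  refine h1.congr' ?_
  filter_upwards [eventually_gt_atTop 0] with T hT
  have h2 := Complex.integral_boundary_rect_eq_zero_of_continuousOn_of_differentiableOn Φ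
    ((-T : ℝ) : ℂ) (T + Real.pi * Complex.I) (hc.mono ?_) ?_
  · simp only [Complex.ofReal_re, Complex.ofReal_im, Complex.add_re, Complex.mul_re, Complex.I_re,
      mul_zero, Complex.I_im, mul_one, sub_self, add_zero, Complex.add_im, Complex.mul_im, zero_add,
      Complex.ofReal_zero, zero_mul, smul_eq_mul] at h2
    rw [intervalIntegral.integral_sub (continuous_strip_bottom hc).continuousOn.intervalIntegrable
      (continuous_strip_top hc).continuousOn.intervalIntegrable]
    linear_combination -h2
  · intro w hw
    have := hw.2
    simp only [mem_preimage, Complex.ofReal_im, Complex.add_im, Complex.mul_im, Complex.ofReal_re,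
      Complex.I_im, mul_one, Complex.I_re, mul_zero, add_zero, zero_add, uIcc_of_le hpi.le] at this
    exact this
  · intro w hw
    have := hw.2
    simp only [mem_preimage, Complex.ofReal_im, Complex.add_im, Complex.mul_im, Complex.ofReal_re,
      Complex.I_im, mul_one, Complex.I_re, mul_zero, add_zero, zero_add, min_eq_left hpi.le,
      max_eq_right hpi.le] at this
    exact (hd w this.1 this.2).differentiableWithinAt

lemma tendsto_right_edge (hc : ContinuousOn Φ closedStrip) {c : ℂ} {K R : ℝ}
    (h : ∀ w ∈ closedStrip, R ≤ w.re → ‖Φ w - c‖ ≤ K * Real.exp (-w.re)) :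
    Tendsto (fun T : ℝ => ∫ φ in (0 : ℝ)..Real.pi, Φ (T + φ * Complex.I)) atTop
      (𝓝 (Real.pi * c)) := by
  have hpi := Real.pi_pos
  rw [tendsto_iff_norm_sub_tendsto_zero]
  have h1 : Tendsto (fun T : ℝ => K * Real.exp (-T) * |Real.pi - 0|) atTop (𝓝 0) := by
    have := (Real.tendsto_exp_neg_atTop_nhds_zero.const_mul K).mul_const |Real.pi - 0|
    simpa using this
  refine squeeze_zero' (Eventually.of_forall fun _ => norm_nonneg _) ?_ h1
  filter_upwards [eventually_ge_atTop R] with T hT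
  have hcont : ContinuousOn (fun φ : ℝ => Φ (T + φ * Complex.I)) (uIcc 0 Real.pi) := by
    refine hc.comp (by fun_prop) fun φ hφ => ?_
    rw [uIcc_of_le hpi.le] at hφ
    exact mk_mem_strip T hφ.1 hφ.2
  have h2 : (∫ φ in (0 : ℝ)..Real.pi, Φ (T + φ * Complex.I)) - Real.pi * c =
      ∫ φ in (0 : ℝ)..Real.pi, (Φ (T + φ * Complex.I) - c) := by
    rw [intervalIntegral.integral_sub hcont.intervalIntegrable intervalIntegrable_const]
    simp
  rw [h2]
  refine intervalIntegral.norm_integral_le_of_norm_le_const fun φ hφ => ?_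
  rw [uIoc_of_le hpi.le] at hφ
  have := h _ (mk_mem_strip T hφ.1.le hφ.2) (by simpa using hT)
  simpa using this

lemma tendsto_left_edge {K : ℝ}
    (h : ∀ t φ : ℝ, t ≤ 0 → 0 < φ → φ < Real.pi →
      ‖Φ (t + φ * Complex.I)‖ ≤ K * (1 + |t|) ^ 4 * Real.exp t * edgeProfile φ ^ 2) :
    Tendsto (fun T : ℝ => ∫ φ in (0 : ℝ)..Real.pi, Φ ((-T : ℝ) + φ * Complex.I))
      atTop (𝓝 0) := by
  have hpi := Real.pi_pos
  set S := ∫ φ in (0 : ℝ)..Real.pi, edgeProfile φ ^ 2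
  have hS : 0 ≤ S := intervalIntegral.integral_nonneg hpi.le fun φ _ => sq_nonneg _
  have h1 : Tendsto (fun T : ℝ => |K| * (8 ^ 4 * Real.exp (-(1 / 2) * T)) * S) atTop (𝓝 0) := by
    have e1 : Tendsto (fun T : ℝ => Real.exp (-(1 / 2) * T)) atTop (𝓝 0) :=
      Real.tendsto_exp_atBot.comp (tendsto_id.const_mul_atTop_of_neg (by norm_num))
    have := ((e1.const_mul (8 ^ 4)).const_mul |K|).mul_const S
    simpa using this
  refine squeeze_zero_norm' ?_ h1
  filter_upwards [eventually_ge_atTop 0] with T hT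
  rw [← intervalIntegral.integral_const_mul]
  refine intervalIntegral.norm_integral_le_of_norm_le hpi.le ?_
    (intervalIntegrable_edgeProfile_sq.const_mul _)
  filter_upwards [compl_mem_ae_iff.2 (measure_singleton (Real.pi))] with φ hφ hmem
  have hlt : φ < Real.pi := lt_of_le_of_ne hmem.2 hφ
  refine (h (-T) φ (by linarith) hmem.1 hlt).trans ?_
  have e2 := one_add_pow_mul_exp_le hT
  rw [abs_neg, abs_of_nonneg hT]
  calc K * (1 + T) ^ 4 * Real.exp (-T) * edgeProfile φ ^ 2
      = K * ((1 + T) ^ 4 * Real.exp (-T) * edgeProfile φ ^ 2) := by ring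
    _ ≤ |K| * ((1 + T) ^ 4 * Real.exp (-T) * edgeProfile φ ^ 2) := by
        gcongr; exact le_abs_self K
    _ ≤ |K| * (8 ^ 4 * Real.exp (-(1 / 2) * T) * edgeProfile φ ^ 2) := by gcongr
    _ = _ := by ring

lemma exp_add_pi_mul_I (t : ℂ) : Complex.exp (t + Real.pi * Complex.I) = -Complex.exp t := by
  rw [Complex.exp_add, Complex.exp_pi_mul_I, mul_neg_one]

/-- Cauchy's theorem for `G² e^w` bounds the imaginary part of `G` on the edges of the strip by its
real part, in mean square. -/
lemma IsStripLog.integrableOn_norm_mul_exp (hG : IsStripLog G a) :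
    IntegrableOn (fun t : ℝ => ‖G t‖ * Real.exp t) (Iic 0) ∧
    IntegrableOn (fun t : ℝ => ‖G (t + Real.pi * Complex.I)‖ * Real.exp t) (Iic 0) := by
  have hpi := Real.pi_pos
  set Φ : ℂ → ℂ := fun w => G w ^ 2 * Complex.exp w
  have hΦc : ContinuousOn Φ closedStrip :=
    (hG.continuousOn.pow 2).mul Complex.continuous_exp.continuousOn
  have hc0 := continuous_strip_bottom hG.continuousOn
  have hc1 := continuous_strip_top hG.continuousOn
  obtain ⟨C, R, hC, hexp⟩ := hG.expansion 0
  obtain ⟨K, hK, hle⟩ := hG.exists_norm_le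
  obtain ⟨D, hD, hre⟩ := hG.re_le
  have hexp' : ∀ w ∈ closedStrip, max R 0 ≤ w.re → ‖G w‖ ^ 2 * Real.exp w.re ≤
      C ^ 2 * Real.exp (-w.re) := fun w hw hR => by
    have h1 := hexp w hw ((le_max_left _ _).trans hR)
    simp only [Finset.range_zero, Finset.sum_empty, sub_zero, Nat.cast_zero, zero_add,
      neg_one_mul] at h1
    calc ‖G w‖ ^ 2 * Real.exp w.re ≤ (C * Real.exp (-w.re)) ^ 2 * Real.exp w.re := by gcongr
      _ = C ^ 2 * Real.exp (-w.re) * (Real.exp (-w.re) * Real.exp w.re) := by ring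
      _ = C ^ 2 * Real.exp (-w.re) := by rw [← Real.exp_add]; simp
  have hmem0 : ∀ t : ℝ, (t : ℂ) ∈ closedStrip := fun t => by constructor <;> simp [hpi.le]
  have hmem1 : ∀ t : ℝ, (t + Real.pi * Complex.I : ℂ) ∈ closedStrip := fun t =>
    mk_mem_strip t hpi.le le_rfl
  have hlim := tendsto_integral_edges (Φ := Φ) hΦc
    (fun w h0 h1 => ((hG.differentiableAt w h0 h1).pow 2).mul Complex.differentiableAt_exp)
    (c := Real.pi * 0)
    (tendsto_right_edge hΦc (K := C ^ 2) (R := max R 0) fun w hw hR => by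
      rw [sub_zero, norm_mul, norm_pow, Complex.norm_exp]
      exact hexp' w hw hR)
    (tendsto_left_edge (K := K ^ 2) fun t φ ht h0 h1 => by
      rw [norm_mul, norm_pow, Complex.norm_exp]
      have e1 := hle t φ h0 h1
      have e2 : ((t : ℂ) + φ * Complex.I).re = t := by simp
      rw [e2]
      calc ‖G (t + φ * Complex.I)‖ ^ 2 * Real.exp t
          ≤ (K * (1 + |t|) ^ 2 * edgeProfile φ) ^ 2 * Real.exp t := by gcongr
        _ = _ := by ring)
  -- the real parts are square integrable with respect to the weight `e^t`
  have hu : ∀ β : ℂ, β = 0 ∨ β = Real.pi * Complex.I →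
      Continuous (fun t : ℝ => G (t + β)) ∧
      Integrable (fun t : ℝ => (G (t + β)).re ^ 2 * Real.exp t) := fun β hβ => by
    have hm : ∀ t : ℝ, (t + β : ℂ) ∈ closedStrip ∧ (t + β).re = t := fun t => by
      rcases hβ with rfl | rfl
      · simpa using hmem0 t
      · exact ⟨hmem1 t, by simp⟩
    have hc : Continuous (fun t : ℝ => G (t + β)) :=
      hG.continuousOn.comp_continuous (by fun_prop) fun t => (hm t).1
    refine ⟨hc, integrable_of_exp_decay (K := C ^ 2) (R := max R 0)
      (((Complex.continuous_re.comp hc).pow 2).mul Real.continuous_exp) ?_ fun t ht => ?_⟩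
    · have h1 : IntegrableOn (fun t : ℝ => D ^ 2 * (8 ^ 4 * Real.exp (1 / 2 * t))) (Iic 0) :=
        ((integrableOn_exp_mul_Iic (by norm_num) 0).const_mul _).const_mul _
      refine h1.mono' (((Complex.continuous_re.comp hc).pow 2).mul
        Real.continuous_exp).aestronglyMeasurable ?_
      refine (ae_restrict_mem measurableSet_Iic).mono fun t ht => ?_
      have ht' : t ≤ 0 := ht
      have e1 := hre _ (hm t).1
      rw [(hm t).2, abs_of_nonpos ht'] at e1
      have e2 := one_add_pow_mul_exp_le (neg_nonneg.2 ht')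
      rw [neg_neg] at e2
      rw [Real.norm_of_nonneg (by positivity), ← sq_abs]
      have e3 : (1 + -t) ^ 2 ≤ (1 + -t) ^ 4 := pow_le_pow_right₀ (by linarith) (by norm_num)
      calc |(G (t + β)).re| ^ 2 * Real.exp t ≤ (D * (1 + -t)) ^ 2 * Real.exp t := by gcongr
        _ = D ^ 2 * ((1 + -t) ^ 2 * Real.exp t) := by ring
        _ ≤ D ^ 2 * ((1 + -t) ^ 4 * Real.exp t) := by gcongr
        _ ≤ D ^ 2 * (8 ^ 4 * Real.exp (-(1 / 2) * -t)) := by gcongr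
        _ = _ := by rw [neg_mul_neg]
    · have e1 := hexp' _ (hm t).1 (by rw [(hm t).2]; exact ht)
      rw [(hm t).2] at e1
      rw [Real.norm_of_nonneg (by positivity), ← sq_abs]
      refine le_trans ?_ e1
      gcongr
      exact Complex.abs_re_le_norm _
  obtain ⟨hc0', hu0⟩ := hu 0 (Or.inl rfl)
  obtain ⟨-, hu1⟩ := hu _ (Or.inr rfl)
  simp only [add_zero] at hu0
  set q : ℝ → ℝ := fun t => ‖G t‖ ^ 2 * Real.exp t +
    ‖G (t + Real.pi * Complex.I)‖ ^ 2 * Real.exp t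
  have hqc : Continuous q := ((hc0.norm.pow 2).mul Real.continuous_exp).add
    ((hc1.norm.pow 2).mul Real.continuous_exp)
  have hq0 : ∀ t, 0 ≤ q t := fun t => by positivity
  have hΦ0 := continuous_strip_bottom hΦc
  have hΦ1 := continuous_strip_top hΦc
  -- `|G|² = 2 (Re G)² - Re (G²)`, and `e^w` changes sign from one edge to the other
  have hq : ∀ t, q t = 2 * ((G t).re ^ 2 * Real.exp t +
      (G (t + Real.pi * Complex.I)).re ^ 2 * Real.exp t) -
      Complex.reCLM (Φ t - Φ (t + Real.pi * Complex.I)) := fun t => by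
    have e1 : Φ t - Φ (t + Real.pi * Complex.I) =
        (G t ^ 2 + G (t + Real.pi * Complex.I) ^ 2) * (Real.exp t : ℝ) := by
      simp only [Φ, exp_add_pi_mul_I, Complex.ofReal_exp]; ring
    have e2 : ∀ z : ℂ, ‖z‖ ^ 2 = z.re ^ 2 + z.im ^ 2 := fun z => by
      rw [Complex.sq_norm, Complex.normSq_apply]; ring
    have e3 : ∀ z : ℂ, (z ^ 2).re = z.re ^ 2 - z.im ^ 2 := fun z => by
      rw [pow_two, Complex.mul_re]; ring
    rw [e1, Complex.reCLM_apply, Complex.re_mul_ofReal, Complex.add_re, e3, e3]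
    simp only [q, e2]
    ring
  -- `q ≥ 0`, so convergence of its integrals over `[-T, T]` gives integrability
  have hqint : Integrable q := by
    have hsum := (hu0.add hu1).const_mul 2
    have hl1 := intervalIntegral_tendsto_integral hsum tendsto_neg_atTop_atBot tendsto_id
    have hl2 := (Complex.reCLM.continuous.tendsto _).comp hlim
    refine integrable_of_intervalIntegral_norm_tendsto _
      (fun T => (hqc.integrableOn_Icc).mono_set Ioc_subset_Icc_self)
      tendsto_neg_atTop_atBot tendsto_id ((hl1.sub hl2).congr fun T => ?_)
    simp only [Function.comp, id]
    have hd : Continuous fun t : ℝ => Φ t - Φ (t + Real.pi * Complex.I) := hΦ0.sub hΦ1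
    have hd' : Continuous fun t : ℝ => Complex.reCLM (Φ t - Φ (t + Real.pi * Complex.I)) :=
      Complex.reCLM.continuous.comp hd
    have e := Complex.reCLM.intervalIntegral_comp_comm (hd.intervalIntegrable (μ := volume) (-T) T)
    rw [← e, ← intervalIntegral.integral_sub hsum.intervalIntegrable (hd'.intervalIntegrable _ _)]
    refine intervalIntegral.integral_congr fun t _ => ?_
    rw [Real.norm_of_nonneg (hq0 t), hq t]
    simp
  -- `|G| e^t ≤ e^t + |G|² e^t`
  have hdom : IntegrableOn (fun t => Real.exp (1 * t) + q t) (Iic 0) :=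
    (integrableOn_exp_mul_Iic one_pos 0).add hqint.integrableOn
  have hx : ∀ x e : ℝ, 0 < e → x * e ≤ e + x ^ 2 * e := fun x e he => by
    nlinarith [sq_nonneg (x - 1), sq_nonneg x]
  constructor
  · refine hdom.mono' (hc0.norm.mul Real.continuous_exp).aestronglyMeasurable
      (Eventually.of_forall fun t => ?_)
    rw [Real.norm_of_nonneg (by positivity), one_mul]
    have e1 := hx ‖G t‖ _ (Real.exp_pos t)
    have e2 : 0 ≤ ‖G (t + Real.pi * Complex.I)‖ ^ 2 * Real.exp t := by positivity
    simp only [q]; linarith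
  · refine hdom.mono' (hc1.norm.mul Real.continuous_exp).aestronglyMeasurable
      (Eventually.of_forall fun t => ?_)
    rw [Real.norm_of_nonneg (by positivity), one_mul]
    have e1 := hx ‖G (t + Real.pi * Complex.I)‖ _ (Real.exp_pos t)
    have e2 : 0 ≤ ‖G t‖ ^ 2 * Real.exp t := by positivity
    simp only [q]; linarith

/-- The Cauchy integral of `(G(w) - ∑_{l ≤ q} a_l e^{-lw}) e^{(q+1)w}` along the edges of the
strip. -/
lemma IsStripLog.integral_edges (hG : IsStripLog G a) (q : ℕ) (hΦ : Φ = fun w =>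
    (G w - ∑ l ∈ Finset.range q, a (l + 1) * Complex.exp (-((l + 1 : ℕ) : ℂ) * w)) *
      Complex.exp (((q + 1 : ℕ) : ℂ) * w)) :
    Integrable (fun t : ℝ => Φ t - Φ (t + Real.pi * Complex.I)) ∧
    ∫ t : ℝ, (Φ t - Φ (t + Real.pi * Complex.I)) =
      -(Complex.I * (Real.pi * a (q + 1))) := by
  have hpi := Real.pi_pos
  have hpoly : Differentiable ℂ fun w : ℂ =>
      ∑ l ∈ Finset.range q, a (l + 1) * Complex.exp (-((l + 1 : ℕ) : ℂ) * w) := by fun_prop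
  have hexpd : Differentiable ℂ fun w : ℂ => Complex.exp (((q + 1 : ℕ) : ℂ) * w) := by fun_prop
  have hΦc : ContinuousOn Φ closedStrip := by
    rw [hΦ]
    exact (hG.continuousOn.sub hpoly.continuous.continuousOn).mul hexpd.continuous.continuousOn
  have hΦd : ∀ w : ℂ, 0 < w.im → w.im < Real.pi → DifferentiableAt ℂ Φ w := fun w h0 h1 => by
    rw [hΦ]
    exact ((hG.differentiableAt w h0 h1).sub (hpoly w)).mul (hexpd w)
  obtain ⟨C, R, hC, hexp⟩ := hG.expansion (q + 1)
  obtain ⟨K, hK, hle⟩ := hG.exists_norm_le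
  have hright : ∀ w ∈ closedStrip, R ≤ w.re → ‖Φ w - a (q + 1)‖ ≤ C * Real.exp (-w.re) := by
    intro w hw hR
    have h1 := hexp w hw hR
    rw [Finset.sum_range_succ] at h1
    have e1 : Φ w - a (q + 1) = (G w - (∑ l ∈ Finset.range q, a (l + 1) *
        Complex.exp (-((l + 1 : ℕ) : ℂ) * w) + a (q + 1) * Complex.exp (-((q + 1 : ℕ) : ℂ) * w))) *
        Complex.exp (((q + 1 : ℕ) : ℂ) * w) := by
      have e2 : Complex.exp (-((q + 1 : ℕ) : ℂ) * w) * Complex.exp (((q + 1 : ℕ) : ℂ) * w) = 1 := by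
        rw [← Complex.exp_add, ← add_mul, neg_add_cancel, zero_mul, Complex.exp_zero]
      rw [hΦ]
      linear_combination a (q + 1) * e2
    have e3 : ‖Complex.exp (((q + 1 : ℕ) : ℂ) * w)‖ = Real.exp ((q + 1 : ℕ) * w.re) := by
      rw [Complex.norm_exp, ← Complex.ofReal_natCast, Complex.re_ofReal_mul]
    rw [e1, norm_mul, e3]
    calc _ ≤ C * Real.exp (-(((q + 1 : ℕ) : ℝ) + 1) * w.re) * Real.exp ((q + 1 : ℕ) * w.re) := by
          gcongr
      _ = _ := by rw [mul_assoc, ← Real.exp_add]; congr 2; ring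
  -- on the left half of the strip only the factor `e^w` is kept
  set S := ∑ l ∈ Finset.range q, ‖a (l + 1)‖
  have hS : 0 ≤ S := Finset.sum_nonneg fun _ _ => norm_nonneg _
  have hleft : ∀ w : ℂ, w.re ≤ 0 → ‖Φ w‖ ≤ ‖G w‖ * Real.exp w.re + S * Real.exp w.re := by
    intro w hw
    have e1 : Φ w = G w * Complex.exp (((q + 1 : ℕ) : ℂ) * w) - ∑ l ∈ Finset.range q,
        a (l + 1) * Complex.exp (((q - l : ℕ) : ℂ) * w) := by
      rw [hΦ]; beta_reduce
      rw [sub_mul, Finset.sum_mul]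
      congr 1
      refine Finset.sum_congr rfl fun l hl => ?_
      rw [mul_assoc, ← Complex.exp_add, Nat.cast_sub (Finset.mem_range.1 hl).le]
      congr 2; push_cast; ring
    have e2 : ∀ m : ℕ, 1 ≤ m → ‖Complex.exp ((m : ℂ) * w)‖ ≤ Real.exp w.re := fun m hm => by
      rw [Complex.norm_exp]
      have : ((m : ℂ) * w).re = m * w.re := by simp
      rw [this, Real.exp_le_exp]
      have : (1 : ℝ) ≤ m := by exact_mod_cast hm
      nlinarith
    rw [e1]
    refine (norm_sub_le _ _).trans (add_le_add ?_ ?_)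
    · rw [norm_mul]; gcongr; exact e2 _ (by omega)
    · rw [Finset.sum_mul]
      refine (norm_sum_le _ _).trans (Finset.sum_le_sum fun l hl => ?_)
      rw [norm_mul]; gcongr
      exact e2 _ (by have := Finset.mem_range.1 hl; omega)
  have hlim := tendsto_integral_edges hΦc hΦd (tendsto_right_edge hΦc hright)
    (tendsto_left_edge (K := K + S) fun t φ ht h0 h1 => by
      have e1 := hleft (t + φ * Complex.I) (by simpa using ht)
      have e2 : ((t : ℂ) + φ * Complex.I).re = t := by simp
      rw [e2] at e1
      refine e1.trans ?_
      have e3 := one_le_edgeProfile h0.le h1.le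
      have e4 : 1 ≤ 1 + |t| := by linarith [abs_nonneg t]
      have e5 : 1 ≤ (1 + |t|) ^ 4 * edgeProfile φ ^ 2 :=
        one_le_mul_of_one_le_of_one_le (one_le_pow₀ e4) (one_le_pow₀ e3)
      have e6 : ‖G (t + φ * Complex.I)‖ ≤ K * ((1 + |t|) ^ 4 * edgeProfile φ ^ 2) := by
        refine (hle t φ h0 h1).trans ?_
        rw [mul_assoc]
        have e8 : edgeProfile φ ≤ edgeProfile φ ^ 2 := by nlinarith
        gcongr
        norm_num
      have e7 : S ≤ S * ((1 + |t|) ^ 4 * edgeProfile φ ^ 2) := le_mul_of_one_le_right hS e5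
      calc _ = (‖G (t + φ * Complex.I)‖ + S) * Real.exp t := by ring
        _ ≤ (K * ((1 + |t|) ^ 4 * edgeProfile φ ^ 2) +
            S * ((1 + |t|) ^ 4 * edgeProfile φ ^ 2)) * Real.exp t := by gcongr
        _ = _ := by ring)
  have hΦ0 := continuous_strip_bottom hΦc
  have hΦ1 := continuous_strip_top hΦc
  have hcont : Continuous fun t : ℝ => Φ t - Φ (t + Real.pi * Complex.I) := hΦ0.sub hΦ1
  have hint : Integrable fun t : ℝ => Φ t - Φ (t + Real.pi * Complex.I) := by
    refine integrable_of_exp_decay (K := C + C) (R := R) hcont ?_ fun t ht => ?_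
    · obtain ⟨i0, i1⟩ := hG.integrableOn_norm_mul_exp
      have i2 : IntegrableOn (fun t => S * Real.exp (1 * t)) (Iic 0) :=
        (integrableOn_exp_mul_Iic one_pos 0).const_mul S
      refine ((i0.add i2).add (i1.add i2)).mono' hcont.aestronglyMeasurable ?_
      refine (ae_restrict_mem measurableSet_Iic).mono fun t ht => ?_
      have ht' : t ≤ 0 := ht
      have e0 := hleft t (by simpa using ht')
      have e1 := hleft (t + Real.pi * Complex.I) (by simpa using ht')
      have e2 : ((t : ℂ) + Real.pi * Complex.I).re = t := by simp
      rw [e2] at e1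
      rw [Complex.ofReal_re] at e0
      simp only [Pi.add_apply, one_mul]
      exact (norm_sub_le _ _).trans (add_le_add e0 e1)
    · have e0 := hright t (by constructor <;> simp [hpi.le]) (by simpa using ht)
      have e1 := hright (t + Real.pi * Complex.I) (mk_mem_strip t hpi.le le_rfl) (by simpa using ht)
      have e2 : ((t : ℂ) + Real.pi * Complex.I).re = t := by simp
      rw [e2] at e1
      rw [Complex.ofReal_re] at e0
      rw [← sub_sub_sub_cancel_right _ _ (a (q + 1)), add_mul]
      exact (norm_sub_le _ _).trans (add_le_add e0 e1)
  exact ⟨hint, tendsto_nhds_unique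
    (intervalIntegral_tendsto_integral hint tendsto_neg_atTop_atBot tendsto_id) hlim⟩

end StripContour

/-! ### Moments of logarithms of zero-free functions in the half plane -/

/-- `F` is a zero-free function on the punctured closed upper half plane, continuous and holomorphic
inside, with `|log |F||` of at most logarithmic growth at `0`. -/
structure IsZeroFree (F : ℂ → ℂ) : Prop where
  continuousOn : ContinuousOn F puncturedHalfPlane
  differentiableAt : ∀ k : ℂ, 0 < k.im → DifferentiableAt ℂ F k
  ne_zero : ∀ k ∈ puncturedHalfPlane, F k ≠ 0
  log_le : ∃ C r : ℝ, 0 < r ∧ ∀ k ∈ puncturedHalfPlane, ‖k‖ ≤ r →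
    |Real.log ‖F k‖| ≤ C * (1 + |Real.log ‖k‖|)

section LogTransfer

variable {F : ℂ → ℂ} {a : ℕ → ℂ}

/-- A continuous function with values in `2πiℤ` is constant on preconnected sets. -/
lemma eq_of_exp_eq_one {X : Type*} [TopologicalSpace X] {s : Set X} (hs : IsPreconnected s)
    {δ : X → ℂ} (hc : ContinuousOn δ s) (he : ∀ x ∈ s, Complex.exp (δ x) = 1) {x y : X}
    (hx : x ∈ s) (hy : y ∈ s) : δ x = δ y := by
  have h2pi : (0 : ℝ) < 2 * Real.pi := Real.two_pi_pos
  have hn : ∀ z ∈ s, ∃ m : ℤ, δ z = m * (2 * Real.pi * Complex.I) := fun z hz =>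
    Complex.exp_eq_one_iff.1 (he z hz)
  set f : X → ℝ := fun z => (δ z).im / (2 * Real.pi)
  have hfc : ContinuousOn f s := (Complex.continuous_im.comp_continuousOn hc).div_const _
  have hf : ∀ z ∈ s, ∃ m : ℤ, f z = m ∧ δ z = m * (2 * Real.pi * Complex.I) := fun z hz => by
    obtain ⟨m, hm⟩ := hn z hz
    refine ⟨m, ?_, hm⟩
    simp only [f, hm]
    rw [div_eq_iff h2pi.ne']
    simp
  have key : ∀ x ∈ s, ∀ y ∈ s, f x ≤ f y := by
    intro x hx y hy
    by_contra! hlt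
    obtain ⟨m, hm, -⟩ := hf x hx
    obtain ⟨m', hm', -⟩ := hf y hy
    rw [hm, hm'] at hlt
    have h1 : m' + 1 ≤ m := by exact_mod_cast hlt
    have h2 : (m' : ℝ) + 1 ≤ m := by exact_mod_cast h1
    obtain ⟨z, hz, hfz⟩ := hs.intermediate_value hy hx hfc
      (show (m' : ℝ) + 1 / 2 ∈ Icc (f y) (f x) by rw [hm, hm']; constructor <;> linarith)
    obtain ⟨j, hj, -⟩ := hf z hz
    rw [hj] at hfz
    have h3 : (2 * j : ℤ) = 2 * m' + 1 := by
      have : (2 * j : ℝ) = 2 * m' + 1 := by linarith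
      exact_mod_cast this
    omega
  obtain ⟨m, hm, e1⟩ := hf x hx
  obtain ⟨m', hm', e2⟩ := hf y hy
  have h := le_antisymm (key x hx y hy) (key y hy x hx)
  rw [hm, hm'] at h
  rw [e1, e2]
  have : m = m' := by exact_mod_cast h
  rw [this]

lemma exp_mem_puncturedHalfPlane {w : ℂ} (hw : w ∈ closedStrip) :
    Complex.exp w ∈ puncturedHalfPlane := by
  refine ⟨?_, Complex.exp_ne_zero w⟩
  rw [Complex.exp_im]
  exact mul_nonneg (Real.exp_pos _).le (Real.sin_nonneg_of_nonneg_of_le_pi hw.1 hw.2)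

lemma isPreconnected_closedStrip (R : ℝ) : IsPreconnected (closedStrip ∩ {w | R ≤ w.re}) := by
  have h1 : closedStrip ∩ {w | R ≤ w.re} =
      ({w | 0 ≤ w.im} ∩ {w | w.im ≤ Real.pi}) ∩ {w | R ≤ w.re} := by
    ext w
    simp [closedStrip]
  rw [h1]
  exact (((convex_halfSpace_im_ge 0).inter (convex_halfSpace_im_le Real.pi)).inter
    (convex_halfSpace_re_ge R)).isPreconnected

/-- A continuous logarithm on the closed strip, after the substitution `k = e^w`. -/
lemma IsZeroFree.exists_continuous_log (hF : IsZeroFree F) : ∃ G : ℂ → ℂ, Continuous G ∧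
    ∀ w ∈ closedStrip, Complex.exp (G w) = F (Complex.exp w) := by
  set clamp : ℂ → ℂ := fun w => w.re + (max 0 (min w.im Real.pi) : ℝ) * Complex.I
  have hclamp : Continuous clamp := by
    simp only [clamp]
    fun_prop
  have hmem : ∀ w, clamp w ∈ closedStrip := fun w =>
    mk_mem_strip _ (le_max_left _ _) (max_le Real.pi_pos.le (min_le_right _ _))
  have hid : ∀ w ∈ closedStrip, clamp w = w := fun w hw => by
    simp only [clamp, min_eq_left hw.2, max_eq_right hw.1, Complex.re_add_im]
  have hg : Continuous fun w => F (Complex.exp (clamp w)) :=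
    hF.continuousOn.comp_continuous (Complex.continuous_exp.comp hclamp) fun w =>
      exp_mem_puncturedHalfPlane (hmem w)
  obtain ⟨G, hG, he⟩ := Complex.exists_continuousOn_eqOn_exp_comp (U := univ)
    (show SimplyConnectedSpace (univ : Set ℂ) from
      have := (convex_univ (𝕜 := ℝ) (E := ℂ)).contractibleSpace univ_nonempty
      inferInstance) isOpen_univ hg.continuousOn (by
      rintro ⟨w, -, hw⟩
      exact hF.ne_zero _ (exp_mem_puncturedHalfPlane (hmem w)) hw)
  refine ⟨G, continuousOn_univ.1 hG, fun w hw => ?_⟩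
  have := he (mem_univ w)
  simp only [Function.comp, hid w hw] at this
  exact this

lemma norm_log_le {z : ℂ} (h : ‖z - 1‖ ≤ 1 / 2) : ‖Complex.log z‖ ≤ 3 / 2 * ‖z - 1‖ := by
  have := Complex.norm_log_one_add_half_le_self h
  rwa [add_sub_cancel] at this

/-- Logarithms with prescribed exponential and small imaginary part are principal. -/
lemma eq_log_of_norm_lt {z u : ℂ} (h : Complex.exp z = u) (hz : ‖z‖ < Real.pi) :
    z = Complex.log u := by
  have h1 := abs_lt.1 ((Complex.abs_im_le_norm z).trans_lt hz)
  rw [← h, Complex.log_exp h1.1 h1.2.le]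

lemma differentiableAt_of_exp_comp {G f : ℂ → ℂ} {w : ℂ} (hG : ContinuousAt G w)
    (he : ∀ᶠ z in 𝓝 w, Complex.exp (G z) = f z) (hf : DifferentiableAt ℂ f w) :
    DifferentiableAt ℂ G w := by
  have hew := he.self_of_nhds
  have hne : f w ≠ 0 := hew ▸ Complex.exp_ne_zero _
  have h1 : ∀ᶠ z in 𝓝 w, ‖G z - G w‖ < Real.pi := by
    have := Metric.continuousAt_iff.1 hG Real.pi Real.pi_pos
    obtain ⟨d, hd, h⟩ := this
    filter_upwards [Metric.ball_mem_nhds w hd] with z hz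
    rw [← dist_eq_norm]; exact h hz
  have h2 : G =ᶠ[𝓝 w] fun z => G w + Complex.log (f z / f w) := by
    filter_upwards [h1, he] with z hz hez
    rw [← eq_log_of_norm_lt (z := G z - G w) (by rw [Complex.exp_sub, hez, hew]) hz]
    ring
  refine DifferentiableAt.congr_of_eventuallyEq ?_ h2
  refine ((hf.div_const _).clog ?_).const_add _
  rw [div_self hne]
  exact Complex.one_mem_slitPlane

/-- The normalized logarithm of `F(e^w)` satisfies the hypotheses of the strip lemmas. -/
lemma IsZeroFree.exists_isStripLog (hF : IsZeroFree F) (ha : HasLogExpansion F a) :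
    ∃ G : ℂ → ℂ, IsStripLog G a ∧ ∀ w ∈ closedStrip, Complex.exp (G w) = F (Complex.exp w) := by
  have hpi := Real.pi_gt_three
  obtain ⟨G₀, hG₀, he₀⟩ := hF.exists_continuous_log
  have hexpand : ∀ N : ℕ, ∃ C R : ℝ, 0 ≤ C ∧ ∀ w ∈ closedStrip, R ≤ w.re →
      ‖F (Complex.exp w) * Complex.exp (-∑ l ∈ Finset.range N,
        a (l + 1) * Complex.exp (-((l + 1 : ℕ) : ℂ) * w)) - 1‖ ≤
        C * Real.exp (-((N : ℝ) + 1) * w.re) ∧ C * Real.exp (-((N : ℝ) + 1) * w.re) ≤ 1 / 2 := by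
    intro N
    obtain ⟨C, hC, hb⟩ := (ha N).exists_pos
    obtain ⟨R, hR⟩ := eventually_upperInfty_iff.1 hb.bound
    have hlim : Tendsto (fun t : ℝ => C * Real.exp (-((N : ℝ) + 1) * t)) atTop (𝓝 0) := by
      have e1 : Tendsto (fun t : ℝ => Real.exp (-((N : ℝ) + 1) * t)) atTop (𝓝 0) :=
        Real.tendsto_exp_atBot.comp (tendsto_id.const_mul_atTop_of_neg (by
          have : (0 : ℝ) ≤ N := N.cast_nonneg
          linarith))
      simpa using e1.const_mul C
    obtain ⟨R', hR'⟩ := eventually_atTop.1 (hlim.eventually (ge_mem_nhds (by norm_num : (0 : ℝ) < 1 / 2)))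
    refine ⟨C, max R' (Real.log (max R 1)), hC.le, fun w hw hRw => ⟨?_, hR' _
      ((le_max_left _ _).trans hRw)⟩⟩
    have h1 : R ≤ ‖Complex.exp w‖ := by
      rw [Complex.norm_exp]
      have e1 := Real.exp_le_exp.2 ((le_max_right _ _).trans hRw)
      rw [Real.exp_log (lt_max_of_lt_right one_pos)] at e1
      exact (le_max_left _ _).trans e1
    have h2 := hR (Complex.exp w) (exp_mem_puncturedHalfPlane hw).1 h1
    have e3 : ∀ l : ℕ, (Complex.exp w)⁻¹ ^ (l + 1) = Complex.exp (-((l + 1 : ℕ) : ℂ) * w) :=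
      fun l => by rw [← Complex.exp_neg, ← Complex.exp_nat_mul]; congr 1; ring
    simp only [e3] at h2
    refine h2.trans (le_of_eq ?_)
    rw [Complex.norm_exp, neg_mul, Complex.neg_re, ← Complex.ofReal_natCast, Complex.re_ofReal_mul]
    push_cast
    congr 2; ring
  -- normalization: the additive constant is fixed by `G → 0`
  obtain ⟨C₁, R₁, hC₁, h₁⟩ := hexpand 0
  simp only [Finset.range_zero, Finset.sum_empty, neg_zero, Complex.exp_zero, mul_one,
    Nat.cast_zero, zero_add] at h₁
  have hslit : ∀ w ∈ closedStrip ∩ {w | R₁ ≤ w.re}, F (Complex.exp w) ∈ Complex.slitPlane := by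
    intro w hw
    obtain ⟨e1, e2⟩ := h₁ w hw.1 hw.2
    rw [← add_sub_cancel 1 (F (Complex.exp w))]
    exact Complex.mem_slitPlane_of_norm_lt_one (by linarith)
  have hsc : ContinuousOn (fun w => F (Complex.exp w)) closedStrip :=
    hF.continuousOn.comp Complex.continuous_exp.continuousOn fun w => exp_mem_puncturedHalfPlane
  have hR₁mem : (R₁ : ℂ) ∈ closedStrip ∩ {w | R₁ ≤ w.re} := by
    refine ⟨?_, by simp⟩
    constructor <;> simp; linarith
  set c := G₀ R₁ - Complex.log (F (Complex.exp R₁))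
  have hconst : ∀ w ∈ closedStrip ∩ {w | R₁ ≤ w.re},
      G₀ w - Complex.log (F (Complex.exp w)) = c := fun w hw =>
    eq_of_exp_eq_one (isPreconnected_closedStrip R₁)
      (hG₀.continuousOn.sub ((hsc.mono inter_subset_left).clog hslit)) (fun z hz => by
        rw [Pi.sub_apply, Complex.exp_sub, he₀ z hz.1, Complex.exp_log (hF.ne_zero _
          (exp_mem_puncturedHalfPlane hz.1)), div_self (hF.ne_zero _
          (exp_mem_puncturedHalfPlane hz.1))]) hw hR₁mem
  have hc : Complex.exp c = 1 := by
    simp only [c]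
    have := hF.ne_zero _ (exp_mem_puncturedHalfPlane hR₁mem.1)
    rw [Complex.exp_sub, he₀ _ hR₁mem.1, Complex.exp_log this, div_self this]
  set G : ℂ → ℂ := fun w => G₀ w - c
  have hGc : Continuous G := hG₀.sub continuous_const
  have he : ∀ w ∈ closedStrip, Complex.exp (G w) = F (Complex.exp w) := fun w hw => by
    simp only [G, Complex.exp_sub, hc, he₀ w hw, div_one]
  have hlog : ∀ w ∈ closedStrip, R₁ ≤ w.re → G w = Complex.log (F (Complex.exp w)) :=
    fun w hw hR => by
      have := hconst w ⟨hw, hR⟩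
      simp only [G]
      linear_combination this
  have hsmall : ∀ w ∈ closedStrip, R₁ ≤ w.re → ‖G w‖ ≤ 1 := fun w hw hR => by
    obtain ⟨e1, e2⟩ := h₁ w hw hR
    rw [hlog w hw hR]
    have := norm_log_le (e1.trans e2)
    linarith
  have hre : ∀ w ∈ closedStrip, (G w).re = Real.log ‖F (Complex.exp w)‖ := fun w hw => by
    rw [← he w hw, Complex.norm_exp, Real.log_exp]
  refine ⟨G, ⟨hGc.continuousOn, fun w h0 h1 => ?_, ?_, fun N => ?_⟩, he⟩
  · have hexpim : 0 < (Complex.exp w).im := by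
      rw [Complex.exp_im]
      exact mul_pos (Real.exp_pos _) (Real.sin_pos_of_pos_of_lt_pi h0 h1)
    refine differentiableAt_of_exp_comp (f := fun z => F (Complex.exp z)) hGc.continuousAt ?_
      ((hF.differentiableAt _ hexpim).comp w Complex.differentiableAt_exp)
    have hev : ∀ᶠ z : ℂ in 𝓝 w, 0 < z.im ∧ z.im < Real.pi :=
      (Complex.continuous_im.continuousAt.eventually (lt_mem_nhds h0)).and
        (Complex.continuous_im.continuousAt.eventually (gt_mem_nhds h1))
    filter_upwards [hev] with z hz
    exact he z ⟨hz.1.le, hz.2.le⟩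
  · obtain ⟨C, r, hr, hC⟩ := hF.log_le
    have hcpt : IsCompact (Icc (Real.log r) R₁ ×ℂ Icc 0 Real.pi) := isCompact_Icc.reProdIm isCompact_Icc
    obtain ⟨B, hB⟩ := hcpt.exists_bound_of_continuousOn hGc.continuousOn
    refine ⟨|C| + |B| + 1, by positivity, fun w hw => ?_⟩
    have hp := abs_nonneg w.re
    have hpos : 1 ≤ 1 + |w.re| := by linarith
    rcases le_total w.re (Real.log r) with h | h
    · have h3 : ‖Complex.exp w‖ ≤ r := by
        rw [Complex.norm_exp, ← Real.exp_log hr]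
        exact Real.exp_le_exp.2 h
      have h4 := hC _ (exp_mem_puncturedHalfPlane hw) h3
      rw [← hre w hw, Complex.norm_exp, Real.log_exp] at h4
      refine h4.trans ?_
      gcongr
      linarith [le_abs_self C, abs_nonneg B]
    · have h5 : ‖G w‖ ≤ |B| + 1 := by
        rcases le_total w.re R₁ with h' | h'
        · linarith [hB w ⟨⟨h, h'⟩, hw⟩, le_abs_self B]
        · linarith [hsmall w hw h', abs_nonneg B]
      have h6 := (Complex.abs_re_le_norm (G w)).trans h5
      nlinarith [abs_nonneg C, abs_nonneg B]
  · obtain ⟨C, R, hC, h⟩ := hexpand N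
    set S := ∑ l ∈ Finset.range N, ‖a (l + 1)‖
    obtain ⟨R', hR'⟩ := eventually_atTop.1
      ((Real.tendsto_exp_neg_atTop_nhds_zero.const_mul S).eventually
        (ge_mem_nhds (by norm_num : S * 0 < 1)))
    refine ⟨3 / 2 * C, max (max R R₁) (max R' 0), by positivity, fun w hw hRw => ?_⟩
    simp only [max_le_iff] at hRw
    obtain ⟨⟨hR, hR1⟩, hR2, hR0⟩ := hRw
    obtain ⟨e1, e2⟩ := h w hw hR
    set P := ∑ l ∈ Finset.range N, a (l + 1) * Complex.exp (-((l + 1 : ℕ) : ℂ) * w)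
    have hP : ‖P‖ ≤ 1 := by
      refine le_trans ?_ (hR' _ hR2)
      rw [Finset.sum_mul]
      refine (norm_sum_le _ _).trans (Finset.sum_le_sum fun l _ => ?_)
      rw [norm_mul]
      gcongr
      rw [Complex.norm_exp, Real.exp_le_exp, neg_mul, Complex.neg_re, ← Complex.ofReal_natCast,
        Complex.re_ofReal_mul]
      push_cast
      have : (0 : ℝ) ≤ l := l.cast_nonneg
      nlinarith
    have h7 : G w - P = Complex.log (F (Complex.exp w) * Complex.exp (-P)) := by
      refine eq_log_of_norm_lt ?_ ?_
      · rw [sub_eq_add_neg, Complex.exp_add, he w hw]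
      · have := norm_sub_le (G w) P
        linarith [hsmall w hw hR1]
    rw [h7]
    refine (norm_log_le (e1.trans e2)).trans ?_
    rw [mul_assoc]
    gcongr

lemma IsZeroFree.mul {F' : ℂ → ℂ} (hF : IsZeroFree F) (hF' : IsZeroFree F') :
    IsZeroFree fun k => F k * F' k := by
  refine ⟨hF.continuousOn.mul hF'.continuousOn,
    fun k hk => (hF.differentiableAt k hk).mul (hF'.differentiableAt k hk),
    fun k hk => mul_ne_zero (hF.ne_zero k hk) (hF'.ne_zero k hk), ?_⟩
  obtain ⟨C, r, hr, h⟩ := hF.log_le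
  obtain ⟨C', r', hr', h'⟩ := hF'.log_le
  refine ⟨C + C', min r r', lt_min hr hr', fun k hk hkr => ?_⟩
  rw [norm_mul, Real.log_mul (norm_ne_zero_iff.2 (hF.ne_zero k hk))
    (norm_ne_zero_iff.2 (hF'.ne_zero k hk)), add_mul]
  exact (abs_add_le _ _).trans (add_le_add (h k hk (hkr.trans (min_le_left _ _)))
    (h' k hk (hkr.trans (min_le_right _ _))))

lemma IsZeroFree.inv (hF : IsZeroFree F) : IsZeroFree fun k => (F k)⁻¹ := by
  refine ⟨hF.continuousOn.inv₀ hF.ne_zero,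
    fun k hk => (hF.differentiableAt k hk).inv (hF.ne_zero k ⟨hk.le, ?_⟩),
    fun k hk => inv_ne_zero (hF.ne_zero k hk), ?_⟩
  · rintro rfl; simp at hk
  · simpa only [norm_inv, Real.log_inv, abs_neg] using hF.log_le

lemma isZeroFree_id : IsZeroFree fun k => k :=
  ⟨continuousOn_id, fun _ _ => differentiableAt_id, fun _ hk => hk.2, 1, 1, one_pos,
    fun k _ _ => by linarith⟩

lemma isZeroFree_of_entire (hd : Differentiable ℂ F) (h0 : ∀ k : ℂ, 0 ≤ k.im → F k ≠ 0) :
    IsZeroFree F := by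
  refine ⟨hd.continuous.continuousOn, fun k _ => hd k, fun k hk => h0 k hk.1, ?_⟩
  have h1 : ContinuousAt (fun k => Real.log ‖F k‖) 0 :=
    hd.continuous.continuousAt.norm.log (norm_ne_zero_iff.2 (h0 0 (by simp)))
  obtain ⟨r, hr, h⟩ := Metric.continuousAt_iff.1 h1 1 one_pos
  refine ⟨|Real.log ‖F 0‖| + 1, r / 2, by positivity, fun k _ hk => ?_⟩
  have h2 := h (x := k) (by rw [dist_zero_right]; linarith)
  rw [Real.dist_eq] at h2
  have h3 := abs_sub_abs_le_abs_sub (Real.log ‖F k‖) (Real.log ‖F 0‖)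
  have h4 := abs_nonneg (Real.log ‖k‖)
  nlinarith [abs_nonneg (Real.log ‖F 0‖)]

lemma IsZeroFree.prod {ι : Type*} (s : Finset ι) {F : ι → ℂ → ℂ}
    (h : ∀ i ∈ s, IsZeroFree (F i)) : IsZeroFree fun k => ∏ i ∈ s, F i k := by
  classical
  induction s using Finset.induction_on with
  | empty => simpa using isZeroFree_of_entire (differentiable_const 1) fun _ _ => one_ne_zero
  | insert i s hi ih =>
    simpa only [Finset.prod_insert hi] using
      (h i (Finset.mem_insert_self i s)).mul (ih fun j hj => h j (Finset.mem_insert_of_mem hj))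

lemma IsZeroFree.pow (hF : IsZeroFree F) (m : ℕ) : IsZeroFree fun k => F k ^ m := by
  simpa using IsZeroFree.prod (Finset.range m) fun _ _ => hF

/-- The moment identities, in terms of the logarithm `lam` of `F` on `ℝ ∖ {0}`. -/
lemma IsZeroFree.moments (hF : IsZeroFree F) (ha : HasLogExpansion F a) :
    (∃ lam, IsLogBranch F lam) ∧
    ∀ lam, IsLogBranch F lam → ∀ (q : ℕ) (f : ℝ → ℂ), (f = fun k : ℝ =>
      (lam k + (-1) ^ q * lam (-k) - ∑ l ∈ Finset.range q,
        a (l + 1) * (1 + (-1) ^ (q + l + 1)) * (1 / (k : ℂ) ^ (l + 1))) * (k : ℂ) ^ q) →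
      IntegrableOn f (Ioi 0) ∧ ∫ k in Ioi 0, f k = -(Complex.I * (Real.pi * a (q + 1))) := by
  have hpi := Real.pi_pos
  obtain ⟨G, hG, he⟩ := hF.exists_isStripLog ha
  have hmem0 : ∀ t : ℝ, (t : ℂ) ∈ closedStrip := fun t => by constructor <;> simp [hpi.le]
  have hmem1 : ∀ t : ℝ, (t + Real.pi * Complex.I : ℂ) ∈ closedStrip := fun t =>
    mk_mem_strip t hpi.le le_rfl
  have hc0 := continuous_strip_bottom hG.continuousOn
  have hc1 := continuous_strip_top hG.continuousOn
  have he0 : ∀ t : ℝ, Complex.exp (G t) = F (Real.exp t : ℝ) := fun t => by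
    rw [he _ (hmem0 t), Complex.ofReal_exp]
  have he1 : ∀ t : ℝ, Complex.exp (G (t + Real.pi * Complex.I)) = F (-Real.exp t : ℝ) := fun t => by
    rw [he _ (hmem1 t), exp_add_pi_mul_I, Complex.ofReal_neg, Complex.ofReal_exp]
  obtain ⟨C, R, hC, hexp⟩ := hG.expansion 0
  simp only [Finset.range_zero, Finset.sum_empty, sub_zero, Nat.cast_zero, zero_add,
    neg_one_mul] at hexp
  have hlim : ∀ ε : ℝ → ℂ, (∀ t, ε t ∈ closedStrip ∧ (ε t).re = t) →
      Tendsto (fun t => G (ε t)) atTop (𝓝 0) := fun ε hε => by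
    refine squeeze_zero_norm' (a := fun t => C * Real.exp (-t)) ?_
      (by simpa using Real.tendsto_exp_neg_atTop_nhds_zero.const_mul C)
    filter_upwards [eventually_ge_atTop R] with t ht
    have := hexp (ε t) (hε t).1 (by rwa [(hε t).2])
    rwa [(hε t).2] at this
  have hlim0 := hlim (fun t => (t : ℂ)) fun t => ⟨hmem0 t, by simp⟩
  have hlim1 := hlim (fun t => t + Real.pi * Complex.I) fun t => ⟨hmem1 t, by simp⟩
  constructor
  · refine ⟨fun k => if 0 < k then G (Real.log k : ℝ) else
      G ((Real.log (-k) : ℝ) + Real.pi * Complex.I), ?_, fun k hk => ?_, ?_⟩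
    · intro k hk
      refine ContinuousAt.continuousWithinAt ?_
      rcases lt_or_gt_of_ne (show k ≠ 0 from hk) with h | h
      · have e1 : ContinuousAt (fun k : ℝ => G ((Real.log (-k) : ℝ) + Real.pi * Complex.I)) k :=
          hc1.continuousAt.comp ((Real.continuousAt_log (by linarith)).comp continuousAt_neg)
        refine e1.congr ?_
        filter_upwards [gt_mem_nhds h] with x hx
        rw [if_neg (not_lt.2 (le_of_lt hx))]
      · have e1 : ContinuousAt (fun k : ℝ => G (Real.log k : ℝ)) k :=
          hc0.continuousAt.comp (Real.continuousAt_log h.ne')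
        refine e1.congr ?_
        filter_upwards [lt_mem_nhds h] with x hx
        rw [if_pos hx]
    · rcases lt_or_gt_of_ne hk with h | h
      · rw [if_neg (not_lt.2 h.le), he1, Real.exp_log (by linarith), neg_neg]
      · rw [if_pos h, he0, Real.exp_log h]
    · rw [IsOrderBornology.cobounded_eq, tendsto_sup]
      constructor
      · refine (hlim1.comp (Real.tendsto_log_atTop.comp tendsto_neg_atBot_atTop)).congr' ?_
        filter_upwards [eventually_lt_atBot 0] with x hx
        rw [if_neg (not_lt.2 hx.le)]; rfl
      · refine (hlim0.comp Real.tendsto_log_atTop).congr' ?_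
        filter_upwards [eventually_gt_atTop 0] with x hx
        rw [if_pos hx]; rfl
  · intro lam hlam q f hf
    have hlt := hlam.tendsto_zero
    rw [IsOrderBornology.cobounded_eq, tendsto_sup] at hlt
    -- two logarithms tending to zero at infinity agree
    have huniq : ∀ δ : ℝ → ℂ, Continuous δ → (∀ t, Complex.exp (δ t) = 1) →
        Tendsto δ atTop (𝓝 0) → ∀ t, δ t = 0 := fun δ hδ h1 h2 t => by
      refine tendsto_nhds_unique ?_ h2
      refine (tendsto_const_nhds (x := δ t)).congr fun s => ?_
      exact eq_of_exp_eq_one isPreconnected_univ hδ.continuousOn (fun x _ => h1 x) (mem_univ _)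
        (mem_univ _)
    have hl0 : ∀ t : ℝ, lam (Real.exp t) = G t := fun t => by
      refine sub_eq_zero.1 (huniq (fun t => lam (Real.exp t) - G t) ?_ (fun t => ?_) ?_ t)
      · exact (hlam.continuousOn.comp_continuous Real.continuous_exp
          fun t => (Real.exp_pos t).ne').sub hc0
      · rw [Complex.exp_sub, hlam.exp_eq _ (Real.exp_pos t).ne', ← he0,
          div_self (Complex.exp_ne_zero _)]
      · simpa using (hlt.2.comp Real.tendsto_exp_atTop).sub hlim0
    have hl1 : ∀ t : ℝ, lam (-Real.exp t) = G (t + Real.pi * Complex.I) := fun t => by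
      refine sub_eq_zero.1 (huniq (fun t => lam (-Real.exp t) - G (t + Real.pi * Complex.I)) ?_
        (fun t => ?_) ?_ t)
      · exact (hlam.continuousOn.comp_continuous Real.continuous_exp.neg
          fun t => (neg_neg_of_pos (Real.exp_pos t)).ne).sub hc1
      · rw [Complex.exp_sub, hlam.exp_eq _ (neg_neg_of_pos (Real.exp_pos t)).ne, ← he1,
          div_self (Complex.exp_ne_zero _)]
      · simpa using (hlt.1.comp (tendsto_neg_atTop_atBot.comp Real.tendsto_exp_atTop)).sub hlim1
    -- the substitution `k = e^t` identifies the integral with the one along the edges of the strip,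
    -- where the lower edge gives `k > 0` and the upper one `-k`
    obtain ⟨hi, hv⟩ := hG.integral_edges q rfl
    have himg : Real.exp '' univ = Ioi 0 := by rw [image_univ, Real.range_exp]
    have hder : ∀ x ∈ (univ : Set ℝ), HasDerivWithinAt Real.exp (Real.exp x) univ x :=
      fun x _ => (Real.hasDerivAt_exp x).hasDerivWithinAt
    have hpt : ∀ t : ℝ, |Real.exp t| • f (Real.exp t) =
        (G t - ∑ l ∈ Finset.range q, a (l + 1) * Complex.exp (-((l + 1 : ℕ) : ℂ) * t)) *
          Complex.exp (((q + 1 : ℕ) : ℂ) * t) -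
        (G (t + Real.pi * Complex.I) - ∑ l ∈ Finset.range q, a (l + 1) *
          Complex.exp (-((l + 1 : ℕ) : ℂ) * (t + Real.pi * Complex.I))) *
          Complex.exp (((q + 1 : ℕ) : ℂ) * (t + Real.pi * Complex.I)) := fun t => by
      set E := Complex.exp t
      have hE : E ≠ 0 := Complex.exp_ne_zero _
      have e1 : ∀ m : ℕ, Complex.exp ((m : ℂ) * t) = E ^ m := fun m => Complex.exp_nat_mul _ _
      have e2 : ∀ m : ℕ, Complex.exp ((m : ℂ) * (t + Real.pi * Complex.I)) = (-1) ^ m * E ^ m :=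
        fun m => by rw [Complex.exp_nat_mul, exp_add_pi_mul_I, neg_pow]
      have e3 : ∀ m : ℕ, Complex.exp (-(m : ℂ) * t) = 1 / E ^ m := fun m => by
        rw [neg_mul, Complex.exp_neg, e1, one_div]
      have e4 : ∀ m : ℕ, Complex.exp (-(m : ℂ) * (t + Real.pi * Complex.I)) =
          (-1) ^ m * (1 / E ^ m) := fun m => by
        rw [neg_mul, Complex.exp_neg, e2, mul_inv, one_div, ← inv_pow, inv_neg, inv_one]
      simp only [e1, e2, e3, e4]
      rw [abs_of_pos (Real.exp_pos t), Complex.real_smul, hf]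
      beta_reduce
      rw [hl0, hl1, Complex.ofReal_exp]
      have e5 : ∑ l ∈ Finset.range q, a (l + 1) * (1 + (-1) ^ (q + l + 1)) * (1 / E ^ (l + 1)) =
          ∑ l ∈ Finset.range q, a (l + 1) * (1 / E ^ (l + 1)) +
          (-1) ^ q * ∑ l ∈ Finset.range q, a (l + 1) * ((-1) ^ (l + 1) * (1 / E ^ (l + 1))) := by
        rw [Finset.mul_sum, ← Finset.sum_add_distrib]
        refine Finset.sum_congr rfl fun l _ => ?_
        rw [add_assoc q, pow_add]; ring
      rw [e5, pow_succ (-1 : ℂ) q]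
      ring
    rw [← himg, integrableOn_image_iff_integrableOn_abs_deriv_smul MeasurableSet.univ hder
      Real.exp_injective.injOn, integral_image_eq_integral_abs_deriv_smul MeasurableSet.univ hder
      Real.exp_injective.injOn]
    simp only [hpt, integrableOn_univ, setIntegral_univ]
    exact ⟨hi, hv⟩

end LogTransfer

variable {n : ℕ}

/-! ### Factorization of the Jost determinant -/

/-- The properties of the Jost matrix that determine the zeros of its determinant: regularity in the
half plane, a lower bound off the imaginary axis, and absence of zeros `iκ` with `κ` close to `0` or
to `∞`. -/
structure IsJostFamily (J : ℂ → Matrix (Fin n) (Fin n) ℂ) : Prop where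
  continuousOn : ContinuousOn J puncturedHalfPlane
  differentiableAt : ∀ k : ℂ, 0 < k.im → DifferentiableAt ℂ J k
  norm_le : ∃ C : ℝ, 1 ≤ C ∧ ∀ k ∈ puncturedHalfPlane, ‖k‖ ≤ 1 → ‖J k‖ ≤ C
  lower : ∀ R : ℝ, 0 < R → ∃ c : ℝ, 0 < c ∧ ∀ k ∈ puncturedHalfPlane, ‖k‖ ≤ R → k.re ≠ 0 →
    IsUnit (J k).det ∧ ‖(J k)⁻¹‖ ≤ 1 / (c * |k.re|)
  small : ∃ δ : ℝ, 0 < δ ∧ ∀ κ : ℝ, 0 < κ → κ < δ → (J (Complex.I * κ)).det ≠ 0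
  large : ∃ R : ℝ, ∀ κ : ℝ, R ≤ κ → (J (Complex.I * κ)).det ≠ 0

namespace IsJostFamily

variable {J : ℂ → Matrix (Fin n) (Fin n) ℂ}

lemma differentiableAt_det {k : ℂ} (h : DifferentiableAt ℂ J k) :
    DifferentiableAt ℂ (fun k => (J k).det) k := by
  have h1 : ∀ i j, DifferentiableAt ℂ (fun k => J k i j) k := fun i j =>
    ((Matrix.entryLinearMap ℂ ℂ i j).toContinuousLinearMap.differentiableAt (x := J k)).comp k h
  simp only [Matrix.det_apply']
  refine DifferentiableAt.fun_sum fun σ _ => DifferentiableAt.const_mul ?_ _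
  exact DifferentiableAt.fun_finsetProd fun i _ => h1 _ _

lemma continuousOn_det (hJ : IsJostFamily J) :
    ContinuousOn (fun k => (J k).det) puncturedHalfPlane :=
  (Continuous.matrix_det continuous_id).comp_continuousOn hJ.continuousOn

lemma isOpen_upper : IsOpen {k : ℂ | 0 < k.im} := isOpen_lt continuous_const Complex.continuous_im

lemma mem_of_im_pos {k : ℂ} (h : 0 < k.im) : k ∈ puncturedHalfPlane :=
  ⟨h.le, by rintro rfl; simp at h⟩

lemma analyticAt_det (hJ : IsJostFamily J) {k : ℂ} (hk : 0 < k.im) :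
    AnalyticAt ℂ (fun k => (J k).det) k :=
  DifferentiableOn.analyticAt (s := {k : ℂ | 0 < k.im})
    (fun z hz => (differentiableAt_det (hJ.differentiableAt z hz)).differentiableWithinAt)
    (isOpen_upper.mem_nhds hk)

lemma det_ne_zero_of_re (hJ : IsJostFamily J) {k : ℂ} (hk : k ∈ puncturedHalfPlane)
    (hre : k.re ≠ 0) : (J k).det ≠ 0 := by
  obtain ⟨c, -, h⟩ := hJ.lower ‖k‖ (norm_pos_iff.2 hk.2)
  exact (h k hk le_rfl hre).1.ne_zero

lemma eq_I_mul_of_det_eq_zero (hJ : IsJostFamily J) {k : ℂ} (hk : k ∈ puncturedHalfPlane)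
    (h0 : (J k).det = 0) : 0 < k.im ∧ k = Complex.I * k.im := by
  have hre : k.re = 0 := by
    by_contra h
    exact hJ.det_ne_zero_of_re hk h h0
  have hk' : k = Complex.I * k.im := by
    apply Complex.ext <;> simp [hre]
  refine ⟨lt_of_le_of_ne hk.1 fun h => hk.2 ?_, hk'⟩
  rw [hk', ← h]; simp

/-- The order of the zero of `det J` at `iκ` is the dimension of the kernel of `J(iκ)`. -/
lemma exists_local_factor (hJ : IsJostFamily J) {κ : ℝ} (hκ : 0 < κ) :
    ∃ D : ℂ → ℂ, AnalyticAt ℂ D (Complex.I * κ) ∧ D (Complex.I * κ) ≠ 0 ∧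
      ∀ᶠ z in 𝓝 (Complex.I * κ), (J z).det =
        (z - Complex.I * κ) ^ (n - (J (Complex.I * κ)).rank) * D z := by
  have him : 0 < (Complex.I * κ).im := by simpa using hκ
  obtain ⟨c, hc, h⟩ := hJ.lower (κ + 1) (by linarith)
  refine exists_det_eq_pow_mul (C := 1 / c) (hJ.differentiableAt _ him) (hJ.analyticAt_det him) ?_
  have h1 : ∀ᶠ t : ℝ in 𝓝 0, |t| < 1 := by
    filter_upwards [Metric.ball_mem_nhds (0 : ℝ) one_pos] with t ht
    simpa using ht
  filter_upwards [h1.filter_mono nhdsWithin_le_nhds, self_mem_nhdsWithin] with t ht1 ht0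
  have hre : (Complex.I * κ + t : ℂ).re = t := by simp
  have h2 := h (Complex.I * κ + t) (mem_of_im_pos (by simpa using hκ)) (by
    refine (norm_add_le _ _).trans ?_
    rw [norm_mul, Complex.norm_I, one_mul, Complex.norm_real, Complex.norm_real,
      Real.norm_of_nonneg hκ.le, Real.norm_eq_abs]
    linarith) (by rw [hre]; exact ht0)
  rw [hre] at h2
  exact ⟨h2.1, by rw [div_div]; exact h2.2⟩

/-- The parameters `κ > 0` of the zeros `iκ` of the determinant. -/
def zeroSet (J : ℂ → Matrix (Fin n) (Fin n) ℂ) : Set ℝ :=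
  {κ | 0 < κ ∧ (J (Complex.I * κ)).det = 0}

lemma finite_zeroSet (hJ : IsJostFamily J) : (zeroSet J).Finite := by
  by_contra hinf
  obtain ⟨δ, hδ, hs⟩ := hJ.small
  obtain ⟨R, hR⟩ := hJ.large
  have hsub : zeroSet J ⊆ Icc δ R := fun κ hκ =>
    ⟨not_lt.1 fun h => hs κ hκ.1 h hκ.2, not_lt.1 fun h => hR κ h.le hκ.2⟩
  obtain ⟨κ, hκ, hacc⟩ := Set.Infinite.exists_accPt_of_subset_isCompact hinf isCompact_Icc hsub
  obtain ⟨D, hD, hD0, hev⟩ := hJ.exists_local_factor (hδ.trans_le hκ.1)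
  have h1 := hev.and (hD.continuousAt.eventually_ne hD0)
  have hcont : ContinuousAt (fun s : ℝ => Complex.I * (s : ℂ)) κ := by fun_prop
  have h2 := hcont.eventually h1
  rw [accPt_iff_frequently] at hacc
  obtain ⟨s, ⟨hne, hs0⟩, hs1, hs2⟩ := (hacc.and_eventually h2).exists
  rw [hs0.2] at hs1
  have h3 : Complex.I * (s : ℂ) - Complex.I * κ ≠ 0 := by
    rw [← mul_sub]
    exact mul_ne_zero Complex.I_ne_zero (sub_ne_zero.2 (by exact_mod_cast hne))
  exact mul_ne_zero (pow_ne_zero _ h3) hs2 hs1.symm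

lemma norm_inv_det_le {M : Matrix (Fin n) (Fin n) ℂ} {b : ℝ} (h : ‖M⁻¹‖ ≤ b) :
    ‖(M.det)⁻¹‖ ≤ n.factorial * b ^ n := by
  have h1 := norm_det_le M⁻¹
  rw [Matrix.det_nonsing_inv, Ring.inverse_eq_inv'] at h1
  exact h1.trans (by gcongr)

/-- Near `0` the determinant is not smaller than a multiple of `|k|^n`.  Close to the imaginary axis
this is the maximum principle for `((z - iy/2)(z - 3iy/2))^n / det J(z)` on the disc with centre
`iy` and radius `y/2`, on whose boundary `|(z - iy/2)(z - 3iy/2)| = y |Re z|`. -/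
lemma exists_norm_inv_det_le (hJ : IsJostFamily J) : ∃ C r : ℝ, 0 < C ∧ 0 < r ∧
    ∀ k ∈ puncturedHalfPlane, ‖k‖ ≤ r →
      ‖((J k).det)⁻¹‖ ≤ n.factorial * (C / ‖k‖) ^ n := by
  obtain ⟨c, hc, hlow⟩ := hJ.lower 1 one_pos
  obtain ⟨δ, hδ, hs⟩ := hJ.small
  refine ⟨16 / c, min (1 / 2) (δ / 2), by positivity, by positivity, fun k hk hkr => ?_⟩
  have hkpos : 0 < ‖k‖ := norm_pos_iff.2 hk.2
  have hk1 : ‖k‖ ≤ 1 / 2 := hkr.trans (min_le_left _ _)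
  have hk2 : ‖k‖ ≤ δ / 2 := hkr.trans (min_le_right _ _)
  have hknorm := Complex.norm_le_abs_re_add_abs_im k
  rw [abs_of_nonneg hk.1] at hknorm
  set y := k.im
  rcases le_or_gt (y / 4) |k.re| with hcase | hcase
  · have hre : 0 < |k.re| := by
      by_contra h
      have h0 : |k.re| = 0 := le_antisymm (not_lt.1 h) (abs_nonneg _)
      rw [h0] at hcase hknorm
      linarith
    obtain ⟨-, h2⟩ := hlow k hk (by linarith) (abs_pos.1 hre)
    refine (norm_inv_det_le h2).trans ?_
    have h3 : 1 / (c * |k.re|) ≤ 16 / c / ‖k‖ := by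
      rw [div_div, div_le_div_iff₀ (by positivity) (by positivity)]
      nlinarith
    gcongr
  · have hy : 0 < y := by linarith [abs_nonneg k.re]
    have hyk : y ≤ ‖k‖ := (le_abs_self y).trans (Complex.abs_im_le_norm k)
    set z₀ : ℂ := Complex.I * y
    set Q : ℂ → ℂ := fun z => (z - z₀) ^ 2 + (y : ℂ) ^ 2 / 4
    have hdisc : ∀ z ∈ Metric.closedBall z₀ (y / 2), 0 < z.im ∧ ‖z‖ ≤ 3 / 2 * y := fun z hz => by
      rw [Metric.mem_closedBall, dist_eq_norm] at hz
      have e1 := abs_le.1 ((Complex.abs_im_le_norm (z - z₀)).trans hz)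
      have e2 : (z - z₀).im = z.im - y := by simp [z₀]
      have e3 : ‖z₀‖ = y := by simp [z₀, abs_of_pos hy]
      refine ⟨by linarith [e1.1], ?_⟩
      have := norm_sub_norm_le z z₀
      linarith
    have hne : ∀ z ∈ Metric.closedBall z₀ (y / 2), (J z).det ≠ 0 := fun z hz h0 => by
      obtain ⟨h1, h2⟩ := hdisc z hz
      obtain ⟨-, h3⟩ := hJ.eq_I_mul_of_det_eq_zero (mem_of_im_pos h1) h0
      rw [h3] at h0
      refine hs z.im h1 ?_ h0
      have := (le_abs_self _).trans (Complex.abs_im_le_norm z)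
      linarith
    have hdiff : ∀ z ∈ Metric.closedBall z₀ (y / 2),
        DifferentiableAt ℂ (fun z => ((J z).det)⁻¹ * Q z ^ n) z := fun z hz =>
      ((differentiableAt_det (hJ.differentiableAt z (hdisc z hz).1)).inv (hne z hz)).mul
        (by simp only [Q]; fun_prop)
    have hbd : ∀ z ∈ Metric.sphere z₀ (y / 2),
        ‖((J z).det)⁻¹ * Q z ^ n‖ ≤ n.factorial * (y / c) ^ n := fun z hz => by
      have hz' := Metric.sphere_subset_closedBall hz
      have e1 : ‖Q z‖ = y * |z.re| := by
        have e0 : (z.re) ^ 2 + (z.im - y) ^ 2 = y ^ 2 / 4 := by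
          have h1 : ‖z - z₀‖ = y / 2 := by simpa [dist_eq_norm] using hz
          have h2 := Complex.sq_norm (z - z₀)
          rw [h1, Complex.normSq_apply] at h2
          simp [z₀] at h2
          nlinarith
        have h3 : Q z = (2 * z.re : ℝ) * (z - z₀) := by
          apply Complex.ext
          · simp [Q, z₀, pow_two]; nlinarith
          · simp [Q, z₀, pow_two]; ring
        have h4 : ‖z - z₀‖ = y / 2 := by simpa [dist_eq_norm] using hz
        rw [h3, norm_mul, h4, Complex.norm_real, Real.norm_eq_abs, abs_mul, abs_two]
        ring
      rw [norm_mul, norm_pow, e1]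
      by_cases hre : z.re = 0
      · rcases Nat.eq_zero_or_pos n with hn | hn
        · subst hn; simp
        · rw [hre, abs_zero, mul_zero, zero_pow hn.ne', mul_zero]; positivity
      · have hre' := abs_pos.2 hre
        have e2 := (hlow z (mem_of_im_pos (hdisc z hz').1)
          (by linarith [(hdisc z hz').2]) hre).2
        calc ‖((J z).det)⁻¹‖ * (y * |z.re|) ^ n
            ≤ n.factorial * (1 / (c * |z.re|)) ^ n * (y * |z.re|) ^ n := by
              gcongr; exact norm_inv_det_le e2
          _ = n.factorial * (y / c) ^ n := by
              rw [mul_assoc, ← mul_pow]; congr 2; field_simp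
    have hkz : ‖k - z₀‖ = |k.re| := by
      have : k - z₀ = (k.re : ℝ) := by apply Complex.ext <;> simp [z₀, y]
      rw [this, Complex.norm_real, Real.norm_eq_abs]
    have hmax := Complex.norm_le_of_forall_mem_frontier_norm_le (U := Metric.ball z₀ (y / 2))
      (f := fun z => ((J z).det)⁻¹ * Q z ^ n) Metric.isBounded_ball
      (DifferentiableOn.diffContOnCl fun z hz => (hdiff z (by
        rw [closure_ball z₀ (by positivity)] at hz; exact hz)).differentiableWithinAt)
      (by rw [frontier_ball z₀ (by positivity)]; exact hbd)
      (z := k) (subset_closure (by rw [Metric.mem_ball, dist_eq_norm, hkz]; linarith))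
    have hQ : y ^ 2 / 8 ≤ ‖Q k‖ := by
      have e1 : ‖((y : ℂ) ^ 2 / 4)‖ = y ^ 2 / 4 := by
        rw [norm_div, norm_pow, Complex.norm_real, Real.norm_of_nonneg hy.le]; simp
      have e2 : ‖((y : ℂ) ^ 2 / 4)‖ - ‖(k - z₀) ^ 2‖ ≤ ‖Q k‖ := by
        have := norm_sub_norm_le ((y : ℂ) ^ 2 / 4) (-(k - z₀) ^ 2)
        rw [norm_neg] at this
        simp only [Q]
        rwa [sub_neg_eq_add, add_comm] at this
      rw [e1, norm_pow, hkz] at e2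
      nlinarith [abs_nonneg k.re]
    rw [norm_mul, norm_pow] at hmax
    have hfin : ‖((J k).det)⁻¹‖ * (y ^ 2 / 8) ^ n ≤ n.factorial * (y / c) ^ n :=
      le_trans (by gcongr) hmax
    have h5 : ‖((J k).det)⁻¹‖ ≤ n.factorial * (8 / (c * y)) ^ n := by
      have h6 : (y / c) ^ n = (8 / (c * y)) ^ n * (y ^ 2 / 8) ^ n := by
        rw [← mul_pow]; congr 1; field_simp
      rw [h6, ← mul_assoc] at hfin
      exact le_of_mul_le_mul_right hfin (by positivity)
    refine h5.trans ?_
    have h7 : 8 / (c * y) ≤ 16 / c / ‖k‖ := by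
      rw [div_div, div_le_div_iff₀ (by positivity) (by positivity)]
      nlinarith
    gcongr

/-- `|log |det J||` is of at most logarithmic growth at `0`. -/
lemma exists_log_det_le (hJ : IsJostFamily J) : ∃ C r : ℝ, 0 < r ∧ ∀ k ∈ puncturedHalfPlane,
    ‖k‖ ≤ r → (J k).det ≠ 0 → |Real.log ‖(J k).det‖| ≤ C * (1 + |Real.log ‖k‖|) := by
  obtain ⟨B, hB1, hB⟩ := hJ.norm_le
  obtain ⟨C, r, hC, hr, h⟩ := hJ.exists_norm_inv_det_le
  refine ⟨|Real.log (n.factorial * B ^ n)| + |Real.log (n.factorial * C ^ n)| + n, min r 1,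
    by positivity, fun k hk hkr hne => ?_⟩
  have hk0 : 0 < ‖k‖ := norm_pos_iff.2 hk.2
  have hpos : 0 < ‖(J k).det‖ := norm_pos_iff.2 hne
  have hfac : (0 : ℝ) < n.factorial := by exact_mod_cast n.factorial_pos
  have e1 : Real.log ‖(J k).det‖ ≤ Real.log (n.factorial * B ^ n) := by
    refine Real.log_le_log hpos ((norm_det_le _).trans ?_)
    have := hB k hk (hkr.trans (min_le_right _ _))
    gcongr
  have e2 : -Real.log ‖(J k).det‖ ≤ Real.log (n.factorial * C ^ n) - n * Real.log ‖k‖ := by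
    have h1 := h k hk (hkr.trans (min_le_left _ _))
    rw [norm_inv] at h1
    have h2 := Real.log_le_log (inv_pos.2 hpos) h1
    rw [Real.log_inv, div_pow, ← mul_div_assoc, Real.log_div (by positivity) (by positivity),
      Real.log_pow] at h2
    exact h2
  have a1 := le_abs_self (Real.log (n.factorial * B ^ n))
  have a2 := le_abs_self (Real.log (n.factorial * C ^ n))
  have a3 : -(n * Real.log ‖k‖) ≤ n * |Real.log ‖k‖| := by
    have := neg_abs_le (Real.log ‖k‖)
    have hn : (0 : ℝ) ≤ n := n.cast_nonneg
    nlinarith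
  set X := |Real.log (n.factorial * B ^ n)|
  set Y := |Real.log (n.factorial * C ^ n)|
  have b1 : 0 ≤ X := abs_nonneg _
  have b2 : 0 ≤ Y := abs_nonneg _
  have b3 := abs_nonneg (Real.log ‖k‖)
  have b4 : (0 : ℝ) ≤ n := n.cast_nonneg
  have b5 : 0 ≤ (X + Y) * |Real.log ‖k‖| := by positivity
  have b6 : 0 ≤ n * |Real.log ‖k‖| := by positivity
  rw [abs_le]
  constructor <;> nlinarith

/-- Factorization of the Jost determinant: after division by the zeros `iκ`, with multiplicity
`dim ker J(iκ)`, the determinant is zero-free. -/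
lemma exists_factorization (hJ : IsJostFamily J) (S : Finset ℝ) (hS : ∀ κ, κ ∈ S ↔ κ ∈ zeroSet J) :
    ∃ D : ℂ → ℂ, IsZeroFree D ∧ ∀ k ∈ puncturedHalfPlane, (J k).det =
      (∏ κ ∈ S, (k - Complex.I * κ) ^ (n - (J (Complex.I * κ)).rank)) * D k := by
  classical
  set m : ℝ → ℕ := fun κ => n - (J (Complex.I * κ)).rank
  set P : Finset ℝ → ℂ → ℂ := fun T k => ∏ κ ∈ T, (k - Complex.I * κ) ^ m κ
  have hPd : ∀ T, Differentiable ℂ (P T) := fun T => by simp only [P]; fun_prop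
  have hP0 : ∀ (T : Finset ℝ) (k : ℂ), (∀ κ ∈ T, k ≠ Complex.I * κ) → P T k ≠ 0 := fun T k h =>
    Finset.prod_ne_zero_iff.2 fun κ hκ => pow_ne_zero _ (sub_ne_zero.2 (h κ hκ))
  have hpos : ∀ κ ∈ S, 0 < κ := fun κ hκ => ((hS κ).1 hκ).1
  choose! E hE hE0 hEev using fun κ (hκ : 0 < κ) => hJ.exists_local_factor hκ
  set Z : Set ℂ := (fun κ : ℝ => Complex.I * (κ : ℂ)) '' S
  have hZ : IsClosed Z := (S.finite_toSet.image _).isClosed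
  -- the quotient off the zeros `iκ`, continued to them by the local factor `E κ` of `det J`
  set D : ℂ → ℂ := fun k => if k ∈ Z then E k.im k / P (S.erase k.im) k else (J k).det / P S k
  have hnotZ : ∀ k ∉ Z, ∀ κ ∈ S, k ≠ Complex.I * κ := fun k hk κ hκ h => hk ⟨κ, hκ, h.symm⟩
  have hoff : ∀ k ∉ Z, D =ᶠ[𝓝 k] fun k => (J k).det / P S k := fun k hk => by
    filter_upwards [hZ.isOpen_compl.mem_nhds hk] with z hz
    simp only [D, if_neg hz]
  have hinj : ∀ κ κ' : ℝ, Complex.I * (κ : ℂ) = Complex.I * κ' → κ = κ' := fun κ κ' h => by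
    exact_mod_cast mul_left_cancel₀ Complex.I_ne_zero h
  have hother : ∀ κ ∈ S, ∀ κ' ∈ S.erase κ, Complex.I * (κ : ℂ) ≠ Complex.I * κ' :=
    fun κ _ κ' h' h => (Finset.mem_erase.1 h').1 (hinj _ _ h).symm
  have hon : ∀ κ ∈ S, D =ᶠ[𝓝 (Complex.I * κ)] fun k => E κ k / P (S.erase κ) k := fun κ hκ => by
    have h1 : ∀ᶠ z in 𝓝 (Complex.I * (κ : ℂ)), P (S.erase κ) z ≠ 0 :=
      (hPd _).continuous.continuousAt.eventually_ne (hP0 _ _ (hother κ hκ))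
    filter_upwards [h1, hEev κ (hpos κ hκ)] with z hz1 hz2
    by_cases hz : z = Complex.I * κ
    · have hzZ : z ∈ Z := ⟨κ, hκ, hz.symm⟩
      have him : z.im = κ := by rw [hz]; simp
      simp only [D, if_pos hzZ, him]
    · have hzZ : z ∉ Z := by
        rintro ⟨κ', hκ', h'⟩
        have hne : κ' ≠ κ := by rintro rfl; exact hz h'.symm
        refine hz1 (Finset.prod_eq_zero (Finset.mem_erase.2 ⟨hne, hκ'⟩) ?_)
        rw [← h', sub_self]
        refine zero_pow fun hm => ?_
        obtain ⟨hp, hdet⟩ := (hS κ').1 hκ'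
        have h2 := (hEev κ' hp).self_of_nhds
        simp only [m] at hm
        rw [hdet, hm, pow_zero, one_mul] at h2
        exact hE0 κ' hp h2.symm
      have h3 : P S z = (z - Complex.I * κ) ^ m κ * P (S.erase κ) z :=
        (Finset.mul_prod_erase S (fun κ => (z - Complex.I * (κ : ℂ)) ^ m κ) hκ).symm
      simp only [D, if_neg hzZ]
      rw [h3, hz2, mul_div_mul_left _ _ (pow_ne_zero _ (sub_ne_zero.2 hz))]
  have hval : ∀ κ ∈ S, D (Complex.I * κ) = E κ (Complex.I * κ) / P (S.erase κ) (Complex.I * κ) :=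
    fun κ hκ => (hon κ hκ).self_of_nhds
  have hZpos : ∀ k ∈ Z, ∃ κ ∈ S, 0 < κ ∧ Complex.I * (κ : ℂ) = k := by
    rintro _ ⟨κ, hκ, rfl⟩
    exact ⟨κ, hκ, hpos κ hκ, rfl⟩
  have hdiff : ∀ k : ℂ, 0 < k.im → DifferentiableAt ℂ D k := fun k hk => by
    by_cases hkZ : k ∈ Z
    · obtain ⟨κ, hκ, hp, rfl⟩ := hZpos k hkZ
      exact ((hE κ hp).differentiableAt.div (hPd _ _)
        (hP0 _ _ (hother κ hκ))).congr_of_eventuallyEq (hon κ hκ)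
    · exact ((differentiableAt_det (hJ.differentiableAt k hk)).div (hPd _ _)
        (hP0 _ _ (hnotZ k hkZ))).congr_of_eventuallyEq (hoff k hkZ)
  have hdetZ : ∀ k ∈ puncturedHalfPlane, k ∉ Z → (J k).det ≠ 0 := fun k hk hkZ h0 => by
    obtain ⟨h1, h2⟩ := hJ.eq_I_mul_of_det_eq_zero hk h0
    refine hkZ ⟨k.im, (hS _).2 ⟨h1, ?_⟩, h2.symm⟩
    rw [← h2]; exact h0
  refine ⟨D, ⟨fun k hk => ?_, hdiff, fun k hk => ?_, ?_⟩, fun k hk => ?_⟩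
  · by_cases hkZ : k ∈ Z
    · obtain ⟨κ, hκ, hp, rfl⟩ := hZpos k hkZ
      exact (hdiff _ (by simpa using hp)).continuousAt.continuousWithinAt
    · exact ((hJ.continuousOn_det k hk).div (hPd _).continuous.continuousAt.continuousWithinAt
        (hP0 _ _ (hnotZ k hkZ))).congr_of_eventuallyEq ((hoff k hkZ).filter_mono
          nhdsWithin_le_nhds) (hoff k hkZ).self_of_nhds
  · by_cases hkZ : k ∈ Z
    · obtain ⟨κ, hκ, hp, rfl⟩ := hZpos k hkZ
      rw [hval κ hκ]
      exact div_ne_zero (hE0 κ hp) (hP0 _ _ (hother κ hκ))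
    · simp only [D, if_neg hkZ]
      exact div_ne_zero (hdetZ k hk hkZ) (hP0 _ _ (hnotZ k hkZ))
  · obtain ⟨C, r, hr, hlog⟩ := hJ.exists_log_det_le
    have h0Z : (0 : ℂ) ∉ Z := fun h => by
      obtain ⟨κ, -, hp, h'⟩ := hZpos 0 h
      exact mul_ne_zero Complex.I_ne_zero (by exact_mod_cast hp.ne') h'
    obtain ⟨r', hr', hZr⟩ := Metric.isOpen_iff.1 hZ.isOpen_compl 0 h0Z
    have hPc : ContinuousAt (fun k => Real.log ‖P S k‖) 0 :=
      (hPd S).continuous.continuousAt.norm.log (norm_ne_zero_iff.2 (hP0 _ _ (hnotZ 0 h0Z)))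
    obtain ⟨r'', hr'', hPr⟩ := Metric.continuousAt_iff.1 hPc 1 one_pos
    refine ⟨C + (|Real.log ‖P S 0‖| + 1), min r (min (r' / 2) (r'' / 2)), by positivity,
      fun k hk hkr => ?_⟩
    simp only [le_min_iff] at hkr
    have hkZ : k ∉ Z := hZr (by rw [Metric.mem_ball, dist_zero_right]; linarith [hkr.2.1])
    have h2 := hPr (x := k) (by rw [dist_zero_right]; linarith [hkr.2.2])
    rw [Real.dist_eq] at h2
    have h3 := abs_sub_abs_le_abs_sub (Real.log ‖P S k‖) (Real.log ‖P S 0‖)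
    have h4 := hlog k hk hkr.1 (hdetZ k hk hkZ)
    have h5 := abs_nonneg (Real.log ‖k‖)
    have h6 := abs_nonneg (Real.log ‖P S 0‖)
    simp only [D, if_neg hkZ]
    rw [norm_div, Real.log_div (norm_ne_zero_iff.2 (hdetZ k hk hkZ))
      (norm_ne_zero_iff.2 (hP0 _ _ (hnotZ k hkZ)))]
    refine (abs_sub _ _).trans ?_
    nlinarith
  · by_cases hkZ : k ∈ Z
    · obtain ⟨κ, hκ, hp, rfl⟩ := hZpos k hkZ
      have h1 := (hEev κ hp).self_of_nhds
      rw [((hS κ).1 hκ).2] at h1 ⊢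
      rw [sub_self] at h1
      have h2 : (0 : ℂ) ^ m κ = 0 := by
        rcases mul_eq_zero.1 h1.symm with h | h
        · exact h
        · exact absurd h (hE0 κ hp)
      rw [Finset.prod_eq_zero hκ (by rw [sub_self]; exact h2), zero_mul]
    · simp only [D, if_neg hkZ]
      rw [mul_div_cancel₀]
      exact hP0 _ _ (hnotZ k hkZ)

end IsJostFamily

variable {n : ℕ}

/-! ### The zeros of the Jost determinant and the bound states -/

section JostFamily

variable {V W : ℝ → Matrix (Fin n) (Fin n) ℂ} {A B : Matrix (Fin n) (Fin n) ℂ}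
  {g g' f f' : ℂ → ℝ → Matrix (Fin n) (Fin n) ℂ} {p : ℕ} {c₂ : ℂ}

lemma isJostFamily_jostMatrix (hW : IsRegularPotential W) (hg : IsJostFactor W g g')
    (hVW : ∀ x, 0 < x → V x = W x) (hAB : IsSelfadjointBC A B) (hf : IsJostSolution V f f')
    (hc : IsLeadingConstant (jostMatrix f f' A B) p c₂) : IsJostFamily (jostMatrix f f' A B) := by
  have hJ : ∀ k ∈ puncturedHalfPlane, jostMatrix f f' A B k =
      (gammaMat g g' A B (-(starRingEnd ℂ k)))ᴴ := fun k hk => jostMatrix_eq hW hVW hg hf hk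
  have hnc : ∀ k : ℂ, ‖-(starRingEnd ℂ k)‖ = ‖k‖ := fun k => by simp
  have hcI : ∀ κ : ℝ, -(starRingEnd ℂ (Complex.I * κ)) = Complex.I * κ := fun κ => by simp
  refine ⟨?_, fun k hk => ?_, ?_, fun R hR => ?_, ?_, ?_⟩
  · have h1 : ContinuousOn (gammaMat g g' A B) puncturedHalfPlane := fun k hk =>
      (differentiableWithinAt_gammaMat hW hg A B hk).continuousWithinAt
    have h2 : ContinuousOn (fun k => (gammaMat g g' A B (-(starRingEnd ℂ k)))ᴴ)
        puncturedHalfPlane :=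
      (Continuous.matrix_conjTranspose continuous_id).comp_continuousOn
        (h1.comp Complex.continuous_conj.neg.continuousOn fun k hk => neg_conj_mem hk)
    exact h2.congr hJ
  · have hmem : puncturedHalfPlane ∈ 𝓝 (-(starRingEnd ℂ k)) :=
      mem_of_superset (IsJostFamily.isOpen_upper.mem_nhds (show 0 < (-(starRingEnd ℂ k)).im by
        simpa using hk)) fun z hz => IsJostFamily.mem_of_im_pos hz
    have h1 : DifferentiableAt ℂ (gammaMat g g' A B) (-(starRingEnd ℂ k)) :=
      (differentiableWithinAt_gammaMat hW hg A B
        (neg_conj_mem (IsJostFamily.mem_of_im_pos hk))).differentiableAt hmem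
    have h2 : DifferentiableAt ℂ (fun z => gammaMat g g' A B (-z)) (starRingEnd ℂ k) :=
      h1.comp (starRingEnd ℂ k) differentiableAt_id.neg
    have h3 := h2.star_conj
    rw [Complex.conj_conj] at h3
    refine h3.congr_of_eventuallyEq ?_
    filter_upwards [IsJostFamily.isOpen_upper.mem_nhds hk] with z hz
    exact hJ z (IsJostFamily.mem_of_im_pos hz)
  · obtain ⟨C, hC, h⟩ := exists_norm_gammaMat_le hW hg A B
    refine ⟨2 * C + 1, by linarith, fun k hk hk1 => ?_⟩
    have h1 := h _ (neg_conj_mem hk)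
    rw [hnc] at h1
    rw [hJ k hk, Matrix.l2_opNorm_conjTranspose]
    nlinarith
  · obtain ⟨c, hc, h⟩ := exists_gammaMat_lower_bound hW hg hAB R hR
    refine ⟨c, hc, fun k hk hkR hre => ?_⟩
    have h1 := h _ (neg_conj_mem hk) (by rwa [hnc])
    have h2 : (-(starRingEnd ℂ k)).re = -k.re := by simp
    rw [h2, abs_neg] at h1
    obtain ⟨h3, h4⟩ := isUnit_det_of_lower_bound (mul_pos hc (abs_pos.2 hre)) h1
    rw [hJ k hk]
    refine ⟨by rw [Matrix.det_conjTranspose]; exact h3.star, ?_⟩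
    rw [← Matrix.conjTranspose_nonsing_inv, Matrix.l2_opNorm_conjTranspose]
    exact h4
  · obtain ⟨δ, hδ, h⟩ := exists_no_small_zeros hW hg hAB
    refine ⟨δ, hδ, fun κ hκ hκδ h0 => ?_⟩
    rw [hJ _ (I_mul_mem hκ), hcI, Matrix.det_conjTranspose, star_eq_zero] at h0
    obtain ⟨v, hv, hv0⟩ := Matrix.exists_mulVec_eq_zero_iff.2 h0
    refine hv ?_
    have := h κ hκ hκδ (WithLp.toLp 2 v) (by
      have : matOp (gammaMat g g' A B (Complex.I * κ)) (WithLp.toLp 2 v) =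
          WithLp.toLp 2 (gammaMat g g' A B (Complex.I * κ) *ᵥ v) := rfl
      rw [this, hv0]; rfl)
    simpa using congrArg WithLp.ofLp this
  · have h1 := (tendsto_hFun hc).eventually_ne one_ne_zero
    obtain ⟨R, hR⟩ := eventually_upperInfty_iff.1 h1
    refine ⟨max R 0, fun κ hκ h0 => ?_⟩
    have hκ0 : 0 ≤ κ := (le_max_right _ _).trans hκ
    refine hR (Complex.I * κ) (by simpa using hκ0) ?_ (by rw [hFun, h0, zero_div])
    simpa [abs_of_nonneg hκ0] using (le_max_left _ _).trans hκ

/-- On the imaginary axis `J(iκ) = Γ(iκ)†`, as `-k* = k` there. -/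
lemma zeroSet_jostMatrix (hW : IsRegularPotential W) (hg : IsJostFactor W g g')
    (hVW : ∀ x, 0 < x → V x = W x) (hf : IsJostSolution V f f') :
    IsJostFamily.zeroSet (jostMatrix f f' A B) = boundStates V A B := by
  ext κ
  have hcI : ∀ κ : ℝ, -(starRingEnd ℂ (Complex.I * κ)) = Complex.I * κ := fun κ => by simp
  constructor
  · rintro ⟨hκ, h0⟩
    rw [jostMatrix_eq hW hVW hg hf (I_mul_mem hκ), hcI, Matrix.det_conjTranspose,
      star_eq_zero] at h0
    exact (mem_boundStates_iff hW hg hVW hκ).2 h0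
  · intro h
    refine ⟨h.1, ?_⟩
    rw [jostMatrix_eq hW hVW hg hf (I_mul_mem h.1), hcI, Matrix.det_conjTranspose,
      (mem_boundStates_iff hW hg hVW h.1).1 h, star_zero]

lemma sub_rank_jostMatrix (hW : IsRegularPotential W) (hg : IsJostFactor W g g')
    (hVW : ∀ x, 0 < x → V x = W x) (hf : IsJostSolution V f f') {κ : ℝ} (hκ : 0 < κ) :
    n - (jostMatrix f f' A B (Complex.I * κ)).rank =
      Module.finrank ℂ (eigenspace V A B (-(κ : ℂ) ^ 2)) := by
  have hcI : -(starRingEnd ℂ (Complex.I * κ)) = Complex.I * κ := by simp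
  rw [finrank_eigenspace hW hg hVW hκ, finrank_ker_matOp,
    jostMatrix_eq hW hVW hg hf (I_mul_mem hκ), hcI]

end JostFamily

/-! ### Trace identities for a function with zeros on the imaginary axis -/

section TraceIdentities

lemma HasLogExpansion.inv {F : ℂ → ℂ} {a : ℕ → ℂ} (hF : HasLogExpansion F a) :
    HasLogExpansion (fun k => (F k)⁻¹) (fun l => -a l) := by
  intro N
  have h1 := hF N
  set X : ℂ → ℂ := fun k => F k * Complex.exp (-∑ l ∈ Finset.range N, a (l + 1) * k⁻¹ ^ (l + 1))
  have h2 : Tendsto X upperInfty (𝓝 1) := by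
    have e1 : Tendsto (fun k : ℂ => k⁻¹ ^ (N + 1)) upperInfty (𝓝 0) := by
      simpa using tendsto_inv_upperInfty.pow (N + 1)
    have e2 := (h1.trans_tendsto e1).add_const 1
    simp only [sub_add_cancel, zero_add] at e2
    exact e2
  have h3 : (fun k => (X k)⁻¹) =O[upperInfty] fun _ => (1 : ℂ) :=
    isBigO_one_of_tendsto (h2.inv₀ one_ne_zero)
  have h4 := (h1.neg_left.mul h3)
  simp only [mul_one] at h4
  refine h4.congr' ?_ EventuallyEq.rfl
  filter_upwards [h2.eventually_ne one_ne_zero] with k hk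
  have e2 : (F k)⁻¹ * Complex.exp (-∑ l ∈ Finset.range N, -a (l + 1) * k⁻¹ ^ (l + 1)) =
      (X k)⁻¹ := by
    simp only [X, mul_inv, ← Complex.exp_neg, neg_mul, Finset.sum_neg_distrib, neg_neg]
  rw [e2]
  change -(X k - 1) * (X k)⁻¹ = _
  field_simp
  ring

lemma HasLogExpansion.pow {F : ℂ → ℂ} {a : ℕ → ℂ} (hF : HasLogExpansion F a) (m : ℕ) :
    HasLogExpansion (fun k => F k ^ m) (fun l => m * a l) := by
  simpa using HasLogExpansion.prod (Finset.range m) fun _ => hF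

variable {h D : ℂ → ℂ} {S : Finset ℝ} {m : ℝ → ℕ} {a : ℕ → ℂ}

lemma add_I_mul_ne_zero {κ : ℝ} (hκ : 0 < κ) {k : ℂ} (hk : 0 ≤ k.im) : k + Complex.I * κ ≠ 0 :=
  fun h0 => by
    have := congrArg Complex.im h0
    simp at this
    linarith

lemma isZeroFree_prod_add (hS : ∀ κ ∈ S, 0 < κ) :
    IsZeroFree fun k => ∏ κ ∈ S, (k + Complex.I * κ) ^ m κ :=
  IsZeroFree.prod S fun κ hκ => (isZeroFree_of_entire (by fun_prop)
    fun _ hk => add_I_mul_ne_zero (hS κ hκ) hk).pow (m κ)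

lemma isZeroFree_prod_sq (S : Finset ℝ) (m : ℝ → ℕ) :
    IsZeroFree fun k => ∏ κ ∈ S, (k ^ 2) ^ m κ :=
  IsZeroFree.prod S fun κ _ => (isZeroFree_id.pow 2).pow (m κ)

/-- Replacing the zeros of `h` by their mirror images: the factors `(k + iκ)/(k - iκ)` have modulus
one on `ℝ`, and their logarithm is odd there. -/
lemma hasLogExpansion_odd_factor (he : HasLogExpansion h a)
    (hh : ∀ k ∈ puncturedHalfPlane, h k = (∏ κ ∈ S, (k - Complex.I * κ) ^ m κ) * D k) :
    HasLogExpansion (fun k => D k * ∏ κ ∈ S, (k + Complex.I * κ) ^ m κ)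
      (fun l => a l + ∑ κ ∈ S, m κ *
        (-(-(Complex.I * κ)) ^ l / l + -(-(-(-(Complex.I * κ))) ^ l / l))) := by
  have h1 := HasLogExpansion.prod S fun κ : ℝ =>
    ((hasLogExpansion_one_add (Complex.I * κ)).mul
      (hasLogExpansion_one_add (-(Complex.I * κ))).inv).pow (m κ)
  refine (he.mul h1).congr ?_ fun _ => rfl
  filter_upwards [eventually_upperInfty (1 + ∑ κ ∈ S, |κ|)] with k hk
  rw [hh k hk.1, mul_right_comm, mul_comm (D k), ← Finset.prod_mul_distrib]
  congr 1
  refine Finset.prod_congr rfl fun κ hκ => ?_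
  rw [← mul_pow]
  have hk0 := hk.1.2
  have hne : k - Complex.I * κ ≠ 0 := by
    intro h0
    have e1 : ‖k‖ = |κ| := by rw [sub_eq_zero.1 h0]; simp
    have e2 := Finset.single_le_sum (f := fun κ : ℝ => |κ|) (fun i _ => abs_nonneg i) hκ
    beta_reduce at e2
    linarith [hk.2]
  have hne' : 1 + -(Complex.I * κ) * k⁻¹ ≠ 0 := by
    intro h0
    refine hne ?_
    field_simp at h0
    linear_combination h0
  congr 1
  have e3 : k - Complex.I * κ = k * (1 + -(Complex.I * κ) * k⁻¹) := by field_simp; ring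
  have e4 : k + Complex.I * κ = k * (1 + Complex.I * κ * k⁻¹) := by field_simp
  rw [e3, e4]
  set u := 1 + -(Complex.I * κ) * k⁻¹
  set v := 1 + Complex.I * κ * k⁻¹
  field_simp

/-- Moving the zeros of `h` to the origin: the factors `k²/(k² + κ²)` are positive and even on
`ℝ \ {0}`. -/
lemma hasLogExpansion_even_factor (he : HasLogExpansion h a)
    (hh : ∀ k ∈ puncturedHalfPlane, h k = (∏ κ ∈ S, (k - Complex.I * κ) ^ m κ) * D k) :
    HasLogExpansion (fun k => D k * ((∏ κ ∈ S, (k ^ 2) ^ m κ) *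
        (∏ κ ∈ S, (k + Complex.I * κ) ^ m κ)⁻¹))
      (fun l => a l + ∑ κ ∈ S, m κ *
        (-(-(-(Complex.I * κ)) ^ l / l) + -(-(-(-(Complex.I * κ))) ^ l / l))) := by
  have h1 := HasLogExpansion.prod S fun κ : ℝ =>
    ((hasLogExpansion_one_add (Complex.I * κ)).inv.mul
      (hasLogExpansion_one_add (-(Complex.I * κ))).inv).pow (m κ)
  refine (he.mul h1).congr ?_ fun _ => rfl
  filter_upwards [eventually_upperInfty (1 + ∑ κ ∈ S, |κ|)] with k hk
  rw [hh k hk.1, mul_right_comm, mul_comm (D k), ← Finset.prod_mul_distrib,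
    ← Finset.prod_inv_distrib, ← Finset.prod_mul_distrib]
  congr 1
  refine Finset.prod_congr rfl fun κ hκ => ?_
  rw [← mul_pow, ← inv_pow, ← mul_pow]
  have hk0 := hk.1.2
  have hne : k - Complex.I * κ ≠ 0 := by
    intro h0
    have e1 : ‖k‖ = |κ| := by rw [sub_eq_zero.1 h0]; simp
    have e2 := Finset.single_le_sum (f := fun κ : ℝ => |κ|) (fun i _ => abs_nonneg i) hκ
    beta_reduce at e2
    linarith [hk.2]
  have hne' : 1 + -(Complex.I * κ) * k⁻¹ ≠ 0 := by
    intro h0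
    refine hne ?_
    field_simp at h0
    linear_combination h0
  congr 1
  have e3 : k - Complex.I * κ = k * (1 + -(Complex.I * κ) * k⁻¹) := by field_simp; ring
  have e4 : k + Complex.I * κ = k * (1 + Complex.I * κ * k⁻¹) := by field_simp
  rw [e3, e4, mul_inv, mul_assoc k, mul_comm (1 + Complex.I * κ * k⁻¹)⁻¹, ← mul_assoc,
    ← mul_assoc, mul_assoc k, mul_inv_cancel₀ hne', mul_one]
  field_simp

lemma sum_even_terms (c : ℕ → ℂ) (j : ℕ) :
    ∑ l ∈ Finset.range (2 * j), c (l + 1) * (1 + (-1) ^ (l + 1)) =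
      2 * ∑ l ∈ Finset.range j, c (2 * (l + 1)) := by
  induction j with
  | zero => simp
  | succ j ih =>
    have e1 : (-1 : ℂ) ^ (2 * j + 1) = -1 := by rw [pow_succ, pow_mul]; simp
    have e2 : (-1 : ℂ) ^ (2 * j + 1 + 1) = 1 := by rw [pow_succ, e1]; simp
    rw [show 2 * (j + 1) = 2 * j + 1 + 1 by ring, Finset.sum_range_succ, Finset.sum_range_succ,
      ih, Finset.sum_range_succ, e1, e2, show 2 * (j + 1) = 2 * j + 1 + 1 by ring]
    ring

lemma sum_odd_terms (c : ℕ → ℂ) (j : ℕ) :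
    ∑ l ∈ Finset.range (2 * j + 1), c (l + 1) * (1 + (-1) ^ l) =
      2 * ∑ l ∈ Finset.range (j + 1), c (2 * l + 1) := by
  induction j with
  | zero => simp; ring
  | succ j ih =>
    have e1 : (-1 : ℂ) ^ (2 * j + 1) = -1 := by rw [pow_succ, pow_mul]; simp
    have e2 : (-1 : ℂ) ^ (2 * j + 1 + 1) = 1 := by rw [pow_succ, e1]; simp
    rw [show 2 * (j + 1) + 1 = 2 * j + 1 + 1 + 1 by ring, Finset.sum_range_succ,
      Finset.sum_range_succ, ih, Finset.sum_range_succ _ (j + 1), e1, e2,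
      show 2 * (j + 1) = 2 * j + 1 + 1 by ring]
    ring

/-- The odd logarithm `2i arctan(κ/k)` of `(k + iκ)/(k - iκ)`. -/
lemma exp_two_I_arctan {κ k : ℝ} (hk : k ≠ 0) :
    Complex.exp (2 * Complex.I * (Real.arctan (κ / k) : ℝ)) * (k - Complex.I * κ) =
      k + Complex.I * κ := by
  set t := Real.arctan (κ / k)
  have hc : Real.cos t ≠ 0 := (Real.cos_arctan_pos _).ne'
  have h1 : κ = k * Real.tan t := by
    rw [Real.tan_arctan]; field_simp
  have h2 : κ * Real.cos t = k * Real.sin t := by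
    rw [h1, Real.tan_eq_sin_div_cos]; field_simp
  have e1 : Complex.exp (2 * Complex.I * (t : ℝ)) =
      (Real.cos t + Real.sin t * Complex.I) * (Real.cos t + Real.sin t * Complex.I) := by
    rw [Complex.ofReal_cos, Complex.ofReal_sin, ← Complex.exp_mul_I, ← Complex.exp_add]
    congr 1; ring
  have h2' : (κ : ℂ) * Real.cos t = k * Real.sin t := by exact_mod_cast h2
  have h3 : (Real.cos t : ℂ) ^ 2 + (Real.sin t : ℂ) ^ 2 = 1 := by
    exact_mod_cast Real.cos_sq_add_sin_sq t
  have hc' : (Real.cos t : ℂ) ≠ 0 := by exact_mod_cast hc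
  have hI := Complex.I_sq
  rw [e1]
  apply mul_left_cancel₀ hc'
  set c := (Real.cos t : ℂ)
  set s := (Real.sin t : ℂ)
  set i := Complex.I
  have e5 : c * ((c + s * i) * (c + s * i) * (k - i * κ)) =
      (c + s * i) * (c + s * i) * (k * c - i * (κ * c)) := by ring
  have e6 : c * (k + i * κ) = k * c + i * (κ * c) := by ring
  rw [e5, e6, h2']
  linear_combination (k * (c + s * i)) * h3 + (-(k * (c + s * i)) * s ^ 2) * hI

/-- Bound-state sums as moments of a logarithm: `D` is zero-free and `h = ∏ (k - iκ)^{m κ} D`.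
The zeros are removed with the factors `(k + iκ)/(k - iκ)`, whose logarithms are odd on the real
line, for the even part, and with `k²/(k² + κ²)`, whose logarithms are even, for the odd part. -/
lemma trace_identities (hS : ∀ κ ∈ S, 0 < κ) (hD : IsZeroFree D) (he : HasLogExpansion h a)
    (hh : ∀ k ∈ puncturedHalfPlane, h k = (∏ κ ∈ S, (k - Complex.I * κ) ^ m κ) * D k) :
    (∃ L, IsLogBranch h L) ∧ ∀ L, IsLogBranch h L →
      (∀ j : ℕ, ∀ f : ℝ → ℂ, (f = fun k : ℝ => (evenPart L k - ∑ l ∈ Finset.range j,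
          a (2 * (l + 1)) * (1 / (k : ℂ) ^ (2 * (l + 1)))) * (k : ℂ) ^ (2 * j)) →
        IntegrableOn f (Ioi 0) ∧ ∫ k in Ioi 0, f k = -(Complex.I * Real.pi / 2 *
          (a (2 * j + 1) + 2 * Complex.I ^ (2 * j + 1) / (2 * j + 1) *
            ∑ κ ∈ S, (m κ : ℂ) * (κ : ℂ) ^ (2 * j + 1)))) ∧
      (∀ j : ℕ, ∀ f : ℝ → ℂ, (f = fun k : ℝ => (oddPart L k - ∑ l ∈ Finset.range (j + 1),
          a (2 * l + 1) * (1 / (k : ℂ) ^ (2 * l + 1))) * (k : ℂ) ^ (2 * j + 1)) →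
        IntegrableOn f (Ioi 0) ∧ ∫ k in Ioi 0, f k = -(Complex.I * Real.pi / 2 *
          (a (2 * j + 2) + 2 * Complex.I ^ (2 * j + 2) / (2 * j + 2) *
            ∑ κ ∈ S, (m κ : ℂ) * (κ : ℂ) ^ (2 * j + 2)))) := by
  have hreal : ∀ k : ℝ, k ≠ 0 → (k : ℂ) ∈ puncturedHalfPlane := fun k hk =>
    ⟨by simp, by exact_mod_cast hk⟩
  have hsubne : ∀ κ ∈ S, ∀ k : ℝ, (k : ℂ) - Complex.I * κ ≠ 0 := fun κ hκ k h0 => by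
    have := congrArg Complex.im h0
    simp at this
    exact (hS κ hκ).ne' this
  have haddne : ∀ κ ∈ S, ∀ k : ℝ, (k : ℂ) + Complex.I * κ ≠ 0 := fun κ hκ k =>
    add_I_mul_ne_zero (hS κ hκ) (by simp)
  -- the logarithm of the even correction factors
  set E : ℝ → ℂ := fun k => ∑ κ ∈ S, m κ * ((Real.log (k ^ 2 / (k ^ 2 + κ ^ 2)) : ℝ) : ℂ)
  have hEeven : ∀ k, E (-k) = E k := fun k => by simp only [E, neg_sq]
  have hEpos : ∀ κ ∈ S, ∀ k : ℝ, k ≠ 0 → 0 < k ^ 2 / (k ^ 2 + κ ^ 2) := fun κ _ k hk => by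
    have : 0 < k ^ 2 := by positivity
    positivity
  have hEcont : ContinuousOn E {0}ᶜ := by
    refine continuousOn_finsetSum _ fun κ hκ => continuousOn_const.mul
      (Complex.continuous_ofReal.comp_continuousOn (ContinuousOn.log ?_ fun k hk =>
        (hEpos κ hκ k hk).ne'))
    refine (continuousOn_id.pow 2).div ((continuousOn_id.pow 2).add continuousOn_const) fun k _ => ?_
    have := hS κ hκ
    exact (add_pos_of_nonneg_of_pos (sq_nonneg _) (pow_pos this 2)).ne'
  have hinv : ∀ κ : ℝ, Tendsto (fun k : ℝ => κ / k) (Bornology.cobounded ℝ) (𝓝 0) := fun κ => by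
    simpa [div_eq_mul_inv] using (tendsto_inv₀_cobounded (α := ℝ)).const_mul κ
  have hcob : ∀ᶠ k : ℝ in Bornology.cobounded ℝ, k ≠ 0 := by
    filter_upwards [(tendsto_norm_cobounded_atTop (E := ℝ)).eventually (eventually_gt_atTop 0)] with
      k hk using norm_pos_iff.1 hk
  have hElim : Tendsto E (Bornology.cobounded ℝ) (𝓝 0) := by
    have h0 : (0 : ℂ) = ∑ κ ∈ S, m κ * ((Real.log (1 / (1 + 0 ^ 2)) : ℝ) : ℂ) := by simp
    rw [h0]
    refine tendsto_finsetSum _ fun κ hκ => Tendsto.const_mul _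
      ((Complex.continuous_ofReal.tendsto _).comp ?_)
    have h1 : Tendsto (fun k : ℝ => 1 / (1 + (κ / k) ^ 2)) (Bornology.cobounded ℝ)
        (𝓝 (1 / (1 + 0 ^ 2))) :=
      tendsto_const_nhds.div (((hinv κ).pow 2).const_add 1) (by norm_num)
    refine ((Real.continuousAt_log (by norm_num)).tendsto.comp h1).congr' ?_
    filter_upwards [hcob] with k hk
    simp only [Function.comp]
    congr 1
    field_simp
  have hEexp : ∀ k : ℝ, k ≠ 0 → h k * Complex.exp (E k) =
      D k * ((∏ κ ∈ S, ((k : ℂ) ^ 2) ^ m κ) * (∏ κ ∈ S, ((k : ℂ) + Complex.I * κ) ^ m κ)⁻¹) := by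
    intro k hk
    rw [hh k (hreal k hk), Complex.exp_sum, mul_right_comm, mul_comm (D k),
      ← Finset.prod_mul_distrib, ← Finset.prod_inv_distrib, ← Finset.prod_mul_distrib]
    congr 1
    refine Finset.prod_congr rfl fun κ hκ => ?_
    rw [Complex.exp_nat_mul, ← mul_pow, ← inv_pow, ← mul_pow, ← Complex.ofReal_exp,
      Real.exp_log (hEpos κ hκ k hk)]
    congr 1
    have e1 := hsubne κ hκ k
    have e2 := haddne κ hκ k
    have e3 : (k : ℂ) ^ 2 + (κ : ℂ) ^ 2 = (k - Complex.I * κ) * (k + Complex.I * κ) := by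
      linear_combination (κ : ℂ) ^ 2 * Complex.I_sq
    push_cast
    rw [e3]
    field_simp
  have hF2 : IsZeroFree fun k => D k * ((∏ κ ∈ S, (k ^ 2) ^ m κ) *
      (∏ κ ∈ S, (k + Complex.I * κ) ^ m κ)⁻¹) :=
    hD.mul ((isZeroFree_prod_sq S m).mul (isZeroFree_prod_add hS).inv)
  obtain ⟨⟨lam₂, hlam₂⟩, hmom₂⟩ := hF2.moments (hasLogExpansion_even_factor he hh)
  refine ⟨⟨fun k => lam₂ k - E k, hlam₂.continuousOn.sub hEcont, fun k hk => ?_,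
    by simpa using hlam₂.tendsto_zero.sub hElim⟩, fun L hL => ⟨fun j f hf => ?_, fun j f hf => ?_⟩⟩
  · rw [Complex.exp_sub, hlam₂.exp_eq k hk, ← hEexp k hk,
      mul_div_cancel_right₀ _ (Complex.exp_ne_zero _)]
  · -- the logarithm of the odd correction factors
    set O : ℝ → ℂ := fun k => ∑ κ ∈ S, m κ * (2 * Complex.I * (Real.arctan (κ / k) : ℝ))
    have hOodd : ∀ k, O (-k) = -O k := fun k => by
      simp only [O, div_neg, Real.arctan_neg, Complex.ofReal_neg, mul_neg, Finset.sum_neg_distrib]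
    have hF1 : IsZeroFree fun k => D k * ∏ κ ∈ S, (k + Complex.I * κ) ^ m κ :=
      hD.mul (isZeroFree_prod_add hS)
    have hbranch : IsLogBranch (fun k => D k * ∏ κ ∈ S, (k + Complex.I * κ) ^ m κ)
        (fun k => L k + O k) := by
      refine ⟨hL.continuousOn.add ?_, fun k hk => ?_, ?_⟩
      · refine continuousOn_finsetSum _ fun κ hκ => continuousOn_const.mul (continuousOn_const.mul
          (Complex.continuous_ofReal.comp_continuousOn (Real.continuous_arctan.comp_continuousOn
            (continuousOn_const.div continuousOn_id fun k hk => hk))))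
      · rw [Complex.exp_add, hL.exp_eq k hk, hh k (hreal k hk), Complex.exp_sum, mul_right_comm,
          mul_comm (D k), ← Finset.prod_mul_distrib]
        congr 1
        refine Finset.prod_congr rfl fun κ hκ => ?_
        rw [Complex.exp_nat_mul, ← mul_pow, mul_comm, exp_two_I_arctan hk]
      · have h0 : (0 : ℂ) = 0 + ∑ κ ∈ S, m κ * (2 * Complex.I * (Real.arctan 0 : ℝ)) := by simp
        rw [h0]
        exact hL.tendsto_zero.add (tendsto_finsetSum _ fun κ hκ => Tendsto.const_mul _
          (Tendsto.const_mul _ ((Complex.continuous_ofReal.tendsto _).comp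
            ((Real.continuous_arctan.tendsto _).comp (hinv κ)))))
    obtain ⟨hi, hv⟩ := (hF1.moments (hasLogExpansion_odd_factor he hh)).2 _ hbranch (2 * j) _ rfl
    have hsum : ∀ (b : ℕ → ℂ) (k : ℂ), (∀ l, b (2 * (l + 1)) = a (2 * (l + 1))) →
        ∑ l ∈ Finset.range (2 * j), b (l + 1) * (1 + (-1) ^ (2 * j + l + 1)) *
          (1 / k ^ (l + 1)) =
        2 * ∑ l ∈ Finset.range j, a (2 * (l + 1)) * (1 / k ^ (2 * (l + 1))) := fun b k hb => by
      have e0 : ∀ l : ℕ, (-1 : ℂ) ^ (2 * j + l + 1) = (-1) ^ (l + 1) := fun l => by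
        rw [add_assoc, pow_add, pow_mul]; simp
      have h1 := sum_even_terms (fun l => b l * (1 / k ^ l)) j
      simp only [hb] at h1
      rw [← h1]
      exact Finset.sum_congr rfl fun l _ => by rw [e0]; ring
    have hfeq : f = fun k => (1 / 2 : ℂ) * ((L k + O k + (-1) ^ (2 * j) * (L (-k) + O (-k)) -
        ∑ l ∈ Finset.range (2 * j), (a (l + 1) + ∑ κ ∈ S, m κ * (-(-(Complex.I * κ)) ^ (l + 1) /
          (l + 1 : ℕ) + -(-(-(-(Complex.I * κ))) ^ (l + 1) / (l + 1 : ℕ)))) *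
          (1 + (-1) ^ (2 * j + l + 1)) * (1 / (k : ℂ) ^ (l + 1))) * (k : ℂ) ^ (2 * j)) := by
      rw [hf]
      funext k
      rw [hsum (fun l => a l + ∑ κ ∈ S, m κ * (-(-(Complex.I * κ)) ^ l / l +
        -(-(-(-(Complex.I * κ))) ^ l / l))) k fun l => by
          simp only [neg_neg, pow_mul, neg_sq]
          simp [neg_div], hOodd, evenPart]
      have e6 : (-1 : ℂ) ^ (2 * j) = 1 := by rw [pow_mul]; simp
      rw [e6]
      ring
    rw [hfeq]
    refine ⟨hi.const_mul _, ?_⟩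
    rw [integral_const_mul, hv]
    have e7 : ∑ κ ∈ S, (m κ : ℂ) * (-(-(Complex.I * κ)) ^ (2 * j + 1) / (2 * j + 1 : ℕ) +
        -(-(-(-(Complex.I * κ))) ^ (2 * j + 1) / (2 * j + 1 : ℕ))) =
        2 * Complex.I ^ (2 * j + 1) / (2 * j + 1) *
            ∑ κ ∈ S, (m κ : ℂ) * (κ : ℂ) ^ (2 * j + 1) := by
      rw [Finset.mul_sum]
      refine Finset.sum_congr rfl fun κ _ => ?_
      have hodd : Odd (2 * j + 1) := ⟨j, rfl⟩
      rw [neg_neg, hodd.neg_pow, mul_pow]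
      push_cast
      ring
    rw [e7]
    ring
  · have hbranch : IsLogBranch (fun k => D k * ((∏ κ ∈ S, (k ^ 2) ^ m κ) *
        (∏ κ ∈ S, (k + Complex.I * κ) ^ m κ)⁻¹)) (fun k => L k + E k) := by
      refine ⟨hL.continuousOn.add hEcont, fun k hk => ?_,
        by simpa using hL.tendsto_zero.add hElim⟩
      rw [Complex.exp_add, hL.exp_eq k hk, hEexp k hk]
    obtain ⟨hi, hv⟩ := hmom₂ _ hbranch (2 * j + 1) _ rfl
    have hsum : ∀ (b : ℕ → ℂ) (k : ℂ), (∀ l, b (2 * l + 1) = a (2 * l + 1)) →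
        ∑ l ∈ Finset.range (2 * j + 1), b (l + 1) * (1 + (-1) ^ (2 * j + 1 + l + 1)) *
          (1 / k ^ (l + 1)) =
        2 * ∑ l ∈ Finset.range (j + 1), a (2 * l + 1) * (1 / k ^ (2 * l + 1)) := fun b k hb => by
      have e0 : ∀ l : ℕ, (-1 : ℂ) ^ (2 * j + 1 + l + 1) = (-1) ^ l := fun l => by
        rw [show 2 * j + 1 + l + 1 = 2 * (j + 1) + l by ring, pow_add, pow_mul]; simp
      have h1 := sum_odd_terms (fun l => b l * (1 / k ^ l)) j
      simp only [hb] at h1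
      rw [← h1]
      exact Finset.sum_congr rfl fun l _ => by rw [e0]; ring
    have hfeq : f = fun k => (1 / 2 : ℂ) * ((L k + E k + (-1) ^ (2 * j + 1) * (L (-k) + E (-k)) -
        ∑ l ∈ Finset.range (2 * j + 1), (a (l + 1) + ∑ κ ∈ S, m κ *
          (-(-(-(Complex.I * κ)) ^ (l + 1) / (l + 1 : ℕ)) +
            -(-(-(-(Complex.I * κ))) ^ (l + 1) / (l + 1 : ℕ)))) *
          (1 + (-1) ^ (2 * j + 1 + l + 1)) * (1 / (k : ℂ) ^ (l + 1))) * (k : ℂ) ^ (2 * j + 1)) := by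
      rw [hf]
      funext k
      rw [hsum (fun l => a l + ∑ κ ∈ S, m κ * (-(-(-(Complex.I * κ)) ^ l / l) +
        -(-(-(-(Complex.I * κ))) ^ l / l))) k fun l => by
          have hodd : Odd (2 * l + 1) := ⟨l, rfl⟩
          simp only [neg_neg, hodd.neg_pow]
          simp [neg_div], hEeven, oddPart]
      have e6 : (-1 : ℂ) ^ (2 * j + 1) = -1 := by rw [pow_succ, pow_mul]; simp
      rw [e6]
      ring
    rw [hfeq]
    refine ⟨hi.const_mul _, ?_⟩
    rw [integral_const_mul, hv]
    have e7 : ∑ κ ∈ S, (m κ : ℂ) * (-(-(-(Complex.I * κ)) ^ (2 * j + 1 + 1) / (2 * j + 1 + 1 : ℕ)) +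
        -(-(-(-(Complex.I * κ))) ^ (2 * j + 1 + 1) / (2 * j + 1 + 1 : ℕ))) =
        2 * Complex.I ^ (2 * j + 2) / (2 * j + 2) *
            ∑ κ ∈ S, (m κ : ℂ) * (κ : ℂ) ^ (2 * j + 2) := by
      rw [Finset.mul_sum]
      refine Finset.sum_congr rfl fun κ _ => ?_
      have heven : Even (2 * j + 1 + 1) := ⟨j + 1, by ring⟩
      rw [neg_neg, heven.neg_pow, mul_pow]
      push_cast
      ring
    rw [e7]
    ring

end TraceIdentities

variable {n : ℕ}

/-! ### The trace identities of the matrix Schrödinger operator -/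

lemma inv_two_I_pow_even (l : ℕ) : (2 * Complex.I)⁻¹ ^ (2 * l) = (-1 : ℂ) ^ l / 2 ^ (2 * l) := by
  rw [mul_inv, mul_pow, pow_mul Complex.I⁻¹, Complex.inv_I, neg_sq, Complex.I_sq, inv_pow]
  field_simp

lemma inv_two_I_pow_odd (l : ℕ) :
    (2 * Complex.I)⁻¹ ^ (2 * l + 1) = (-1 : ℂ) ^ (l + 1) * Complex.I / 2 ^ (2 * l + 1) := by
  rw [pow_succ, inv_two_I_pow_even, mul_inv, Complex.inv_I]
  field_simp
  ring

lemma I_pow_even (l : ℕ) : Complex.I ^ (2 * l) = (-1 : ℂ) ^ l := by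
  rw [pow_mul, Complex.I_sq]

lemma neg_one_pow_mul_self (j : ℕ) : (-1 : ℂ) ^ j * (-1 : ℂ) ^ j = 1 := by
  rw [← mul_pow]; simp

lemma sum_Icc_one_eq_sum_range (c : ℕ → ℂ) (j : ℕ) :
    ∑ l ∈ Finset.Icc 1 j, c l = ∑ l ∈ Finset.range j, c (l + 1) := by
  rw [Finset.range_eq_Ico, Finset.sum_Ico_add' c 0 j 1]
  rfl

lemma boundStateSum_eq {V : ℝ → Matrix (Fin n) (Fin n) ℂ} {A B : Matrix (Fin n) (Fin n) ℂ}
    (hfin : (boundStates V A B).Finite) (q : ℕ) : (boundStateSum V A B q : ℂ) =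
      ∑ κ ∈ hfin.toFinset, (Module.finrank ℂ (eigenspace V A B (-(κ : ℂ) ^ 2)) : ℂ) *
        (κ : ℂ) ^ q := by
  rw [boundStateSum, finsum_mem_eq_finite_toFinset_sum _ hfin]
  push_cast
  refine Finset.sum_congr rfl fun κ hκ => ?_
  rw [abs_of_pos ((Set.Finite.mem_toFinset hfin).1 hκ).1]

end MatrixSchrodinger

theorem theorem3p6 (n : ℕ) (V : ℝ → Matrix (Fin n) (Fin n) ℂ)
    (A B : Matrix (Fin n) (Fin n) ℂ)
    (hV : MatrixSchrodinger.IsAdmissiblePotential V)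
    (hAB : MatrixSchrodinger.IsSelfadjointBC A B) :
    -- the eigenvalues are `-κ²` with `κ > 0`, finitely many with multiplicity
    (∀ E : ℂ, MatrixSchrodinger.IsEigenvalue V A B E → ∃ κ : ℝ, 0 < κ ∧ E = -(κ : ℂ) ^ 2) ∧
    (MatrixSchrodinger.boundStates V A B).Finite ∧
    (∀ E : ℂ, FiniteDimensional ℂ (MatrixSchrodinger.eigenspace V A B E)) ∧
    -- the Jost solution and a diagonal form of the boundary conditions exist
    (∃ f f' : ℂ → ℝ → Matrix (Fin n) (Fin n) ℂ, MatrixSchrodinger.IsJostSolution V f f') ∧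
    (∃ θ : Fin n → ℝ, MatrixSchrodinger.IsBoundaryAngles A B θ) ∧
    ∀ f f' : ℂ → ℝ → Matrix (Fin n) (Fin n) ℂ, MatrixSchrodinger.IsJostSolution V f f' →
    ∀ θ : Fin n → ℝ, MatrixSchrodinger.IsBoundaryAngles A B θ →
    ∀ p : ℕ, p = MatrixSchrodinger.numM θ + MatrixSchrodinger.numN θ →
    -- the leading constant of `det J(k)` exists
    (∃ c₂ : ℂ, MatrixSchrodinger.IsLeadingConstant
      (MatrixSchrodinger.jostMatrix f f' A B) p c₂) ∧
    ∀ c₂ : ℂ, MatrixSchrodinger.IsLeadingConstant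
      (MatrixSchrodinger.jostMatrix f f' A B) p c₂ →
    -- the logarithm of `h` exists
    (∃ L : ℝ → ℂ, MatrixSchrodinger.IsLogBranch
      (MatrixSchrodinger.hFun (MatrixSchrodinger.jostMatrix f f' A B) p c₂) L) ∧
    ∀ L : ℝ → ℂ, MatrixSchrodinger.IsLogBranch
      (MatrixSchrodinger.hFun (MatrixSchrodinger.jostMatrix f f' A B) p c₂) L →
    ∀ e : ℕ → ℂ, e = MatrixSchrodinger.eCoeff V A B p (MatrixSchrodinger.numD θ) c₂ →
    -- first odd identity
    (IntegrableOn (fun k : ℝ => MatrixSchrodinger.evenPart L k) (Ioi 0) ∧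
      (MatrixSchrodinger.boundStateSum V A B 1 : ℂ)
        - (1 / (Real.pi : ℂ)) * ∫ k in Ioi (0 : ℝ), MatrixSchrodinger.evenPart L k
        = e 1 / 4) ∧
    -- odd identities
    (∀ j : ℕ, 1 ≤ j →
      IntegrableOn (fun k : ℝ => (MatrixSchrodinger.evenPart L k -
        ∑ l ∈ Finset.Icc 1 j, (-1 : ℂ) ^ l * e (2 * l) * (1 / (2 * (k : ℂ)) ^ (2 * l)))
          * (k : ℂ) ^ (2 * j)) (Ioi 0) ∧
      (MatrixSchrodinger.boundStateSum V A B (2 * j + 1) : ℂ)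
        + (-1 : ℂ) ^ (j + 1) * ((2 * (j : ℂ) + 1) / (Real.pi : ℂ)) *
          ∫ k in Ioi (0 : ℝ), (MatrixSchrodinger.evenPart L k -
            ∑ l ∈ Finset.Icc 1 j, (-1 : ℂ) ^ l * e (2 * l) * (1 / (2 * (k : ℂ)) ^ (2 * l)))
              * (k : ℂ) ^ (2 * j)
        = (2 * (j : ℂ) + 1) * e (2 * j + 1) / 2 ^ (2 * j + 2)) ∧
    -- even identities
    (∀ j : ℕ, 1 ≤ j →
      IntegrableOn (fun k : ℝ => (-Complex.I * MatrixSchrodinger.oddPart L k -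
        ∑ l ∈ Finset.range j,
          (-1 : ℂ) ^ (l + 1) * e (2 * l + 1) * (1 / (2 * (k : ℂ)) ^ (2 * l + 1)))
          * (k : ℂ) ^ (2 * j - 1)) (Ioi 0) ∧
      (MatrixSchrodinger.boundStateSum V A B (2 * j) : ℂ)
        + (-1 : ℂ) ^ j * ((2 * (j : ℂ)) / (Real.pi : ℂ)) *
          ∫ k in Ioi (0 : ℝ), (-Complex.I * MatrixSchrodinger.oddPart L k -
            ∑ l ∈ Finset.range j,
              (-1 : ℂ) ^ (l + 1) * e (2 * l + 1) * (1 / (2 * (k : ℂ)) ^ (2 * l + 1)))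
              * (k : ℂ) ^ (2 * j - 1)
        = -(j : ℂ) * (e (2 * j) / 2 ^ (2 * j))) := by
  classical
  obtain ⟨W, hW, hVW, ρ, hρ, hd⟩ := MatrixSchrodinger.exists_regularization hV
  obtain ⟨g, g', hg⟩ := MatrixSchrodinger.exists_isJostFactor hW
  obtain ⟨f₀, f₀', hf₀⟩ := MatrixSchrodinger.exists_isJostSolution hW hVW
  obtain ⟨θ₀, hθ₀⟩ := MatrixSchrodinger.exists_isBoundaryAngles hAB
  have hfin : (MatrixSchrodinger.boundStates V A B).Finite := by
    obtain ⟨c, hc⟩ := MatrixSchrodinger.exists_isLeadingConstant hW hVW hρ hd hf₀ hθ₀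
    rw [← MatrixSchrodinger.zeroSet_jostMatrix hW hg hVW hf₀]
    exact (MatrixSchrodinger.isJostFamily_jostMatrix hW hg hVW hAB hf₀ hc).finite_zeroSet
  refine ⟨fun E hE => MatrixSchrodinger.exists_eq_neg_sq_of_isEigenvalue hW hVW hAB hE, hfin,
    MatrixSchrodinger.finiteDimensional_eigenspace hW hg hVW hAB, ⟨f₀, f₀', hf₀⟩, ⟨θ₀, hθ₀⟩, ?_⟩
  rintro f f' hf θ hθ p rfl
  refine ⟨MatrixSchrodinger.exists_isLeadingConstant hW hVW hρ hd hf hθ, fun c₂ hc => ?_⟩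
  have hJ := MatrixSchrodinger.isJostFamily_jostMatrix hW hg hVW hAB hf hc
  have hmem : ∀ κ, κ ∈ hfin.toFinset ↔ κ ∈ MatrixSchrodinger.IsJostFamily.zeroSet
      (MatrixSchrodinger.jostMatrix f f' A B) := fun κ => by
    rw [MatrixSchrodinger.zeroSet_jostMatrix hW hg hVW hf, Set.Finite.mem_toFinset]
  have hpos : ∀ κ ∈ hfin.toFinset, 0 < κ := fun κ hκ => ((hmem κ).1 hκ).1
  obtain ⟨D, hD, hfac⟩ := hJ.exists_factorization hfin.toFinset hmem
  set p := MatrixSchrodinger.numM θ + MatrixSchrodinger.numN θ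
  set h := MatrixSchrodinger.hFun (MatrixSchrodinger.jostMatrix f f' A B) p c₂ with hh
  set m : ℝ → ℕ := fun κ =>
    Module.finrank ℂ (MatrixSchrodinger.eigenspace V A B (-(κ : ℂ) ^ 2)) with hm
  have hlog := MatrixSchrodinger.hasLogExpansion_hFun (p := p) hW hVW hρ hd hf
    (MatrixSchrodinger.numM_add_numN_add_numD θ) hc
  -- the zero-free part of `h` is that of `det J` divided by `c₂ k ^ p`
  have hD' : MatrixSchrodinger.IsZeroFree fun k => D k * (c₂ * k ^ p)⁻¹ :=
    hD.mul (((MatrixSchrodinger.isZeroFree_of_entire (differentiable_const c₂)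
      fun _ _ => hc.1).mul (MatrixSchrodinger.isZeroFree_id.pow p)).inv)
  have hfac' : ∀ k ∈ MatrixSchrodinger.puncturedHalfPlane, h k =
      (∏ κ ∈ hfin.toFinset, (k - Complex.I * κ) ^ m κ) * (D k * (c₂ * k ^ p)⁻¹) := fun k hk => by
    rw [hh, MatrixSchrodinger.hFun, hfac k hk, div_eq_mul_inv, mul_assoc]
    congr 1
    refine Finset.prod_congr rfl fun κ hκ => ?_
    rw [MatrixSchrodinger.sub_rank_jostMatrix hW hg hVW hf (hpos κ hκ)]
  obtain ⟨hex, htrace⟩ := MatrixSchrodinger.trace_identities (m := m) hpos hD' hlog hfac'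
  refine ⟨hex, fun L hL e he => ?_⟩
  obtain ⟨hodd, heven⟩ := htrace L hL
  rw [← he] at hodd heven
  have hpi : (Real.pi : ℂ) ≠ 0 := by exact_mod_cast Real.pi_ne_zero
  have hI := Complex.I_sq
  have hkey : ∀ j : ℕ,
      IntegrableOn (fun k : ℝ => (MatrixSchrodinger.evenPart L k -
        ∑ l ∈ Finset.Icc 1 j, (-1 : ℂ) ^ l * e (2 * l) * (1 / (2 * (k : ℂ)) ^ (2 * l)))
          * (k : ℂ) ^ (2 * j)) (Ioi 0) ∧
      (MatrixSchrodinger.boundStateSum V A B (2 * j + 1) : ℂ)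
        + (-1 : ℂ) ^ (j + 1) * ((2 * (j : ℂ) + 1) / (Real.pi : ℂ)) *
          ∫ k in Ioi (0 : ℝ), (MatrixSchrodinger.evenPart L k -
            ∑ l ∈ Finset.Icc 1 j, (-1 : ℂ) ^ l * e (2 * l) * (1 / (2 * (k : ℂ)) ^ (2 * l)))
              * (k : ℂ) ^ (2 * j)
        = (2 * (j : ℂ) + 1) * e (2 * j + 1) / 2 ^ (2 * j + 2) := fun j => by
    obtain ⟨h1, h2⟩ := hodd j (fun k : ℝ => (MatrixSchrodinger.evenPart L k -
        ∑ l ∈ Finset.Icc 1 j, (-1 : ℂ) ^ l * e (2 * l) * (1 / (2 * (k : ℂ)) ^ (2 * l)))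
          * (k : ℂ) ^ (2 * j)) (by
      funext k
      congr 2
      rw [MatrixSchrodinger.sum_Icc_one_eq_sum_range]
      refine Finset.sum_congr rfl fun l _ => ?_
      rw [MatrixSchrodinger.inv_two_I_pow_even, mul_pow]
      field_simp)
    refine ⟨h1, ?_⟩
    rw [h2, MatrixSchrodinger.boundStateSum_eq hfin, pow_succ Complex.I,
      MatrixSchrodinger.I_pow_even, MatrixSchrodinger.inv_two_I_pow_odd]
    have hj : (2 * (j : ℂ) + 1) ≠ 0 := by exact_mod_cast Nat.succ_ne_zero (2 * j)
    have hs := MatrixSchrodinger.neg_one_pow_mul_self j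
    simp only [hm]
    set N := ∑ κ ∈ hfin.toFinset, (Module.finrank ℂ
      (MatrixSchrodinger.eigenspace V A B (-(κ : ℂ) ^ 2)) : ℂ) * (κ : ℂ) ^ (2 * j + 1)
    rw [pow_succ (-1 : ℂ) j, pow_succ (2 : ℂ) (2 * j + 1)]
    set s := (-1 : ℂ) ^ j
    set t := (2 : ℂ) ^ (2 * j + 1)
    have ht : t ≠ 0 := pow_ne_zero _ two_ne_zero
    field_simp
    linear_combination (2 * N * t - (2 * (j : ℂ) + 1) * e (2 * j + 1)) * hI * (s * s) +
      (-(2 * N * t) + (2 * (j : ℂ) + 1) * e (2 * j + 1)) * hs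
  refine ⟨?_, fun j _ => hkey j, fun j hj => ?_⟩
  · have h0 := hkey 0
    simpa [sub_eq_add_neg, show (2 : ℂ) ^ 2 = 4 by norm_num] using h0
  · obtain ⟨i, rfl⟩ : ∃ i, j = i + 1 := ⟨j - 1, by omega⟩
    have e0 : 2 * (i + 1) - 1 = 2 * i + 1 := by omega
    rw [e0]
    obtain ⟨h1, h2⟩ := heven i _ rfl
    have hfun : (fun k : ℝ => (-Complex.I * MatrixSchrodinger.oddPart L k -
        ∑ l ∈ Finset.range (i + 1),
          (-1 : ℂ) ^ (l + 1) * e (2 * l + 1) * (1 / (2 * (k : ℂ)) ^ (2 * l + 1)))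
          * (k : ℂ) ^ (2 * i + 1)) = fun k : ℝ => -Complex.I *
        ((MatrixSchrodinger.oddPart L k - ∑ l ∈ Finset.range (i + 1),
          (e (2 * l + 1) * (2 * Complex.I)⁻¹ ^ (2 * l + 1)) * (1 / (k : ℂ) ^ (2 * l + 1))) *
          (k : ℂ) ^ (2 * i + 1)) := by
      funext k
      rw [← mul_assoc, mul_sub, Finset.mul_sum]
      congr 2
      refine Finset.sum_congr rfl fun l _ => ?_
      rw [MatrixSchrodinger.inv_two_I_pow_odd, mul_pow]
      simp only [one_div, mul_inv]
      linear_combination ((-1 : ℂ) ^ (l + 1) * e (2 * l + 1) * (2 ^ (2 * l + 1))⁻¹ *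
        ((k : ℂ) ^ (2 * l + 1))⁻¹) * hI
    rw [hfun]
    refine ⟨h1.const_mul _, ?_⟩
    rw [integral_const_mul, h2, MatrixSchrodinger.boundStateSum_eq hfin,
      show 2 * i + 2 = 2 * (i + 1) by ring, MatrixSchrodinger.I_pow_even,
      MatrixSchrodinger.inv_two_I_pow_even]
    have hj : ((i : ℂ) + 1) ≠ 0 := by exact_mod_cast Nat.succ_ne_zero i
    have hj' : (2 * (i : ℂ) + 2) = 2 * ((i : ℂ) + 1) := by ring
    have hs := MatrixSchrodinger.neg_one_pow_mul_self (i + 1)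
    simp only [hm]
    set N := ∑ κ ∈ hfin.toFinset, (Module.finrank ℂ
      (MatrixSchrodinger.eigenspace V A B (-(κ : ℂ) ^ 2)) : ℂ) * (κ : ℂ) ^ (2 * (i + 1))
    rw [hj']
    push_cast
    set s := (-1 : ℂ) ^ (i + 1)
    set t := (2 : ℂ) ^ (2 * (i + 1))
    have ht : t ≠ 0 := pow_ne_zero _ two_ne_zero
    field_simp
    linear_combination (N * t + ((i : ℂ) + 1) * e (2 * (i + 1))) * hI * (s * s) -
      (N * t + ((i : ℂ) + 1) * e (2 * (i + 1))) * hs
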